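/- Let $Y_i=m(X_i)+\varepsilon_i$, $i\ge 1$, where the predictors and the errors satisfy the following conditions. (P2) For $i\ge 1$, $X_i=\sum_{k\ge 0}a_k\zeta_{i-k}$ (convergence in mean square), where $(\zeta_j)_{j\in\mathbb Z}$ are i.i.d. centered Gaussian, $a_0=1$, $a_k=A_0k^{-(\alpha_X+1)/2}$ for $k\ge 1$ with some $\alpha_X\in(0,1)$, $A_0\in\mathbb R$, and $\mathrm{Var}(X_i)=1$. (E2) For $i\ge 1$, $\varepsilon_i=\sum_{k\ge 0}c_k\eta_{i-k}$ (convergence in mean square), where $(\eta_j)_{j\in\mathbb Z}$ are i.i.d. centered with $E\eta_0^4<\infty$, the family $(\eta_j)_{j\in\mathbb Z}$ is independent of $(X_i)_{i\ge1}$, $c_0=1$, $c_k\sim C_0k^{-(\alpha+1)/2}$ as $k\to\infty$ with some $\alpha\in(0,1)$, $C_0\ne 0$, and $E\varepsilon_1^2=1$. Let $K\ge 0$ be a bounded measurable kernel with $\int K=1$, $\int uK(u)\,du=0$, $\kappa_2:=\int u^2K(u)\,du<\infty$, and let $\kappa_1:=\int K^2$. Let $h=h_n\to 0$ with $nh\to\infty$.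 Let $f$ be the density of $X_1$; assume that $f$ and $m$ are twice differentiable with bounded first and second derivatives, and that $f>0$. Let $r\ge 0$ be a weight function such that $\int r(x)f(x)^{-p}\,dx<\infty$ for every integer $p\ge 0$ (for example, any integrable $r$ with bounded support). Assume that at least one of the following holds: $K$ has compact support; $m$ is bounded; $\log n=O(nh)$. Put $$\hat f_h(x)=\frac1{nh}\sum_{i=1}^nK\Big(\frac{x-X_i}h\Big),\qquad \hat m_h(x)=\frac1{nh}\frac1{\hat f_h(x)}\sum_{i=1}^nY_iK\Big(\frac{x-X_i}h\Big)$$ ($\hat m_h(x)=0$ if $\hat f_h(x)=0$), and $$\mathrm{MISE}_r(h)=\int E\big[(\hat m_h(x)-m(x))^2\big]r(x)\,dx .$$ Then there is a constant $C_1>0$ with $\mathrm{Var}\big(\sum_{i=1}^n\varepsilon_i\big)\sim C_1^2n^{2-\alpha}$. Moreover, $\mathrm{MISE}_r(h)$ is finite for all large $n$, and with $$B:=\int\Big(\frac{m''(x)f(x)+2m'(x)f'(x)}{f(x)}\Big)^2r(x)\,dx,$$ $$R_n:=\frac{\kappa_1}{nh}\int\frac{r(x)}{f(x)}\,dx+\frac{h^4\kappa_2^2}{4}B+C_1^2n^{-\alpha}\int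 r(x)\,dx+C_1^2h^2\kappa_2n^{-\alpha}\int\frac{f''(x)}{f(x)}r(x)\,dx,$$ we have, as $n\to\infty$, $$\mathrm{MISE}_r(h)=R_n+o\Big(\frac1{nh}+h^4+n^{-\alpha}\Big),$$ and, if $B\ne 0$ or $m$ is constant, $$\mathrm{MISE}_r(h)\sim R_n .$$ In particular, long memory of the errors contributes a term of order $n^{-\alpha}$, while the memory parameter $\alpha_X$ of the predictors does not enter. -/

import Mathlib

open MeasureTheory ProbabilityTheory Filter Topology Asymptotics

noncomputable section

/-- `X i = ∑_{k ≥ 0} a k * ξ (i - k)` for `i ≥ 1`, the series converging in mean square, where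
`ξ` is a two-sided i.i.d. sequence of centered random variables. (The coefficients of a long
memory process are not absolutely summable, so that the series is not unconditionally
convergent in the pointwise sense.) -/
structure IsLinearProcess {Ω : Type*} [MeasurableSpace Ω] (μ : Measure Ω)
    (a : ℕ → ℝ) (ξ : ℤ → Ω → ℝ) (X : ℕ → Ω → ℝ) : Prop where
  measurable_innov : ∀ j, Measurable (ξ j)
  measurable_proc : ∀ i, Measurable (X i)
  indep : iIndepFun ξ μ
  identDistrib : ∀ j, IdentDistrib (ξ j) (ξ 0) μ μ
  integrable : Integrable (ξ 0) μ
  centered : ∫ ω, ξ 0 ω ∂μ = 0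
  series : ∀ i, 1 ≤ i →
    Tendsto (fun N : ℕ =>
        eLpNorm (fun ω => X i ω - ∑ k ∈ Finset.range N, a k * ξ ((i : ℤ) - (k : ℤ)) ω) 2 μ)
      atTop (𝓝 0)

/-- The coefficients `a 0 = 1`, `a k = A₀ k ^ (-(αX + 1) / 2)` for `k ≥ 1`. -/
def predictorCoeff (A₀ αX : ℝ) (k : ℕ) : ℝ :=
  if k = 0 then 1 else A₀ * (k : ℝ) ^ (-(αX + 1) / 2)

/-- Condition (P2): the predictors `X i`, `i ≥ 1`, form a unit variance Gaussian linear process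
with memory parameter `αX ∈ (0, 1)`. -/
structure LRDPredictors {Ω : Type*} [MeasurableSpace Ω] (μ : Measure Ω)
    (αX A₀ : ℝ) (ζ : ℤ → Ω → ℝ) (X : ℕ → Ω → ℝ) : Prop where
  mem_Ioo : αX ∈ Set.Ioo (0 : ℝ) 1
  linear : IsLinearProcess μ (predictorCoeff A₀ αX) ζ X
  gaussian : ∃ v : NNReal, ∀ j, μ.map (ζ j) = gaussianReal 0 v
  unit_variance : ∀ i, 1 ≤ i → Var[X i; μ] = 1

/-- Condition (E2): the errors `ε i`, `i ≥ 1`, form a linear process with memory parameter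
`α ∈ (0, 1)`, whose innovations have a finite fourth moment and are independent of the
predictors `X i`, `i ≥ 1`. -/
structure LRDErrors {Ω : Type*} [MeasurableSpace Ω] (μ : Measure Ω)
    (α C₀ : ℝ) (c : ℕ → ℝ) (η : ℤ → Ω → ℝ) (ε : ℕ → Ω → ℝ) (X : ℕ → Ω → ℝ) : Prop where
  mem_Ioo : α ∈ Set.Ioo (0 : ℝ) 1
  coeff_zero : c 0 = 1
  const_ne_zero : C₀ ≠ 0
  coeff_asymp : c ~[atTop] fun k : ℕ => C₀ * (k : ℝ) ^ (-(α + 1) / 2)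
  linear : IsLinearProcess μ c η ε
  fourth_moment : MemLp (η 0) 4 μ
  second_moment : ∫ ω, (ε 1 ω) ^ 2 ∂μ = 1
  indep_predictors :
    IndepFun (fun ω (i : ℕ) => X (i + 1) ω) (fun ω (j : ℤ) => η j ω) μ

/-- The usual conditions on the kernel. -/
structure IsKernel (K : ℝ → ℝ) : Prop where
  measurable : Measurable K
  nonneg : ∀ u, 0 ≤ K u
  bounded : ∃ M : ℝ, ∀ u, K u ≤ M
  integrable : Integrable K
  integral_eq_one : ∫ u, K u = 1
  integrable_first : Integrable fun u => u * K u
  integral_first : ∫ u, u * K u = 0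
  integrable_second : Integrable fun u => u ^ 2 * K u

def kappa1 (K : ℝ → ℝ) : ℝ := ∫ u, (K u) ^ 2

def kappa2 (K : ℝ → ℝ) : ℝ := ∫ u, u ^ 2 * K u

/-- Twice differentiable with bounded first and second derivatives. -/
structure TwiceDiffBdd (g : ℝ → ℝ) : Prop where
  diff : Differentiable ℝ g
  diff_deriv : Differentiable ℝ (deriv g)
  bdd_deriv : ∃ B : ℝ, ∀ x, |deriv g x| ≤ B
  bdd_deriv2 : ∃ B : ℝ, ∀ x, |deriv (deriv g) x| ≤ B

/-- `f` is the probability density of the random variable `Z`. -/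
def IsDensityOf {Ω : Type*} [MeasurableSpace Ω] (μ : Measure Ω) (Z : Ω → ℝ) (f : ℝ → ℝ) : Prop :=
  μ.map Z = volume.withDensity fun x => ENNReal.ofReal (f x)

/-- The kernel density estimator of the density of the predictors. -/
def kernelDensityEstimator {Ω : Type*} (K : ℝ → ℝ) (X : ℕ → Ω → ℝ) (n : ℕ) (h x : ℝ) (ω : Ω) : ℝ :=
  1 / ((n : ℝ) * h) * ∑ i ∈ Finset.Icc 1 n, K ((x - X i ω) / h)

/-- The Nadaraya-Watson estimator of `m`, based on the observations `(X i, Y i)`, `1 ≤ i ≤ n`. It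
has the value `0` where the density estimator vanishes. -/
def nadarayaWatson {Ω : Type*} (K : ℝ → ℝ) (X Y : ℕ → Ω → ℝ) (n : ℕ) (h x : ℝ) (ω : Ω) : ℝ :=
  1 / ((n : ℝ) * h) * (1 / kernelDensityEstimator K X n h x ω) *
    ∑ i ∈ Finset.Icc 1 n, Y i ω * K ((x - X i ω) / h)

/-- The responses `Y i = m (X i) + ε i`. -/
def response {Ω : Type*} (m : ℝ → ℝ) (X ε : ℕ → Ω → ℝ) (i : ℕ) (ω : Ω) : ℝ :=
  m (X i ω) + ε i ω

/-- The squared error of the estimator at `x`. -/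
def squaredError {Ω : Type*} (K m : ℝ → ℝ) (X ε : ℕ → Ω → ℝ) (n : ℕ) (h x : ℝ) (ω : Ω) : ℝ :=
  (nadarayaWatson K X (response m X ε) n h x ω - m x) ^ 2

/-- The mean integrated squared error, weighted by `r`. The integral extends over the whole line,
which is the support of a positive density. -/
def MISE {Ω : Type*} [MeasurableSpace Ω] (μ : Measure Ω) (K m r : ℝ → ℝ) (X ε : ℕ → Ω → ℝ)
    (n : ℕ) (h : ℝ) : ℝ :=
  ∫ x, (∫ ω, squaredError K m X ε n h x ω ∂μ) * r x

/-- The integral in the squared bias term. -/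
def biasIntegral (f m r : ℝ → ℝ) : ℝ :=
  ∫ x, ((deriv (deriv m) x * f x + 2 * deriv m x * deriv f x) / f x) ^ 2 * r x

/-- The claimed asymptotic expression for the mean integrated squared error. -/
def asymptoticMISE (K f m r : ℝ → ℝ) (C₁ α : ℝ) (n : ℕ) (h : ℝ) : ℝ :=
  kappa1 K / ((n : ℝ) * h) * (∫ x, r x / f x)
    + h ^ 4 * (kappa2 K) ^ 2 / 4 * biasIntegral f m r
    + C₁ ^ 2 * (n : ℝ) ^ (-α) * (∫ x, r x)
    + C₁ ^ 2 * h ^ 2 * kappa2 K * (n : ℝ) ^ (-α) * (∫ x, deriv (deriv f) x / f x * r x)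

end

/-! Write `K_i` for the kernel weight of `X i` at `x`, `S` for the sum of these weights, `N = n h`,
and `g` for the kernel-smoothed normal density. The density `f` is the standard normal one.

Given the predictors, the mean squared error at `x` is the squared bias of a local average plus the
quadratic form of the error covariances in the weights `K_i / S` (`integral_squaredError`). If `S`
is replaced by its mean `N g`, both terms become moments of sums over the predictors. The quadratic
form yields the variance of order `1 / N`, with constant `∫ K²` over the density, plus the variance
`Γ` of the mean of `n` errors, which is asymptotic to `C₁² n ^ (-α)`. The bias yields the `h ^ 4`
term. The last term of the claimed expression is `o(n ^ (-α))`, so the remainder absorbs it.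

The memory of the predictors drops out because of the decomposition `X i = Z i + ζ i` into a
Gaussian prediction and a fresh Gaussian innovation. A summand `ψ (X i)` splits into a martingale
difference and `gaussianMean v ψ (Z i)`. Martingale differences are orthogonal, so only the diagonal
of the error covariances meets them. The second part is a smooth function of a Gaussian process even
if `K` is not smooth, and its size and derivative are `O(h)`. By a Maurey-Pisier rotation
(`IsGaussian.lintegral_convex_sub_le`) its covariances are dominated by those of `Z`. Together with
the errors this leaves `n⁻² ∑ |γ_ε| |γ_Z|`, which is `o(n ^ (-α))` merely because `γ_Z` tends to
zero (`tendsto_sum_abs_mul_abs_dist`). The outcome is `abs_integral_quadForm_sub_le`.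

The same splitting bounds exponential moments of `S - N g` (`exists_mgf_kernelSum_le`). By Chernoff,
the event that `S` differs from `N g` by a relative error `N ^ (-αX / 4)` has probability at most `C
φ(x) ^ (-p) N ^ (-4)`, with `φ` the normal density. On that event the weights still sum to at most
one, and the bias is controlled by one of the three alternatives on `K`, `m` and `n h`. All bounds
are uniform in `x` up to powers of `1 / φ(x)`, which the weight `r` integrates; the main terms
converge by dominated convergence.

For the asymptotic equivalence, every bias bound carries the factor `B ^ 2`, where `B` bounds the
derivatives of `m`. For constant `m` one takes `B = 0` and the remainder rate loses its `h ^ 4`. If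
the bias integral is nonzero, the claimed expression has the exact order of the rate
(`isBigO_asymptoticMISE`). -/

open scoped ENNReal NNReal

/-! ### Linear processes: second moments as mean square limits. -/

/-- Products of `L²`-convergent sequences have convergent integrals. -/
lemma tendsto_integral_mul_of_tendsto_eLpNorm {Ω : Type*} [MeasurableSpace Ω] {μ : Measure Ω}
    {F G : ℕ → Ω → ℝ} {f g : Ω → ℝ}
    (hF : ∀ N, MemLp (F N) 2 μ) (hG : ∀ N, MemLp (G N) 2 μ) (hf : MemLp f 2 μ) (hg : MemLp g 2 μ)
    (h1 : Tendsto (fun N => eLpNorm (f - F N) 2 μ) atTop (𝓝 0))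
    (h2 : Tendsto (fun N => eLpNorm (g - G N) 2 μ) atTop (𝓝 0)) :
    Tendsto (fun N => ∫ ω, F N ω * G N ω ∂μ) atTop (𝓝 (∫ ω, f ω * g ω ∂μ)) := by
  have e1 : Tendsto (fun N => (hF N).toLp (F N)) atTop (𝓝 (hf.toLp f)) := by
    rw [Lp.tendsto_Lp_iff_tendsto_eLpNorm'']
    simpa only [eLpNorm_sub_comm] using h1
  have e2 : Tendsto (fun N => (hG N).toLp (G N)) atTop (𝓝 (hg.toLp g)) := by
    rw [Lp.tendsto_Lp_iff_tendsto_eLpNorm'']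
    simpa only [eLpNorm_sub_comm] using h2
  have key : ∀ {a b : Ω → ℝ} (ha : MemLp a 2 μ) (hb : MemLp b 2 μ),
      inner ℝ (ha.toLp a) (hb.toLp b) = ∫ ω, a ω * b ω ∂μ := by
    intro a b ha hb
    rw [L2.inner_def]
    refine integral_congr_ae ?_
    filter_upwards [ha.coeFn_toLp, hb.coeFn_toLp] with ω h3 h4
    rw [h3, h4]
    simp [mul_comm]
  have := e1.inner (𝕜 := ℝ) e2
  simpa only [key] using this

namespace IsLinearProcess

variable {Ω : Type*} [MeasurableSpace Ω] {μ : Measure Ω} {a : ℕ → ℝ} {ξ : ℤ → Ω → ℝ}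
  {X : ℕ → Ω → ℝ}

lemma memLp_innov (hX : IsLinearProcess μ a ξ X) (h2 : MemLp (ξ 0) 2 μ) (j : ℤ) :
    MemLp (ξ j) 2 μ :=
  (hX.identDistrib j).memLp_iff.2 h2

lemma memLp_partialSum (hX : IsLinearProcess μ a ξ X) (h2 : MemLp (ξ 0) 2 μ) (i N : ℕ) :
    MemLp (fun ω => ∑ k ∈ Finset.range N, a k * ξ ((i : ℤ) - (k : ℤ)) ω) 2 μ :=
  memLp_finsetSum _ fun k _ => (hX.memLp_innov h2 _).const_mul (a k)

/-- Some partial sum lies at finite mean square distance, and partial sums are square integrable. -/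
lemma memLp (hX : IsLinearProcess μ a ξ X) (h2 : MemLp (ξ 0) 2 μ) {i : ℕ} (hi : 1 ≤ i) :
    MemLp (X i) 2 μ := by
  obtain ⟨N, hN⟩ := ((hX.series i hi).eventually (gt_mem_nhds ENNReal.zero_lt_top)).exists
  have h3 : MemLp (fun ω => X i ω - ∑ k ∈ Finset.range N, a k * ξ ((i : ℤ) - (k : ℤ)) ω) 2 μ :=
    ⟨((hX.measurable_proc i).sub (Finset.measurable_fun_sum _ fun k _ =>
      (hX.measurable_innov _).const_mul _)).aestronglyMeasurable, hN⟩
  exact (memLp_congr_ae (ae_of_all _ fun ω => by simp)).1 (h3.add (hX.memLp_partialSum h2 i N))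

lemma integrable_innov_mul (hX : IsLinearProcess μ a ξ X) (h2 : MemLp (ξ 0) 2 μ) (j k : ℤ) :
    Integrable (fun ω => ξ j ω * ξ k ω) μ :=
  (hX.memLp_innov h2 j).integrable_mul (hX.memLp_innov h2 k)

lemma integral_innov (hX : IsLinearProcess μ a ξ X) (j : ℤ) : ∫ ω, ξ j ω ∂μ = 0 := by
  rw [(hX.identDistrib j).integral_eq, hX.centered]

lemma integral_innov_mul [IsProbabilityMeasure μ] (hX : IsLinearProcess μ a ξ X) (j k : ℤ) :
    ∫ ω, ξ j ω * ξ k ω ∂μ = if j = k then ∫ ω, ξ 0 ω ^ 2 ∂μ else 0 := by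
  split_ifs with h
  · subst h
    simp_rw [← pow_two]
    exact ((hX.identDistrib j).pow (n := 2)).integral_eq
  · rw [(hX.indep.indepFun h).integral_fun_mul_eq_mul_integral
      (hX.measurable_innov j).aestronglyMeasurable (hX.measurable_innov k).aestronglyMeasurable,
      hX.integral_innov, zero_mul]

lemma integral_partialSum_mul_innov [IsProbabilityMeasure μ] (hX : IsLinearProcess μ a ξ X)
    (h2 : MemLp (ξ 0) 2 μ) (i N : ℕ) {j : ℤ} (hj : (i : ℤ) < j) :
    ∫ ω, (∑ k ∈ Finset.range N, a k * ξ ((i : ℤ) - (k : ℤ)) ω) * ξ j ω ∂μ = 0 := by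
  simp_rw [Finset.sum_mul, mul_assoc]
  rw [integral_finsetSum _ fun k _ =>
    (hX.integrable_innov_mul h2 _ j).const_mul (a k)]
  refine Finset.sum_eq_zero fun k _ => ?_
  rw [integral_const_mul, hX.integral_innov_mul, if_neg (by lia), mul_zero]

lemma integral_mul_innov [IsProbabilityMeasure μ] (hX : IsLinearProcess μ a ξ X)
    (h2 : MemLp (ξ 0) 2 μ) {i : ℕ} (hi : 1 ≤ i) {j : ℤ} (hj : (i : ℤ) < j) :
    ∫ ω, X i ω * ξ j ω ∂μ = 0 := by
  have := tendsto_integral_mul_of_tendsto_eLpNorm (fun N => hX.memLp_partialSum h2 i N)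
    (fun _ => hX.memLp_innov h2 j) (hX.memLp h2 hi) (hX.memLp_innov h2 j) (hX.series i hi)
    (by simp)
  simp_rw [hX.integral_partialSum_mul_innov h2 i _ hj] at this
  exact tendsto_nhds_unique this tendsto_const_nhds

lemma integral_eq_zero [IsProbabilityMeasure μ] (hX : IsLinearProcess μ a ξ X)
    (h2 : MemLp (ξ 0) 2 μ) {i : ℕ} (hi : 1 ≤ i) : ∫ ω, X i ω ∂μ = 0 := by
  have := tendsto_integral_mul_of_tendsto_eLpNorm (fun N => hX.memLp_partialSum h2 i N)
    (fun _ => memLp_const (1 : ℝ)) (hX.memLp h2 hi) (memLp_const (1 : ℝ)) (hX.series i hi)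
    (by simp)
  have h0 : ∀ N : ℕ, ∫ ω, (∑ k ∈ Finset.range N, a k * ξ ((i : ℤ) - (k : ℤ)) ω) * 1 ∂μ = 0 := by
    intro N
    simp_rw [mul_one]
    rw [integral_finsetSum _ fun k _ =>
      ((hX.memLp_innov h2 _).integrable one_le_two).const_mul (a k)]
    exact Finset.sum_eq_zero fun k _ => by rw [integral_const_mul, hX.integral_innov, mul_zero]
  simp_rw [h0, mul_one] at this
  exact tendsto_nhds_unique this tendsto_const_nhds

/-- The autocovariances of a linear process. -/
lemma integral_mul [IsProbabilityMeasure μ] (hX : IsLinearProcess μ a ξ X)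
    (h2 : MemLp (ξ 0) 2 μ) (ha : Summable fun k => a k ^ 2) {i : ℕ} (hi : 1 ≤ i) (l : ℕ) :
    ∫ ω, X i ω * X (i + l) ω ∂μ = (∫ ω, ξ 0 ω ^ 2 ∂μ) * ∑' k, a k * a (k + l) := by
  -- Truncating the later variable at `N + l` keeps the partner `k + l` of every `k < N` in range,
  -- so the truncated covariance is exactly a partial sum of the series.
  have h1 : Tendsto (fun N : ℕ => N + l) atTop atTop := tendsto_add_atTop_nat l
  have := tendsto_integral_mul_of_tendsto_eLpNorm (fun N => hX.memLp_partialSum h2 i N)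
    (fun N => hX.memLp_partialSum h2 (i + l) (N + l)) (hX.memLp h2 hi)
    (hX.memLp h2 (hi.trans (Nat.le_add_right i l))) (hX.series i hi)
    ((hX.series (i + l) (hi.trans (Nat.le_add_right i l))).comp h1)
  have e : ∀ N : ℕ, ∫ ω, (∑ k ∈ Finset.range N, a k * ξ ((i : ℤ) - (k : ℤ)) ω) *
      (∑ k ∈ Finset.range (N + l), a k * ξ (((i + l : ℕ) : ℤ) - (k : ℤ)) ω) ∂μ =
      (∫ ω, ξ 0 ω ^ 2 ∂μ) * ∑ k ∈ Finset.range N, a k * a (k + l) := by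
    intro N
    simp_rw [Finset.sum_mul_sum, mul_mul_mul_comm (a _)]
    rw [integral_finsetSum _ fun k _ => integrable_finsetSum _ fun k' _ =>
      (hX.integrable_innov_mul h2 _ _).const_mul (a k * a k'),
      Finset.mul_sum]
    refine Finset.sum_congr rfl fun k hk => ?_
    rw [integral_finsetSum _ fun k' _ =>
      (hX.integrable_innov_mul h2 _ _).const_mul (a k * a k')]
    rw [Finset.sum_eq_single (k + l)]
    · rw [integral_const_mul, hX.integral_innov_mul, if_pos (by push_cast; ring), mul_comm]
    · intro b _ hb
      rw [integral_const_mul, hX.integral_innov_mul, if_neg (by push_cast; lia), mul_zero]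
    · intro hb
      simp at hb hk
      lia
  simp_rw [e] at this
  refine tendsto_nhds_unique this ((HasSum.tendsto_sum_nat ?_).const_mul _)
  refine Summable.hasSum ?_
  refine Summable.of_norm_bounded (g := fun k => a k ^ 2 + a (k + l) ^ 2)
    (ha.add ((summable_nat_add_iff l).2 ha)) fun k => ?_
  rw [Real.norm_eq_abs, abs_le]
  constructor <;> nlinarith [sq_nonneg (a k + a (k + l)), sq_nonneg (a k - a (k + l))]

end IsLinearProcess

/-! ### Stability of Gaussian laws and processes under mean square limits. -/

section GaussianClosure

variable {Ω : Type*} [MeasurableSpace Ω] {μ : Measure Ω} [IsProbabilityMeasure μ]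

/-- Mean square limits of real Gaussian variables are Gaussian. -/
lemma hasGaussianLaw_of_tendsto_eLpNorm {Y : ℕ → Ω → ℝ} {y : Ω → ℝ}
    (hY : ∀ N, HasGaussianLaw (Y N) μ) (hy : MemLp y 2 μ)
    (h : Tendsto (fun N => eLpNorm (y - Y N) 2 μ) atTop (𝓝 0)) : HasGaussianLaw y μ := by
  have hY2 : ∀ N, MemLp (Y N) 2 μ := fun N => (hY N).memLp_two
  rw [hasGaussianLaw_iff_charFun_map_eq hy.aestronglyMeasurable.aemeasurable]
  intro t
  have m1 : Tendsto (fun N => ∫ ω, Y N ω ∂μ) atTop (𝓝 (∫ ω, y ω ∂μ)) := by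
    simpa using tendsto_integral_mul_of_tendsto_eLpNorm hY2 (fun _ => memLp_const (1 : ℝ)) hy
      (memLp_const (1 : ℝ)) h (by simp)
  have m2 : Tendsto (fun N => ∫ ω, Y N ω ^ 2 ∂μ) atTop (𝓝 (∫ ω, y ω ^ 2 ∂μ)) := by
    simpa [pow_two] using tendsto_integral_mul_of_tendsto_eLpNorm hY2 hY2 hy hy h h
  have hvar : ∀ {w : Ω → ℝ}, MemLp w 2 μ →
      Var[fun ω => inner ℝ t (w ω); μ] = t ^ 2 * (∫ ω, w ω ^ 2 ∂μ - (∫ ω, w ω ∂μ) ^ 2) := by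
    intro w hw
    have : (fun ω => inner ℝ t (w ω)) = fun ω => t * w ω := by
      ext ω; simp [mul_comm]
    rw [this, variance_const_mul, variance_eq_sub hw]
    rfl
  have hmean : ∀ w : Ω → ℝ, ∫ ω, inner ℝ t (w ω) ∂μ = t * ∫ ω, w ω ∂μ := by
    intro w
    rw [← integral_const_mul]
    congr 1; ext ω; simp [mul_comm]
  -- Mean square convergence gives convergence in distribution, hence of characteristic functions.
  -- The Gaussian ones depend only on mean and variance, which converge by `m1` and `m2`.
  have lim1 : Tendsto (fun N => charFun (μ.map (Y N)) t) atTop (𝓝 (charFun (μ.map y) t)) := by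
    have h3 := tendstoInMeasure_of_tendsto_eLpNorm (p := 2) (by norm_num)
      (fun N => (hY2 N).aestronglyMeasurable) hy.aestronglyMeasurable
      (by simpa only [eLpNorm_sub_comm] using h)
    have h4 := h3.tendstoInDistribution (fun N => (hY2 N).aestronglyMeasurable.aemeasurable)
    have h5 := h4.tendsto
    exact ProbabilityMeasure.tendsto_iff_tendsto_charFun.1 h5 t
  simp_rw [fun N => (hY N).charFun_map_eq t] at lim1
  refine tendsto_nhds_unique lim1 ?_
  refine (Complex.continuous_exp.tendsto _).comp ?_
  simp_rw [hmean, fun N => hvar (hY2 N), hvar hy]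
  refine Tendsto.sub (Tendsto.mul_const _ ?_) (Tendsto.div_const ?_ 2)
  · exact (Complex.continuous_ofReal.tendsto _).comp (m1.const_mul t)
  · exact (Complex.continuous_ofReal.tendsto _).comp ((m2.sub (m1.pow 2)).const_mul _)

/-- Mean square limits of Gaussian processes are Gaussian processes. -/
lemma isGaussianProcess_of_tendsto_eLpNorm {T : Type*} {Y : ℕ → T → Ω → ℝ} {y : T → Ω → ℝ}
    (hY : ∀ N, IsGaussianProcess (Y N) μ) (hy : ∀ t, MemLp (y t) 2 μ)
    (h : ∀ t, Tendsto (fun N => eLpNorm (y t - Y N t) 2 μ) atTop (𝓝 0)) :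
    IsGaussianProcess y μ where
  hasGaussianLaw I := by
    classical
    have hm : AEMeasurable (fun ω => I.restrict (y · ω)) μ :=
      aemeasurable_pi_lambda _ fun i => (hy i).aestronglyMeasurable.aemeasurable
    constructor
    refine ⟨fun L => ?_⟩
    -- Gaussianity of a vector is tested on linear functionals, which are finite combinations of
    -- coordinates; this reduces the claim to the scalar lemma.
    have hL : ∀ w : T → Ω → ℝ, (fun ω => L (I.restrict (w · ω))) =
        ∑ i : I, L (Pi.single i 1) • w i := by
      intro w
      ext ω
      rw [← ContinuousLinearMap.coe_coe, LinearMap.pi_apply_eq_sum_univ]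
      have e : ∀ i : I, (fun j : I => if i = j then (1 : ℝ) else 0) = Pi.single i 1 := by
        intro i
        ext j
        simp [Pi.single_apply, eq_comm]
      simp only [e]
      simp [mul_comm]
    have key : HasGaussianLaw (fun ω => L (I.restrict (y · ω))) μ := by
      refine hasGaussianLaw_of_tendsto_eLpNorm
        (Y := fun N ω => L (I.restrict (Y N · ω))) (fun N => ?_) ?_ ?_
      · exact ((hY N).hasGaussianLaw I).map_fun L
      · rw [hL]
        exact memLp_finsetSum' _ fun i _ => (hy i).const_smul _
      · have h1 : Tendsto (fun N => ∑ i : I, ‖L (Pi.single i 1)‖ₑ * eLpNorm (y i - Y N i) 2 μ)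
            atTop (𝓝 0) := by
          rw [show (0 : ℝ≥0∞) = ∑ i : I, ‖L (Pi.single i 1)‖ₑ * 0 by simp]
          exact tendsto_finsetSum _ fun i _ => ENNReal.Tendsto.const_mul (h i)
            (Or.inr enorm_ne_top)
        refine tendsto_of_tendsto_of_tendsto_of_le_of_le tendsto_const_nhds h1
          (fun _ => zero_le) fun N => ?_
        simp only
        rw [hL, hL, ← Finset.sum_sub_distrib]
        refine (eLpNorm_sum_le (fun i _ => ?_) one_le_two).trans
          (Finset.sum_le_sum fun i _ => ?_)
        · exact (((hy i).aestronglyMeasurable).const_smul _).sub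
            ((((hY N).hasGaussianLaw_eval i).memLp_two.aestronglyMeasurable).const_smul _)
        · rw [← smul_sub, eLpNorm_const_smul]
    have h2 := key.map_eq_gaussianReal
    have h3 : (μ.map fun ω => I.restrict (y · ω)).map L = μ.map fun ω => L (I.restrict (y · ω)) := by
      rw [AEMeasurable.map_map_of_aemeasurable (by fun_prop) hm]
      rfl
    rw [h3, h2, integral_map hm (by fun_prop), variance_map (by fun_prop) hm]
    rfl

omit [IsProbabilityMeasure μ] in
lemma isGaussianProcess_of_iIndepFun {T : Type*} {ζ : T → Ω → ℝ} (h : iIndepFun ζ μ)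
    (hg : ∀ j, HasGaussianLaw (ζ j) μ) : IsGaussianProcess ζ μ where
  hasGaussianLaw I :=
    iIndepFun.hasGaussianLaw (X := fun (i : I) => ζ i) (fun i => hg i)
      (h.precomp Subtype.val_injective)

end GaussianClosure

/-! ### One-step prediction of the predictors. -/

/-- A decomposition `X i = Z i + ζ i` of a sequence of standard Gaussian variables into a jointly
Gaussian prediction `Z i` and an innovation `ζ i` that is independent of the past. -/
structure GaussianDecomposition {Ω : Type*} [MeasurableSpace Ω] (μ : Measure Ω)
    (X Z ζ : ℕ → Ω → ℝ) (v : ℝ≥0) : Prop where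
  measurable_pred : ∀ i, Measurable (Z i)
  measurable_innov : ∀ i, Measurable (ζ i)
  eq_add : ∀ i ω, X i ω = Z i ω + ζ i ω
  var_ne_zero : v ≠ 0
  map_innov : ∀ i, μ.map (ζ i) = gaussianReal 0 v
  map_eq : ∀ i, μ.map (X i) = gaussianReal 0 1
  indep : ∀ i, IndepFun (ζ i) (fun ω => ((fun j : Fin i => (Z j ω, ζ j ω)), Z i ω)) μ
  gaussian : IsGaussianProcess Z μ
  pred_integral : ∀ i, ∫ ω, Z i ω ∂μ = 0

namespace LRDPredictors

variable {Ω : Type*} [MeasurableSpace Ω] {μ : Measure Ω} {αX A₀ : ℝ} {ζ : ℤ → Ω → ℝ}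
  {X : ℕ → Ω → ℝ}

/-- The coefficients of the one step prediction of the predictors. -/
noncomputable def predictionCoeff (A₀ αX : ℝ) (k : ℕ) : ℝ := if k = 0 then 0 else predictorCoeff A₀ αX k

/-- The term `k = 0` of the series is the innovation itself, since the zeroth coefficient is `1`;
removing it changes no other term. -/
lemma isLinearProcess_prediction (hX : LRDPredictors μ αX A₀ ζ X) :
    IsLinearProcess μ (predictionCoeff A₀ αX) ζ (fun i ω => X i ω - ζ i ω) where
  measurable_innov := hX.linear.measurable_innov
  measurable_proc i := (hX.linear.measurable_proc i).sub (hX.linear.measurable_innov _)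
  indep := hX.linear.indep
  identDistrib := hX.linear.identDistrib
  integrable := hX.linear.integrable
  centered := hX.linear.centered
  series i hi := by
    refine (tendsto_congr' ?_).2 (hX.linear.series i hi)
    filter_upwards [eventually_ge_atTop 1] with N hN
    obtain ⟨M, rfl⟩ : ∃ M, N = M + 1 := ⟨N - 1, by lia⟩
    congr 1
    ext ω
    rw [Finset.sum_range_succ', Finset.sum_range_succ']
    simp [predictionCoeff, predictorCoeff]
    ring

variable [IsProbabilityMeasure μ]

/-- All innovations and predictions together form a mean square limit of linear images of
independent Gaussian variables, hence a Gaussian process. There independence amounts to vanishing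
covariance. The innovation at time `i` is uncorrelated with earlier innovations, and with the
predictions up to time `i` because those only involve earlier innovations. -/
lemma gaussianDecomposition (hX : LRDPredictors μ αX A₀ ζ X) :
    ∃ v : ℝ≥0, GaussianDecomposition μ (fun i => X (i + 1))
      (fun i ω => X (i + 1) ω - ζ (i + 1 : ℕ) ω) (fun i => ζ (i + 1 : ℕ)) v := by
  obtain ⟨v, hv⟩ := hX.gaussian
  have hZ := hX.isLinearProcess_prediction
  have hg : ∀ j, HasGaussianLaw (ζ j) μ := by
    intro j
    constructor
    rw [hv j]
    infer_instance
  have h2 : MemLp (ζ 0) 2 μ := (hg 0).memLp_two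
  have hζ := isGaussianProcess_of_iIndepFun hX.linear.indep hg
  have pos : ∀ i : ℕ, 1 ≤ i + 1 := fun i => by lia
  have hZ2 : ∀ i : ℕ, MemLp (fun ω => X (i + 1) ω - ζ (i + 1 : ℕ) ω) 2 μ := fun i =>
    hZ.memLp h2 (pos i)
  -- the innovations and the predictions are jointly Gaussian
  let W : (ℤ ⊕ ℕ) → Ω → ℝ := Sum.elim ζ (fun i ω => X (i + 1) ω - ζ (i + 1 : ℕ) ω)
  have hW : IsGaussianProcess W μ := by
    let Y : ℕ → (ℤ ⊕ ℕ) → Ω → ℝ := fun N => Sum.elim ζ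
      (fun i ω => ∑ k ∈ Finset.range N, predictionCoeff A₀ αX k * ζ (((i + 1 : ℕ) : ℤ) - k) ω)
    refine isGaussianProcess_of_tendsto_eLpNorm (Y := Y) (fun N => ?_) ?_ ?_
    · refine hζ.of_isGaussianProcess fun s => ?_
      rcases s with j | i
      · exact ⟨{j}, ContinuousLinearMap.proj ⟨j, by simp⟩, fun ω => rfl⟩
      · classical
        refine ⟨(Finset.range N).image fun k : ℕ => ((i + 1 : ℕ) : ℤ) - k,
          ∑ k : Finset.range N, predictionCoeff A₀ αX k • ContinuousLinearMap.proj
            ⟨((i + 1 : ℕ) : ℤ) - (k : ℕ), Finset.mem_image_of_mem _ k.2⟩, fun ω => ?_⟩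
        simp only [Y, Sum.elim_inr, sum_apply, smul_apply,
          ContinuousLinearMap.proj_apply, Finset.restrict, smul_eq_mul]
        exact (Finset.sum_coe_sort (Finset.range N)
          fun k => predictionCoeff A₀ αX k * ζ (((i + 1 : ℕ) : ℤ) - k) ω).symm
    · rintro (j | i)
      · exact hX.linear.memLp_innov h2 j
      · exact hZ2 i
    · rintro (j | i)
      · simp [W, Y]
      · exact hZ.series (i + 1) (pos i)
  have hGX : ∀ i : ℕ, HasGaussianLaw (X (i + 1)) μ := by
    intro i
    have := hW.hasGaussianLaw_fun_add (s := Sum.inr i) (t := Sum.inl ((i + 1 : ℕ) : ℤ))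
    simpa [W] using this
  have hlaw : ∀ i : ℕ, μ.map (X (i + 1)) = gaussianReal 0 1 := by
    intro i
    rw [(hGX i).map_eq_gaussianReal, hX.unit_variance _ (pos i),
      hX.linear.integral_eq_zero h2 (pos i)]
    simp
  refine ⟨v, fun i => hZ.measurable_proc _, fun i => hX.linear.measurable_innov _,
    fun i ω => by ring, ?_, fun i => hv _, hlaw, fun i => ?_, ?_, fun i => ?_⟩
  -- With degenerate innovations every partial sum, and so `X 1`, would vanish almost surely,
  -- against the unit variance.
  · rintro rfl
    have h0 : ∀ j, ζ j =ᵐ[μ] 0 := by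
      intro j
      have h1 := hv j
      rw [gaussianReal_zero_var] at h1
      have h3 : ∀ᵐ x ∂(μ.map (ζ j)), x = 0 := by
        rw [h1]; simp [ae_dirac_eq]
      exact ae_of_ae_map (hX.linear.measurable_innov j).aemeasurable h3
    have h4 : ∫ ω, X 1 ω * X 1 ω ∂μ = 0 := by
      have := tendsto_integral_mul_of_tendsto_eLpNorm
        (fun N => hX.linear.memLp_partialSum h2 1 N) (fun N => hX.linear.memLp_partialSum h2 1 N)
        (hX.linear.memLp h2 le_rfl) (hX.linear.memLp h2 le_rfl) (hX.linear.series 1 le_rfl)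
        (hX.linear.series 1 le_rfl)
      refine tendsto_nhds_unique this (tendsto_const_nhds.congr fun N => ?_)
      refine (integral_eq_zero_of_ae ?_).symm
      filter_upwards [ae_all_iff.2 h0] with ω hω
      simp [hω]
    have h5 := hX.unit_variance 1 le_rfl
    rw [variance_eq_sub (hX.linear.memLp h2 le_rfl), hX.linear.integral_eq_zero h2 le_rfl] at h5
    simp [pow_two, h4] at h5
  -- The past consists of `i` innovations but `i + 1` predictions, as the prediction at time `i`
  -- itself is included.
  · have h3 := (hW.comp_right (Sum.elim (fun _ : Unit => Sum.inl (((i + 1 : ℕ) : ℤ)))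
      (Sum.elim (fun j : Fin i => Sum.inl ((((j : ℕ) + 1 : ℕ) : ℤ)))
        (fun j : Fin (i + 1) => Sum.inr (j : ℕ)))))
    let P : Fin i ⊕ Fin (i + 1) → Ω → ℝ := Sum.elim (fun j : Fin i => ζ (((j : ℕ) + 1 : ℕ) : ℤ))
      (fun j : Fin (i + 1) => fun ω => X ((j : ℕ) + 1) ω - ζ (((j : ℕ) + 1 : ℕ) : ℤ) ω)
    have h4 : IsGaussianProcess (Sum.elim (fun _ : Unit => ζ ((i + 1 : ℕ) : ℤ)) P) μ := by
      convert! h3 using 1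
      ext (_ | _ | _) ω <;> rfl
    have h5 := h4.indepFun_of_covariance_eq_zero
      (fun _ => (hX.linear.measurable_innov _).aemeasurable)
      (by
        rintro (j | j)
        · exact (hX.linear.measurable_innov _).aemeasurable
        · exact (hZ.measurable_proc _).aemeasurable) ?_
    · exact h5.comp (φ := fun z => z ())
        (ψ := fun p => ((fun j : Fin i => (p (Sum.inr j.castSucc), p (Sum.inl j))),
          p (Sum.inr (Fin.last i)))) (measurable_pi_apply (X := fun _ : Unit => ℝ) ()) (by fun_prop)
    · rintro _ (j | j)
      · change cov[ζ ((i + 1 : ℕ) : ℤ), ζ (((j : ℕ) + 1 : ℕ) : ℤ); μ] = 0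
        rw [covariance_eq_sub (hX.linear.memLp_innov h2 _) (hX.linear.memLp_innov h2 _)]
        have := hX.linear.integral_innov_mul ((i + 1 : ℕ) : ℤ) (((j : ℕ) + 1 : ℕ) : ℤ)
        rw [if_neg (by have := j.2; omega)] at this
        simp only [Pi.mul_apply, this, hX.linear.integral_innov]
        simp
      · rw [covariance_comm]
        change cov[fun ω => X ((j : ℕ) + 1) ω - ζ (((j : ℕ) + 1 : ℕ) : ℤ) ω,
          ζ ((i + 1 : ℕ) : ℤ); μ] = 0
        rw [covariance_eq_sub (hZ2 _) (hX.linear.memLp_innov h2 _)]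
        have hj := j.2
        have h6 : ∫ ω, (X ((j : ℕ) + 1) ω - ζ (((j : ℕ) + 1 : ℕ) : ℤ) ω) * ζ ((i + 1 : ℕ) : ℤ) ω ∂μ
            = 0 := by
          rcases Nat.lt_or_ge j i with h7 | h7
          · exact hZ.integral_mul_innov h2 (pos _) (by omega)
          -- For the prediction at the same time the index inequality is not strict; orthogonality
          -- comes from its vanishing zeroth coefficient.
          · have hji : (j : ℕ) = i := by lia
            rw [hji]
            have := tendsto_integral_mul_of_tendsto_eLpNorm
              (fun N => hZ.memLp_partialSum h2 (i + 1) N)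
              (fun _ => hX.linear.memLp_innov h2 ((i + 1 : ℕ) : ℤ)) (hZ2 i)
              (hX.linear.memLp_innov h2 ((i + 1 : ℕ) : ℤ)) (hZ.series (i + 1) (pos i)) (by simp)
            refine tendsto_nhds_unique this (tendsto_const_nhds.congr fun N => ?_)
            simp_rw [Finset.sum_mul, mul_assoc]
            rw [integral_finsetSum _ fun k _ => (hZ.integrable_innov_mul h2 _ _).const_mul _]
            refine (Finset.sum_eq_zero fun k _ => ?_).symm
            rw [integral_const_mul, hZ.integral_innov_mul]
            rcases Nat.eq_zero_or_pos k with rfl | hk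
            · simp [predictionCoeff]
            · rw [if_neg (by omega), mul_zero]
        simp only [Pi.mul_apply, h6, hX.linear.integral_innov]
        simp
  · exact hW.comp_right Sum.inr
  · exact hZ.integral_eq_zero h2 (pos i)

end LRDPredictors

/-! ### Gaussian rotation inequality. -/

section Rotation

variable {E : Type*} [NormedAddCommGroup E] [NormedSpace ℝ E] [MeasurableSpace E] [BorelSpace E]
  [SecondCountableTopology E] [CompleteSpace E]

/-- The Maurey-Pisier comparison: increments of a smooth function of a centered Gaussian vector are
dominated, for convex test functions, by the derivative in an independent Gaussian direction. -/
lemma IsGaussian.lintegral_convex_sub_le (ν : Measure E) [IsGaussian ν] (hν : ν[id] = 0)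
    {F : E → ℝ} {F' : E → E →L[ℝ] ℝ} (hF : ∀ x, HasFDerivAt F (F' x) x) (hF' : Continuous F')
    {Φ : ℝ → ℝ} (hΦ : ConvexOn ℝ Set.univ Φ) (hΦc : Continuous Φ) (hΦ0 : ∀ t, 0 ≤ Φ t) :
    ∫⁻ p, ENNReal.ofReal (Φ (F p.2 - F p.1)) ∂(ν.prod ν) ≤
      ∫⁻ p, ENNReal.ofReal (Φ (Real.pi / 2 * F' p.1 p.2)) ∂(ν.prod ν) := by
  have hpi : (0 : ℝ) < Real.pi / 2 := by positivity
  have hFc : Continuous F := continuous_iff_continuousAt.2 fun x => (hF x).continuousAt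
  set H : E × E → ℝ := fun p => Φ (Real.pi / 2 * F' p.1 p.2) with hH
  have hHc : Continuous H := by
    refine hΦc.comp (continuous_const.mul ?_)
    exact (hF'.comp continuous_fst).clm_apply continuous_snd
  -- The first component runs from `p.1` to `p.2` as the angle goes from `0` to `π / 2`, and its
  -- derivative is the second component. Since `ν` is centered, each rotation preserves `ν.prod ν`.
  let R : (E × E) → ℝ → E × E := fun p θ =>
    (Real.cos θ • p.1 + Real.sin θ • p.2, - Real.sin θ • p.1 + Real.cos θ • p.2)
  have hRc : Continuous (Function.uncurry R) := by
    simp only [R, Function.uncurry_def]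
    fun_prop
  have hRp : ∀ p, Continuous (R p) := fun p => hRc.comp (Continuous.prodMk_right p)
  have pointwise : ∀ p : E × E, ENNReal.ofReal (Φ (F p.2 - F p.1)) ≤
      ENNReal.ofReal (Real.pi / 2)⁻¹ *
        ∫⁻ θ in Set.Icc 0 (Real.pi / 2), ENNReal.ofReal (H (R p θ)) := by
    intro p
    let g' : ℝ → ℝ := fun θ => F' (R p θ).1 (R p θ).2
    have hg'c : Continuous g' :=
      (hF'.comp (hRp p).fst).clm_apply (hRp p).snd
    have hderiv : ∀ θ, HasDerivAt (fun θ => F (R p θ).1) (g' θ) θ := by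
      intro θ
      have h1 : HasDerivAt (fun θ => (R p θ).1) (R p θ).2 θ := by
        simp only [R]
        exact ((Real.hasDerivAt_cos θ).smul_const p.1).add ((Real.hasDerivAt_sin θ).smul_const p.2)
      exact (hF _).comp_hasDerivAt θ h1
    have hint : ∫ θ in Set.Icc 0 (Real.pi / 2), g' θ = F p.2 - F p.1 := by
      rw [integral_Icc_eq_integral_Ioc, ← intervalIntegral.integral_of_le hpi.le,
        intervalIntegral.integral_eq_sub_of_hasDerivAt (fun θ _ => hderiv θ)
          (hg'c.intervalIntegrable _ _)]
      simp [R]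
    have hvol : (volume (Set.Icc 0 (Real.pi / 2))) = ENNReal.ofReal (Real.pi / 2) := by simp
    -- The increment of `F` is the average of `π / 2 * g'` over the interval of angles, so Jensen's
    -- inequality applies to `Φ`.
    have jensen := hΦ.map_set_average_le (μ := volume) (t := Set.Icc 0 (Real.pi / 2))
      (f := fun θ => Real.pi / 2 * g' θ) hΦc.continuousOn isClosed_univ
      (by rw [hvol]; simpa using Real.pi_pos) (by rw [hvol]; exact ENNReal.ofReal_ne_top) (by simp)
      ((continuous_const.mul hg'c).continuousOn.integrableOn_compact isCompact_Icc)
      ((hΦc.comp (continuous_const.mul hg'c)).continuousOn.integrableOn_compact isCompact_Icc)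
    rw [setAverage_eq, setAverage_eq, Measure.real, hvol, ENNReal.toReal_ofReal hpi.le,
      integral_const_mul, hint, smul_eq_mul, smul_eq_mul, inv_mul_cancel_left₀ hpi.ne'] at jensen
    refine (ENNReal.ofReal_le_ofReal jensen).trans (le_of_eq ?_)
    rw [ENNReal.ofReal_mul (by positivity), ofReal_integral_eq_lintegral_ofReal
      (f := fun θ => Φ (Real.pi / 2 * g' θ)) ((hΦc.comp (continuous_const.mul hg'c)).continuousOn.integrableOn_compact isCompact_Icc)
      (ae_of_all _ fun θ => hΦ0 _)]
  calc ∫⁻ p, ENNReal.ofReal (Φ (F p.2 - F p.1)) ∂(ν.prod ν)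
      ≤ ∫⁻ p, ENNReal.ofReal (Real.pi / 2)⁻¹ *
        (∫⁻ θ in Set.Icc 0 (Real.pi / 2), ENNReal.ofReal (H (R p θ))) ∂(ν.prod ν) :=
        lintegral_mono pointwise
    _ = ENNReal.ofReal (Real.pi / 2)⁻¹ * ∫⁻ θ in Set.Icc 0 (Real.pi / 2),
        ∫⁻ p, ENNReal.ofReal (H (R p θ)) ∂(ν.prod ν) := by
        rw [lintegral_const_mul' _ _ ENNReal.ofReal_ne_top, lintegral_lintegral_swap]
        exact (ENNReal.continuous_ofReal.comp (hHc.comp hRc)).measurable.aemeasurable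
    _ = ENNReal.ofReal (Real.pi / 2)⁻¹ * ∫⁻ _θ in Set.Icc 0 (Real.pi / 2),
        ∫⁻ p, ENNReal.ofReal (H p) ∂(ν.prod ν) := by
        congr 1
        refine lintegral_congr fun θ => ?_
        conv_rhs => rw [← IsGaussian.map_rotation_eq_self hν θ]
        rw [lintegral_map (f := fun p => ENNReal.ofReal (H p))
          (ENNReal.continuous_ofReal.comp hHc).measurable (by fun_prop)]
        rfl
    _ = ∫⁻ p, ENNReal.ofReal (H p) ∂(ν.prod ν) := by
        rw [setLIntegral_const, mul_comm, mul_assoc, Real.volume_Icc, sub_zero,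
          ← ENNReal.ofReal_mul hpi.le, mul_inv_cancel₀ hpi.ne', ENNReal.ofReal_one, mul_one]

end Rotation

/-! ### Covariances and exponential moments for functions of the coordinates of a Gaussian vector.
-/

section Coordinates

variable {ι : Type*} [Fintype ι] (ν : Measure (ι → ℝ)) [IsGaussian ν] (hν : ν[id] = 0)

lemma hasFDerivAt_weighted_sum {G G' : ℝ → ℝ} (hG : ∀ x, HasDerivAt G (G' x) x) (e : ι → ℝ)
    (z : ι → ℝ) : HasFDerivAt (fun z : ι → ℝ => ∑ i, e i * G (z i))
      (∑ i, (e i * G' (z i)) • ContinuousLinearMap.proj (R := ℝ) (φ := fun _ : ι => ℝ) i) z := by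
  refine HasFDerivAt.fun_sum fun i _ => ?_
  have h1 : HasFDerivAt (fun z : ι → ℝ => z i)
      (ContinuousLinearMap.proj (R := ℝ) (φ := fun _ : ι => ℝ) i) z :=
    (ContinuousLinearMap.proj (R := ℝ) (φ := fun _ : ι => ℝ) i).hasFDerivAt
  have := ((hG (z i)).comp_hasFDerivAt z h1).const_mul (e i)
  rw [smul_smul] at this
  exact this

lemma continuous_weighted_sum_fderiv {G' : ℝ → ℝ} (hG' : Continuous G') (e : ι → ℝ) :
    Continuous fun z : ι → ℝ =>
      ∑ i, (e i * G' (z i)) • ContinuousLinearMap.proj (R := ℝ) (φ := fun _ : ι => ℝ) i := by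
  refine continuous_finsetSum _ fun i _ => ?_
  exact (continuous_const.mul (hG'.comp (continuous_apply i))).smul continuous_const

omit [Fintype ι] in
lemma IsGaussian.memLp_eval [Finite ι] (i : ι) : MemLp (fun z : ι → ℝ => z i) 2 ν := by
  have := Fintype.ofFinite ι
  exact IsGaussian.memLp_dual ν (ContinuousLinearMap.proj (R := ℝ) (φ := fun _ : ι => ℝ) i) 2
    (by norm_num)

include hν in
/-- A covariance comparison for smooth functions of the coordinates of a Gaussian vector. -/
lemma IsGaussian.sum_covariance_le {G G' : ℝ → ℝ} (hG : ∀ x, HasDerivAt G (G' x) x)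
    (hG' : Continuous G') {M L : ℝ} (hM : ∀ x, |G x| ≤ M) (hL : ∀ x, |G' x| ≤ L) (e : ι → ℝ) :
    ∑ i, ∑ j, e i * e j * (∫ z, G (z i) * G (z j) ∂ν - (∫ z, G (z i) ∂ν) * ∫ z, G (z j) ∂ν) ≤
      Real.pi ^ 2 / 8 * ∑ i, ∑ j, e i * e j *
        ((∫ z, G' (z i) * G' (z j) ∂ν) * ∫ z, z i * z j ∂ν) := by
  have hGc : Continuous G := continuous_iff_continuousAt.2 fun x => (hG x).continuousAt
  have hM0 : 0 ≤ M := (abs_nonneg _).trans (hM 0)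
  have hL0 : 0 ≤ L := (abs_nonneg _).trans (hL 0)
  set F : (ι → ℝ) → ℝ := fun z => ∑ i, e i * G (z i) with hF
  have hFc : Continuous F := by
    simp only [hF]; fun_prop
  have hFi : ∀ i, Integrable (fun z : ι → ℝ => G (z i)) ν := fun i =>
    Integrable.of_bound (hGc.comp (continuous_apply i)).aestronglyMeasurable M (ae_of_all _ fun z => by simpa using hM (z i))
  have hFF : ∀ i j, Integrable (fun z : ι → ℝ => G (z i) * G (z j)) ν := fun i j =>
    Integrable.of_bound (by fun_prop) (M * M) (ae_of_all _ fun z => by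
      rw [Real.norm_eq_abs, abs_mul]
      exact mul_le_mul (hM _) (hM _) (abs_nonneg _) hM0)
  have hF'F' : ∀ i j, Integrable (fun z : ι → ℝ => G' (z i) * G' (z j)) ν := fun i j =>
    Integrable.of_bound (by fun_prop) (L * L) (ae_of_all _ fun z => by
      rw [Real.norm_eq_abs, abs_mul]
      exact mul_le_mul (hL _) (hL _) (abs_nonneg _) hL0)
  have hzz : ∀ i j, Integrable (fun z : ι → ℝ => z i * z j) ν := fun i j =>
    (IsGaussian.memLp_eval ν i).integrable_mul (IsGaussian.memLp_eval ν j)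
  -- the left hand side
  have hFint : Integrable F ν := integrable_finsetSum _ fun i _ => (hFi i).const_mul _
  have hF2 : ∀ z, F z ^ 2 = ∑ i, ∑ j, e i * e j * (G (z i) * G (z j)) := by
    intro z
    rw [pow_two, Finset.sum_mul_sum]
    exact Finset.sum_congr rfl fun i _ => Finset.sum_congr rfl fun j _ => by ring
  have hF2int : Integrable (fun z => F z ^ 2) ν := by
    simp_rw [hF2]
    exact integrable_finsetSum _ fun i _ => integrable_finsetSum _ fun j _ =>
      (hFF i j).const_mul _
  have hF2eq : ∫ z, F z ^ 2 ∂ν = ∑ i, ∑ j, e i * e j * ∫ z, G (z i) * G (z j) ∂ν := by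
    simp_rw [hF2]
    rw [integral_finsetSum _ fun i _ => integrable_finsetSum _ fun j _ => (hFF i j).const_mul _]
    refine Finset.sum_congr rfl fun i _ => ?_
    rw [integral_finsetSum _ fun j _ => (hFF i j).const_mul _]
    exact Finset.sum_congr rfl fun j _ => integral_const_mul _ _
  have hFeq : (∫ z, F z ∂ν) ^ 2 =
      ∑ i, ∑ j, e i * e j * ((∫ z, G (z i) ∂ν) * ∫ z, G (z j) ∂ν) := by
    rw [hF, integral_finsetSum _ fun i _ => (hFi i).const_mul _, pow_two, Finset.sum_mul_sum]
    refine Finset.sum_congr rfl fun i _ => Finset.sum_congr rfl fun j _ => ?_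
    rw [integral_const_mul, integral_const_mul]
    ring
  have e1 : ∀ p : (ι → ℝ) × (ι → ℝ), (F p.2 - F p.1) ^ 2 =
      (1 * F p.2 ^ 2 - 2 * (F p.1 * F p.2)) + F p.1 ^ 2 * 1 := fun p => by ring
  have i1 : Integrable (fun p : (ι → ℝ) × (ι → ℝ) => 1 * F p.2 ^ 2) (ν.prod ν) :=
    (integrable_const (1 : ℝ)).mul_prod hF2int
  have i2 : Integrable (fun p : (ι → ℝ) × (ι → ℝ) => 2 * (F p.1 * F p.2)) (ν.prod ν) :=
    (hFint.mul_prod hFint).const_mul 2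
  have i3 : Integrable (fun p : (ι → ℝ) × (ι → ℝ) => F p.1 ^ 2 * 1) (ν.prod ν) :=
    hF2int.mul_prod (integrable_const (1 : ℝ))
  have hleft : ∫ p, (F p.2 - F p.1) ^ 2 ∂(ν.prod ν) =
      2 * (∫ z, F z ^ 2 ∂ν - (∫ z, F z ∂ν) ^ 2) := by
    simp_rw [e1]
    rw [integral_add (f := fun p : (ι → ℝ) × (ι → ℝ) => 1 * F p.2 ^ 2 - 2 * (F p.1 * F p.2))
      (i1.sub i2) i3, integral_sub i1 i2,
      integral_prod_mul (fun z => F z ^ 2) (fun _ => (1 : ℝ)),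
      integral_prod_mul (fun _ => (1 : ℝ)) (fun z => F z ^ 2), integral_const_mul,
      integral_prod_mul F F]
    simp
    ring
  -- the right hand side
  set F' : (ι → ℝ) → (ι → ℝ) →L[ℝ] ℝ := fun z =>
      ∑ i, (e i * G' (z i)) • ContinuousLinearMap.proj (R := ℝ) (φ := fun _ : ι => ℝ) i with hF'
  have e2 : ∀ p : (ι → ℝ) × (ι → ℝ), (Real.pi / 2 * F' p.1 p.2) ^ 2 =
      Real.pi ^ 2 / 4 * ∑ i, ∑ j, e i * e j * ((G' (p.1 i) * G' (p.1 j)) * (p.2 i * p.2 j)) := by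
    intro p
    have : F' p.1 p.2 = ∑ i, e i * G' (p.1 i) * p.2 i := by simp [hF']
    rw [this, mul_pow, div_pow, pow_two (∑ i, _), Finset.sum_mul_sum]
    norm_num
    exact Finset.sum_congr rfl fun i _ => Finset.sum_congr rfl fun j _ => by ring
  have i4 : ∀ i j, Integrable (fun p : (ι → ℝ) × (ι → ℝ) =>
      e i * e j * ((G' (p.1 i) * G' (p.1 j)) * (p.2 i * p.2 j))) (ν.prod ν) := fun i j =>
    ((hF'F' i j).mul_prod (hzz i j)).const_mul _
  have hrint : Integrable (fun p : (ι → ℝ) × (ι → ℝ) => (Real.pi / 2 * F' p.1 p.2) ^ 2)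
      (ν.prod ν) := by
    simp_rw [e2]
    exact (integrable_finsetSum _ fun i _ => integrable_finsetSum _ fun j _ => i4 i j).const_mul _
  have hright : ∫ p, (Real.pi / 2 * F' p.1 p.2) ^ 2 ∂(ν.prod ν) = Real.pi ^ 2 / 4 *
      ∑ i, ∑ j, e i * e j * ((∫ z, G' (z i) * G' (z j) ∂ν) * ∫ z, z i * z j ∂ν) := by
    simp_rw [e2]
    rw [integral_const_mul,
      integral_finsetSum _ fun i _ => integrable_finsetSum _ fun j _ => i4 i j]
    congr 1
    refine Finset.sum_congr rfl fun i _ => ?_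
    rw [integral_finsetSum _ fun j _ => i4 i j]
    refine Finset.sum_congr rfl fun j _ => ?_
    rw [integral_const_mul, integral_prod_mul (fun z : ι → ℝ => G' (z i) * G' (z j))
      (fun z : ι → ℝ => z i * z j)]
  -- With the square as test function the left side is twice the variance of `F`, which turns `π ^ 2
  -- / 4` into `π ^ 2 / 8`.
  have main := IsGaussian.lintegral_convex_sub_le ν hν (F := F) (F' := F')
    (hasFDerivAt_weighted_sum hG e) (continuous_weighted_sum_fderiv hG' e)
    (Φ := fun t => t ^ 2) (even_two.convexOn_pow) (by fun_prop) (fun t => sq_nonneg t)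
  have hlint : Integrable (fun p : (ι → ℝ) × (ι → ℝ) => (F p.2 - F p.1) ^ 2) (ν.prod ν) := by
    simp_rw [e1]
    exact (i1.sub i2).add i3
  rw [← ofReal_integral_eq_lintegral_ofReal hlint (ae_of_all _ fun p => sq_nonneg _),
    ← ofReal_integral_eq_lintegral_ofReal hrint (ae_of_all _ fun p => sq_nonneg _),
    ENNReal.ofReal_le_ofReal_iff (integral_nonneg fun p => sq_nonneg _), hleft, hright, hF2eq,
    hFeq, ← Finset.sum_sub_distrib] at main
  simp_rw [← Finset.sum_sub_distrib, ← mul_sub] at main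
  linarith

include hν in
/-- Gaussian concentration for sums of a smooth function of the coordinates. -/
lemma IsGaussian.lintegral_exp_sum_le {G G' : ℝ → ℝ} (hG : ∀ x, HasDerivAt G (G' x) x)
    (hG' : Continuous G') {M L : ℝ} (hM : ∀ x, |G x| ≤ M) (hL : ∀ x, |G' x| ≤ L) (t : ℝ) :
    ∫⁻ z, ENNReal.ofReal (Real.exp (t * ∑ i, (G (z i) - ∫ z, G (z i) ∂ν))) ∂ν ≤
      ENNReal.ofReal (Real.exp (t ^ 2 * (Real.pi ^ 2 / 8 * L ^ 2 *
        ∑ i, ∑ j, |∫ z, z i * z j ∂ν|))) := by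
  have hGc : Continuous G := continuous_iff_continuousAt.2 fun x => (hG x).continuousAt
  have hL0 : 0 ≤ L := (abs_nonneg _).trans (hL 0)
  set F : (ι → ℝ) → ℝ := fun z => ∑ i, 1 * G (z i) with hF
  have hFc : Continuous F := by
    simp only [hF]; fun_prop
  have hFi : ∀ i, Integrable (fun z : ι → ℝ => G (z i)) ν := fun i =>
    Integrable.of_bound (hGc.comp (continuous_apply i)).aestronglyMeasurable M (ae_of_all _ fun z => by simpa using hM (z i))
  have hFint : Integrable F ν := integrable_finsetSum _ fun i _ => (hFi i).const_mul _
  have hFb : ∀ z, |F z| ≤ ∑ _i : ι, M := by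
    intro z
    refine (Finset.abs_sum_le_sum_abs _ _).trans (Finset.sum_le_sum fun i _ => ?_)
    simpa using hM (z i)
  have hexpint : Integrable (fun z => Real.exp (-t * F z)) ν := by
    refine Integrable.of_bound (by fun_prop) (Real.exp (|t| * ∑ _i : ι, M))
      (ae_of_all _ fun z => ?_)
    rw [Real.norm_eq_abs, Real.abs_exp, Real.exp_le_exp]
    refine (le_abs_self _).trans ?_
    rw [abs_mul, abs_neg]
    exact mul_le_mul_of_nonneg_left (hFb z) (abs_nonneg _)
  have hmean : ∫ z, F z ∂ν = ∑ i, ∫ z, G (z i) ∂ν := by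
    rw [hF, integral_finsetSum _ fun i _ => (hFi i).const_mul _]
    simp
  -- Jensen's inequality in the first of the two independent copies replaces that copy by its mean,
  -- from below.
  have hjensen : Real.exp (-t * ∫ z, F z ∂ν) ≤ ∫ z, Real.exp (-t * F z) ∂ν := by
    rw [← integral_const_mul]
    exact convexOn_exp.map_integral_le Real.continuous_exp.continuousOn isClosed_univ (by simp)
      (hFint.const_mul _) hexpint
  set F' : (ι → ℝ) → (ι → ℝ) →L[ℝ] ℝ := fun z =>
      ∑ i, ((1 : ℝ) * G' (z i)) • ContinuousLinearMap.proj (R := ℝ) (φ := fun _ : ι => ℝ) i with hF'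
  have main := IsGaussian.lintegral_convex_sub_le ν hν (F := F) (F' := F')
    (hasFDerivAt_weighted_sum hG _) (continuous_weighted_sum_fderiv hG' _)
    (Φ := fun s => Real.exp (t * s)) (by
      have := convexOn_exp.comp_linearMap (LinearMap.mulLeft ℝ t)
      simpa [Function.comp_def] using! this) (by fun_prop) (fun s => (Real.exp_pos _).le)
  have hzz : ∀ i j, Integrable (fun z : ι → ℝ => z i * z j) ν := fun i j =>
    (IsGaussian.memLp_eval ν i).integrable_mul (IsGaussian.memLp_eval ν j)
  -- For fixed `x` the derivative `F' x` is a centered normal variable under `ν`, so its exponential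
  -- moment is explicit and only its variance has to be bounded.
  have inner : ∀ x : ι → ℝ, ∫⁻ y, ENNReal.ofReal (Real.exp (t * (Real.pi / 2 * F' x y))) ∂ν ≤
      ENNReal.ofReal (Real.exp (t ^ 2 * (Real.pi ^ 2 / 8 * L ^ 2 *
        ∑ i, ∑ j, |∫ z, z i * z j ∂ν|))) := by
    intro x
    have h1 := IsGaussian.map_eq_gaussianReal (μ := ν) (F' x)
    have hm : ν[F' x] = 0 := by
      rw [IsGaussian.integral_dual]
      simp only [id_eq] at hν
      rw [hν, map_zero]
    have hF'e : ∀ y, F' x y = ∑ i, G' (x i) * y i := by intro y; simp [hF']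
    have hvar : Var[F' x; ν] ≤ L ^ 2 * ∑ i, ∑ j, |∫ z, z i * z j ∂ν| := by
      rw [variance_of_integral_eq_zero (by fun_prop) hm]
      have h2 : ∀ y, (F' x y) ^ 2 = ∑ i, ∑ j, G' (x i) * G' (x j) * (y i * y j) := by
        intro y
        rw [hF'e, pow_two, Finset.sum_mul_sum]
        exact Finset.sum_congr rfl fun i _ => Finset.sum_congr rfl fun j _ => by ring
      simp_rw [h2]
      rw [integral_finsetSum _ fun i _ => integrable_finsetSum _ fun j _ =>
        (hzz i j).const_mul _, Finset.mul_sum]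
      refine Finset.sum_le_sum fun i _ => ?_
      rw [integral_finsetSum _ fun j _ => (hzz i j).const_mul _, Finset.mul_sum]
      refine Finset.sum_le_sum fun j _ => ?_
      rw [integral_const_mul]
      refine (le_abs_self _).trans ?_
      rw [abs_mul, abs_mul, pow_two]
      exact mul_le_mul_of_nonneg_right (mul_le_mul (hL _) (hL _) (abs_nonneg _) hL0)
        (abs_nonneg _)
    have h3 := mgf_gaussianReal h1 (t * (Real.pi / 2))
    rw [mgf, hm, zero_mul, zero_add, Real.coe_toNNReal _ (variance_nonneg _ _)] at h3
    have h4 : Integrable (fun y => Real.exp (t * (Real.pi / 2) * F' x y)) ν := by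
      have := integrable_exp_mul_gaussianReal (μ := ν[F' x]) (v := Var[F' x; ν].toNNReal)
        (t * (Real.pi / 2))
      rw [← h1] at this
      exact this.comp_aemeasurable (by fun_prop)
    simp_rw [← mul_assoc] at h3 h4 ⊢
    rw [← ofReal_integral_eq_lintegral_ofReal h4 (ae_of_all _ fun y => (Real.exp_pos _).le), h3]
    refine ENNReal.ofReal_le_ofReal (Real.exp_le_exp.2 ?_)
    calc Var[F' x; ν] * (t * (Real.pi / 2)) ^ 2 / 2
        = t ^ 2 * (Real.pi ^ 2 / 8) * Var[F' x; ν] := by ring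
      _ ≤ t ^ 2 * (Real.pi ^ 2 / 8) * (L ^ 2 * ∑ i, ∑ j, |∫ z, z i * z j ∂ν|) :=
        mul_le_mul_of_nonneg_left hvar (by positivity)
      _ = _ := by ring
  have hF'c : Continuous F' := continuous_weighted_sum_fderiv hG' _
  have hprod : ∫⁻ p, ENNReal.ofReal (Real.exp (t * (F p.2 - F p.1))) ∂(ν.prod ν) ≤
      ENNReal.ofReal (Real.exp (t ^ 2 * (Real.pi ^ 2 / 8 * L ^ 2 *
        ∑ i, ∑ j, |∫ z, z i * z j ∂ν|))) := by
    refine main.trans ?_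
    rw [lintegral_prod]
    · refine (lintegral_mono inner).trans ?_
      simp
    · refine Measurable.aemeasurable (ENNReal.measurable_ofReal.comp (Continuous.measurable ?_))
      refine Real.continuous_exp.comp (continuous_const.mul (continuous_const.mul ?_))
      exact (hF'c.comp continuous_fst).clm_apply continuous_snd
  refine le_trans ?_ hprod
  have e3 : ∀ p : (ι → ℝ) × (ι → ℝ), ENNReal.ofReal (Real.exp (t * (F p.2 - F p.1))) =
      ENNReal.ofReal (Real.exp (-t * F p.1)) * ENNReal.ofReal (Real.exp (t * F p.2)) := by
    intro p
    rw [← ENNReal.ofReal_mul (Real.exp_pos _).le, ← Real.exp_add]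
    congr 2; ring
  simp_rw [e3]
  rw [lintegral_prod_mul (f := fun z => ENNReal.ofReal (Real.exp (-t * F z)))
    (g := fun z => ENNReal.ofReal (Real.exp (t * F z))) (by fun_prop) (by fun_prop)]
  have e4 : ∀ z, ENNReal.ofReal (Real.exp (t * ∑ i, (G (z i) - ∫ z, G (z i) ∂ν))) =
      ENNReal.ofReal (Real.exp (-t * ∫ z, F z ∂ν)) * ENNReal.ofReal (Real.exp (t * F z)) := by
    intro z
    rw [← ENNReal.ofReal_mul (Real.exp_pos _).le, ← Real.exp_add, Finset.sum_sub_distrib, hmean]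
    congr 2
    simp [hF]
    ring
  simp_rw [e4]
  rw [lintegral_const_mul _ (by fun_prop)]
  gcongr
  rw [← ofReal_integral_eq_lintegral_ofReal hexpint (ae_of_all _ fun y => (Real.exp_pos _).le)]
  exact ENNReal.ofReal_le_ofReal hjensen

end Coordinates

/-! ### Autocovariances for regularly decaying coefficients. -/

section Coefficients

/-- A sequence of order `k ^ (-β)` is bounded by a multiple of `(k + 1) ^ (-β)`. -/
lemma exists_abs_le_rpow_of_tendsto {c : ℕ → ℝ} {β C : ℝ}
    (hc : Tendsto (fun k : ℕ => c k * (k : ℝ) ^ β) atTop (𝓝 C)) :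
    ∃ B : ℝ, 0 ≤ B ∧ ∀ k : ℕ, |c k| ≤ B * ((k : ℝ) + 1) ^ (-β) := by
  have h1 : Tendsto (fun k : ℕ => ((k : ℝ) + 1) / k) atTop (𝓝 1) := by
    have : Tendsto (fun k : ℕ => 1 + 1 / (k : ℝ)) atTop (𝓝 (1 + 0)) :=
      tendsto_const_nhds.add tendsto_one_div_atTop_nhds_zero_nat
    rw [add_zero] at this
    refine this.congr' ?_
    filter_upwards [eventually_gt_atTop 0] with k hk
    have : (k : ℝ) ≠ 0 := by positivity
    field_simp
  have h2 : Tendsto (fun k : ℕ => c k * ((k : ℝ) + 1) ^ β) atTop (𝓝 (C * 1 ^ β)) := by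
    refine (hc.mul (h1.rpow_const (p := β) (Or.inl one_ne_zero))).congr' ?_
    filter_upwards [eventually_gt_atTop 0] with k hk
    have hk' : (0 : ℝ) < k := by positivity
    rw [Real.div_rpow (by positivity) hk'.le]
    field_simp
  obtain ⟨B, hB⟩ := (Metric.isBounded_range_of_tendsto _ h2).exists_norm_le
  refine ⟨B, (norm_nonneg _).trans (hB _ (Set.mem_range_self 0)), fun k => ?_⟩
  have h3 := hB _ (Set.mem_range_self k)
  have hk' : (0 : ℝ) < ((k : ℝ) + 1) ^ β := by positivity
  rw [Real.norm_eq_abs, abs_mul, abs_of_pos hk'] at h3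
  rw [Real.rpow_neg (by positivity), ← div_eq_mul_inv, le_div_iff₀ hk']
  exact h3

/-- Substituting `N l ∼ x l` into `c k ∼ C k ^ (-β)`; this supplies the pointwise limits of the step
functions below. -/
lemma tendsto_floor_rpow {c : ℕ → ℝ} {β C : ℝ}
    (hc : Tendsto (fun k : ℕ => c k * (k : ℝ) ^ β) atTop (𝓝 C)) {N : ℕ → ℕ} {x : ℝ} (hx : 0 < x)
    (hN : Tendsto (fun l : ℕ => (N l : ℝ) / l) atTop (𝓝 x)) :
    Tendsto (fun l : ℕ => (l : ℝ) ^ β * c (N l)) atTop (𝓝 (C * x ^ (-β))) := by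
  have hN' : Tendsto N atTop atTop := by
    have h1 : Tendsto (fun l : ℕ => (N l : ℝ) / l * l) atTop atTop :=
      hN.pos_mul_atTop hx tendsto_natCast_atTop_atTop
    refine tendsto_natCast_atTop_iff.1 (h1.congr' ?_)
    filter_upwards [eventually_gt_atTop 0] with l hl
    have : (l : ℝ) ≠ 0 := by positivity
    field_simp
  refine ((hc.comp hN').mul (hN.rpow_const (p := -β) (Or.inl hx.ne'))).congr' ?_
  filter_upwards [eventually_gt_atTop 0, hN'.eventually (eventually_gt_atTop 0)] with l hl hNl
  have h1 : (0 : ℝ) < l := by positivity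
  have h2 : (0 : ℝ) < N l := by positivity
  simp only [Function.comp]
  rw [Real.rpow_neg (by positivity), Real.div_rpow h2.le h1.le]
  field_simp

/-- Near zero the singularity has exponent `-β > -1`; at infinity the decay has exponent `-2 β <
-1`. -/
lemma integrableOn_covarianceKernel {β : ℝ} (h1 : 1 / 2 < β) (h2 : β < 1) :
    IntegrableOn (fun x : ℝ => x ^ (-β) * (1 + x) ^ (-β)) (Set.Ioi 0) := by
  have hm : Measurable fun x : ℝ => x ^ (-β) * (1 + x) ^ (-β) := by fun_prop
  rw [← Set.Ioc_union_Ioi_eq_Ioi zero_le_one]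
  refine IntegrableOn.union ?_ ?_
  · have : IntegrableOn (fun x : ℝ => x ^ (-β)) (Set.Ioc 0 1) :=
      (intervalIntegrable_iff_integrableOn_Ioc_of_le zero_le_one).1
        (intervalIntegral.intervalIntegrable_rpow' (by linarith))
    refine this.mono' hm.aestronglyMeasurable ?_
    refine (ae_restrict_iff' measurableSet_Ioc).2 (ae_of_all _ fun x hx => ?_)
    have hx0 : 0 < x := hx.1
    rw [Real.norm_eq_abs, abs_of_nonneg (by positivity)]
    exact mul_le_of_le_one_right (by positivity)
      (Real.rpow_le_one_of_one_le_of_nonpos (by linarith) (by linarith))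
  · have : IntegrableOn (fun x : ℝ => x ^ (-β + -β)) (Set.Ioi 1) :=
      integrableOn_Ioi_rpow_of_lt (by linarith) one_pos
    refine this.mono' hm.aestronglyMeasurable ?_
    refine (ae_restrict_iff' measurableSet_Ioi).2 (ae_of_all _ fun x hx => ?_)
    have hx0 : 0 < x := zero_lt_one.trans hx
    rw [Real.norm_eq_abs, abs_of_nonneg (by positivity), Real.rpow_add hx0]
    exact mul_le_mul_of_nonneg_left
      (Real.rpow_le_rpow_of_nonpos hx0 (by linarith) (by linarith)) (by positivity)

lemma summable_sq_of_tendsto {c : ℕ → ℝ} {β C : ℝ} (hβ : 1 / 2 < β)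
    (hc : Tendsto (fun k : ℕ => c k * (k : ℝ) ^ β) atTop (𝓝 C)) : Summable fun k => c k ^ 2 := by
  obtain ⟨B, hB0, hB⟩ := exists_abs_le_rpow_of_tendsto hc
  have h1 : Summable fun k : ℕ => B ^ 2 * (((k + 1 : ℕ) : ℝ) ^ (-(2 * β))) :=
    ((summable_nat_add_iff 1).2 (Real.summable_nat_rpow.2 (by linarith))).mul_left _
  refine Summable.of_nonneg_of_le (fun k => sq_nonneg _) (fun k => ?_) h1
  rw [← sq_abs]
  refine (pow_le_pow_left₀ (abs_nonneg _) (hB k) 2).trans (le_of_eq ?_)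
  rw [mul_pow, ← Real.rpow_natCast, ← Real.rpow_natCast, ← Real.rpow_mul (by positivity)]
  push_cast
  ring_nf

/-- The autocovariances of a sequence of coefficients of order `k ^ (-β)`. -/
lemma tendsto_rpow_mul_tsum {c : ℕ → ℝ} {β C : ℝ} (h1 : 1 / 2 < β) (h2 : β < 1)
    (hc : Tendsto (fun k : ℕ => c k * (k : ℝ) ^ β) atTop (𝓝 C)) :
    Tendsto (fun l : ℕ => (∑' k, c k * c (k + l)) * (l : ℝ) ^ (2 * β - 1)) atTop
      (𝓝 (C ^ 2 * ∫ x in Set.Ioi (0 : ℝ), x ^ (-β) * (1 + x) ^ (-β))) := by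
  obtain ⟨B, hB0, hB⟩ := exists_abs_le_rpow_of_tendsto hc
  -- A step function whose integral over `[k / l, (k + 1) / l)` is the `k`-th summand times `l ^ (2
  -- β - 1)`. The scaled series thus becomes an integral accessible to dominated convergence.
  let F : ℕ → ℝ → ℝ := fun l x =>
    ((l : ℝ) ^ β * c ⌊x * l⌋₊) * ((l : ℝ) ^ β * c (⌊x * l⌋₊ + l))
  have hFm : ∀ l, Measurable (F l) := by
    intro l
    have hfl : Measurable fun x : ℝ => ⌊x * l⌋₊ := Nat.measurable_floor.comp (by fun_prop)
    have ha : Measurable fun x : ℝ => c ⌊x * l⌋₊ := (measurable_of_countable c).comp hfl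
    have hb : Measurable fun x : ℝ => c (⌊x * l⌋₊ + l) :=
      (measurable_of_countable fun k => c (k + l)).comp hfl
    exact (ha.const_mul _).mul (hb.const_mul _)
  have hbound : ∀ l : ℕ, 0 < l → ∀ x ∈ Set.Ioi (0 : ℝ),
      ‖F l x‖ ≤ B ^ 2 * (x ^ (-β) * (1 + x) ^ (-β)) := by
    intro l hl x hx
    have hl' : (0 : ℝ) < l := by positivity
    have hx' : (0 : ℝ) < x := hx
    -- The bound on `c` in terms of `k + 1` pays off here: `⌊x l⌋ + 1` is at least `x l`, so the
    -- majorant does not depend on `l`.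
    have key : ∀ (k : ℕ) (y : ℝ), 0 < y → y * l ≤ (k : ℝ) + 1 →
        |(l : ℝ) ^ β * c k| ≤ B * y ^ (-β) := by
      intro k y hy hk
      rw [abs_mul, abs_of_nonneg (by positivity)]
      calc (l : ℝ) ^ β * |c k| ≤ (l : ℝ) ^ β * (B * ((k : ℝ) + 1) ^ (-β)) :=
            mul_le_mul_of_nonneg_left (hB k) (by positivity)
        _ ≤ (l : ℝ) ^ β * (B * (y * l) ^ (-β)) := by
            refine mul_le_mul_of_nonneg_left (mul_le_mul_of_nonneg_left ?_ hB0) (by positivity)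
            exact Real.rpow_le_rpow_of_nonpos (by positivity) hk (by linarith)
        _ = B * y ^ (-β) := by
            rw [Real.mul_rpow hy.le hl'.le, Real.rpow_neg hl'.le]
            have : (l : ℝ) ^ β ≠ 0 := by positivity
            field_simp
    rw [Real.norm_eq_abs, abs_mul, pow_two, mul_mul_mul_comm]
    have hfl := (Nat.lt_floor_add_one (x * l)).le
    refine mul_le_mul (key _ x hx' hfl) (key _ (1 + x) (by linarith) ?_) (abs_nonneg _)
      (by positivity)
    push_cast
    linarith
  have hdom : IntegrableOn (fun x : ℝ => B ^ 2 * (x ^ (-β) * (1 + x) ^ (-β))) (Set.Ioi 0) :=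
    (integrableOn_covarianceKernel h1 h2).const_mul _
  have hlim : Tendsto (fun l => ∫ x in Set.Ioi (0 : ℝ), F l x) atTop
      (𝓝 (∫ x in Set.Ioi (0 : ℝ), (C * x ^ (-β)) * (C * (1 + x) ^ (-β)))) := by
    refine tendsto_integral_filter_of_dominated_convergence _
      (Eventually.of_forall fun l => (hFm l).aestronglyMeasurable) ?_ hdom ?_
    · filter_upwards [eventually_gt_atTop 0] with l hl
      exact (ae_restrict_iff' measurableSet_Ioi).2 (ae_of_all _ (hbound l hl))
    · refine (ae_restrict_iff' measurableSet_Ioi).2 (ae_of_all _ fun x hx => ?_)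
      have hx' : (0 : ℝ) < x := hx
      have hfl : Tendsto (fun l : ℕ => (⌊x * (l : ℝ)⌋₊ : ℝ) / l) atTop (𝓝 x) :=
        (tendsto_nat_floor_mul_div_atTop hx'.le).comp tendsto_natCast_atTop_atTop
      refine (tendsto_floor_rpow hc hx' hfl).mul
        (tendsto_floor_rpow hc (N := fun l => ⌊x * (l : ℝ)⌋₊ + l) (x := 1 + x) (by linarith) ?_)
      refine (hfl.const_add 1).congr' ?_
      filter_upwards [eventually_gt_atTop 0] with l hl
      have : (l : ℝ) ≠ 0 := by positivity
      push_cast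
      field_simp
      ring
  have e1 : ∫ x in Set.Ioi (0 : ℝ), (C * x ^ (-β)) * (C * (1 + x) ^ (-β)) =
      C ^ 2 * ∫ x in Set.Ioi (0 : ℝ), x ^ (-β) * (1 + x) ^ (-β) := by
    rw [← integral_const_mul]
    congr 1; ext x; ring
  rw [e1] at hlim
  refine hlim.congr' ?_
  filter_upwards [eventually_gt_atTop 0] with l hl
  have hl' : (0 : ℝ) < l := by positivity
  let s : ℕ → Set ℝ := fun k => Set.Ico ((k : ℝ) / l) (((k : ℝ) + 1) / l)
  have hfloor : ∀ k x, x ∈ s k → ⌊x * l⌋₊ = k := by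
    intro k x hx
    have := hx.1
    have := hx.2
    rw [div_le_iff₀ hl'] at *
    rw [lt_div_iff₀ hl'] at *
    exact (Nat.floor_eq_iff ((Nat.cast_nonneg k).trans ‹_›)).2 ⟨‹_›, ‹_›⟩
  have hU : ⋃ k, s k = Set.Ici 0 := by
    ext x
    simp only [Set.mem_iUnion, Set.mem_Ici]
    constructor
    · rintro ⟨k, hk⟩
      exact le_trans (by positivity) hk.1
    · intro hx
      refine ⟨⌊x * l⌋₊, ?_, ?_⟩
      · rw [div_le_iff₀ hl']
        exact Nat.floor_le (by positivity)
      · rw [lt_div_iff₀ hl']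
        exact Nat.lt_floor_add_one _
  have hint : IntegrableOn (F l) (⋃ k, s k) := by
    rw [hU, integrableOn_Ici_iff_integrableOn_Ioi]
    exact hdom.mono' (hFm l).aestronglyMeasurable
      ((ae_restrict_iff' measurableSet_Ioi).2 (ae_of_all _ (hbound l hl)))
  have hsum := hasSum_integral_iUnion (fun k => (measurableSet_Ico : MeasurableSet (s k))) (by
    intro j k hjk
    refine Set.disjoint_left.2 fun x hx hx' => hjk ?_
    rw [← hfloor j x hx, ← hfloor k x hx']) hint
  rw [hU, integral_Ici_eq_integral_Ioi] at hsum
  rw [← hsum.tsum_eq, ← tsum_mul_right]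
  refine tsum_congr fun k => ?_
  have e2 : ∫ x in s k, F l x = ∫ _x in s k, ((l : ℝ) ^ β * c k) * ((l : ℝ) ^ β * c (k + l)) := by
    refine setIntegral_congr_fun measurableSet_Ico fun x hx => ?_
    simp only [F, hfloor k x hx]
  rw [e2, setIntegral_const, Measure.real, Real.volume_Ico, ← sub_div, add_sub_cancel_left,
    ENNReal.toReal_ofReal (by positivity), smul_eq_mul, Real.rpow_sub hl', Real.rpow_one,
    two_mul, Real.rpow_add hl']
  ring

lemma covarianceKernel_integral_pos {β : ℝ} (h1 : 1 / 2 < β) (h2 : β < 1) :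
    0 < ∫ x in Set.Ioi (0 : ℝ), x ^ (-β) * (1 + x) ^ (-β) := by
  rw [setIntegral_pos_iff_support_of_nonneg_ae _ (integrableOn_covarianceKernel h1 h2)]
  · refine lt_of_lt_of_le ?_ (measure_mono (s := Set.Ioc 0 1) fun x hx => ⟨?_, hx.1⟩)
    · simp
    · have hx0 : 0 < x := hx.1
      simp only [Function.mem_support]
      positivity
  · refine (ae_restrict_iff' measurableSet_Ioi).2 (ae_of_all _ fun x hx => ?_)
    have hx0 : (0 : ℝ) < x := hx
    simp only [Pi.zero_apply]
    positivity

end Coefficients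

/-! ### Double sums over the distance of two indices. -/

section DoubleSums

/-- The distance `l > 0` occurs `2 (n - l)` times and the distance `0` only `n` times. In the
induction, bordering the square array adds each distance `1, …, n` twice and the distance `0` once.
-/
lemma sum_sum_dist (g : ℕ → ℝ) (n : ℕ) :
    ∑ i ∈ Finset.range n, ∑ j ∈ Finset.range n, g (Nat.dist i j) =
      2 * ∑ l ∈ Finset.range n, ((n : ℝ) - l) * g l - n * g 0 := by
  induction n with
  | zero => simp
  | succ n ih =>
    have h1 : ∑ i ∈ Finset.range n, g (Nat.dist i n) = ∑ l ∈ Finset.range n, g (l + 1) := by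
      rw [← Finset.sum_range_reflect]
      refine Finset.sum_congr rfl fun i hi => ?_
      have := Finset.mem_range.1 hi
      rw [Nat.dist_eq_sub_of_le (by lia)]
      congr 1
      lia
    have h2 : ∑ j ∈ Finset.range n, g (Nat.dist n j) = ∑ l ∈ Finset.range n, g (l + 1) := by
      simp_rw [Nat.dist_comm n]
      exact h1
    have h3 : ∑ l ∈ Finset.range (n + 1), g l = ∑ l ∈ Finset.range n, g (l + 1) + g 0 :=
      Finset.sum_range_succ' _ _
    have h4 : ∑ l ∈ Finset.range (n + 1), (((n + 1 : ℕ) : ℝ) - l) * g l =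
        ∑ l ∈ Finset.range n, ((n : ℝ) - l) * g l + ∑ l ∈ Finset.range (n + 1), g l := by
      have h5 : ∑ l ∈ Finset.range n, ((n : ℝ) - l) * g l =
          ∑ l ∈ Finset.range (n + 1), ((n : ℝ) - l) * g l := by
        rw [Finset.sum_range_succ]; simp
      rw [h5, ← Finset.sum_add_distrib]
      refine Finset.sum_congr rfl fun l _ => ?_
      push_cast; ring
    rw [Finset.sum_range_succ]
    simp_rw [Finset.sum_range_succ (fun j => g (Nat.dist _ j))]
    rw [Finset.sum_add_distrib, ih, h1, h2, h4, h3, Nat.dist_self]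
    push_cast
    ring

/-- Double sums of a function of order `l ^ (-α)` of the distance of the indices. -/
lemma tendsto_sum_sum_dist {g : ℕ → ℝ} {α C : ℝ} (h0 : 0 < α) (h1 : α < 1)
    (hg : Tendsto (fun l : ℕ => g l * (l : ℝ) ^ α) atTop (𝓝 C)) :
    Tendsto (fun n : ℕ => (∑ i ∈ Finset.range n, ∑ j ∈ Finset.range n, g (Nat.dist i j)) /
      (n : ℝ) ^ (2 - α)) atTop (𝓝 (2 * C / ((1 - α) * (2 - α)))) := by
  obtain ⟨B, hB0, hB⟩ := exists_abs_le_rpow_of_tendsto hg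
  -- Again a step function on cells of length `1 / n`, whose limit is `(1 - x) * (C * x ^ (-α))`.
  let F : ℕ → ℝ → ℝ := fun n x => (1 - (⌊x * n⌋₊ : ℝ) / n) * ((n : ℝ) ^ α * g ⌊x * n⌋₊)
  have hFm : ∀ n, Measurable (F n) := by
    intro n
    have hfl : Measurable fun x : ℝ => ⌊x * n⌋₊ := Nat.measurable_floor.comp (by fun_prop)
    exact (measurable_of_countable fun k : ℕ => (1 - (k : ℝ) / n) * ((n : ℝ) ^ α * g k)).comp hfl
  have hbound : ∀ n : ℕ, 0 < n → ∀ x ∈ Set.Ioo (0 : ℝ) 1, ‖F n x‖ ≤ B * x ^ (-α) := by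
    intro n hn x hx
    have hn' : (0 : ℝ) < n := by positivity
    have hx' : (0 : ℝ) < x := hx.1
    have hfl : (⌊x * n⌋₊ : ℝ) ≤ x * n := Nat.floor_le (by positivity)
    have hfl2 := (Nat.lt_floor_add_one (x * n)).le
    have hq : (⌊x * n⌋₊ : ℝ) / n ≤ 1 := by
      rw [div_le_one hn']
      exact hfl.trans (mul_le_of_le_one_left hn'.le hx.2.le)
    have hq0 : 0 ≤ (⌊x * n⌋₊ : ℝ) / n := by positivity
    rw [Real.norm_eq_abs, abs_mul, abs_mul, abs_of_nonneg (sub_nonneg.2 hq),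
      abs_of_nonneg (by positivity : 0 ≤ (n : ℝ) ^ α)]
    calc (1 - (⌊x * n⌋₊ : ℝ) / n) * ((n : ℝ) ^ α * |g ⌊x * n⌋₊|)
        ≤ 1 * ((n : ℝ) ^ α * |g ⌊x * n⌋₊|) :=
          mul_le_mul_of_nonneg_right (by linarith) (by positivity)
      _ ≤ (n : ℝ) ^ α * (B * ((⌊x * n⌋₊ : ℝ) + 1) ^ (-α)) := by
          rw [one_mul]
          exact mul_le_mul_of_nonneg_left (hB _) (by positivity)
      _ ≤ (n : ℝ) ^ α * (B * (x * n) ^ (-α)) := by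
          refine mul_le_mul_of_nonneg_left (mul_le_mul_of_nonneg_left ?_ hB0) (by positivity)
          exact Real.rpow_le_rpow_of_nonpos (by positivity) hfl2 (by linarith)
      _ = B * x ^ (-α) := by
          rw [Real.mul_rpow hx'.le hn'.le, Real.rpow_neg hn'.le]
          have : (n : ℝ) ^ α ≠ 0 := by positivity
          field_simp
  have hdom : IntegrableOn (fun x : ℝ => B * x ^ (-α)) (Set.Ioo 0 1) := by
    have : IntegrableOn (fun x : ℝ => x ^ (-α)) (Set.Ioc 0 1) :=
      (intervalIntegrable_iff_integrableOn_Ioc_of_le zero_le_one).1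
        (intervalIntegral.intervalIntegrable_rpow' (by linarith))
    exact (this.mono_set Set.Ioo_subset_Ioc_self).const_mul _
  have hlim : Tendsto (fun n => ∫ x in Set.Ioo (0 : ℝ) 1, F n x) atTop
      (𝓝 (∫ x in Set.Ioo (0 : ℝ) 1, (1 - x) * (C * x ^ (-α)))) := by
    refine tendsto_integral_filter_of_dominated_convergence _
      (Eventually.of_forall fun n => (hFm n).aestronglyMeasurable) ?_ hdom ?_
    · filter_upwards [eventually_gt_atTop 0] with n hn
      exact (ae_restrict_iff' measurableSet_Ioo).2 (ae_of_all _ (hbound n hn))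
    · refine (ae_restrict_iff' measurableSet_Ioo).2 (ae_of_all _ fun x hx => ?_)
      have hfl : Tendsto (fun l : ℕ => (⌊x * (l : ℝ)⌋₊ : ℝ) / l) atTop (𝓝 x) :=
        (tendsto_nat_floor_mul_div_atTop hx.1.le).comp tendsto_natCast_atTop_atTop
      exact (hfl.const_sub 1).mul (tendsto_floor_rpow hg hx.1 hfl)
  have hval : ∫ x in Set.Ioo (0 : ℝ) 1, (1 - x) * (C * x ^ (-α)) = C / ((1 - α) * (2 - α)) := by
    have e : ∀ x ∈ Set.Ioo (0 : ℝ) 1, (1 - x) * (C * x ^ (-α)) =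
        C * x ^ (-α) - C * x ^ (1 - α) := by
      intro x hx
      rw [sub_eq_add_neg 1 α, Real.rpow_add hx.1, Real.rpow_one]
      ring
    rw [setIntegral_congr_fun measurableSet_Ioo e, ← integral_Ioc_eq_integral_Ioo,
      ← intervalIntegral.integral_of_le zero_le_one, intervalIntegral.integral_sub,
      intervalIntegral.integral_const_mul, intervalIntegral.integral_const_mul,
      integral_rpow (Or.inl (by linarith)), integral_rpow (Or.inl (by linarith))]
    · have a1 : (1 : ℝ) - α ≠ 0 := by linarith
      have a2 : (2 : ℝ) - α ≠ 0 := by linarith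
      rw [show -α + 1 = 1 - α by ring, show 1 - α + 1 = 2 - α by ring, Real.one_rpow,
        Real.one_rpow, Real.zero_rpow a1, Real.zero_rpow a2]
      field_simp
      ring
    · exact (intervalIntegral.intervalIntegrable_rpow' (by linarith)).const_mul _
    · exact (intervalIntegral.intervalIntegrable_rpow' (by linarith)).const_mul _
  rw [hval] at hlim
  -- The diagonal correction `n * g 0` is of relative order `n ^ (-(1 - α))`, negligible because `α
  -- < 1`.
  have hdiag : Tendsto (fun n : ℕ => g 0 * (n : ℝ) ^ (-(1 - α))) atTop (𝓝 (g 0 * 0)) :=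
    ((tendsto_rpow_neg_atTop (by linarith)).comp tendsto_natCast_atTop_atTop).const_mul _
  have := (hlim.const_mul 2).sub hdiag
  rw [mul_zero, sub_zero, ← mul_div_assoc] at this
  refine this.congr' ?_
  filter_upwards [eventually_gt_atTop 0] with n hn
  have hn' : (0 : ℝ) < n := by positivity
  let s : ℕ → Set ℝ := fun k => Set.Ico ((k : ℝ) / n) (((k : ℝ) + 1) / n)
  have hfloor : ∀ k x, x ∈ s k → ⌊x * n⌋₊ = k := by
    intro k x hx
    have := hx.1
    have := hx.2
    rw [div_le_iff₀ hn'] at *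
    rw [lt_div_iff₀ hn'] at *
    exact (Nat.floor_eq_iff ((Nat.cast_nonneg k).trans ‹_›)).2 ⟨‹_›, ‹_›⟩
  have hU : ⋃ k ∈ Finset.range n, s k = Set.Ico 0 1 := by
    ext x
    simp only [Set.mem_iUnion, Set.mem_Ico, Finset.mem_range, exists_prop]
    constructor
    · rintro ⟨k, hk, hx⟩
      refine ⟨le_trans (by positivity) hx.1, hx.2.trans_le ?_⟩
      rw [div_le_one hn']
      exact_mod_cast hk
    · rintro ⟨hx, hx1⟩
      refine ⟨⌊x * n⌋₊, ?_, ?_, ?_⟩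
      · rw [Nat.floor_lt (by positivity)]
        exact mul_lt_of_lt_one_left hn' hx1
      · rw [div_le_iff₀ hn']
        exact Nat.floor_le (by positivity)
      · rw [lt_div_iff₀ hn']
        exact Nat.lt_floor_add_one _
  have hint : IntegrableOn (F n) (Set.Ico 0 1) := by
    rw [integrableOn_Ico_iff_integrableOn_Ioo]
    exact hdom.mono' (hFm n).aestronglyMeasurable
      ((ae_restrict_iff' measurableSet_Ioo).2 (ae_of_all _ (hbound n hn)))
  have hsum : ∫ x in Set.Ioo (0 : ℝ) 1, F n x = ∑ k ∈ Finset.range n, ∫ x in s k, F n x := by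
    rw [← integral_Ico_eq_integral_Ioo, ← hU]
    refine integral_biUnion_finset _ (fun k _ => measurableSet_Ico) ?_ fun k hk => ?_
    · intro j _ k _ hjk
      refine Set.disjoint_left.2 fun x hx hx' => hjk ?_
      rw [← hfloor j x hx, ← hfloor k x hx']
    · refine hint.mono_set ?_
      rw [← hU]
      exact Set.subset_biUnion_of_mem (u := s) hk
  have e2 : ∀ k, ∫ x in s k, F n x = (n : ℝ)⁻¹ * ((1 - (k : ℝ) / n) * ((n : ℝ) ^ α * g k)) := by
    intro k
    have : ∫ x in s k, F n x = ∫ _x in s k, (1 - (k : ℝ) / n) * ((n : ℝ) ^ α * g k) := by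
      refine setIntegral_congr_fun measurableSet_Ico fun x hx => ?_
      simp only [F, hfloor k x hx]
    rw [this, setIntegral_const, Measure.real, Real.volume_Ico, ← sub_div, add_sub_cancel_left,
      ENNReal.toReal_ofReal (by positivity), smul_eq_mul, one_div]
  rw [hsum, sum_sum_dist]
  simp_rw [e2]
  have e3 : ∑ k ∈ Finset.range n, (n : ℝ)⁻¹ * ((1 - (k : ℝ) / n) * ((n : ℝ) ^ α * g k)) =
      (∑ l ∈ Finset.range n, ((n : ℝ) - l) * g l) * ((n : ℝ) ^ α / n ^ 2) := by
    rw [Finset.sum_mul]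
    refine Finset.sum_congr rfl fun k _ => ?_
    field_simp
  rw [e3, Real.rpow_sub hn', neg_sub, Real.rpow_sub hn', Real.rpow_one, Real.rpow_two]
  field_simp

end DoubleSums

/-! ### Averaging over an independent variable. -/

section Conditioning

variable {Ω E : Type*} [MeasurableSpace Ω] [MeasurableSpace E] {μ : Measure Ω}
  [IsProbabilityMeasure μ] {V : Ω → ℝ} {U : Ω → E} {κ : Measure ℝ}

/-- The joint law is a product, so Tonelli's theorem applies. Used with `V` an innovation and `U`
its past, this replaces conditional expectations. -/
lemma ProbabilityTheory.IndepFun.lintegral_eq (h : IndepFun V U μ) (hV : Measurable V)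
    (hU : Measurable U) (hκ : μ.map V = κ) {H : E × ℝ → ℝ≥0∞} (hH : Measurable H) :
    ∫⁻ ω, H (U ω, V ω) ∂μ = ∫⁻ ω, ∫⁻ y, H (U ω, y) ∂κ ∂μ := by
  have h1 := (indepFun_iff_map_prod_eq_prod_map_map hU.aemeasurable hV.aemeasurable).1 h.symm
  have : IsProbabilityMeasure (μ.map U) := Measure.isProbabilityMeasure_map hU.aemeasurable
  have : IsProbabilityMeasure κ := hκ ▸ Measure.isProbabilityMeasure_map hV.aemeasurable
  rw [← lintegral_map hH (hU.prodMk hV), h1, hκ, lintegral_prod _ hH.aemeasurable,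
    lintegral_map hH.lintegral_prod_right' hU]

lemma ProbabilityTheory.IndepFun.integral_eq (h : IndepFun V U μ) (hV : Measurable V)
    (hU : Measurable U) (hκ : μ.map V = κ) {H : E × ℝ → ℝ} (hH : Measurable H)
    (hi : Integrable (fun ω => H (U ω, V ω)) μ) :
    ∫ ω, H (U ω, V ω) ∂μ = ∫ ω, ∫ y, H (U ω, y) ∂κ ∂μ := by
  have h1 := (indepFun_iff_map_prod_eq_prod_map_map hU.aemeasurable hV.aemeasurable).1 h.symm
  have : IsProbabilityMeasure (μ.map U) := Measure.isProbabilityMeasure_map hU.aemeasurable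
  have : IsProbabilityMeasure κ := hκ ▸ Measure.isProbabilityMeasure_map hV.aemeasurable
  have h2 : Integrable H ((μ.map U).prod κ) := by
    rw [← hκ, ← h1]
    exact (integrable_map_measure hH.aestronglyMeasurable (hU.prodMk hV).aemeasurable).2 hi
  rw [← integral_map (f := H) (hU.prodMk hV).aemeasurable hH.aestronglyMeasurable, h1, hκ,
    integral_prod _ h2, integral_map hU.aemeasurable]
  exact hH.stronglyMeasurable.integral_prod_right'.aestronglyMeasurable

end Conditioning

/-! ### The martingale part: projection of functions of `X i` on the past. -/

/-- The average of `ψ (z + ·)` under the centered normal distribution of variance `v`. -/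
noncomputable def gaussianMean (v : ℝ≥0) (ψ : ℝ → ℝ) (z : ℝ) : ℝ := ∫ y, ψ (z + y) ∂gaussianReal 0 v

lemma measurable_gaussianMean (v : ℝ≥0) {ψ : ℝ → ℝ} (hψ : Measurable ψ) :
    Measurable (gaussianMean v ψ) :=
  (StronglyMeasurable.integral_prod_right' (f := fun p : ℝ × ℝ => ψ (p.1 + p.2))
    (hψ.comp (by fun_prop)).stronglyMeasurable).measurable

lemma integral_sub_gaussianMean (v : ℝ≥0) (ψ : ℝ → ℝ) (z : ℝ) :
    ∫ y, (ψ (z + y) - gaussianMean v ψ z) ∂gaussianReal 0 v = 0 := by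
  by_cases h : Integrable (fun y => ψ (z + y)) (gaussianReal 0 v)
  · rw [integral_sub h (integrable_const _)]
    simp [gaussianMean]
  -- If `ψ (z + ·)` is not integrable, neither is its difference from a constant, and the integral
  -- takes the default value `0`.
  · refine integral_undef fun h' => h ?_
    exact (h'.add (integrable_const (gaussianMean v ψ z))).congr (ae_of_all _ fun y => by simp)

namespace GaussianDecomposition

variable {Ω : Type*} [MeasurableSpace Ω] {μ : Measure Ω} [IsProbabilityMeasure μ]
  {X Z ζ : ℕ → Ω → ℝ} {v : ℝ≥0}

omit [IsProbabilityMeasure μ] in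
lemma measurable (hD : GaussianDecomposition μ X Z ζ v) (i : ℕ) : Measurable (X i) := by
  rw [show X i = fun ω => Z i ω + ζ i ω from funext (hD.eq_add i)]
  exact (hD.measurable_pred i).add (hD.measurable_innov i)

omit [IsProbabilityMeasure μ] in
lemma measurable_past (hD : GaussianDecomposition μ X Z ζ v) (i : ℕ) :
    Measurable fun ω => ((fun j : Fin i => (Z j ω, ζ j ω)), Z i ω) :=
  (measurable_pi_lambda _ fun j : Fin i =>
    (hD.measurable_pred j).prodMk (hD.measurable_innov j)).prodMk
    (hD.measurable_pred i)

omit [IsProbabilityMeasure μ] in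
lemma integral_comp (hD : GaussianDecomposition μ X Z ζ v) (i : ℕ) {ψ : ℝ → ℝ}
    (hψ : Measurable ψ) : ∫ ω, ψ (X i ω) ∂μ = ∫ y, ψ y ∂gaussianReal 0 1 := by
  rw [← hD.map_eq i, integral_map (hD.measurable i).aemeasurable hψ.aestronglyMeasurable]

omit [IsProbabilityMeasure μ] in
lemma memLp_comp (hD : GaussianDecomposition μ X Z ζ v) (i : ℕ) {ψ : ℝ → ℝ}
    {p : ℝ≥0∞} (h : MemLp ψ p (gaussianReal 0 1)) :
    MemLp (fun ω => ψ (X i ω)) p μ := by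
  rw [← hD.map_eq i] at h
  exact h.comp_of_map (hD.measurable i).aemeasurable

omit [IsProbabilityMeasure μ] in
lemma integrable_comp (hD : GaussianDecomposition μ X Z ζ v) (i : ℕ) {ψ : ℝ → ℝ}
    (h : Integrable ψ (gaussianReal 0 1)) : Integrable (fun ω => ψ (X i ω)) μ :=
  memLp_one_iff_integrable.1 (hD.memLp_comp i (memLp_one_iff_integrable.2 h))

/-- Averages of the form `E[F(past) ψ(X i)]`. -/
lemma integral_mul_eq (hD : GaussianDecomposition μ X Z ζ v) (i : ℕ) {ψ : ℝ → ℝ}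
    (hψ : Measurable ψ) {F : (Fin i → ℝ × ℝ) × ℝ → ℝ} (hF : Measurable F)
    (hi : Integrable (fun ω => F ((fun j : Fin i => (Z j ω, ζ j ω)), Z i ω) * ψ (X i ω)) μ) :
    ∫ ω, F ((fun j : Fin i => (Z j ω, ζ j ω)), Z i ω) * ψ (X i ω) ∂μ =
      ∫ ω, F ((fun j : Fin i => (Z j ω, ζ j ω)), Z i ω) * gaussianMean v ψ (Z i ω) ∂μ := by
  simp only [hD.eq_add] at hi ⊢
  rw [(hD.indep i).integral_eq (hD.measurable_innov i) (hD.measurable_past i) (hD.map_innov i)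
    (H := fun q => F q.1 * ψ (q.1.2 + q.2)) (by fun_prop) hi]
  simp only [integral_const_mul]
  rfl

lemma integral_gaussianMean (hD : GaussianDecomposition μ X Z ζ v) (i : ℕ) {ψ : ℝ → ℝ}
    (hψ : Measurable ψ) (hi : Integrable ψ (gaussianReal 0 1)) :
    ∫ ω, gaussianMean v ψ (Z i ω) ∂μ = ∫ y, ψ y ∂gaussianReal 0 1 := by
  have := hD.integral_mul_eq i hψ (F := fun _ => 1) measurable_const
    (by simpa using hD.integrable_comp i hi)
  simp only [one_mul] at this
  rw [← this, hD.integral_comp i hψ]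

section Orthogonality

variable (hD : GaussianDecomposition μ X Z ζ v) {ψ : ℝ → ℝ} (hψ : Measurable ψ)
  (h2 : MemLp ψ 2 (gaussianReal 0 1)) {B : ℝ} (hB : ∀ z, |gaussianMean v ψ z| ≤ B)

include hD hψ h2 hB

lemma memLp_sub_gaussianMean (i : ℕ) :
    MemLp (fun ω => ψ (X i ω) - gaussianMean v ψ (Z i ω)) 2 μ :=
  (hD.memLp_comp i h2).sub (MemLp.of_bound ((measurable_gaussianMean v hψ).comp
    (hD.measurable_pred i)).aestronglyMeasurable B (ae_of_all _ fun _ => hB _))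

/-- The earlier factor is determined by the past of time `i`; averaging over the innovation at time
`i` annihilates the later factor. -/
lemma integral_mul_sub_gaussianMean_of_lt {i j : ℕ} (hij : j < i) :
    ∫ ω, (ψ (X j ω) - gaussianMean v ψ (Z j ω)) * (ψ (X i ω) - gaussianMean v ψ (Z i ω)) ∂μ = 0 := by
  have hi : Integrable (fun ω => (ψ (X j ω) - gaussianMean v ψ (Z j ω)) *
      (ψ (X i ω) - gaussianMean v ψ (Z i ω))) μ :=
    (hD.memLp_sub_gaussianMean hψ h2 hB j).integrable_mul (hD.memLp_sub_gaussianMean hψ h2 hB i)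
  have hm := measurable_gaussianMean v hψ
  simp only [hD.eq_add] at hi ⊢
  rw [(hD.indep i).integral_eq (hD.measurable_innov i) (hD.measurable_past i) (hD.map_innov i)
    (H := fun q => (ψ ((q.1.1 ⟨j, hij⟩).1 + (q.1.1 ⟨j, hij⟩).2) -
      gaussianMean v ψ (q.1.1 ⟨j, hij⟩).1) * (ψ (q.1.2 + q.2) - gaussianMean v ψ q.1.2))
      (by fun_prop) hi]
  simp only [integral_const_mul, integral_sub_gaussianMean, mul_zero, integral_zero]

lemma integral_mul_sub_gaussianMean {i j : ℕ} (hij : i ≠ j) :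
    ∫ ω, (ψ (X i ω) - gaussianMean v ψ (Z i ω)) * (ψ (X j ω) - gaussianMean v ψ (Z j ω)) ∂μ = 0 := by
  rcases lt_or_gt_of_ne hij with h | h
  · exact hD.integral_mul_sub_gaussianMean_of_lt hψ h2 hB h
  · simp_rw [mul_comm (ψ (X i _) - _)]
    exact hD.integral_mul_sub_gaussianMean_of_lt hψ h2 hB h

/-- Pythagoras: `gaussianMean v ψ (Z i)` is the projection of `ψ (X i)` on the past. -/
lemma integral_sub_gaussianMean_sq (i : ℕ) :
    ∫ ω, (ψ (X i ω) - gaussianMean v ψ (Z i ω)) ^ 2 ∂μ =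
      ∫ y, ψ y ^ 2 ∂gaussianReal 0 1 - ∫ ω, gaussianMean v ψ (Z i ω) ^ 2 ∂μ := by
  have hm := measurable_gaussianMean v hψ
  have hX := hD.memLp_comp i h2
  have hZ : MemLp (fun ω => gaussianMean v ψ (Z i ω)) 2 μ :=
    MemLp.of_bound (hm.comp (hD.measurable_pred i)).aestronglyMeasurable B
      (ae_of_all _ fun ω => hB _)
  have i1 : Integrable (fun ω => gaussianMean v ψ (Z i ω) * ψ (X i ω)) μ := hZ.integrable_mul hX
  have e1 : ∫ ω, gaussianMean v ψ (Z i ω) * ψ (X i ω) ∂μ = ∫ ω, gaussianMean v ψ (Z i ω) ^ 2 ∂μ := by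
    have := hD.integral_mul_eq i hψ (F := fun q => gaussianMean v ψ q.2) (by fun_prop) i1
    simpa only [pow_two] using this
  have e2 : ∀ ω, (ψ (X i ω) - gaussianMean v ψ (Z i ω)) ^ 2 =
      (ψ (X i ω) ^ 2 + gaussianMean v ψ (Z i ω) ^ 2) -
        2 * (gaussianMean v ψ (Z i ω) * ψ (X i ω)) := fun ω => by ring
  simp_rw [e2]
  rw [integral_sub (f := fun ω => ψ (X i ω) ^ 2 + gaussianMean v ψ (Z i ω) ^ 2)
    (hX.integrable_sq.add hZ.integrable_sq) (i1.const_mul 2),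
    integral_add hX.integrable_sq hZ.integrable_sq, integral_const_mul, e1,
    hD.integral_comp i (ψ := fun y => ψ y ^ 2) (by fun_prop)]
  ring

end Orthogonality

/-- An exponential bound for the martingale `∑ (ψ (X i) - E[ψ (X i) | past])`. -/
lemma lintegral_exp_sum_sub_gaussianMean_le (hD : GaussianDecomposition μ X Z ζ v) {ψ : ℝ → ℝ}
    (hψ : Measurable ψ) {M s t : ℝ} (h0 : ∀ y, 0 ≤ ψ y) (hM : ∀ y, ψ y ≤ M)
    (hs : ∀ z, gaussianMean v (fun y => ψ y ^ 2) z ≤ s) (ht : |t| * M ≤ 1) (n : ℕ) :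
    ∫⁻ ω, ENNReal.ofReal (Real.exp (t * ∑ i ∈ Finset.range n,
      (ψ (X i ω) - gaussianMean v ψ (Z i ω)))) ∂μ ≤ ENNReal.ofReal (Real.exp (t ^ 2 * (n * s))) := by
  have hm := measurable_gaussianMean v hψ
  have hint : ∀ z, Integrable (fun y => ψ (z + y)) (gaussianReal 0 v) := fun z =>
    Integrable.of_bound (hψ.comp (by fun_prop)).aestronglyMeasurable M (ae_of_all _ fun y => by
      rw [Real.norm_eq_abs, abs_of_nonneg (h0 _)]; exact hM _)
  have hint2 : ∀ z, Integrable (fun y => ψ (z + y) ^ 2) (gaussianReal 0 v) := fun z =>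
    Integrable.of_bound ((hψ.comp (by fun_prop)).pow_const 2).aestronglyMeasurable (M ^ 2) (ae_of_all _ fun y => by
      rw [Real.norm_eq_abs, abs_of_nonneg (sq_nonneg _)]
      exact pow_le_pow_left₀ (h0 _) (hM _) 2)
  have hg0 : ∀ z, 0 ≤ gaussianMean v ψ z := fun z => integral_nonneg fun y => h0 _
  have hgM : ∀ z, gaussianMean v ψ z ≤ M := by
    intro z
    refine (integral_mono (hint z) (integrable_const M) fun y => hM (z + y)).trans ?_
    simp
  -- One-step bound: `ht` keeps the exponent in `[-1, 1]`, where `exp y ≤ 1 + y + y ^ 2`. The linear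
  -- term averages to zero, the quadratic one to at most `s`, and `1 + y ≤ exp y` restores an
  -- exponential.
  have step : ∀ z, ∫⁻ y, ENNReal.ofReal (Real.exp (t * (ψ (z + y) - gaussianMean v ψ z)))
      ∂gaussianReal 0 v ≤ ENNReal.ofReal (Real.exp (t ^ 2 * s)) := by
    intro z
    set a := gaussianMean v ψ z with ha
    have hpt : ∀ y, Real.exp (t * (ψ (z + y) - a)) ≤
        (1 + t * (ψ (z + y) - a)) + t ^ 2 * (ψ (z + y) - a) ^ 2 := by
      intro y
      have h1 : |t * (ψ (z + y) - a)| ≤ 1 := by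
        rw [abs_mul]
        refine (mul_le_mul_of_nonneg_left ?_ (abs_nonneg _)).trans ht
        rw [abs_le]
        constructor
        · have := h0 (z + y); have := hgM z; linarith
        · have := hM (z + y); have := hg0 z; linarith
      have := (abs_le.1 (Real.abs_exp_sub_one_sub_id_le h1)).2
      rw [mul_pow] at this
      linarith
    have hd : Integrable (fun y => ψ (z + y) - a) (gaussianReal 0 v) :=
      (hint z).sub (integrable_const _)
    have e1 : ∀ y, (ψ (z + y) - a) ^ 2 = (ψ (z + y) ^ 2 - 2 * a * ψ (z + y)) + a ^ 2 :=
      fun y => by ring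
    have hd2 : Integrable (fun y => (ψ (z + y) - a) ^ 2) (gaussianReal 0 v) := by
      simp_rw [e1]
      exact ((hint2 z).sub ((hint z).const_mul _)).add (integrable_const _)
    have hvar : ∫ y, (ψ (z + y) - a) ^ 2 ∂gaussianReal 0 v ≤ s := by
      simp_rw [e1]
      rw [integral_add (f := fun y => ψ (z + y) ^ 2 - 2 * a * ψ (z + y))
        ((hint2 z).sub ((hint z).const_mul _)) (integrable_const _),
        integral_sub (hint2 z) ((hint z).const_mul _), integral_const_mul]
      have h2 : ∫ y, ψ (z + y) ∂gaussianReal 0 v = a := rfl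
      have h3 := hs z
      simp only [gaussianMean] at h3
      rw [h2]
      simp only [integral_const, probReal_univ, smul_eq_mul, one_mul]
      nlinarith [sq_nonneg a]
    have i1 : Integrable (fun y => 1 + t * (ψ (z + y) - a)) (gaussianReal 0 v) :=
      (integrable_const _).add (hd.const_mul t)
    have i2 := hd2.const_mul (t ^ 2)
    calc ∫⁻ y, ENNReal.ofReal (Real.exp (t * (ψ (z + y) - a))) ∂gaussianReal 0 v
        ≤ ∫⁻ y, ENNReal.ofReal ((1 + t * (ψ (z + y) - a)) + t ^ 2 * (ψ (z + y) - a) ^ 2)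
          ∂gaussianReal 0 v := lintegral_mono fun y => ENNReal.ofReal_le_ofReal (hpt y)
      _ = ENNReal.ofReal (∫ y, (1 + t * (ψ (z + y) - a)) + t ^ 2 * (ψ (z + y) - a) ^ 2
          ∂gaussianReal 0 v) := by
          rw [ofReal_integral_eq_lintegral_ofReal (f := fun y =>
            (1 + t * (ψ (z + y) - a)) + t ^ 2 * (ψ (z + y) - a) ^ 2) (i1.add i2)
            (ae_of_all _ fun y => (Real.exp_pos _).le.trans (hpt y))]
      _ ≤ ENNReal.ofReal (Real.exp (t ^ 2 * s)) := by
          refine ENNReal.ofReal_le_ofReal ?_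
          rw [integral_add i1 i2, integral_add (integrable_const _) (hd.const_mul t),
            integral_const_mul, integral_const_mul, ha, integral_sub_gaussianMean, ← ha]
          simp only [integral_const, probReal_univ, smul_eq_mul, one_mul, mul_zero, add_zero]
          have := Real.add_one_le_exp (t ^ 2 * s)
          nlinarith [mul_le_mul_of_nonneg_left hvar (sq_nonneg t)]
  induction n with
  | zero => simp
  | succ n ih =>
    have e : ∀ ω, ENNReal.ofReal (Real.exp (t * ∑ i ∈ Finset.range (n + 1),
        (ψ (X i ω) - gaussianMean v ψ (Z i ω)))) =
        ENNReal.ofReal (Real.exp (t * ∑ i : Fin n,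
          (ψ (Z i ω + ζ i ω) - gaussianMean v ψ (Z i ω)))) *
        ENNReal.ofReal (Real.exp (t * (ψ (Z n ω + ζ n ω) - gaussianMean v ψ (Z n ω)))) := by
      intro ω
      rw [← ENNReal.ofReal_mul (Real.exp_pos _).le, ← Real.exp_add, ← mul_add,
        Finset.sum_range_succ, Finset.sum_range]
      simp only [hD.eq_add]
    simp_rw [e]
    -- The last innovation is integrated out first, with everything before it held fixed.
    rw [(hD.indep n).lintegral_eq (hD.measurable_innov n) (hD.measurable_past n) (hD.map_innov n)
      (H := fun q => ENNReal.ofReal (Real.exp (t * ∑ i : Fin n,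
        (ψ ((q.1.1 i).1 + (q.1.1 i).2) - gaussianMean v ψ (q.1.1 i).1))) *
        ENNReal.ofReal (Real.exp (t * (ψ (q.1.2 + q.2) - gaussianMean v ψ q.1.2))))
      (by fun_prop)]
    calc _ ≤ ∫⁻ ω, ENNReal.ofReal (Real.exp (t * ∑ i : Fin n,
          (ψ (Z i ω + ζ i ω) - gaussianMean v ψ (Z i ω)))) *
          ENNReal.ofReal (Real.exp (t ^ 2 * s)) ∂μ := by
          refine lintegral_mono fun ω => ?_
          simp only
          rw [lintegral_const_mul _ (by fun_prop)]
          gcongr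
          exact step _
      _ ≤ ENNReal.ofReal (Real.exp (t ^ 2 * (n * s))) * ENNReal.ofReal (Real.exp (t ^ 2 * s)) := by
          rw [lintegral_mul_const' _ _ ENNReal.ofReal_ne_top]
          gcongr
          simpa only [hD.eq_add, Finset.sum_range] using ih
      _ = _ := by
          rw [← ENNReal.ofReal_mul (Real.exp_pos _).le, ← Real.exp_add]
          congr 2
          push_cast; ring

omit [IsProbabilityMeasure μ] in
lemma integral_id_map_pred (hD : GaussianDecomposition μ X Z ζ v) (n : ℕ) :
    (μ.map fun ω => (Finset.range n).restrict (Z · ω))[id] = 0 := by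
  have hmeas : Measurable fun ω => (Finset.range n).restrict (Z · ω) :=
    measurable_pi_lambda _ fun i => hD.measurable_pred i
  have := (hD.gaussian.hasGaussianLaw (Finset.range n)).isGaussian_map
  have h1 : Integrable (id : (Finset.range n → ℝ) → (Finset.range n → ℝ))
    (μ.map fun ω => (Finset.range n).restrict (Z · ω)) := IsGaussian.integrable_id
  ext i
  have h2 := (ContinuousLinearMap.proj (R := ℝ)
    (φ := fun _ : Finset.range n => ℝ) i).integral_comp_comm h1
  simp only [ContinuousLinearMap.proj_apply] at h2
  exact h2.symm.trans ((integral_map (f := fun y : Finset.range n → ℝ => y i) hmeas.aemeasurable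
    (measurable_pi_apply i).aestronglyMeasurable).trans (hD.pred_integral i))

/-! ### The smooth part: functions of the predictions. -/

section Smooth

variable (hD : GaussianDecomposition μ X Z ζ v) {G G' : ℝ → ℝ}
  (hG : ∀ x, HasDerivAt G (G' x) x) (hG' : Continuous G') {M L : ℝ} (hM : ∀ x, |G x| ≤ M)
  (hL : ∀ x, |G' x| ≤ L)

include hD hG hG' hM hL

omit [IsProbabilityMeasure μ] in
lemma sum_covariance_le (n : ℕ) (e : ℕ → ℝ) :
    ∑ i ∈ Finset.range n, ∑ j ∈ Finset.range n, e i * e j *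
      (∫ ω, G (Z i ω) * G (Z j ω) ∂μ - (∫ ω, G (Z i ω) ∂μ) * ∫ ω, G (Z j ω) ∂μ) ≤
    Real.pi ^ 2 / 8 * ∑ i ∈ Finset.range n, ∑ j ∈ Finset.range n, e i * e j *
      ((∫ ω, G' (Z i ω) * G' (Z j ω) ∂μ) * ∫ ω, Z i ω * Z j ω ∂μ) := by
  have hGc : Continuous G := continuous_iff_continuousAt.2 fun x => (hG x).continuousAt
  have hlaw := hD.gaussian.hasGaussianLaw (Finset.range n)
  have hmeas : Measurable fun ω => (Finset.range n).restrict (Z · ω) :=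
    measurable_pi_lambda _ fun i => hD.measurable_pred i
  have := hlaw.isGaussian_map
  have hmean := hD.integral_id_map_pred n
  have key := IsGaussian.sum_covariance_le _ hmean hG hG' hM hL (fun i => e i)
  have t1 : ∀ i : Finset.range n, ∫ z, G (z i)
      ∂(μ.map fun ω => (Finset.range n).restrict (Z · ω)) = ∫ ω, G (Z i ω) ∂μ := fun i =>
    integral_map hmeas.aemeasurable (hGc.comp (continuous_apply i)).aestronglyMeasurable
  have t2 : ∀ i j : Finset.range n, ∫ z, G (z i) * G (z j)
      ∂(μ.map fun ω => (Finset.range n).restrict (Z · ω)) = ∫ ω, G (Z i ω) * G (Z j ω) ∂μ :=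
    fun i j => integral_map hmeas.aemeasurable (((hGc.comp (continuous_apply i)).mul
      (hGc.comp (continuous_apply j))).aestronglyMeasurable)
  have t3 : ∀ i j : Finset.range n, ∫ z, G' (z i) * G' (z j)
      ∂(μ.map fun ω => (Finset.range n).restrict (Z · ω)) = ∫ ω, G' (Z i ω) * G' (Z j ω) ∂μ :=
    fun i j => integral_map hmeas.aemeasurable (((hG'.comp (continuous_apply i)).mul
      (hG'.comp (continuous_apply j))).aestronglyMeasurable)
  have t4 : ∀ i j : Finset.range n, ∫ z, z i * z j
      ∂(μ.map fun ω => (Finset.range n).restrict (Z · ω)) = ∫ ω, Z i ω * Z j ω ∂μ :=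
    fun i j => integral_map hmeas.aemeasurable (by fun_prop)
  simp_rw [t1, t2, t3, t4] at key
  simp only [← Finset.sum_coe_sort (Finset.range n)]
  exact key

omit [IsProbabilityMeasure μ] in
/-- Gaussian concentration for sums of a smooth function of the predictions. -/
lemma lintegral_exp_sum_pred_le (n : ℕ) (t : ℝ) :
    ∫⁻ ω, ENNReal.ofReal (Real.exp (t * ∑ i ∈ Finset.range n,
      (G (Z i ω) - ∫ ω, G (Z i ω) ∂μ))) ∂μ ≤
    ENNReal.ofReal (Real.exp (t ^ 2 * (Real.pi ^ 2 / 8 * L ^ 2 *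
      ∑ i ∈ Finset.range n, ∑ j ∈ Finset.range n, |∫ ω, Z i ω * Z j ω ∂μ|))) := by
  have hGc : Continuous G := continuous_iff_continuousAt.2 fun x => (hG x).continuousAt
  have hlaw := hD.gaussian.hasGaussianLaw (Finset.range n)
  have hmeas : Measurable fun ω => (Finset.range n).restrict (Z · ω) :=
    measurable_pi_lambda _ fun i => hD.measurable_pred i
  have := hlaw.isGaussian_map
  have hmean := hD.integral_id_map_pred n
  have key := IsGaussian.lintegral_exp_sum_le _ hmean hG hG' hM hL t
  have t1 : ∀ i : Finset.range n, ∫ z, G (z i)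
      ∂(μ.map fun ω => (Finset.range n).restrict (Z · ω)) = ∫ ω, G (Z i ω) ∂μ := fun i =>
    integral_map hmeas.aemeasurable (hGc.comp (continuous_apply i)).aestronglyMeasurable
  have t4 : ∀ i j : Finset.range n, ∫ z, z i * z j
      ∂(μ.map fun ω => (Finset.range n).restrict (Z · ω)) = ∫ ω, Z i ω * Z j ω ∂μ :=
    fun i j => integral_map hmeas.aemeasurable (by fun_prop)
  simp_rw [t1, t4] at key
  rw [lintegral_map (by fun_prop) hmeas] at key
  simp only [← Finset.sum_coe_sort (Finset.range n)]
  exact key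

/-- The covariance comparison, averaged over random weights. -/
lemma sum_gram_mul_covariance_le {Ω' : Type*} [MeasurableSpace Ω'] {μ' : Measure Ω'}
    {e : ℕ → Ω' → ℝ} (he : ∀ i, MemLp (e i) 2 μ') (n : ℕ) :
    ∑ i ∈ Finset.range n, ∑ j ∈ Finset.range n, (∫ ω, e i ω * e j ω ∂μ') *
      (∫ ω, G (Z i ω) * G (Z j ω) ∂μ - (∫ ω, G (Z i ω) ∂μ) * ∫ ω, G (Z j ω) ∂μ) ≤
    Real.pi ^ 2 / 8 * L ^ 2 * ∑ i ∈ Finset.range n, ∑ j ∈ Finset.range n,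
      |∫ ω, e i ω * e j ω ∂μ'| * |∫ ω, Z i ω * Z j ω ∂μ| := by
  have hL0 : 0 ≤ L := (abs_nonneg _).trans (hL 0)
  have hee : ∀ i j, Integrable (fun ω => e i ω * e j ω) μ' := fun i j =>
    (he i).integrable_mul (he j)
  have avg : ∀ A : ℕ → ℕ → ℝ, ∫ ω, ∑ i ∈ Finset.range n, ∑ j ∈ Finset.range n,
      e i ω * e j ω * A i j ∂μ' = ∑ i ∈ Finset.range n, ∑ j ∈ Finset.range n,
      (∫ ω, e i ω * e j ω ∂μ') * A i j := by
    intro A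
    rw [integral_finsetSum _ fun i _ => integrable_finsetSum _ fun j _ => (hee i j).mul_const _]
    refine Finset.sum_congr rfl fun i _ => ?_
    rw [integral_finsetSum _ fun j _ => (hee i j).mul_const _]
    exact Finset.sum_congr rfl fun j _ => integral_mul_const _ _
  have int : ∀ A : ℕ → ℕ → ℝ, Integrable (fun ω => ∑ i ∈ Finset.range n, ∑ j ∈ Finset.range n,
      e i ω * e j ω * A i j) μ' := fun A =>
    integrable_finsetSum _ fun i _ => integrable_finsetSum _ fun j _ => (hee i j).mul_const _
  -- The comparison holds for each realization of the weights and integrates to one with their Gram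
  -- matrix. Absolute values are taken only afterwards, entry by entry, so decay of both covariances
  -- is retained.
  rw [← avg]
  refine (integral_mono (int _) ((int _).const_mul (Real.pi ^ 2 / 8))
    fun ω => hD.sum_covariance_le hG hG' hM hL n (fun i => e i ω)).trans ?_
  rw [integral_const_mul, avg, mul_assoc]
  refine mul_le_mul_of_nonneg_left ?_ (by positivity)
  rw [Finset.mul_sum]
  refine Finset.sum_le_sum fun i _ => ?_
  rw [Finset.mul_sum]
  refine Finset.sum_le_sum fun j _ => ?_
  refine (le_abs_self _).trans ?_
  rw [abs_mul, abs_mul]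
  have h1 : |∫ ω, G' (Z i ω) * G' (Z j ω) ∂μ| ≤ L ^ 2 := by
    have := norm_integral_le_of_norm_le_const (μ := μ) (f := fun ω => G' (Z i ω) * G' (Z j ω))
      (C := L ^ 2) (ae_of_all _ fun ω => by
        rw [Real.norm_eq_abs, abs_mul, pow_two]
        exact mul_le_mul (hL _) (hL _) (abs_nonneg _) hL0)
    simpa using this
  calc |∫ ω, e i ω * e j ω ∂μ'| * (|∫ ω, G' (Z i ω) * G' (Z j ω) ∂μ| * |∫ ω, Z i ω * Z j ω ∂μ|)
      ≤ |∫ ω, e i ω * e j ω ∂μ'| * (L ^ 2 * |∫ ω, Z i ω * Z j ω ∂μ|) := by gcongr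
    _ = _ := by ring

end Smooth

end GaussianDecomposition

/-! ### Derivatives of the normal density. -/

section GaussianDensity

/-- The centered normal density has bounded derivatives. -/
lemma exists_gaussianPDFReal_deriv {v : ℝ≥0} (hv : v ≠ 0) :
    ∃ (g1 g2 : ℝ → ℝ) (c : ℝ), 0 ≤ c ∧ (∀ x, HasDerivAt (gaussianPDFReal 0 v) (g1 x) x) ∧
      (∀ x, HasDerivAt g1 (g2 x) x) ∧
      ∀ x, |gaussianPDFReal 0 v x| ≤ c ∧ |g1 x| ≤ c ∧ |g2 x| ≤ c := by
  have hv' : (0 : ℝ) < v := by positivity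
  set A : ℝ := (Real.sqrt (2 * Real.pi * v))⁻¹ with hA
  have hA0 : 0 < A := by positivity
  have hd : ∀ x : ℝ, HasDerivAt (gaussianPDFReal 0 v) (-(x / v) * gaussianPDFReal 0 v x) x := by
    intro x
    have h1 : HasDerivAt (fun x : ℝ => -(x - 0) ^ 2 / (2 * (v : ℝ))) (-(x / v)) x := by
      have := ((((hasDerivAt_id x).sub_const 0).pow 2).neg).div_const (2 * (v : ℝ))
      refine this.congr_deriv ?_
      simp
      field_simp
    have := (h1.exp).const_mul A
    rw [gaussianPDFReal_def]
    refine this.congr_deriv ?_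
    ring
  have hd2 : ∀ x : ℝ, HasDerivAt (fun x => -(x / v) * gaussianPDFReal 0 v x)
      (-(1 / v) * gaussianPDFReal 0 v x + -(x / v) * (-(x / v) * gaussianPDFReal 0 v x)) x := by
    intro x
    exact (((hasDerivAt_id x).div_const (v : ℝ)).neg).mul (hd x)
  -- From `1 + s ≤ exp s` with `s` the absolute Gaussian exponent. This one inequality handles the
  -- quadratic factors in both derivatives.
  have hb : ∀ x : ℝ, (1 + x ^ 2 / (2 * v)) * gaussianPDFReal 0 v x ≤ A := by
    intro x
    have h1 := Real.add_one_le_exp (x ^ 2 / (2 * (v : ℝ)))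
    simp only [gaussianPDFReal, sub_zero, ← hA]
    rw [neg_div, Real.exp_neg]
    have h2 : 0 < Real.exp (x ^ 2 / (2 * (v : ℝ))) := Real.exp_pos _
    calc (1 + x ^ 2 / (2 * (v : ℝ))) * (A * (Real.exp (x ^ 2 / (2 * (v : ℝ))))⁻¹)
        ≤ Real.exp (x ^ 2 / (2 * (v : ℝ))) * (A * (Real.exp (x ^ 2 / (2 * (v : ℝ))))⁻¹) :=
          mul_le_mul_of_nonneg_right (by linarith) (by positivity)
      _ = A := by field_simp
  have hg0 : ∀ x, 0 ≤ gaussianPDFReal 0 v x := gaussianPDFReal_nonneg 0 v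
  have hb0 : ∀ x, gaussianPDFReal 0 v x ≤ A := fun x => by
    have : 0 ≤ x ^ 2 / (2 * (v : ℝ)) * gaussianPDFReal 0 v x := mul_nonneg (by positivity) (hg0 x)
    have := hb x
    linarith
  have hb2 : ∀ x, x ^ 2 / v ^ 2 * gaussianPDFReal 0 v x ≤ 2 / v * A := fun x => by
    have h1 : x ^ 2 / (2 * (v : ℝ)) * gaussianPDFReal 0 v x ≤ A := by
      have := hb x; have := hg0 x; linarith
    have := mul_le_mul_of_nonneg_left h1 (by positivity : (0 : ℝ) ≤ 2 / v)
    refine le_trans (le_of_eq ?_) this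
    field_simp
  refine ⟨_, _, A + A / v + 2 / v * A + A, by positivity, hd, hd2, fun x => ⟨?_, ?_, ?_⟩⟩
  · rw [abs_of_nonneg (hg0 x)]
    have : 0 ≤ A / v + 2 / v * A + A := by positivity
    linarith [hb0 x]
  · rw [abs_mul, abs_neg, abs_of_nonneg (hg0 x)]
    have h1 : |x / v| ≤ 1 + x ^ 2 / v ^ 2 := by
      rw [← div_pow, abs_le]
      constructor <;> nlinarith [sq_nonneg (x / v - 1), sq_nonneg (x / v + 1)]
    have h2 := mul_le_mul_of_nonneg_right h1 (hg0 x)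
    have : 0 ≤ A / v + A := by positivity
    linarith [hb0 x, hb2 x]
  · have h1 : 0 ≤ x ^ 2 / v ^ 2 * gaussianPDFReal 0 v x := mul_nonneg (by positivity) (hg0 x)
    have h2 : 0 ≤ gaussianPDFReal 0 v x / v := div_nonneg (hg0 x) hv'.le
    have h3 : gaussianPDFReal 0 v x / v ≤ A / v := div_le_div_of_nonneg_right (hb0 x) hv'.le
    have e : -(1 / (v : ℝ)) * gaussianPDFReal 0 v x + -(x / v) * (-(x / v) * gaussianPDFReal 0 v x) =
        x ^ 2 / v ^ 2 * gaussianPDFReal 0 v x - gaussianPDFReal 0 v x / v := by ring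
    have : 0 ≤ A / v := by positivity
    have : 0 ≤ 2 / v * A := by positivity
    rw [e, abs_le]
    constructor <;> linarith [hb2 x]

end GaussianDensity

/-! ### Second order Taylor estimates without continuity of the second derivative. -/

section Taylor

variable {m : ℝ → ℝ} {B : ℝ} (hm : Differentiable ℝ m) (hm' : Differentiable ℝ (deriv m))
  (h1 : ∀ x, |deriv m x| ≤ B) (h2 : ∀ x, |deriv (deriv m) x| ≤ B)

include hm h1 in
lemma abs_sub_le_of_deriv (x y : ℝ) : |m y - m x| ≤ B * |y - x| := by
  have := Convex.norm_image_sub_le_of_norm_deriv_le (𝕜 := ℝ) (f := m) (s := Set.univ) (C := B)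
    (fun z _ => hm z) (fun z _ => h1 z) convex_univ (Set.mem_univ x) (Set.mem_univ y)
  simpa using this

-- The function `s ↦ m (x - s) + s * deriv m x` has derivative at most `B |s|`, so the mean value
-- inequality applies.
include hm hm' h2 in
lemma abs_taylor_le (x t : ℝ) : |m (x - t) - m x + t * deriv m x| ≤ B * t ^ 2 := by
  have hB : 0 ≤ B := (abs_nonneg _).trans (h2 0)
  let q : ℝ → ℝ := fun s => m (x - s) + s * deriv m x
  have hq : ∀ s, HasDerivAt q (-deriv m (x - s) + deriv m x) s := by
    intro s
    have h3 : HasDerivAt (fun s => m (x - s)) (-deriv m (x - s)) s := by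
      have := (hm (x - s)).hasDerivAt.comp s ((hasDerivAt_id s).const_sub x)
      refine this.congr_deriv (by ring)
    have h4 : HasDerivAt (fun s : ℝ => s * deriv m x) (deriv m x) s := by
      simpa using (hasDerivAt_id s).mul_const (deriv m x)
    exact h3.add h4
  have := Convex.norm_image_sub_le_of_norm_hasDerivWithin_le (𝕜 := ℝ) (f := q) (s := Set.uIcc 0 t)
    (C := B * |t|) (fun s _ => (hq s).hasDerivWithinAt) (fun s hs => ?_) (convex_uIcc 0 t)
    (Set.left_mem_uIcc) (Set.right_mem_uIcc)
  · simp only [q, sub_zero, zero_mul, add_zero, Real.norm_eq_abs] at this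
    rw [mul_assoc, abs_mul_abs_self, ← pow_two] at this
    convert! this using 2
    ring
  · rw [Real.norm_eq_abs, neg_add_eq_sub]
    refine (abs_sub_le_of_deriv hm' h2 (x - s) x).trans (mul_le_mul_of_nonneg_left ?_ hB)
    rw [sub_sub_cancel]
    have := Set.abs_sub_left_of_mem_uIcc hs
    simpa using this

-- Only differentiability of `deriv m` at `x` is needed: it makes the derivative of the second order
-- remainder at most `e / 2 * |s|` near zero, and the mean value inequality integrates this bound.
include hm hm' in
lemma tendsto_taylor (x : ℝ) :
    Tendsto (fun t => (m (x - t) - m x + t * deriv m x) / t ^ 2) (𝓝[≠] 0)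
      (𝓝 (deriv (deriv m) x / 2)) := by
  have h3 : HasDerivAt (deriv m) (deriv (deriv m) x) x := (hm' x).hasDerivAt
  rw [Metric.tendsto_nhdsWithin_nhds]
  intro e he
  have h4 := h3.isLittleO.def (c := e / 2) (by positivity)
  obtain ⟨δ, hδ, h5⟩ := Metric.eventually_nhds_iff.1 h4
  refine ⟨δ, hδ, fun {t} ht htδ => ?_⟩
  rw [Set.mem_compl_iff, Set.mem_singleton_iff] at ht
  rw [dist_zero_right, Real.norm_eq_abs] at htδ
  let q : ℝ → ℝ := fun s => m (x - s) + s * deriv m x - s ^ 2 * (deriv (deriv m) x / 2)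
  have hq : ∀ s, HasDerivAt q (-deriv m (x - s) + deriv m x - s * deriv (deriv m) x) s := by
    intro s
    have h3 : HasDerivAt (fun s => m (x - s)) (-deriv m (x - s)) s := by
      have := (hm (x - s)).hasDerivAt.comp s ((hasDerivAt_id s).const_sub x)
      refine this.congr_deriv (by ring)
    have h4 : HasDerivAt (fun s : ℝ => s * deriv m x) (deriv m x) s := by
      simpa using (hasDerivAt_id s).mul_const (deriv m x)
    have h6 : HasDerivAt (fun s : ℝ => s ^ 2 * (deriv (deriv m) x / 2)) (s * deriv (deriv m) x) s := by
      refine ((hasDerivAt_pow 2 s).mul_const _).congr_deriv ?_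
      simp
      ring
    exact (h3.add h4).sub h6
  have := Convex.norm_image_sub_le_of_norm_hasDerivWithin_le (𝕜 := ℝ) (f := q) (s := Set.uIcc 0 t)
    (C := e / 2 * |t|) (fun s _ => (hq s).hasDerivWithinAt) (fun s hs => ?_) (convex_uIcc 0 t)
    (Set.left_mem_uIcc) (Set.right_mem_uIcc)
  · simp only [q, sub_zero, Real.norm_eq_abs] at this
    rw [mul_assoc, abs_mul_abs_self, ← pow_two] at this
    have ht2 : 0 < t ^ 2 := by positivity
    rw [Real.dist_eq, div_sub' ht2.ne', abs_div, abs_of_pos ht2, div_lt_iff₀ ht2]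
    calc |m (x - t) - m x + t * deriv m x - t ^ 2 * (deriv (deriv m) x / 2)|
        = |m (x - t) + t * deriv m x - t ^ 2 * (deriv (deriv m) x / 2) -
          (m x + 0 * deriv m x - 0 ^ 2 * (deriv (deriv m) x / 2))| := by congr 1; ring
      _ ≤ e / 2 * t ^ 2 := this
      _ < e * t ^ 2 := by nlinarith
  · have h6 : |s| ≤ |t| := by simpa using Set.abs_sub_left_of_mem_uIcc hs
    have h7 := h5 (y := x - s) (by
      rw [Real.dist_eq]
      simpa using h6.trans_lt htδ)
    simp only [Real.norm_eq_abs, sub_sub_cancel_left, smul_eq_mul, abs_neg] at h7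
    rw [Real.norm_eq_abs]
    calc |-deriv m (x - s) + deriv m x - s * deriv (deriv m) x|
        = |deriv m (x - s) - deriv m x - -s * deriv (deriv m) x| := by
          rw [← abs_neg]; congr 1; ring
      _ ≤ e / 2 * |s| := h7
      _ ≤ e / 2 * |t| := by gcongr

end Taylor

/-! ### Kernel averages: substitution, smoothing and bias. -/

section Kernel

variable {K : ℝ → ℝ}

lemma integral_kernel_mul (K P : ℝ → ℝ) {h : ℝ} (hh : 0 < h) (x : ℝ) :
    ∫ y, K ((x - y) / h) * P y = h * ∫ u, K u * P (x - h * u) := by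
  rw [← integral_sub_left_eq_self _ volume x]
  have := Measure.integral_comp_mul_left (fun y => K ((x - (x - y)) / h) * P (x - y)) h
  rw [abs_of_pos (inv_pos.2 hh), smul_eq_mul] at this
  rw [eq_comm, inv_mul_eq_iff_eq_mul₀ hh.ne'] at this
  rw [this]
  congr 2
  ext u
  rw [sub_sub_cancel, mul_div_cancel_left₀ _ hh.ne']

lemma gaussianMean_eq {v : ℝ≥0} (hv : v ≠ 0) (ψ : ℝ → ℝ) (z : ℝ) :
    gaussianMean v ψ z = ∫ y, ψ y * gaussianPDFReal 0 v (y - z) := by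
  rw [gaussianMean, integral_gaussianReal_eq_integral_smul hv,
    ← integral_add_left_eq_self (fun y => ψ y * gaussianPDFReal 0 v (y - z)) z]
  simp [mul_comm]

lemma gaussianMean_kernel_mul {v : ℝ≥0} (hv : v ≠ 0) (K w : ℝ → ℝ) {h : ℝ} (hh : 0 < h) (x z : ℝ) :
    gaussianMean v (fun y => K ((x - y) / h) * w y) z =
      h * ∫ u, K u * w (x - h * u) * gaussianPDFReal 0 v (x - h * u - z) := by
  rw [gaussianMean_eq hv]
  simp_rw [mul_assoc]
  exact integral_kernel_mul K (fun y => w y * gaussianPDFReal 0 v (y - z)) hh x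

lemma integral_gaussianReal_kernel_mul (K w : ℝ → ℝ) {h : ℝ} (hh : 0 < h) (x : ℝ) :
    ∫ y, K ((x - y) / h) * w y ∂gaussianReal 0 1 =
      h * ∫ u, K u * w (x - h * u) * gaussianPDFReal 0 1 (x - h * u) := by
  have := gaussianMean_kernel_mul one_ne_zero K w hh x 0
  simpa [gaussianMean] using this

/-- Kernel averages of smooth functions are smooth. -/
lemma hasDerivAt_integral_mul_comp {W g g1 : ℝ → ℝ} {c : ℝ} (hW : Integrable W)
    (hg : ∀ x, HasDerivAt g (g1 x) x) (hgb : ∀ x, |g x| ≤ c) (hg1 : ∀ x, |g1 x| ≤ c)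
    (hg1m : Measurable g1) (h x z : ℝ) :
    HasDerivAt (fun z => ∫ u, W u * g (x - h * u - z)) (-∫ u, W u * g1 (x - h * u - z)) z := by
  have hgc : Continuous g := continuous_iff_continuousAt.2 fun x => (hg x).continuousAt
  have := hasDerivAt_integral_of_dominated_loc_of_deriv_le (μ := volume)
    (F := fun z u => W u * g (x - h * u - z)) (F' := fun z u => W u * (-g1 (x - h * u - z)))
    (x₀ := z) (s := Set.univ) (bound := fun u => |W u| * c) Filter.univ_mem
    (Eventually.of_forall fun z => hW.aestronglyMeasurable.mul
      (Continuous.aestronglyMeasurable (by fun_prop)))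
    (hW.mul_bdd (Continuous.aestronglyMeasurable (by fun_prop)) (ae_of_all _ fun u => hgb _))
    (hW.aestronglyMeasurable.mul (Measurable.aestronglyMeasurable (by fun_prop)))
    (ae_of_all _ fun u z _ => by
      rw [norm_mul, norm_neg]
      exact mul_le_mul_of_nonneg_left (hg1 _) (abs_nonneg _))
    (hW.abs.mul_const c)
    (ae_of_all _ fun u z _ => by
      refine HasDerivAt.const_mul _ ?_
      have := (hg (x - h * u - z)).comp z ((hasDerivAt_id z).const_sub (x - h * u))
      exact this.congr_deriv (by ring))
  refine this.2.congr_deriv ?_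
  simp_rw [mul_neg]
  rw [integral_neg]

lemma abs_integral_mul_le {W g : ℝ → ℝ} {c : ℝ} (hW : Integrable W) (hg : ∀ x, |g x| ≤ c) :
    |∫ u, W u * g u| ≤ c * ∫ u, |W u| := by
  rw [← integral_const_mul, ← Real.norm_eq_abs]
  refine norm_integral_le_of_norm_le (hW.abs.const_mul c) (ae_of_all _ fun u => ?_)
  rw [norm_mul, mul_comm]
  exact mul_le_mul_of_nonneg_right (hg u) (norm_nonneg _)

lemma tendsto_integral_mul_comp {W P : ℝ → ℝ} {c x : ℝ} (hW : Integrable W) (hP : Continuous P)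
    (hb : ∀ x, |P x| ≤ c) {h : ℕ → ℝ} (hh : Tendsto h atTop (𝓝 0)) :
    Tendsto (fun n => ∫ u, W u * P (x - h n * u)) atTop (𝓝 ((∫ u, W u) * P x)) := by
  rw [← integral_mul_const]
  refine tendsto_integral_of_dominated_convergence (fun u => |W u| * c)
    (fun n => hW.aestronglyMeasurable.mul (Continuous.aestronglyMeasurable (by fun_prop)))
    (hW.abs.mul_const c) (fun n => ae_of_all _ fun u => ?_) (ae_of_all _ fun u => ?_)
  · rw [norm_mul]
    exact mul_le_mul_of_nonneg_left (hb _) (abs_nonneg _)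
  · have h1 : Tendsto (fun n => x - h n * u) atTop (𝓝 x) := by
      simpa using (hh.mul_const u).const_sub x
    exact ((hP.tendsto x).comp h1).const_mul _

namespace IsKernel

variable (hK : IsKernel K)

include hK

lemma kappa2_nonneg : 0 ≤ kappa2 K :=
  integral_nonneg fun u => mul_nonneg (sq_nonneg u) (hK.nonneg u)

lemma exists_pos_bound : ∃ M : ℝ, 0 < M ∧ ∀ u, K u ≤ M := by
  obtain ⟨M, hM⟩ := hK.bounded
  exact ⟨max M 1, by positivity, fun u => (hM u).trans (le_max_left _ _)⟩

lemma integrable_sq : Integrable fun u => K u ^ 2 := by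
  obtain ⟨M, hM0, hM⟩ := hK.exists_pos_bound
  refine (hK.integrable.mul_bdd (c := M) hK.measurable.aestronglyMeasurable
    (ae_of_all _ fun u => ?_)).congr (ae_of_all _ fun u => (pow_two _).symm)
  rw [Real.norm_eq_abs, abs_of_nonneg (hK.nonneg u)]
  exact hM u

lemma kappa1_pos : 0 < kappa1 K := by
  unfold kappa1
  rw [integral_pos_iff_support_of_nonneg (fun u => sq_nonneg _) hK.integrable_sq]
  have h1 : 0 < ∫ u, K u := by rw [hK.integral_eq_one]; exact one_pos
  rw [integral_pos_iff_support_of_nonneg hK.nonneg hK.integrable] at h1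
  convert! h1 using 2
  ext u
  simp

lemma kappa2_pos : 0 < kappa2 K := by
  unfold kappa2
  rw [integral_pos_iff_support_of_nonneg (fun u => mul_nonneg (sq_nonneg u) (hK.nonneg u))
    hK.integrable_second]
  have h1 : 0 < ∫ u, K u := by rw [hK.integral_eq_one]; exact one_pos
  rw [integral_pos_iff_support_of_nonneg hK.nonneg hK.integrable] at h1
  have h2 : Function.support (fun u => u ^ 2 * K u) = Function.support K \ {0} := by
    ext u
    simp [and_comm]
  rw [h2, measure_sdiff_null (by simp)]
  exact h1

/-- The bias of a kernel average is of second order. -/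
lemma abs_integral_bias_le {m P : ℝ → ℝ} {B c : ℝ} (hm : Differentiable ℝ m)
    (hm' : Differentiable ℝ (deriv m)) (h1 : ∀ x, |deriv m x| ≤ B)
    (h2 : ∀ x, |deriv (deriv m) x| ≤ B) (hP : Differentiable ℝ P) (hPc : ∀ x, |P x| ≤ c)
    (hP' : ∀ x, |deriv P x| ≤ c) (x h : ℝ) :
    |∫ u, K u * (m (x - h * u) - m x) * P (x - h * u)| ≤ 2 * B * c * kappa2 K * h ^ 2 := by
  have hB : 0 ≤ B := (abs_nonneg _).trans (h1 0)
  have hc : 0 ≤ c := (abs_nonneg _).trans (hPc 0)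
  -- The added multiple of `u * K u` integrates to zero by the first moment condition; adding it
  -- makes the integrand quadratic in `h * u`.
  have hbd : ∀ u, |K u * (m (x - h * u) - m x) * P (x - h * u) + h * deriv m x * P x * (u * K u)| ≤
      2 * B * c * h ^ 2 * (u ^ 2 * K u) := by
    intro u
    have e : K u * (m (x - h * u) - m x) * P (x - h * u) + h * deriv m x * P x * (u * K u) =
        K u * ((m (x - h * u) - m x + h * u * deriv m x) * P (x - h * u) -
          h * u * deriv m x * (P (x - h * u) - P x)) := by ring
    rw [e, abs_mul, abs_of_nonneg (hK.nonneg u)]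
    have a1 := abs_taylor_le hm hm' h2 x (h * u)
    have a2 := abs_sub_le_of_deriv hP hP' x (x - h * u)
    rw [sub_sub_cancel_left, abs_neg] at a2
    have a3 : |(m (x - h * u) - m x + h * u * deriv m x) * P (x - h * u)| ≤ B * (h * u) ^ 2 * c := by
      rw [abs_mul]
      exact mul_le_mul a1 (hPc _) (abs_nonneg _) (by positivity)
    have a4 : |h * u * deriv m x * (P (x - h * u) - P x)| ≤ |h * u| * B * (c * |h * u|) := by
      rw [abs_mul, abs_mul (h * u)]
      exact mul_le_mul (mul_le_mul_of_nonneg_left (h1 x) (abs_nonneg _)) a2 (abs_nonneg _)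
        (by positivity)
    have a5 : |h * u| * B * (c * |h * u|) = B * c * (h * u) ^ 2 := by
      rw [← sq_abs (h * u)]; ring
    calc K u * |(m (x - h * u) - m x + h * u * deriv m x) * P (x - h * u) -
          h * u * deriv m x * (P (x - h * u) - P x)|
        ≤ K u * (B * (h * u) ^ 2 * c + B * c * (h * u) ^ 2) := by
          refine mul_le_mul_of_nonneg_left ?_ (hK.nonneg u)
          exact (abs_sub _ _).trans (add_le_add a3 (a4.trans_eq a5))
      _ = _ := by ring
  have hfirst : Integrable fun u => h * deriv m x * P x * (u * K u) :=
    hK.integrable_first.const_mul _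
  have hsec : Integrable fun u => 2 * B * c * h ^ 2 * (u ^ 2 * K u) :=
    hK.integrable_second.const_mul _
  have hmeas : AEStronglyMeasurable (fun u => K u * (m (x - h * u) - m x) * P (x - h * u)) := by
    have := hK.measurable
    have := hm.continuous
    have := hP.continuous
    exact Measurable.aestronglyMeasurable (by fun_prop)
  have hsum : Integrable fun u =>
      K u * (m (x - h * u) - m x) * P (x - h * u) + h * deriv m x * P x * (u * K u) :=
    hsec.mono' (hmeas.add hfirst.aestronglyMeasurable) (ae_of_all _ hbd)
  have hmain : Integrable fun u => K u * (m (x - h * u) - m x) * P (x - h * u) := by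
    exact (hsum.sub hfirst).congr (ae_of_all _ fun u => by simp)
  have e2 : ∫ u, K u * (m (x - h * u) - m x) * P (x - h * u) =
      ∫ u, (K u * (m (x - h * u) - m x) * P (x - h * u) + h * deriv m x * P x * (u * K u)) := by
    rw [integral_add hmain hfirst, integral_const_mul, hK.integral_first, mul_zero, add_zero]
  rw [e2, ← Real.norm_eq_abs]
  refine (norm_integral_le_of_norm_le hsec (ae_of_all _ hbd)).trans (le_of_eq ?_)
  rw [integral_const_mul, kappa2]
  ring

/-- The leading term of the bias of a kernel average. -/
lemma tendsto_integral_bias {m P : ℝ → ℝ} {B c : ℝ} (hm : Differentiable ℝ m)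
    (hm' : Differentiable ℝ (deriv m)) (h1 : ∀ x, |deriv m x| ≤ B)
    (h2 : ∀ x, |deriv (deriv m) x| ≤ B) (hP : Differentiable ℝ P) (hPc : ∀ x, |P x| ≤ c)
    (hP' : ∀ x, |deriv P x| ≤ c) (x : ℝ) {h : ℕ → ℝ} (hh : Tendsto h atTop (𝓝 0))
    (hpos : ∀ᶠ n in atTop, 0 < h n) :
    Tendsto (fun n => (∫ u, K u * (m (x - h n * u) - m x) * P (x - h n * u)) / h n ^ 2) atTop
      (𝓝 (kappa2 K * (deriv (deriv m) x / 2 * P x + deriv m x * deriv P x))) := by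
  have hB : 0 ≤ B := (abs_nonneg _).trans (h1 0)
  have hc : 0 ≤ c := (abs_nonneg _).trans (hPc 0)
  -- The corrected integrand is `h ^ 2 * (u ^ 2 * K u) * q (h * u)`. As `q` is bounded and converges
  -- at `0` off the point itself, dominated convergence against `u ^ 2 * K u` gives the limit.
  let q : ℝ → ℝ := fun t => (m (x - t) - m x + t * deriv m x) / t ^ 2 * P (x - t) -
    deriv m x * ((P (x - t) - P x) / t)
  have hqlim : Tendsto q (𝓝[≠] 0) (𝓝 (deriv (deriv m) x / 2 * P x + deriv m x * deriv P x)) := by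
    have l1 := tendsto_taylor hm hm' x
    have l2 : Tendsto (fun t => P (x - t)) (𝓝[≠] 0) (𝓝 (P x)) := by
      have : Continuous fun t => P (x - t) := hP.continuous.comp (by fun_prop)
      simpa using (this.tendsto 0).mono_left nhdsWithin_le_nhds
    have l3 : Tendsto (fun t => (P (x - t) - P x) / t) (𝓝[≠] 0) (𝓝 (-deriv P x)) := by
      have h3 : HasDerivAt (fun t => P (x - t)) (-deriv P x) 0 := by
        have h4 : HasDerivAt P (deriv P x) (x - 0) := by
          rw [sub_zero]; exact (hP x).hasDerivAt
        exact (h4.comp (0 : ℝ) ((hasDerivAt_id (0 : ℝ)).const_sub x)).congr_deriv (by ring)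
      have := h3.tendsto_slope
      refine this.congr' ?_
      filter_upwards with t
      simp [slope, inv_mul_eq_div]
    have := (l1.mul l2).sub (l3.const_mul (deriv m x))
    rwa [mul_neg, sub_neg_eq_add] at this
  have hqbd : ∀ t, |q t| ≤ 2 * B * c := by
    intro t
    rcases eq_or_ne t 0 with rfl | ht
    · simp [q]; positivity
    have ht2 : 0 < t ^ 2 := by positivity
    have a1 : |(m (x - t) - m x + t * deriv m x) / t ^ 2| ≤ B := by
      rw [abs_div, abs_of_pos ht2, div_le_iff₀ ht2]
      exact abs_taylor_le hm hm' h2 x t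
    have a2 : |(P (x - t) - P x) / t| ≤ c := by
      rw [abs_div, div_le_iff₀ (abs_pos.2 ht)]
      have := abs_sub_le_of_deriv hP hP' x (x - t)
      rwa [sub_sub_cancel_left, abs_neg] at this
    calc |q t| ≤ |(m (x - t) - m x + t * deriv m x) / t ^ 2 * P (x - t)| +
          |deriv m x * ((P (x - t) - P x) / t)| := abs_sub _ _
      _ ≤ B * c + B * c := by
          rw [abs_mul, abs_mul]
          exact add_le_add (mul_le_mul a1 (hPc _) (abs_nonneg _) hB)
            (mul_le_mul (h1 x) a2 (abs_nonneg _) hB)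
      _ = _ := by ring
  have hqm : Measurable q := by
    have := hm.continuous
    have := hP.continuous
    fun_prop
  have hid : ∀ n, 0 < h n → ∀ u, K u * (m (x - h n * u) - m x) * P (x - h n * u) +
      h n * deriv m x * P x * (u * K u) = h n ^ 2 * ((u ^ 2 * K u) * q (h n * u)) := by
    intro n hn u
    rcases eq_or_ne u 0 with rfl | hu
    · simp
    have hn' := hn.ne'
    simp only [q]
    field_simp
    ring
  have hDCT : Tendsto (fun n => ∫ u, (u ^ 2 * K u) * q (h n * u)) atTop
      (𝓝 (∫ u, (u ^ 2 * K u) * (deriv (deriv m) x / 2 * P x + deriv m x * deriv P x))) := by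
    refine tendsto_integral_of_dominated_convergence (fun u => (u ^ 2 * K u) * (2 * B * c))
      (fun n => hK.integrable_second.aestronglyMeasurable.mul
        (Measurable.aestronglyMeasurable (by fun_prop)))
      (hK.integrable_second.mul_const _) (fun n => ae_of_all _ fun u => ?_)
      (ae_of_all _ fun u => ?_)
    · rw [norm_mul, Real.norm_eq_abs,
        abs_of_nonneg (mul_nonneg (sq_nonneg u) (hK.nonneg u))]
      exact mul_le_mul_of_nonneg_left (hqbd _) (mul_nonneg (sq_nonneg u) (hK.nonneg u))
    · rcases eq_or_ne u 0 with rfl | hu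
      · simp
      refine Tendsto.const_mul _ (hqlim.comp ?_)
      refine tendsto_nhdsWithin_iff.2 ⟨by simpa using hh.mul_const u, ?_⟩
      filter_upwards [hpos] with n hn
      exact mul_ne_zero hn.ne' hu
  rw [integral_mul_const] at hDCT
  refine hDCT.congr' ?_
  filter_upwards [hpos] with n hn
  have hfirst : Integrable fun u => h n * deriv m x * P x * (u * K u) :=
    hK.integrable_first.const_mul _
  have hsum : Integrable fun u => h n ^ 2 * ((u ^ 2 * K u) * q (h n * u)) :=
    (hK.integrable_second.mul_bdd (Measurable.aestronglyMeasurable (by fun_prop))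
      (ae_of_all _ fun u => hqbd _)).const_mul _
  have e2 : ∀ u, K u * (m (x - h n * u) - m x) * P (x - h n * u) =
      h n ^ 2 * ((u ^ 2 * K u) * q (h n * u)) - h n * deriv m x * P x * (u * K u) := by
    intro u
    rw [← hid n hn u]; ring
  simp_rw [e2]
  rw [integral_sub hsum hfirst, integral_const_mul, integral_const_mul, hK.integral_first,
    mul_zero, sub_zero, mul_div_cancel_left₀ _ (pow_ne_zero 2 hn.ne')]

end IsKernel

end Kernel

/-! ### Conditional means of kernel weights given the past. -/

/-- The kernel weight of an observation at `y` in the estimation at `x`. -/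
noncomputable def kernelAt (K : ℝ → ℝ) (h x y : ℝ) : ℝ := K ((x - y) / h)

/-- The kernel weight times the bias of the observation. -/
noncomputable def kernelBiasAt (K m : ℝ → ℝ) (h x y : ℝ) : ℝ := K ((x - y) / h) * (m y - m x)

namespace IsKernel

variable {K : ℝ → ℝ} (hK : IsKernel K)

include hK

lemma measurable_kernelAt (h x : ℝ) : Measurable (kernelAt K h x) :=
  hK.measurable.comp (by fun_prop)

lemma measurable_kernelBiasAt {m : ℝ → ℝ} (hm : Measurable m) (h x : ℝ) :
    Measurable (kernelBiasAt K m h x) :=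
  (hK.measurable_kernelAt h x).mul (hm.sub_const _)

/-- Averaging over the innovation convolves the kernel with a normal density, and derivatives fall
on that density, so `K` needs no smoothness. The substitution `y = x - h * u` contributes the factor
`h`; for the square, `K ^ 2 ≤ M K`. -/
lemma exists_gaussianMean_kernelAt_bounds {v : ℝ≥0} (hv : v ≠ 0) :
    ∃ c : ℝ, 0 < c ∧ ∀ x h : ℝ, 0 < h → ∃ G' : ℝ → ℝ,
      (∀ z, HasDerivAt (gaussianMean v (kernelAt K h x)) (G' z) z) ∧ Continuous G' ∧
      (∀ z, |gaussianMean v (kernelAt K h x) z| ≤ c * h) ∧ (∀ z, |G' z| ≤ c * h) ∧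
      ∀ z, gaussianMean v (fun y => kernelAt K h x y ^ 2) z ≤ c * h := by
  obtain ⟨g1, g2, c, hc, hg, hg1, hb⟩ := exists_gaussianPDFReal_deriv hv
  obtain ⟨M, hM0, hM⟩ := hK.exists_pos_bound
  have hg1c : Continuous g1 := continuous_iff_continuousAt.2 fun x => (hg1 x).continuousAt
  have hg2m : Measurable g2 := by
    rw [show g2 = deriv g1 from funext fun x => (hg1 x).deriv.symm]
    exact measurable_deriv g1
  have habs : ∫ u, |K u| = 1 := by
    simp_rw [fun u => abs_of_nonneg (hK.nonneg u), hK.integral_eq_one]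
  have e : ∀ x h, 0 < h → gaussianMean v (kernelAt K h x) =
      fun z => h * ∫ u, K u * gaussianPDFReal 0 v (x - h * u - z) := by
    intro x h hh
    ext z
    have := gaussianMean_kernel_mul hv K (fun _ => 1) hh x z
    have e0 : kernelAt K h x = fun y => K ((x - y) / h) := rfl
    rw [e0]
    simpa using this
  have bd : ∀ {g : ℝ → ℝ}, (∀ x, |g x| ≤ c) → ∀ x h z, |∫ u, K u * g (x - h * u - z)| ≤ c := by
    intro g hg x h z
    have := abs_integral_mul_le (g := fun u => g (x - h * u - z)) hK.integrable fun u => hg _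
    rwa [habs, mul_one] at this
  have le_big : c ≤ c * M + c + 1 := by nlinarith
  refine ⟨c * M + c + 1, by positivity, fun x h hh =>
    ⟨fun z => h * -∫ u, K u * g1 (x - h * u - z), ?_, ?_, ?_, ?_, ?_⟩⟩
  · intro z
    rw [e x h hh]
    exact (hasDerivAt_integral_mul_comp hK.integrable hg (fun x => (hb x).1) (fun x => (hb x).2.1)
      hg1c.measurable h x z).const_mul h
  · refine continuous_const.mul (Continuous.neg ?_)
    exact continuous_iff_continuousAt.2 fun z => (hasDerivAt_integral_mul_comp hK.integrable hg1
      (fun x => (hb x).2.1) (fun x => (hb x).2.2) hg2m h x z).continuousAt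
  · intro z
    rw [e x h hh]
    simp only
    rw [abs_mul, abs_of_pos hh, mul_comm]
    exact mul_le_mul_of_nonneg_right ((bd (fun x => (hb x).1) x h z).trans le_big) hh.le
  · intro z
    rw [abs_mul, abs_neg, abs_of_pos hh, mul_comm]
    exact mul_le_mul_of_nonneg_right ((bd (fun x => (hb x).2.1) x h z).trans le_big) hh.le
  · intro z
    have e2 := gaussianMean_kernel_mul hv (fun u => K u ^ 2) (fun _ => 1) hh x z
    simp only [mul_one] at e2
    change gaussianMean v (fun y => K ((x - y) / h) ^ 2) z ≤ _
    rw [e2, mul_comm]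
    refine mul_le_mul_of_nonneg_right ?_ hh.le
    have h1 := abs_integral_mul_le (g := fun u => gaussianPDFReal 0 v (x - h * u - z))
      hK.integrable_sq fun u => (hb _).1
    have h2 : ∫ u, |K u ^ 2| ≤ M := by
      have : ∫ u, |K u ^ 2| ≤ ∫ u, M * K u := by
        refine integral_mono hK.integrable_sq.abs (hK.integrable.const_mul M) fun u => ?_
        simp only [abs_pow, sq_abs]
        rw [pow_two]
        exact mul_le_mul_of_nonneg_right (hM u) (hK.nonneg u)
      rwa [integral_const_mul, hK.integral_eq_one, mul_one] at this
    have h3 := mul_le_mul_of_nonneg_left h2 hc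
    have := (abs_le.1 h1).2
    linarith

lemma integrable_mul_sub {m : ℝ → ℝ} {B : ℝ} (hm : Differentiable ℝ m)
    (h1 : ∀ x, |deriv m x| ≤ B) (x h : ℝ) : Integrable fun u => K u * (m (x - h * u) - m x) := by
  have hmeas : AEStronglyMeasurable (fun u => K u * (m (x - h * u) - m x)) := by
    have := hK.measurable
    have := hm.continuous
    exact Measurable.aestronglyMeasurable (by fun_prop)
  refine (hK.integrable_first.abs.const_mul (B * |h|)).mono' hmeas (ae_of_all _ fun u => ?_)
  rw [Real.norm_eq_abs, abs_mul, abs_mul, abs_of_nonneg (hK.nonneg u)]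
  have := abs_sub_le_of_deriv hm h1 x (x - h * u)
  rw [sub_sub_cancel_left, abs_neg, abs_mul] at this
  calc K u * |m (x - h * u) - m x| ≤ K u * (B * (|h| * |u|)) :=
        mul_le_mul_of_nonneg_left this (hK.nonneg u)
    _ = _ := by ring

/-- One power of `h` comes from the substitution and two from `abs_integral_bias_le`, applied with a
translate of the normal density or of its derivative. The constant does not depend on `m`, and the
bound is linear in `B`, so it vanishes for constant `m`. -/
lemma exists_gaussianMean_kernelBiasAt_bounds {v : ℝ≥0} (hv : v ≠ 0) :
    ∃ c : ℝ, 0 < c ∧ ∀ (m : ℝ → ℝ) (B : ℝ), Differentiable ℝ m → Differentiable ℝ (deriv m) →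
      (∀ x, |deriv m x| ≤ B) → (∀ x, |deriv (deriv m) x| ≤ B) →
      ∀ x h : ℝ, 0 < h → ∃ G' : ℝ → ℝ,
      (∀ z, HasDerivAt (gaussianMean v (kernelBiasAt K m h x)) (G' z) z) ∧ Continuous G' ∧
      (∀ z, |gaussianMean v (kernelBiasAt K m h x) z| ≤ c * B * h ^ 3) ∧
      ∀ z, |G' z| ≤ c * B * h ^ 3 := by
  obtain ⟨g1, g2, c, hc, hg, hg1, hb⟩ := exists_gaussianPDFReal_deriv hv
  have hk2 := hK.kappa2_nonneg
  have hg1c : Continuous g1 := continuous_iff_continuousAt.2 fun x => (hg1 x).continuousAt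
  have hg2m : Measurable g2 := by
    rw [show g2 = deriv g1 from funext fun x => (hg1 x).deriv.symm]
    exact measurable_deriv g1
  refine ⟨2 * c * kappa2 K + 1, by positivity, fun m B hm hm' h1 h2 x h hh => ?_⟩
  have hB : 0 ≤ B := (abs_nonneg _).trans (h1 0)
  have e : gaussianMean v (kernelBiasAt K m h x) =
      fun z => h * ∫ u, (K u * (m (x - h * u) - m x)) * gaussianPDFReal 0 v (x - h * u - z) := by
    ext z
    exact gaussianMean_kernel_mul hv K (fun y => m y - m x) hh x z
  have hW := hK.integrable_mul_sub hm h1 x h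
  have bd : ∀ {g g' : ℝ → ℝ}, (∀ x, HasDerivAt g (g' x) x) → (∀ x, |g x| ≤ c) →
      (∀ x, |g' x| ≤ c) → ∀ z, h * |∫ u, (K u * (m (x - h * u) - m x)) * g (x - h * u - z)| ≤
        (2 * c * kappa2 K + 1) * B * h ^ 3 := by
    intro g g' hg hgc hgc' z
    have hd : ∀ y, HasDerivAt (fun y => g (y - z)) (g' (y - z)) y := fun y =>
      ((hg (y - z)).comp y ((hasDerivAt_id y).sub_const z)).congr_deriv (by ring)
    have := hK.abs_integral_bias_le hm hm' h1 h2 (P := fun y => g (y - z)) (c := c)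
      (fun y => (hd y).differentiableAt) (fun y => hgc _)
      (fun y => by rw [(hd y).deriv]; exact hgc' _) x h
    refine (mul_le_mul_of_nonneg_left this hh.le).trans ?_
    have : 0 ≤ B * h ^ 3 := by positivity
    nlinarith
  refine ⟨fun z => h * -∫ u, (K u * (m (x - h * u) - m x)) * g1 (x - h * u - z), ?_, ?_, ?_, ?_⟩
  · intro z
    rw [e]
    exact (hasDerivAt_integral_mul_comp hW hg (fun x => (hb x).1) (fun x => (hb x).2.1)
      hg1c.measurable h x z).const_mul h
  · refine continuous_const.mul (Continuous.neg ?_)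
    exact continuous_iff_continuousAt.2 fun z => (hasDerivAt_integral_mul_comp hW hg1
      (fun x => (hb x).2.1) (fun x => (hb x).2.2) hg2m h x z).continuousAt
  · intro z
    rw [e]
    simp only
    rw [abs_mul, abs_of_pos hh]
    exact bd hg (fun x => (hb x).1) (fun x => (hb x).2.1) z
  · intro z
    rw [abs_mul, abs_neg, abs_of_pos hh]
    exact bd hg1 (fun x => (hb x).2.1) (fun x => (hb x).2.2) z

end IsKernel

/-! ### Moments under the standard normal law. -/

/-- The mean of the kernel density estimator for a standard normal sample. -/
noncomputable def smoothedDensity (K : ℝ → ℝ) (h x : ℝ) : ℝ :=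
  ∫ u, K u * gaussianPDFReal 0 1 (x - h * u)

namespace IsKernel

variable {K : ℝ → ℝ} (hK : IsKernel K)

omit hK in
lemma _root_.integral_kernelAt (K : ℝ → ℝ) {h : ℝ} (hh : 0 < h) (x : ℝ) :
    ∫ y, kernelAt K h x y ∂gaussianReal 0 1 = h * smoothedDensity K h x := by
  have := integral_gaussianReal_kernel_mul K (fun _ => 1) hh x
  simpa [kernelAt, smoothedDensity] using this

omit hK in
lemma _root_.gaussianPDFReal_le_one (x : ℝ) : gaussianPDFReal 0 1 x ≤ 1 := by
  simp only [gaussianPDFReal, sub_zero, NNReal.coe_one, mul_one]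
  have h1 : (1 : ℝ) ≤ Real.sqrt (2 * Real.pi) := by
    rw [Real.one_le_sqrt]
    nlinarith [Real.pi_gt_three]
  have h2 : Real.exp (-x ^ 2 / 2) ≤ 1 := Real.exp_le_one_iff.2 (by nlinarith [sq_nonneg x])
  calc _ ≤ (1 : ℝ) * 1 :=
        mul_le_mul (inv_le_one_of_one_le₀ h1) h2 (Real.exp_pos _).le zero_le_one
    _ = 1 := one_mul 1

omit hK in
lemma _root_.abs_gaussianPDFReal_le_one (x : ℝ) : |gaussianPDFReal 0 1 x| ≤ 1 := by
  rw [abs_of_nonneg (gaussianPDFReal_nonneg 0 1 x)]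
  exact gaussianPDFReal_le_one x

omit hK in
lemma _root_.continuous_gaussianPDFReal : Continuous (gaussianPDFReal 0 1) := by
  rw [gaussianPDFReal_def]
  fun_prop

include hK

lemma smoothedDensity_le_one (h x : ℝ) : smoothedDensity K h x ≤ 1 := by
  have := abs_integral_mul_le (g := fun u => gaussianPDFReal 0 1 (x - h * u)) hK.integrable
    fun u => abs_gaussianPDFReal_le_one _
  simp_rw [fun u => abs_of_nonneg (hK.nonneg u), hK.integral_eq_one, mul_one] at this
  exact (abs_le.1 this).2

/-- Jensen's inequality for `φ (x - h u) = φ x * exp (x h u - h² u² / 2)` under the probability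
density `K`, whose first moment is zero. The lower bound is a fixed multiple of `φ x` for every `x`,
so dividing by the smoothed density costs only powers of `1 / φ x`. -/
lemma smoothedDensity_ge {h : ℝ} (hh : |h| ≤ 1) (x : ℝ) :
    Real.exp (-kappa2 K / 2) * gaussianPDFReal 0 1 x ≤ smoothedDensity K h x := by
  -- The mean of the exponent under `K`, at which the tangent line of `exp` is taken.
  set a : ℝ := -(h ^ 2 * kappa2 K / 2) with ha
  have hk2 := hK.kappa2_nonneg
  have h2 : h ^ 2 ≤ 1 := by rw [← sq_abs]; exact pow_le_one₀ (abs_nonneg _) hh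
  have hpt : ∀ u, gaussianPDFReal 0 1 x * Real.exp a *
      ((1 - a) * K u + h * x * (u * K u) - h ^ 2 / 2 * (u ^ 2 * K u)) ≤
      K u * gaussianPDFReal 0 1 (x - h * u) := by
    intro u
    have e1 : gaussianPDFReal 0 1 (x - h * u) =
        gaussianPDFReal 0 1 x * Real.exp a * Real.exp (x * h * u - h ^ 2 * u ^ 2 / 2 - a) := by
      simp only [gaussianPDFReal, sub_zero, NNReal.coe_one, mul_one]
      rw [mul_assoc, mul_assoc, ← Real.exp_add, ← Real.exp_add]
      congr 2
      ring
    rw [e1]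
    have h3 := Real.add_one_le_exp (x * h * u - h ^ 2 * u ^ 2 / 2 - a)
    have h4 : 0 ≤ gaussianPDFReal 0 1 x * Real.exp a :=
      mul_nonneg (gaussianPDFReal_nonneg 0 1 x) (Real.exp_pos _).le
    have h5 := mul_le_mul_of_nonneg_left h3 (mul_nonneg h4 (hK.nonneg u))
    refine le_trans (le_of_eq ?_) (h5.trans (le_of_eq ?_)) <;> ring
  have i0 := hK.integrable.const_mul (1 - a)
  have i1 := hK.integrable_first.const_mul (h * x)
  have i2 := hK.integrable_second.const_mul (h ^ 2 / 2)
  have hmono := integral_mono (((i0.add i1).sub i2).const_mul (gaussianPDFReal 0 1 x * Real.exp a))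
    (hK.integrable.mul_bdd
      (continuous_gaussianPDFReal.comp (by fun_prop : Continuous fun u => x - h * u)).aestronglyMeasurable
      (ae_of_all _ fun u => abs_gaussianPDFReal_le_one _)) hpt
  have e2 : ∫ u, gaussianPDFReal 0 1 x * Real.exp a *
      ((1 - a) * K u + h * x * (u * K u) - h ^ 2 / 2 * (u ^ 2 * K u)) =
      gaussianPDFReal 0 1 x * Real.exp a := by
    rw [integral_const_mul, integral_sub (f := fun u => (1 - a) * K u + h * x * (u * K u))
      (i0.add i1) i2, integral_add i0 i1, integral_const_mul, integral_const_mul,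
      integral_const_mul, hK.integral_eq_one, hK.integral_first]
    change _ * ((1 - a) * 1 + h * x * 0 - h ^ 2 / 2 * kappa2 K) = _
    rw [ha]; ring
  have h6 : Real.exp (-kappa2 K / 2) ≤ Real.exp a := by
    rw [Real.exp_le_exp, ha]
    nlinarith
  calc Real.exp (-kappa2 K / 2) * gaussianPDFReal 0 1 x
      ≤ gaussianPDFReal 0 1 x * Real.exp a := by
        rw [mul_comm]
        exact mul_le_mul_of_nonneg_left h6 (gaussianPDFReal_nonneg 0 1 x)
    _ ≤ smoothedDensity K h x := by
        rw [← e2]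
        exact hmono

lemma tendsto_smoothedDensity {h : ℕ → ℝ} (hh : Tendsto h atTop (𝓝 0)) (x : ℝ) :
    Tendsto (fun n => smoothedDensity K (h n) x) atTop (𝓝 (gaussianPDFReal 0 1 x)) := by
  have := tendsto_integral_mul_comp (x := x) hK.integrable continuous_gaussianPDFReal
    abs_gaussianPDFReal_le_one hh
  rwa [hK.integral_eq_one, one_mul] at this

omit hK in
lemma _root_.kappa1_nonneg (K : ℝ → ℝ) : 0 ≤ kappa1 K := integral_nonneg fun _ => sq_nonneg _

omit hK in
lemma _root_.integral_kernelAt_sq_eq (K : ℝ → ℝ) {h : ℝ} (hh : 0 < h) (x : ℝ) :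
    ∫ y, kernelAt K h x y ^ 2 ∂gaussianReal 0 1 =
      h * ∫ u, K u ^ 2 * gaussianPDFReal 0 1 (x - h * u) := by
  have := integral_gaussianReal_kernel_mul (fun u => K u ^ 2) (fun _ => 1) hh x
  simpa [kernelAt] using this

lemma integral_kernelAt_sq_le {h : ℝ} (hh : 0 < h) (x : ℝ) :
    ∫ y, kernelAt K h x y ^ 2 ∂gaussianReal 0 1 ≤ kappa1 K * h := by
  rw [integral_kernelAt_sq_eq K hh, mul_comm]
  refine mul_le_mul_of_nonneg_right ?_ hh.le
  have := abs_integral_mul_le (g := fun u => gaussianPDFReal 0 1 (x - h * u)) hK.integrable_sq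
    fun u => abs_gaussianPDFReal_le_one _
  simp_rw [abs_pow, sq_abs, one_mul] at this
  exact (abs_le.1 this).2

lemma tendsto_integral_kernelAt_sq {h : ℕ → ℝ} (hh : Tendsto h atTop (𝓝 0))
    (hpos : ∀ᶠ n in atTop, 0 < h n) (x : ℝ) :
    Tendsto (fun n => (∫ y, kernelAt K (h n) x y ^ 2 ∂gaussianReal 0 1) / h n) atTop
      (𝓝 (kappa1 K * gaussianPDFReal 0 1 x)) := by
  refine (tendsto_integral_mul_comp (x := x) hK.integrable_sq continuous_gaussianPDFReal
    abs_gaussianPDFReal_le_one hh).congr' ?_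
  filter_upwards [hpos] with n hn
  rw [integral_kernelAt_sq_eq K hn, mul_div_cancel_left₀ _ hn.ne']

omit hK in
lemma _root_.integral_kernelBiasAt (K m : ℝ → ℝ) {h : ℝ} (hh : 0 < h) (x : ℝ) :
    ∫ y, kernelBiasAt K m h x y ∂gaussianReal 0 1 =
      h * ∫ u, K u * (m (x - h * u) - m x) * gaussianPDFReal 0 1 (x - h * u) :=
  integral_gaussianReal_kernel_mul K (fun y => m y - m x) hh x

omit hK in
lemma _root_.hasDerivAt_gaussianPDFReal (x : ℝ) :
    HasDerivAt (gaussianPDFReal 0 1) (-x * gaussianPDFReal 0 1 x) x := by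
  have h1 : HasDerivAt (fun x : ℝ => -(x - 0) ^ 2 / (2 * ((1 : ℝ≥0) : ℝ))) (-x) x := by
    have := ((((hasDerivAt_id x).sub_const 0).pow 2).neg).div_const (2 * ((1 : ℝ≥0) : ℝ))
    refine this.congr_deriv ?_
    simp
    ring
  have := (h1.exp).const_mul (Real.sqrt (2 * Real.pi * ((1 : ℝ≥0) : ℝ)))⁻¹
  rw [gaussianPDFReal_def]
  exact this.congr_deriv (by ring)

omit hK in
lemma _root_.exists_abs_deriv_gaussianPDFReal_le :
    ∃ c : ℝ, 0 < c ∧ (∀ x, |gaussianPDFReal 0 1 x| ≤ c) ∧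
      ∀ x, |deriv (gaussianPDFReal 0 1) x| ≤ c := by
  obtain ⟨g1, g2, c, hc, hg, hg1, hb⟩ := exists_gaussianPDFReal_deriv (v := 1) one_ne_zero
  exact ⟨c + 1, by positivity, fun x => (hb x).1.trans (by linarith),
    fun x => by rw [(hg x).deriv]; exact (hb x).2.1.trans (by linarith)⟩

section Bias

variable {m : ℝ → ℝ} {B : ℝ} (hm : Differentiable ℝ m) (hm' : Differentiable ℝ (deriv m))
  (h1 : ∀ x, |deriv m x| ≤ B) (h2 : ∀ x, |deriv (deriv m) x| ≤ B)

include hm hm' h1 h2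

lemma tendsto_integral_kernelBiasAt {h : ℕ → ℝ} (hh : Tendsto h atTop (𝓝 0))
    (hpos : ∀ᶠ n in atTop, 0 < h n) (x : ℝ) :
    Tendsto (fun n => (∫ y, kernelBiasAt K m (h n) x y ∂gaussianReal 0 1) / h n ^ 3) atTop
      (𝓝 (kappa2 K * (deriv (deriv m) x / 2 * gaussianPDFReal 0 1 x +
        deriv m x * deriv (gaussianPDFReal 0 1) x))) := by
  obtain ⟨c, hc, hb1, hb2⟩ := exists_abs_deriv_gaussianPDFReal_le
  refine (hK.tendsto_integral_bias hm hm' h1 h2 (P := gaussianPDFReal 0 1)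
    (fun y => (hasDerivAt_gaussianPDFReal y).differentiableAt) hb1 hb2 x hh hpos).congr' ?_
  filter_upwards [hpos] with n hn
  rw [integral_kernelBiasAt K m hn, pow_succ (h n) 2, mul_comm (h n), mul_div_mul_right _ _ hn.ne']

-- The Lipschitz bound on `m` gives `B ^ 2 (y - x) ^ 2`, and `K ^ 2 ≤ M K` leaves a second moment of
-- `K`. A fourth moment is not needed.
omit hm' h2 in
lemma integral_kernelBiasAt_sq_le {M : ℝ} (hM : ∀ u, K u ≤ M) {h : ℝ} (hh : 0 < h) (x : ℝ) :
    Integrable (fun y => kernelBiasAt K m h x y ^ 2) (gaussianReal 0 1) ∧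
    ∫ y, kernelBiasAt K m h x y ^ 2 ∂gaussianReal 0 1 ≤ M * kappa2 K * B ^ 2 * h ^ 3 := by
  have hM0 : 0 ≤ M := (hK.nonneg 0).trans (hM 0)
  have hpt : ∀ y, kernelBiasAt K m h x y ^ 2 ≤
      M * B ^ 2 * h ^ 2 * (K ((x - y) / h) * ((x - y) / h) ^ 2) := by
    intro y
    have a1 := abs_sub_le_of_deriv hm h1 x y
    have a2 : (m y - m x) ^ 2 ≤ B ^ 2 * (y - x) ^ 2 := by
      rw [← sq_abs (m y - m x), ← sq_abs (y - x), ← mul_pow]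
      exact pow_le_pow_left₀ (abs_nonneg _) a1 2
    have a3 : K ((x - y) / h) ^ 2 ≤ M * K ((x - y) / h) := by
      rw [pow_two]
      exact mul_le_mul_of_nonneg_right (hM _) (hK.nonneg _)
    rw [kernelBiasAt, mul_pow]
    refine (mul_le_mul a3 a2 (sq_nonneg _) (mul_nonneg hM0 (hK.nonneg _))).trans (le_of_eq ?_)
    field_simp
    ring
  have hmeas : Measurable fun y => kernelBiasAt K m h x y ^ 2 :=
    (hK.measurable_kernelBiasAt hm.continuous.measurable h x).pow_const 2
  have hint : Integrable (fun y => M * B ^ 2 * h ^ 2 * (K ((x - y) / h) * ((x - y) / h) ^ 2))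
      volume := by
    refine Integrable.const_mul ?_ _
    have e := (hK.integrable_second.comp_div hh.ne').comp_sub_left x
    exact e.congr (ae_of_all _ fun y => mul_comm _ _)
  have hint2 : Integrable (fun y => M * B ^ 2 * h ^ 2 * (K ((x - y) / h) * ((x - y) / h) ^ 2))
      (gaussianReal 0 1) := by
    -- The standard normal law is dominated by Lebesgue measure, its density being at most `1`.
    rw [gaussianReal_of_var_ne_zero _ one_ne_zero]
    refine hint.mono_measure (?_ : _ ≤ volume)
    conv_rhs => rw [← withDensity_one (μ := volume)]
    refine withDensity_mono (ae_of_all _ fun y => ?_)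
    simp only [gaussianPDF, Pi.one_apply]
    exact ENNReal.ofReal_le_one.2 (gaussianPDFReal_le_one y)
  have hint3 := hint2.mono' hmeas.aestronglyMeasurable (ae_of_all _ fun y => by
    rw [Real.norm_eq_abs, abs_of_nonneg (sq_nonneg _)]; exact hpt y)
  refine ⟨hint3, (integral_mono hint3 hint2 hpt).trans ?_⟩
  rw [integral_const_mul, integral_gaussianReal_kernel_mul K (fun y => ((x - y) / h) ^ 2) hh x]
  have h4 : ∫ u, K u * ((x - (x - h * u)) / h) ^ 2 * gaussianPDFReal 0 1 (x - h * u) ≤ kappa2 K := by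
    have h5 := abs_integral_mul_le (g := fun u => gaussianPDFReal 0 1 (x - h * u))
      hK.integrable_second fun u => abs_gaussianPDFReal_le_one _
    simp_rw [fun u => abs_of_nonneg (mul_nonneg (sq_nonneg u) (hK.nonneg u)), one_mul] at h5
    refine le_trans (le_of_eq (integral_congr_ae (ae_of_all _ fun u => ?_))) (abs_le.1 h5).2
    simp only [sub_sub_cancel, mul_div_cancel_left₀ _ hh.ne']
    ring
  calc M * B ^ 2 * h ^ 2 * (h * _) ≤ M * B ^ 2 * h ^ 2 * (h * kappa2 K) := by gcongr
    _ = _ := by ring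

end Bias

end IsKernel

/-! ### Concentration of the density estimator. -/

/-- A Chernoff bound from a subgaussian estimate of the moment generating function near zero. -/
lemma measureReal_le_abs_le_of_mgf_le {Ω : Type*} [MeasurableSpace Ω] {μ : Measure Ω}
    [IsProbabilityMeasure μ] {U : Ω → ℝ} {T V u : ℝ} (hV : 0 < V)
    (hint : ∀ t, Integrable (fun ω => Real.exp (t * U ω)) μ)
    (hU : ∀ t, |t| ≤ T → mgf U μ t ≤ Real.exp (t ^ 2 * V)) (hu : 0 ≤ u) (huT : u / (2 * V) ≤ T) :
    μ.real {ω | u ≤ |U ω|} ≤ 2 * Real.exp (-(u ^ 2 / (4 * V))) := by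
  -- The minimizer of `-t * u + t ^ 2 * V`.
  set t := u / (2 * V) with ht
  have ht0 : 0 ≤ t := by positivity
  have e : Real.exp (-t * u) * Real.exp (t ^ 2 * V) = Real.exp (-(u ^ 2 / (4 * V))) := by
    rw [← Real.exp_add]
    congr 1
    rw [ht]
    field_simp
    ring
  have h1 : μ.real {ω | u ≤ U ω} ≤ Real.exp (-(u ^ 2 / (4 * V))) := by
    refine (measure_ge_le_exp_mul_mgf u ht0 (hint t)).trans ?_
    rw [← e]
    exact mul_le_mul_of_nonneg_left (hU t (by rwa [abs_of_nonneg ht0])) (Real.exp_pos _).le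
  have h2 : μ.real {ω | U ω ≤ -u} ≤ Real.exp (-(u ^ 2 / (4 * V))) := by
    refine (measure_le_le_exp_mul_mgf (-u) (neg_nonpos.2 ht0) (hint (-t))).trans ?_
    rw [← e, neg_neg, mul_neg, neg_mul]
    refine mul_le_mul_of_nonneg_left ?_ (Real.exp_pos _).le
    have := hU (-t) (by rwa [abs_neg, abs_of_nonneg ht0])
    rwa [neg_sq] at this
  calc μ.real {ω | u ≤ |U ω|} ≤ μ.real ({ω | u ≤ U ω} ∪ {ω | U ω ≤ -u}) := by
        refine measureReal_mono fun ω hω => ?_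
        rcases le_abs.1 (show u ≤ |U ω| from hω) with h | h
        · exact Or.inl h
        · exact Or.inr (show U ω ≤ -u by linarith)
    _ ≤ μ.real {ω | u ≤ U ω} + μ.real {ω | U ω ≤ -u} := measureReal_union_le _ _
    _ ≤ _ := by linarith

/-- A single term of the exponential series. It turns exponential smallness involving the density
into an inverse power of the density, which the weight `r` can integrate. -/
lemma exp_neg_le_factorial_div {y : ℝ} (hy : 0 < y) (k : ℕ) :
    Real.exp (-y) ≤ k.factorial / y ^ k := by
  rw [Real.exp_neg, inv_le_comm₀ (Real.exp_pos _) (by positivity), inv_div]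
  exact Real.pow_div_factorial_le_exp y hy.le k

lemma rpow_two_sub_eq {n : ℝ} (hn : 0 < n) (a : ℝ) : n ^ (2 - a) = n ^ 2 * n ^ (-a) := by
  rw [sub_eq_add_neg, Real.rpow_add hn, Real.rpow_two]

/-- The sum of the kernel weights. -/
noncomputable def kernelSum {Ω : Type*} (K : ℝ → ℝ) (X : ℕ → Ω → ℝ) (n : ℕ) (h x : ℝ) (ω : Ω) : ℝ :=
  ∑ i ∈ Finset.range n, kernelAt K h x (X i ω)

lemma IsKernel.memLp_kernelAt {K : ℝ → ℝ} (hK : IsKernel K) (h x : ℝ) {p : ℝ≥0∞} {ν : Measure ℝ}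
    [IsFiniteMeasure ν] : MemLp (kernelAt K h x) p ν := by
  obtain ⟨M, hM0, hM⟩ := hK.exists_pos_bound
  refine MemLp.of_bound (hK.measurable_kernelAt h x).aestronglyMeasurable M (ae_of_all _ fun y => ?_)
  rw [Real.norm_eq_abs, kernelAt, abs_of_nonneg (hK.nonneg _)]
  exact hM _

namespace GaussianDecomposition

variable {Ω : Type*} [MeasurableSpace Ω] {μ : Measure Ω} [IsProbabilityMeasure μ]
  {X Z ζ : ℕ → Ω → ℝ} {v : ℝ≥0} {K : ℝ → ℝ} {a CZ : ℝ}

omit [IsProbabilityMeasure μ] in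
lemma measurable_kernelSum (hD : GaussianDecomposition μ X Z ζ v) (hK : IsKernel K) (n : ℕ)
    (h x : ℝ) : Measurable (kernelSum K X n h x) :=
  Finset.measurable_fun_sum _ fun i _ => (hK.measurable_kernelAt h x).comp (hD.measurable i)

omit [MeasurableSpace Ω] in
lemma _root_.IsKernel.kernelSum_nonneg (hK : IsKernel K) (X : ℕ → Ω → ℝ) (n : ℕ) (h x : ℝ) (ω : Ω) :
    0 ≤ kernelSum K X n h x ω := Finset.sum_nonneg fun _ _ => hK.nonneg _

omit [MeasurableSpace Ω] in
lemma _root_.kernelSum_le {M : ℝ} (hM : ∀ u, K u ≤ M) (X : ℕ → Ω → ℝ)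
    (n : ℕ) (h x : ℝ) (ω : Ω) : kernelSum K X n h x ω ≤ n * M := by
  refine (Finset.sum_le_sum fun i _ => hM _).trans ?_
  simp

variable (hD : GaussianDecomposition μ X Z ζ v) (hK : IsKernel K)
  (hcov : ∀ n : ℕ, ∑ i ∈ Finset.range n, ∑ j ∈ Finset.range n, |∫ ω, Z i ω * Z j ω ∂μ| ≤
    CZ * (n : ℝ) ^ (2 - a))

include hD hK

lemma integrable_exp_kernelSum (n : ℕ) (h x e t : ℝ) :
    Integrable (fun ω => Real.exp (t * (kernelSum K X n h x ω - e))) μ := by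
  obtain ⟨M, hM0, hM⟩ := hK.exists_pos_bound
  have hm := hD.measurable_kernelSum hK n h x
  refine Integrable.of_bound (by fun_prop : Measurable _).aestronglyMeasurable
    (Real.exp (|t| * (n * M + |e|))) (ae_of_all _ fun ω => ?_)
  rw [Real.norm_eq_abs, abs_of_pos (Real.exp_pos _), Real.exp_le_exp]
  refine (le_abs_self _).trans ?_
  rw [abs_mul]
  refine mul_le_mul_of_nonneg_left ((abs_sub _ _).trans ?_) (abs_nonneg _)
  rw [abs_of_nonneg (hK.kernelSum_nonneg X n h x ω)]
  gcongr
  exact kernelSum_le hM X n h x ω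

include hcov

/-- The centered kernel sum is a martingale with conditional second moments `O(h)` plus a sum of
smooth functions of the predictions with derivative `O(h)`. The first part accounts for `n * h` in
the exponent; Gaussian concentration of the second accounts for `h ^ 2 * n ^ (2 - a)`. -/
lemma exists_mgf_kernelSum_le :
    ∃ C : ℝ, 1 ≤ C ∧ ∀ (x h : ℝ) (n : ℕ) (t : ℝ), 0 < h → |t| ≤ 1 / C →
      mgf (fun ω => kernelSum K X n h x ω - n * h * smoothedDensity K h x) μ t ≤
        Real.exp (t ^ 2 * (C * (n * h + h ^ 2 * (n : ℝ) ^ (2 - a)))) := by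
  obtain ⟨M, hM0, hM⟩ := hK.exists_pos_bound
  obtain ⟨c, hc, hG⟩ := hK.exists_gaussianMean_kernelAt_bounds hD.var_ne_zero
  have hCZ : 0 ≤ CZ := by
    have := (Finset.sum_nonneg fun i _ => Finset.sum_nonneg fun j _ => abs_nonneg _).trans (hcov 1)
    simpa using this
  refine ⟨1 + 2 * M + 4 * c + 4 * (Real.pi ^ 2 / 8 * c ^ 2 * CZ), by
    have : 0 ≤ Real.pi ^ 2 / 8 * c ^ 2 * CZ := by positivity
    linarith, fun x h n t hh ht => ?_⟩
  set C := 1 + 2 * M + 4 * c + 4 * (Real.pi ^ 2 / 8 * c ^ 2 * CZ) with hC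
  have hq : 0 ≤ Real.pi ^ 2 / 8 * c ^ 2 * CZ := by positivity
  have hC0 : 0 < C := by linarith
  obtain ⟨G', hd, hG'c, hGb, hG'b, hsq⟩ := hG x h hh
  set ψ := kernelAt K h x with hψdef
  have hψ : Measurable ψ := hK.measurable_kernelAt h x
  have ht2 : |2 * t| * M ≤ 1 := by
    rw [abs_mul, abs_two]
    rw [le_div_iff₀ hC0] at ht
    have : |t| * (2 * M) ≤ |t| * C := mul_le_mul_of_nonneg_left (by linarith) (abs_nonneg t)
    linarith
  have b1 := hD.lintegral_exp_sum_sub_gaussianMean_le hψ (fun y => hK.nonneg _) (fun y => hM _)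
    hsq ht2 n
  have b2 := hD.lintegral_exp_sum_pred_le hd hG'c hGb hG'b n (2 * t)
  have hmean : ∀ i, ∫ ω, gaussianMean v ψ (Z i ω) ∂μ = h * smoothedDensity K h x := by
    intro i
    rw [hD.integral_gaussianMean i hψ, integral_kernelAt K hh]
    exact memLp_one_iff_integrable.1 (hK.memLp_kernelAt h x)
  simp_rw [hmean] at b2
  set E := Real.exp (t ^ 2 * (C * (n * h + h ^ 2 * (n : ℝ) ^ (2 - a)))) with hE
  have hn2 : 0 ≤ (n : ℝ) ^ (2 - a) := by positivity
  have k1 : Real.exp ((2 * t) ^ 2 * (n * (c * h))) ≤ E := by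
    rw [hE, Real.exp_le_exp]
    have : 4 * (n * (c * h)) ≤ C * (n * h + h ^ 2 * (n : ℝ) ^ (2 - a)) := by
      have h1 : 0 ≤ n * h := by positivity
      have h2 : 0 ≤ h ^ 2 * (n : ℝ) ^ (2 - a) := by positivity
      have : C * (n * h + h ^ 2 * (n : ℝ) ^ (2 - a)) = 4 * (n * (c * h)) +
        ((C - 4 * c) * (n * h) + C * (h ^ 2 * (n : ℝ) ^ (2 - a))) := by ring
      rw [this]
      have h3 : 0 ≤ C - 4 * c := by linarith
      have : 0 ≤ (C - 4 * c) * (n * h) + C * (h ^ 2 * (n : ℝ) ^ (2 - a)) := by positivity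
      linarith
    have := mul_le_mul_of_nonneg_left this (sq_nonneg t)
    nlinarith
  have k2 : Real.exp ((2 * t) ^ 2 * (Real.pi ^ 2 / 8 * (c * h) ^ 2 *
      ∑ i ∈ Finset.range n, ∑ j ∈ Finset.range n, |∫ ω, Z i ω * Z j ω ∂μ|)) ≤ E := by
    rw [hE, Real.exp_le_exp]
    have h0 := mul_le_mul_of_nonneg_left (hcov n)
      (by positivity : 0 ≤ Real.pi ^ 2 / 8 * (c * h) ^ 2)
    have : 4 * (Real.pi ^ 2 / 8 * (c * h) ^ 2 * (CZ * (n : ℝ) ^ (2 - a))) ≤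
        C * (n * h + h ^ 2 * (n : ℝ) ^ (2 - a)) := by
      have h1 : 0 ≤ n * h := by positivity
      have h2 : 0 ≤ h ^ 2 * (n : ℝ) ^ (2 - a) := by positivity
      have : C * (n * h + h ^ 2 * (n : ℝ) ^ (2 - a)) =
        4 * (Real.pi ^ 2 / 8 * (c * h) ^ 2 * (CZ * (n : ℝ) ^ (2 - a))) +
        (C * (n * h) + (1 + 2 * M + 4 * c) * (h ^ 2 * (n : ℝ) ^ (2 - a))) := by rw [hC]; ring
      rw [this]
      have : 0 ≤ C * (n * h) + (1 + 2 * M + 4 * c) * (h ^ 2 * (n : ℝ) ^ (2 - a)) := by positivity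
      linarith
    have := mul_le_mul_of_nonneg_left this (sq_nonneg t)
    nlinarith [sq_nonneg t, mul_le_mul_of_nonneg_left h0 (sq_nonneg t)]
  have hexp := hD.integrable_exp_kernelSum hK n h x (n * h * smoothedDensity K h x) t
  rw [mgf, ← ENNReal.ofReal_le_ofReal_iff (Real.exp_pos _).le,
    ofReal_integral_eq_lintegral_ofReal hexp (ae_of_all _ fun _ => (Real.exp_pos _).le)]
  have hZm := measurable_gaussianMean v hψ
  set U1 : Ω → ℝ := fun ω => ∑ i ∈ Finset.range n, (ψ (X i ω) - gaussianMean v ψ (Z i ω)) with hU1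
  set U2 : Ω → ℝ := fun ω => ∑ i ∈ Finset.range n, (gaussianMean v ψ (Z i ω) -
    h * smoothedDensity K h x) with hU2
  have hU1m : Measurable U1 := Finset.measurable_fun_sum _ fun i _ =>
    (hψ.comp (hD.measurable i)).sub (hZm.comp (hD.measurable_pred i))
  -- The two parts are dependent. They are decoupled by `a b ≤ (a² + b²) / 2`, at the price of
  -- doubling `t`.
  have hpt : ∀ ω, Real.exp (t * (kernelSum K X n h x ω - n * h * smoothedDensity K h x)) ≤
      1 / 2 * Real.exp (2 * t * U1 ω) + 1 / 2 * Real.exp (2 * t * U2 ω) := by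
    intro ω
    have e1 : kernelSum K X n h x ω - n * h * smoothedDensity K h x = U1 ω + U2 ω := by
      simp only [hU1, hU2, kernelSum, Finset.sum_sub_distrib, Finset.sum_const, Finset.card_range,
        nsmul_eq_mul, hψdef]
      ring
    rw [e1]
    have e2 : Real.exp (2 * t * U1 ω) = Real.exp (t * U1 ω) ^ 2 := by
      rw [← Real.exp_nat_mul]; congr 1; push_cast; ring
    have e3 : Real.exp (2 * t * U2 ω) = Real.exp (t * U2 ω) ^ 2 := by
      rw [← Real.exp_nat_mul]; congr 1; push_cast; ring
    rw [mul_add, Real.exp_add, e2, e3]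
    nlinarith [sq_nonneg (Real.exp (t * U1 ω) - Real.exp (t * U2 ω))]
  calc _ ≤ ∫⁻ ω, (ENNReal.ofReal (1 / 2) * ENNReal.ofReal (Real.exp (2 * t * U1 ω)) +
        ENNReal.ofReal (1 / 2) * ENNReal.ofReal (Real.exp (2 * t * U2 ω))) ∂μ := by
        refine lintegral_mono fun ω => ?_
        rw [← ENNReal.ofReal_mul (by norm_num), ← ENNReal.ofReal_mul (by norm_num),
          ← ENNReal.ofReal_add (by positivity) (by positivity)]
        exact ENNReal.ofReal_le_ofReal (hpt ω)
    _ = ENNReal.ofReal (1 / 2) * ∫⁻ ω, ENNReal.ofReal (Real.exp (2 * t * U1 ω)) ∂μ +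
        ENNReal.ofReal (1 / 2) * ∫⁻ ω, ENNReal.ofReal (Real.exp (2 * t * U2 ω)) ∂μ := by
        rw [lintegral_add_left (by fun_prop), lintegral_const_mul' _ _ ENNReal.ofReal_ne_top,
          lintegral_const_mul' _ _ ENNReal.ofReal_ne_top]
    _ ≤ ENNReal.ofReal (1 / 2) * ENNReal.ofReal E + ENNReal.ofReal (1 / 2) * ENNReal.ofReal E := by
        gcongr
        · exact b1.trans (ENNReal.ofReal_le_ofReal k1)
        · exact b2.trans (ENNReal.ofReal_le_ofReal k2)
    _ = ENNReal.ofReal E := by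
        rw [← ENNReal.ofReal_mul (by norm_num), ← ENNReal.ofReal_add (by positivity) (by positivity)]
        congr 1; ring

-- As `h ≤ 1` and `a > 0`, one has `h ^ 2 ≤ h ^ (2 - a)`. The variance proxy then gains a power over
-- `(n h) ^ 2` however long the memory.
omit hD hK hcov [IsProbabilityMeasure μ] in
lemma _root_.sq_mul_rpow_two_sub_le {n h : ℝ} (hn : 0 < n) (hh : 0 < h) (hh1 : h ≤ 1)
    (hN : 1 ≤ n * h) (ha : a ∈ Set.Ioo (0 : ℝ) 1) :
    n * h + h ^ 2 * n ^ (2 - a) ≤ 2 * (n * h) ^ (2 - a) := by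
  have h0 : 0 < n * h := by positivity
  have h1 : n * h ≤ (n * h) ^ (2 - a) := by
    conv_lhs => rw [← Real.rpow_one (n * h)]
    exact Real.rpow_le_rpow_of_exponent_le hN (by linarith [ha.2])
  have h2 : h ^ 2 * n ^ (2 - a) ≤ (n * h) ^ (2 - a) := by
    rw [Real.mul_rpow hn.le hh.le, mul_comm]
    refine mul_le_mul_of_nonneg_left ?_ (by positivity)
    rw [← Real.rpow_two]
    exact Real.rpow_le_rpow_of_exponent_ge hh hh1 (by linarith [ha.1])
  linarith

/-- The density estimator is close to its mean with high probability. -/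
lemma exists_measureReal_kernelSum_le (ha : a ∈ Set.Ioo (0 : ℝ) 1) :
    ∃ (C : ℝ) (p : ℕ), 0 < C ∧ ∀ (x h : ℝ) (n : ℕ), 0 < h → h ≤ 1 → 1 ≤ n * h →
      μ.real {ω | (n * h : ℝ) ^ (-(a / 4)) * (n * h * smoothedDensity K h x) ≤
        |kernelSum K X n h x ω - n * h * smoothedDensity K h x|} ≤
      C / gaussianPDFReal 0 1 x ^ p / (n * h) ^ 4 := by
  obtain ⟨C, hC1, hmgf⟩ := hD.exists_mgf_kernelSum_le hK hcov
  -- This makes `(N ^ (a / 2)) ^ k` at least `N ^ 4`.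
  obtain ⟨k, hk⟩ := exists_nat_ge (8 / a)
  have ha0 := ha.1
  set e0 := Real.exp (-kappa2 K / 2) with he0
  have he0p : 0 < e0 := Real.exp_pos _
  refine ⟨2 * (k.factorial / (e0 ^ 2 / (8 * C)) ^ k), 2 * k, by positivity,
    fun x h n hh hh1 hN => ?_⟩
  have hφ := gaussianPDFReal_pos 0 1 x one_ne_zero
  have hg1 := hK.smoothedDensity_ge (h := h) (by rwa [abs_of_pos hh]) x
  have hg2 := hK.smoothedDensity_le_one h x
  set g := smoothedDensity K h x
  set N : ℝ := n * h with hNdef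
  have hN0 : 0 < N := by linarith
  have hn0 : 0 < (n : ℝ) := by
    rcases Nat.eq_zero_or_pos n with h0 | h0
    · subst h0; simp [hNdef] at hN; linarith
    · exact_mod_cast h0
  have hg0 : 0 < g := lt_of_lt_of_le (by positivity) hg1
  have hV := sq_mul_rpow_two_sub_le hn0 hh hh1 hN ha
  rw [← hNdef] at hV
  have hVp : 0 < C * (2 * N ^ (2 - a)) := by positivity
  have hδ1 : N ^ (-(a / 4)) ≤ 1 := Real.rpow_le_one_of_one_le_of_nonpos hN (by linarith)
  have hcond : N ^ (-(a / 4)) * (N * g) / (2 * (C * (2 * N ^ (2 - a)))) ≤ 1 / C := by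
    rw [div_le_div_iff₀ (by positivity) (by positivity)]
    have h1 : N ≤ N ^ (2 - a) := by
      conv_lhs => rw [← Real.rpow_one N]
      exact Real.rpow_le_rpow_of_exponent_le hN (by linarith [ha.2])
    have h2 : N ^ (-(a / 4)) * (N * g) ≤ N :=
      calc N ^ (-(a / 4)) * (N * g) ≤ 1 * (N * 1) := by gcongr
        _ = N := by ring
    have h3 : N ^ (-(a / 4)) * (N * g) * C ≤ N ^ (2 - a) * C := by gcongr; linarith
    have : 0 ≤ N ^ (2 - a) * C := by positivity
    linarith
  have key := measureReal_le_abs_le_of_mgf_le (μ := μ)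
    (U := fun ω => kernelSum K X n h x ω - N * g) hVp
    (hD.integrable_exp_kernelSum hK n h x (N * g)) (T := 1 / C) (fun t ht =>
      (hmgf x h n t hh ht).trans (by
        rw [Real.exp_le_exp]
        gcongr)) (u := N ^ (-(a / 4)) * (N * g)) (by positivity) hcond
  refine key.trans ?_
  -- The tolerance `N ^ (-(a / 4))` costs a factor `N ^ (-(a / 2))` in the exponent, against the
  -- gain `N ^ a` from the variance proxy; a growing `N ^ (a / 2)` remains.
  have e1 : (N ^ (-(a / 4)) * (N * g)) ^ 2 / (4 * (C * (2 * N ^ (2 - a)))) =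
      g ^ 2 / (8 * C) * N ^ (a / 2) := by
    have : (N ^ (-(a / 4))) ^ 2 * N ^ 2 = N ^ (a / 2) * N ^ (2 - a) := by
      rw [← Real.rpow_natCast, ← Real.rpow_mul hN0.le, ← Real.rpow_two, ← Real.rpow_add hN0,
        ← Real.rpow_add hN0]
      congr 1
      push_cast; ring
    have h4 : N ^ (2 - a) ≠ 0 := by positivity
    rw [mul_pow, mul_pow, ← mul_assoc, this]
    field_simp
    ring
  rw [e1]
  have hmono : e0 ^ 2 / (8 * C) * gaussianPDFReal 0 1 x ^ 2 * N ^ (a / 2) ≤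
      g ^ 2 / (8 * C) * N ^ (a / 2) := by
    have : (e0 * gaussianPDFReal 0 1 x) ^ 2 ≤ g ^ 2 := pow_le_pow_left₀ (by positivity) hg1 2
    rw [mul_pow] at this
    have h8 : e0 ^ 2 / (8 * C) * gaussianPDFReal 0 1 x ^ 2 =
      e0 ^ 2 * gaussianPDFReal 0 1 x ^ 2 / (8 * C) := by ring
    rw [h8]
    gcongr
  have h5 := exp_neg_le_factorial_div (k := k)
    (y := e0 ^ 2 / (8 * C) * gaussianPDFReal 0 1 x ^ 2 * N ^ (a / 2)) (by positivity)
  have h6 : N ^ 4 ≤ (N ^ (a / 2)) ^ k := by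
    rw [← Real.rpow_natCast, ← Real.rpow_natCast, ← Real.rpow_mul hN0.le]
    refine Real.rpow_le_rpow_of_exponent_le hN ?_
    rw [div_le_iff₀ ha0] at hk
    push_cast
    linarith
  calc 2 * Real.exp (-(g ^ 2 / (8 * C) * N ^ (a / 2)))
      ≤ 2 * Real.exp (-(e0 ^ 2 / (8 * C) * gaussianPDFReal 0 1 x ^ 2 * N ^ (a / 2))) := by gcongr
    _ ≤ 2 * (k.factorial / (e0 ^ 2 / (8 * C) * gaussianPDFReal 0 1 x ^ 2 * N ^ (a / 2)) ^ k) := by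
        gcongr
    _ = 2 * (k.factorial / (e0 ^ 2 / (8 * C)) ^ k) / gaussianPDFReal 0 1 x ^ (2 * k) /
        (N ^ (a / 2)) ^ k := by
        rw [mul_pow, mul_pow, ← pow_mul]
        field_simp
    _ ≤ _ := by gcongr

/-- The fourth moment of the density estimator is bounded. -/
lemma exists_integral_kernelSum_pow_four_le (ha : a ∈ Set.Ioo (0 : ℝ) 1) :
    ∃ C : ℝ, 0 < C ∧ ∀ (x h : ℝ) (n : ℕ), 0 < h → h ≤ 1 → 1 ≤ n * h →
      ∫ ω, (kernelSum K X n h x ω / (n * h)) ^ 4 ∂μ ≤ C := by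
  obtain ⟨C, hC1, hmgf⟩ := hD.exists_mgf_kernelSum_le hK hcov
  obtain ⟨M, hM0, hM⟩ := hK.exists_pos_bound
  refine ⟨24 * C ^ 4 * Real.exp (1 + 2), by positivity, fun x h n hh hh1 hN => ?_⟩
  have hg2 := hK.smoothedDensity_le_one h x
  set g := smoothedDensity K h x
  set N : ℝ := n * h with hNdef
  have hN0 : 0 < N := by linarith
  have hn0 : 0 < (n : ℝ) := by
    rcases Nat.eq_zero_or_pos n with h0 | h0
    · subst h0; simp [hNdef] at hN; linarith
    · exact_mod_cast h0
  have hV := sq_mul_rpow_two_sub_le hn0 hh hh1 hN ha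
  rw [← hNdef] at hV
  -- At this scale the exponential moment stays bounded while `exp (t * S)` still dominates `(S / N)
  -- ^ 4` up to a constant.
  set t := 1 / (C * N) with ht
  have ht0 : 0 < t := by positivity
  have htC : |t| ≤ 1 / C := by
    rw [abs_of_pos ht0, ht]
    exact one_div_le_one_div_of_le (by linarith) (le_mul_of_one_le_right (by linarith) hN)
  have hpt : ∀ ω, (kernelSum K X n h x ω / N) ^ 4 ≤
      24 * C ^ 4 * Real.exp (t * (kernelSum K X n h x ω - N * g)) * Real.exp 1 := by
    intro ω
    have hS := hK.kernelSum_nonneg X n h x ω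
    have h1 := Real.pow_div_factorial_le_exp (t * kernelSum K X n h x ω) (by positivity) 4
    have h2 : Real.exp (t * kernelSum K X n h x ω) ≤
        Real.exp (t * (kernelSum K X n h x ω - N * g)) * Real.exp 1 := by
      rw [← Real.exp_add, Real.exp_le_exp]
      have : t * (N * g) ≤ 1 := by
        rw [ht]
        have : 1 / (C * N) * (N * g) = g / C := by field_simp
        rw [this, div_le_one (by linarith)]
        linarith
      nlinarith
    have h3 : (t * kernelSum K X n h x ω) ^ 4 = (kernelSum K X n h x ω / N) ^ 4 / C ^ 4 := by
      rw [ht]; field_simp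
    rw [h3] at h1
    have h4 : (Nat.factorial 4 : ℝ) = 24 := by norm_num [Nat.factorial]
    rw [h4] at h1
    have h5 : (kernelSum K X n h x ω / N) ^ 4 =
      24 * C ^ 4 * ((kernelSum K X n h x ω / N) ^ 4 / C ^ 4 / 24) := by field_simp
    rw [h5, mul_assoc (24 * C ^ 4)]
    exact mul_le_mul_of_nonneg_left (h1.trans h2) (by positivity)
  have hm := hD.measurable_kernelSum hK n h x
  have hi2 := ((hD.integrable_exp_kernelSum hK n h x (N * g) t).const_mul
    (24 * C ^ 4)).mul_const (Real.exp 1)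
  have hi1 : Integrable (fun ω => (kernelSum K X n h x ω / N) ^ 4) μ :=
    hi2.mono' (by fun_prop : Measurable _).aestronglyMeasurable (ae_of_all _ fun ω => by
      rw [Real.norm_eq_abs, abs_of_nonneg (by positivity)]; exact hpt ω)
  refine (integral_mono hi1 hi2 hpt).trans ?_
  rw [integral_mul_const, integral_const_mul, add_comm (1 : ℝ), Real.exp_add]
  have h6 : ∫ ω, Real.exp (t * (kernelSum K X n h x ω - N * g)) ∂μ ≤ Real.exp 2 := by
    refine (hmgf x h n t hh htC).trans ?_
    rw [Real.exp_le_exp]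
    have hNN : N ^ (2 - a) ≤ N ^ 2 := by
      rw [← Real.rpow_two]
      exact Real.rpow_le_rpow_of_exponent_le hN (by linarith [ha.1])
    calc t ^ 2 * (C * (N + h ^ 2 * (n : ℝ) ^ (2 - a))) ≤ t ^ 2 * (C * (2 * N ^ 2)) := by
          gcongr; linarith
      _ = 2 / C := by rw [ht]; field_simp
      _ ≤ 2 := by rw [div_le_iff₀ (by linarith)]; linarith
  calc _ ≤ 24 * C ^ 4 * Real.exp 2 * Real.exp 1 := by gcongr
    _ = _ := by ring

end GaussianDecomposition

/-! ### Quadratic forms of the error covariances. -/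

section QuadForm

variable {Ω' : Type*} [MeasurableSpace Ω'] {μ' : Measure Ω'} {e : ℕ → Ω' → ℝ}

/-- The mean square of the linear combination of `e 0, …, e (n - 1)` with weights `u`. -/
noncomputable def quadForm (μ' : Measure Ω') (e : ℕ → Ω' → ℝ) (n : ℕ) (u : ℕ → ℝ) : ℝ :=
  ∫ ω, (∑ i ∈ Finset.range n, u i * e i ω) ^ 2 ∂μ'

lemma quadForm_nonneg (n : ℕ) (u : ℕ → ℝ) : 0 ≤ quadForm μ' e n u :=
  integral_nonneg fun _ => sq_nonneg _

lemma quadForm_const_mul (n : ℕ) (t : ℝ) (u : ℕ → ℝ) :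
    quadForm μ' e n (fun i => t * u i) = t ^ 2 * quadForm μ' e n u := by
  simp only [quadForm, mul_assoc, ← Finset.mul_sum, mul_pow, integral_const_mul]

variable (he : ∀ i, MemLp (e i) 2 μ')

include he

lemma quadForm_eq_sum (n : ℕ) (u : ℕ → ℝ) : quadForm μ' e n u =
    ∑ i ∈ Finset.range n, ∑ j ∈ Finset.range n, (∫ ω, e i ω * e j ω ∂μ') * (u i * u j) := by
  have hee : ∀ i j, Integrable (fun ω => e i ω * e j ω * (u i * u j)) μ' := fun i j =>
    ((he i).integrable_mul (he j)).mul_const _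
  have e1 : ∀ ω, (∑ i ∈ Finset.range n, u i * e i ω) ^ 2 =
      ∑ i ∈ Finset.range n, ∑ j ∈ Finset.range n, e i ω * e j ω * (u i * u j) := fun ω => by
    rw [pow_two, Finset.sum_mul_sum]
    exact Finset.sum_congr rfl fun i _ => Finset.sum_congr rfl fun j _ => by ring
  simp_rw [quadForm, e1]
  rw [integral_finsetSum _ fun i _ => integrable_finsetSum _ fun j _ => hee i j]
  refine Finset.sum_congr rfl fun i _ => ?_
  rw [integral_finsetSum _ fun j _ => hee i j]
  exact Finset.sum_congr rfl fun j _ => integral_mul_const _ _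

/-- Young's inequality `2 A B ≤ s A² + B² / s`. The parameter stays free: it is finally chosen to
tend to zero with the covariance sums. -/
lemma abs_quadForm_add_sub_le (n : ℕ) (u w : ℕ → ℝ) {s : ℝ} (hs : 0 < s) :
    |quadForm μ' e n (fun i => u i + w i) - quadForm μ' e n u| ≤
      s * quadForm μ' e n u + (1 + 1 / s) * quadForm μ' e n w := by
  have hL : ∀ u : ℕ → ℝ, MemLp (fun ω => ∑ i ∈ Finset.range n, u i * e i ω) 2 μ' := fun u =>
    memLp_finsetSum _ fun i _ => (he i).const_mul _
  simp only [quadForm]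
  rw [← integral_sub (hL _).integrable_sq (hL _).integrable_sq, ← integral_const_mul,
    ← integral_const_mul, ← integral_add ((hL _).integrable_sq.const_mul _)
      ((hL _).integrable_sq.const_mul _)]
  refine (abs_integral_le_integral_abs).trans (integral_mono
    ((hL _).integrable_sq.sub (hL _).integrable_sq).abs
    (((hL _).integrable_sq.const_mul _).add ((hL _).integrable_sq.const_mul _)) fun ω => ?_)
  simp only [add_mul, Finset.sum_add_distrib]
  set A := ∑ i ∈ Finset.range n, u i * e i ω
  set B := ∑ i ∈ Finset.range n, w i * e i ω
  have h0 : 1 / s * B ^ 2 = s * (B / s) ^ 2 := by field_simp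
  have h1 : 2 * A * B = 2 * s * (A * (B / s)) := by field_simp
  have h2 : (A + B) ^ 2 - A ^ 2 = 2 * A * B + B ^ 2 := by ring
  rw [h2, h0, h1, abs_le]
  constructor <;> nlinarith [mul_nonneg hs.le (sq_nonneg (A - B / s)),
    mul_nonneg hs.le (sq_nonneg (A + B / s)), sq_nonneg B]

lemma abs_integral_mul_le_one (he1 : ∀ i, ∫ ω, e i ω ^ 2 ∂μ' = 1) (i j : ℕ) :
    |∫ ω, e i ω * e j ω ∂μ'| ≤ 1 := by
  have h1 := (he i).integrable_sq
  have h2 := (he j).integrable_sq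
  calc |∫ ω, e i ω * e j ω ∂μ'| ≤ ∫ ω, |e i ω * e j ω| ∂μ' := abs_integral_le_integral_abs
    _ ≤ ∫ ω, (1 / 2 * e i ω ^ 2 + 1 / 2 * e j ω ^ 2) ∂μ' := by
        refine integral_mono ((he i).integrable_mul (he j)).abs
          ((h1.const_mul _).add (h2.const_mul _)) fun ω => ?_
        rw [abs_le]
        constructor <;> nlinarith [sq_nonneg (e i ω + e j ω), sq_nonneg (e i ω - e j ω)]
    _ = 1 := by
        rw [integral_add (h1.const_mul _) (h2.const_mul _), integral_const_mul, integral_const_mul,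
          he1, he1]
        norm_num

/-- Correlations of unit variance variables are at most `1`. For the local weights this bounds the
conditional variance by `1` on every event. -/
lemma quadForm_le_sq_sum (he1 : ∀ i, ∫ ω, e i ω ^ 2 ∂μ' = 1) (n : ℕ) {u : ℕ → ℝ}
    (hu : ∀ i, 0 ≤ u i) : quadForm μ' e n u ≤ (∑ i ∈ Finset.range n, u i) ^ 2 := by
  rw [quadForm_eq_sum he, pow_two, Finset.sum_mul_sum]
  refine Finset.sum_le_sum fun i _ => Finset.sum_le_sum fun j _ => ?_
  have := (abs_le.1 (abs_integral_mul_le_one he he1 i j)).2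
  exact mul_le_of_le_one_left (mul_nonneg (hu i) (hu j)) this

variable {Ω : Type*} [MeasurableSpace Ω] {μ : Measure Ω}

lemma integrable_quadForm (n : ℕ) {u : ℕ → Ω → ℝ} (hu : ∀ i, MemLp (u i) 2 μ) :
    Integrable (fun ω => quadForm μ' e n (fun i => u i ω)) μ := by
  simp_rw [quadForm_eq_sum he]
  exact integrable_finsetSum _ fun i _ => integrable_finsetSum _ fun j _ =>
    ((hu i).integrable_mul (hu j)).const_mul _

lemma integral_quadForm (n : ℕ) {u : ℕ → Ω → ℝ} (hu : ∀ i, MemLp (u i) 2 μ) :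
    ∫ ω, quadForm μ' e n (fun i => u i ω) ∂μ =
      ∑ i ∈ Finset.range n, ∑ j ∈ Finset.range n, (∫ ω, e i ω * e j ω ∂μ') *
        ∫ ω, u i ω * u j ω ∂μ := by
  have h : ∀ i j, Integrable (fun ω => (∫ ω, e i ω * e j ω ∂μ') * (u i ω * u j ω)) μ := fun i j =>
    ((hu i).integrable_mul (hu j)).const_mul _
  simp_rw [quadForm_eq_sum he]
  rw [integral_finsetSum _ fun i _ => integrable_finsetSum _ fun j _ => h i j]
  refine Finset.sum_congr rfl fun i _ => ?_
  rw [integral_finsetSum _ fun j _ => h i j]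
  exact Finset.sum_congr rfl fun j _ => integral_const_mul _ _

/-- Centered summands may be split off from a constant. -/
lemma integral_quadForm_add_const [IsProbabilityMeasure μ] (n : ℕ) {u : ℕ → Ω → ℝ}
    (hu : ∀ i, MemLp (u i) 2 μ) (hu0 : ∀ i, ∫ ω, u i ω ∂μ = 0) (t : ℝ) :
    ∫ ω, quadForm μ' e n (fun i => u i ω + t) ∂μ =
      ∫ ω, quadForm μ' e n (fun i => u i ω) ∂μ + t ^ 2 * quadForm μ' e n (fun _ => 1) := by
  have hi : ∀ i, Integrable (u i) μ := fun i => (hu i).integrable (by norm_num)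
  rw [integral_quadForm he n (u := fun i ω => u i ω + t) fun i => (hu i).add (memLp_const t),
    integral_quadForm he n hu,
    quadForm_eq_sum he, Finset.mul_sum, ← Finset.sum_add_distrib]
  refine Finset.sum_congr rfl fun i _ => ?_
  rw [Finset.mul_sum, ← Finset.sum_add_distrib]
  refine Finset.sum_congr rfl fun j _ => ?_
  have e1 : ∀ ω, (u i ω + t) * (u j ω + t) = u i ω * u j ω + (t * u i ω + (t * u j ω + t ^ 2)) :=
    fun ω => by ring
  have h1 : ∫ ω, (u i ω + t) * (u j ω + t) ∂μ = ∫ ω, u i ω * u j ω ∂μ + t ^ 2 := by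
    simp_rw [e1]
    have k0 : Integrable (fun ω => u i ω * u j ω) μ := (hu i).integrable_mul (hu j)
    have k1 : Integrable (fun ω => t * u j ω + t ^ 2) μ :=
      ((hi j).const_mul t).add (integrable_const _)
    have k2 : Integrable (fun ω => t * u i ω + (t * u j ω + t ^ 2)) μ := ((hi i).const_mul t).add k1
    rw [integral_add k0 k2, integral_add ((hi i).const_mul t) k1, integral_add ((hi j).const_mul t)
      (integrable_const _), integral_const_mul, integral_const_mul, hu0, hu0]
    simp
  rw [h1]
  ring

end QuadForm

namespace GaussianDecomposition

variable {Ω : Type*} [MeasurableSpace Ω] {μ : Measure Ω} [IsProbabilityMeasure μ]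
  {X Z ζ : ℕ → Ω → ℝ} {v : ℝ≥0}

/-- The second order behaviour of the sums `∑ e i * ψ (X i)` with independent weights. -/
lemma abs_integral_quadForm_sub_le (hD : GaussianDecomposition μ X Z ζ v) {ψ G' : ℝ → ℝ}
    (hψ : Measurable ψ) (h2 : MemLp ψ 2 (gaussianReal 0 1))
    (hG : ∀ x, HasDerivAt (gaussianMean v ψ) (G' x) x) (hG' : Continuous G') {M L : ℝ}
    (hM : ∀ x, |gaussianMean v ψ x| ≤ M) (hL : ∀ x, |G' x| ≤ L)
    {Ω' : Type*} [MeasurableSpace Ω'] {μ' : Measure Ω'}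
    {e : ℕ → Ω' → ℝ} (he : ∀ i, MemLp (e i) 2 μ') (he1 : ∀ i, ∫ ω, e i ω ^ 2 ∂μ' = 1) (n : ℕ)
    {s : ℝ} (hs : 0 < s) :
    |∫ ω, quadForm μ' e n (fun i => ψ (X i ω) - ∫ y, ψ y ∂gaussianReal 0 1) ∂μ -
      n * ∫ y, ψ y ^ 2 ∂gaussianReal 0 1| ≤
    n * M ^ 2 + s * (n * ∫ y, ψ y ^ 2 ∂gaussianReal 0 1) + (1 + 1 / s) *
      (Real.pi ^ 2 / 8 * L ^ 2 * ∑ i ∈ Finset.range n, ∑ j ∈ Finset.range n,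
        |∫ ω, e i ω * e j ω ∂μ'| * |∫ ω, Z i ω * Z j ω ∂μ|) := by
  set E := ∫ y, ψ y ∂gaussianReal 0 1 with hE
  set S := ∫ y, ψ y ^ 2 ∂gaussianReal 0 1 with hS
  have hZm := measurable_gaussianMean v hψ
  have h1 : Integrable ψ (gaussianReal 0 1) := h2.integrable (by norm_num)
  have hΨ : ∀ i, MemLp (fun ω => gaussianMean v ψ (Z i ω)) 2 μ := fun i =>
    MemLp.of_bound (hZm.comp (hD.measurable_pred i)).aestronglyMeasurable M
      (ae_of_all _ fun ω => hM _)
  have hΨi : ∀ i, ∫ ω, gaussianMean v ψ (Z i ω) ∂μ = E := fun i => hD.integral_gaussianMean i hψ h1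
  have hξ := hD.memLp_sub_gaussianMean hψ h2 hM
  have hg : ∀ i, MemLp (fun ω => gaussianMean v ψ (Z i ω) - E) 2 μ := fun i =>
    (hΨ i).sub (memLp_const E)
  -- Off the diagonal, orthogonality of the martingale differences kills every term whatever the
  -- correlations of `e`; on it, `he1` makes the coefficients `1`.
  have q1 : ∫ ω, quadForm μ' e n (fun i => ψ (X i ω) - gaussianMean v ψ (Z i ω)) ∂μ =
      ∑ i ∈ Finset.range n, (S - ∫ ω, gaussianMean v ψ (Z i ω) ^ 2 ∂μ) := by
    rw [integral_quadForm he n hξ]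
    refine Finset.sum_congr rfl fun i hi => ?_
    rw [Finset.sum_eq_single_of_mem i hi fun j _ hj => by
      rw [hD.integral_mul_sub_gaussianMean hψ h2 hM hj.symm, mul_zero]]
    simp_rw [← pow_two]
    rw [he1, one_mul, hD.integral_sub_gaussianMean_sq hψ h2 hM i]
  -- The long memory part: centering turns mixed moments into covariances, to which the Gaussian
  -- comparison applies.
  have q2 : ∫ ω, quadForm μ' e n (fun i => gaussianMean v ψ (Z i ω) - E) ∂μ ≤
      Real.pi ^ 2 / 8 * L ^ 2 * ∑ i ∈ Finset.range n, ∑ j ∈ Finset.range n,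
        |∫ ω, e i ω * e j ω ∂μ'| * |∫ ω, Z i ω * Z j ω ∂μ| := by
    rw [integral_quadForm he n hg]
    refine le_trans (le_of_eq ?_) (hD.sum_gram_mul_covariance_le hG hG' hM hL he n)
    refine Finset.sum_congr rfl fun i _ => Finset.sum_congr rfl fun j _ => ?_
    congr 1
    have i0 : Integrable (fun ω => gaussianMean v ψ (Z i ω) * gaussianMean v ψ (Z j ω)) μ :=
      (hΨ i).integrable_mul (hΨ j)
    have i1 : ∀ i, Integrable (fun ω => gaussianMean v ψ (Z i ω)) μ := fun i =>
      (hΨ i).integrable (by norm_num)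
    have e1 : ∀ ω, (gaussianMean v ψ (Z i ω) - E) * (gaussianMean v ψ (Z j ω) - E) =
        gaussianMean v ψ (Z i ω) * gaussianMean v ψ (Z j ω) -
          (E * gaussianMean v ψ (Z i ω) + (E * gaussianMean v ψ (Z j ω) - E ^ 2)) :=
      fun ω => by ring
    simp_rw [e1]
    have k1 : Integrable (fun ω => E * gaussianMean v ψ (Z j ω) - E ^ 2) μ :=
      ((i1 j).const_mul E).sub (integrable_const _)
    have k2 : Integrable (fun ω => E * gaussianMean v ψ (Z i ω) +
        (E * gaussianMean v ψ (Z j ω) - E ^ 2)) μ := ((i1 i).const_mul E).add k1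
    rw [integral_sub i0 k2, integral_add ((i1 i).const_mul E) k1, integral_sub ((i1 j).const_mul E) (integrable_const _), integral_const_mul,
      integral_const_mul, hΨi, hΨi]
    simp
    ring
  have b1 : 0 ≤ ∑ i ∈ Finset.range n, ∫ ω, gaussianMean v ψ (Z i ω) ^ 2 ∂μ :=
    Finset.sum_nonneg fun i _ => integral_nonneg fun ω => sq_nonneg _
  have b2 : ∑ i ∈ Finset.range n, ∫ ω, gaussianMean v ψ (Z i ω) ^ 2 ∂μ ≤ n * M ^ 2 := by
    calc _ ≤ ∑ i ∈ Finset.range n, M ^ 2 := by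
          refine Finset.sum_le_sum fun i _ => ?_
          refine (integral_mono (hΨ i).integrable_sq (integrable_const (M ^ 2)) fun ω => ?_).trans
            (by simp)
          exact (sq_abs (gaussianMean v ψ (Z i ω))).symm.trans_le
            (pow_le_pow_left₀ (abs_nonneg _) (hM _) 2)
      _ = _ := by simp
  have q1' : ∫ ω, quadForm μ' e n (fun i => ψ (X i ω) - gaussianMean v ψ (Z i ω)) ∂μ =
      n * S - ∑ i ∈ Finset.range n, ∫ ω, gaussianMean v ψ (Z i ω) ^ 2 ∂μ := by
    rw [q1, Finset.sum_sub_distrib]; simp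
  have q3 : |∫ ω, quadForm μ' e n (fun i => ψ (X i ω) - E) ∂μ -
      ∫ ω, quadForm μ' e n (fun i => ψ (X i ω) - gaussianMean v ψ (Z i ω)) ∂μ| ≤
      s * ∫ ω, quadForm μ' e n (fun i => ψ (X i ω) - gaussianMean v ψ (Z i ω)) ∂μ +
      (1 + 1 / s) * ∫ ω, quadForm μ' e n (fun i => gaussianMean v ψ (Z i ω) - E) ∂μ := by
    have j1 := integrable_quadForm he n hξ
    have j2 := integrable_quadForm he n hg
    have j3 := integrable_quadForm he n (u := fun i ω => ψ (X i ω) - E) fun i => (hD.memLp_comp i h2).sub (memLp_const E)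
    have e3 : ∀ ω, quadForm μ' e n (fun i => ψ (X i ω) - E) = quadForm μ' e n
        (fun i => (ψ (X i ω) - gaussianMean v ψ (Z i ω)) + (gaussianMean v ψ (Z i ω) - E)) := by
      intro ω
      congr 1
      ext i
      ring
    rw [← integral_sub j3 j1, ← integral_const_mul, ← integral_const_mul,
      ← integral_add (j1.const_mul _) (j2.const_mul _)]
    refine (abs_integral_le_integral_abs).trans (integral_mono (j3.sub j1).abs
      ((j1.const_mul _).add (j2.const_mul _)) fun ω => ?_)
    rw [e3]
    exact abs_quadForm_add_sub_le he n _ _ hs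
  rw [q1'] at q3
  have q4 := mul_le_mul_of_nonneg_left q2 (by positivity : 0 ≤ 1 + 1 / s)
  have q5 := mul_nonneg hs.le b1
  rw [abs_le] at q3 ⊢
  constructor <;> nlinarith [q3.1, q3.2]

end GaussianDecomposition

/-! ### Independence of errors and predictors. -/

section Independence

variable {Ω : Type*} [MeasurableSpace Ω] {μ : Measure Ω}

/-- A linear process is a function of its innovations. -/
lemma IsLinearProcess.indepFun {c : ℕ → ℝ} {η : ℤ → Ω → ℝ} {ε : ℕ → Ω → ℝ}
    (hε : IsLinearProcess μ c η ε) {E : Type*} [MeasurableSpace E] {U : Ω → E}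
    (hU : IndepFun U (fun ω j => η j ω) μ) : IndepFun U (fun ω i => ε (i + 1) ω) μ := by
  have hη : Measurable fun ω j => η j ω := measurable_pi_lambda _ hε.measurable_innov
  have key : ∀ i : ℕ, ∃ g : (ℤ → ℝ) → ℝ, Measurable g ∧
      (fun ω => g fun j => η j ω) =ᵐ[μ] ε (i + 1) := by
    intro i
    let P : ℕ → (ℤ → ℝ) → ℝ := fun N y => ∑ k ∈ Finset.range N, c k * y (((i + 1 : ℕ) : ℤ) - k)
    have hP : ∀ N, Measurable (P N) := fun N => by fun_prop
    have hPη : ∀ N, Measurable fun ω => P N fun j => η j ω := fun N => (hP N).comp hη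
    have h1 : TendstoInMeasure μ (fun N ω => P N fun j => η j ω) atTop (ε (i + 1)) := by
      refine tendstoInMeasure_of_tendsto_eLpNorm two_ne_zero
        (fun N => (hPη N).aestronglyMeasurable) (hε.measurable_proc _).aestronglyMeasurable ?_
      have := hε.series (i + 1) (by lia)
      refine this.congr fun N => ?_
      rw [← eLpNorm_neg]
      congr 1
      ext ω
      simp [P]
    -- Along a subsequence the partial sums converge almost surely. The limit can be taken on the
    -- space of innovation paths, which yields a measurable function of the innovations equal to the
    -- error almost surely.
    obtain ⟨ns, -, hns⟩ := h1.exists_seq_tendsto_ae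
    have h2 : ∀ᵐ y ∂(μ.map fun ω j => η j ω), ∃ l, Tendsto (fun k => P (ns k) y) atTop (𝓝 l) := by
      rw [ae_map_iff hη.aemeasurable (measurableSet_exists_tendsto fun k => hP _)]
      filter_upwards [hns] with ω hω using ⟨_, hω⟩
    obtain ⟨g, hg, hlim⟩ := measurable_limit_of_tendsto_metrizable_ae
      (fun k => (hP (ns k)).aemeasurable) h2
    refine ⟨g, hg, ?_⟩
    filter_upwards [hns, ae_of_ae_map hη.aemeasurable hlim] with ω h3 h4
    exact tendsto_nhds_unique h4 h3
  choose g hg hgε using key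
  have h3 : IndepFun U (fun ω i => g i fun j => η j ω) μ :=
    hU.comp (φ := id) (ψ := fun y i => g i y) measurable_id (measurable_pi_lambda _ hg)
  refine h3.congr EventuallyEq.rfl ?_
  filter_upwards [ae_all_iff.2 hgε] with ω hω
  ext i
  exact hω i

variable [IsProbabilityMeasure μ] {X ε : ℕ → Ω → ℝ}

/-- The second moment of a linear combination of the errors with weights that depend on the
predictors. -/
lemma integral_add_sum_mul_sq (hXm : ∀ i, Measurable (X i))
    (hI : IndepFun (fun ω i => X i ω) (fun ω i => ε i ω) μ) (he : ∀ i, MemLp (ε i) 2 μ)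
    (he0 : ∀ i, ∫ ω, ε i ω ∂μ = 0) {b : (ℕ → ℝ) → ℝ} (hb : Measurable b)
    (hb2 : MemLp (fun ω => b fun i => X i ω) 2 μ) {w : ℕ → (ℕ → ℝ) → ℝ}
    (hw : ∀ i, Measurable (w i)) (hw1 : ∀ i x, |w i x| ≤ 1) (n : ℕ) :
    Integrable (fun ω => ((b fun i => X i ω) +
      ∑ i ∈ Finset.range n, w i (fun i => X i ω) * ε i ω) ^ 2) μ ∧
    ∫ ω, ((b fun i => X i ω) + ∑ i ∈ Finset.range n, w i (fun i => X i ω) * ε i ω) ^ 2 ∂μ =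
      ∫ ω, (b fun i => X i ω) ^ 2 ∂μ +
        ∫ ω, quadForm μ ε n (fun i => w i fun i => X i ω) ∂μ := by
  have hX : Measurable fun ω i => X i ω := measurable_pi_lambda _ hXm
  have hwX : ∀ i, MemLp (fun ω => w i fun i => X i ω) ⊤ μ := fun i =>
    memLp_top_of_bound ((hw i).comp hX).aestronglyMeasurable 1 (ae_of_all _ fun ω => hw1 _ _)
  have hwX2 : ∀ i, MemLp (fun ω => w i fun i => X i ω) 2 μ := fun i => (hwX i).mono_exponent le_top
  have hwe : ∀ i, MemLp (fun ω => w i (fun i => X i ω) * ε i ω) 2 μ := fun i =>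
    (he i).mul' (hwX i)
  have hT : MemLp (fun ω => ∑ i ∈ Finset.range n, w i (fun i => X i ω) * ε i ω) 2 μ :=
    memLp_finsetSum _ fun i _ => hwe i
  refine ⟨(hb2.add hT).integrable_sq, ?_⟩
  have hbw : ∀ i, Integrable (fun ω => (b fun i => X i ω) * (w i (fun i => X i ω) * ε i ω)) μ :=
    fun i => hb2.integrable_mul (hwe i)
  have hww : ∀ i j, Integrable (fun ω => (w i (fun i => X i ω) * ε i ω) *
      (w j (fun i => X i ω) * ε j ω)) μ := fun i j => (hwe i).integrable_mul (hwe j)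
  -- The cross terms vanish because the errors are centered and independent of everything built from
  -- the predictors.
  have z1 : ∀ i, ∫ ω, (b fun i => X i ω) * (w i (fun i => X i ω) * ε i ω) ∂μ = 0 := by
    intro i
    have h1 : IndepFun (fun ω => (b fun i => X i ω) * w i (fun i => X i ω)) (ε i) μ :=
      hI.comp (φ := fun y => b y * w i y) (ψ := fun y : ℕ → ℝ => y i) (hb.mul (hw i))
        (measurable_pi_apply i)
    simp_rw [← mul_assoc]
    rw [h1.integral_fun_mul_eq_mul_integral
      (((hb.comp hX).mul ((hw i).comp hX)).aestronglyMeasurable) (he i).1, he0, mul_zero]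
  have z2 : ∀ i j, ∫ ω, (w i (fun i => X i ω) * ε i ω) * (w j (fun i => X i ω) * ε j ω) ∂μ =
      (∫ ω, ε i ω * ε j ω ∂μ) * ∫ ω, w i (fun i => X i ω) * w j (fun i => X i ω) ∂μ := by
    intro i j
    have h1 : IndepFun (fun ω => w i (fun i => X i ω) * w j (fun i => X i ω))
        (fun ω => ε i ω * ε j ω) μ :=
      hI.comp (φ := fun y => w i y * w j y) (ψ := fun y : ℕ → ℝ => y i * y j) ((hw i).mul (hw j))
        (by fun_prop)
    have e0 : ∀ ω, (w i (fun i => X i ω) * ε i ω) * (w j (fun i => X i ω) * ε j ω) =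
        (w i (fun i => X i ω) * w j (fun i => X i ω)) * (ε i ω * ε j ω) := fun ω => by ring
    simp_rw [e0]
    rw [h1.integral_fun_mul_eq_mul_integral
      ((((hw i).comp hX).mul ((hw j).comp hX)).aestronglyMeasurable) ((he i).1.mul (he j).1),
      mul_comm]
  have e1 : ∀ ω, ((b fun i => X i ω) + ∑ i ∈ Finset.range n, w i (fun i => X i ω) * ε i ω) ^ 2 =
      (b fun i => X i ω) ^ 2 + (2 * ∑ i ∈ Finset.range n, (b fun i => X i ω) *
        (w i (fun i => X i ω) * ε i ω) + ∑ i ∈ Finset.range n, ∑ j ∈ Finset.range n,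
        (w i (fun i => X i ω) * ε i ω) * (w j (fun i => X i ω) * ε j ω)) := by
    intro ω
    rw [← Finset.sum_mul_sum, ← Finset.mul_sum]
    ring
  have i1 : Integrable (fun ω => ∑ i ∈ Finset.range n, (b fun i => X i ω) *
        (w i (fun i => X i ω) * ε i ω)) μ := integrable_finsetSum _ fun i _ => hbw i
  have i2 : Integrable (fun ω => ∑ i ∈ Finset.range n, ∑ j ∈ Finset.range n,
        (w i (fun i => X i ω) * ε i ω) * (w j (fun i => X i ω) * ε j ω)) μ :=
    integrable_finsetSum _ fun i _ => integrable_finsetSum _ fun j _ => hww i j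
  have i3 : Integrable (fun ω => 2 * ∑ i ∈ Finset.range n, (b fun i => X i ω) *
        (w i (fun i => X i ω) * ε i ω) + ∑ i ∈ Finset.range n, ∑ j ∈ Finset.range n,
        (w i (fun i => X i ω) * ε i ω) * (w j (fun i => X i ω) * ε j ω)) μ := (i1.const_mul 2).add i2
  simp_rw [e1]
  rw [integral_add hb2.integrable_sq i3, integral_add (i1.const_mul 2) i2, integral_const_mul,
    integral_finsetSum _ fun i _ => hbw i, integral_quadForm he n hwX2,
    integral_finsetSum _ fun i _ => integrable_finsetSum _ fun j _ => hww i j]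
  simp_rw [z1, integral_finsetSum _ fun j _ => hww _ j, z2]
  simp

end Independence

lemma sum_Icc_one_eq {M : Type*} [AddCommMonoid M] (f : ℕ → M) (n : ℕ) :
    ∑ i ∈ Finset.Icc 1 n, f i = ∑ i ∈ Finset.range n, f (i + 1) := by
  induction n with
  | zero => simp
  | succ n ih => rw [Finset.sum_Icc_succ_top (by lia), ih, Finset.sum_range_succ]

/-- Meant for `ρ = N g / S`, when the kernel sum `S` is within relative error `δ` of `N g`. -/
lemma abs_sq_sub_one_le {ρ δ : ℝ} (hδ0 : 0 ≤ δ) (hδ : δ ≤ 1 / 4) (h1 : (1 - δ) * ρ ≤ 1)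
    (h2 : 1 ≤ (1 + δ) * ρ) : |ρ ^ 2 - 1| ≤ 6 * δ := by
  have hδ2 : δ * δ ≤ 1 / 4 * δ := mul_le_mul_of_nonneg_right hδ hδ0
  have h3 : ρ ≤ 1 + 4 / 3 * δ :=
    le_of_mul_le_mul_left (a := 1 - δ) (h1.trans (by nlinarith)) (by linarith)
  have h4 : 1 - δ ≤ ρ :=
    le_of_mul_le_mul_left (a := 1 + δ) (le_trans (by nlinarith) h2) (by linarith)
  have h5 : ρ ^ 2 ≤ (1 + 4 / 3 * δ) ^ 2 := pow_le_pow_left₀ (by linarith) h3 2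
  have h6 : (1 - δ) ^ 2 ≤ ρ ^ 2 := pow_le_pow_left₀ (by linarith) h4 2
  rw [abs_le]
  constructor <;> nlinarith

/-! ### Bias and variance of the estimator given the predictors, and their linearization. -/

section Decomposition

variable {Ω : Type*}

/-- The weights of the local average. -/
noncomputable def kernelWeight (K : ℝ → ℝ) (X : ℕ → Ω → ℝ) (n : ℕ) (h x : ℝ) (i : ℕ) (ω : Ω) : ℝ :=
  kernelAt K h x (X i ω) / kernelSum K X n h x ω

/-- The bias of the local average, given the predictors. -/
noncomputable def smootherBias (K m : ℝ → ℝ) (X : ℕ → Ω → ℝ) (n : ℕ) (h x : ℝ) (ω : Ω) : ℝ :=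
  ∑ i ∈ Finset.range n, kernelWeight K X n h x i ω * m (X i ω) - m x

variable {K m : ℝ → ℝ} {X ε : ℕ → Ω → ℝ}

lemma squaredError_eq {n : ℕ} {h : ℝ} (hN : (n * h : ℝ) ≠ 0) (x : ℝ) (ω : Ω) :
    squaredError K m X ε n h x ω =
      (smootherBias K m (fun i => X (i + 1)) n h x ω + ∑ i ∈ Finset.range n,
        kernelWeight K (fun i => X (i + 1)) n h x i ω * ε (i + 1) ω) ^ 2 := by
  have e1 : kernelDensityEstimator K X n h x ω =
      1 / (n * h : ℝ) * kernelSum K (fun i => X (i + 1)) n h x ω := by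
    rw [kernelDensityEstimator, sum_Icc_one_eq]
    rfl
  have e2 : nadarayaWatson K X (response m X ε) n h x ω = ∑ i ∈ Finset.range n,
      kernelWeight K (fun i => X (i + 1)) n h x i ω * (m (X (i + 1) ω) + ε (i + 1) ω) := by
    rw [nadarayaWatson, sum_Icc_one_eq, e1, Finset.mul_sum]
    refine Finset.sum_congr rfl fun i _ => ?_
    simp only [response, kernelWeight, kernelAt]
    -- Where the kernel sum vanishes, division by zero makes all weights `0`, in agreement with the
    -- value `0` prescribed for the estimator.
    rcases eq_or_ne (kernelSum K (fun i => X (i + 1)) n h x ω) 0 with h0 | h0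
    · simp [h0]
    · field_simp
      rw [mul_assoc (n * h : ℝ), mul_div_cancel_left₀ _ hN]
  rw [squaredError, e2, smootherBias]
  simp only [mul_add, Finset.sum_add_distrib]
  ring

variable (hK : IsKernel K)

include hK

lemma IsKernel.kernelWeight_nonneg (X : ℕ → Ω → ℝ) (n : ℕ) (h x : ℝ) (i : ℕ) (ω : Ω) :
    0 ≤ kernelWeight K X n h x i ω :=
  div_nonneg (hK.nonneg _) (hK.kernelSum_nonneg X n h x ω)

-- The sum is `1` unless the kernel sum vanishes, in which case it is `0`.
omit hK in
lemma sum_kernelWeight_le_one (K : ℝ → ℝ) (X : ℕ → Ω → ℝ) (n : ℕ) (h x : ℝ) (ω : Ω) :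
    ∑ i ∈ Finset.range n, kernelWeight K X n h x i ω ≤ 1 := by
  simp only [kernelWeight]
  rw [← Finset.sum_div]
  exact div_self_le_one _

lemma IsKernel.kernelWeight_le_one (X : ℕ → Ω → ℝ) {n : ℕ} (h x : ℝ) {i : ℕ} (hi : i < n) (ω : Ω) :
    kernelWeight K X n h x i ω ≤ 1 :=
  (Finset.single_le_sum (fun j _ => hK.kernelWeight_nonneg X n h x j ω)
    (Finset.mem_range.2 hi)).trans (sum_kernelWeight_le_one K X n h x ω)

omit hK in
lemma sum_kernelWeight_eq_one {n : ℕ} {h x : ℝ} {ω : Ω} (h0 : kernelSum K X n h x ω ≠ 0) :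
    ∑ i ∈ Finset.range n, kernelWeight K X n h x i ω = 1 := by
  simp only [kernelWeight]
  rw [← Finset.sum_div]
  exact div_self h0

omit hK in
lemma smootherBias_eq {n : ℕ} {h x : ℝ} {ω : Ω} (h0 : kernelSum K X n h x ω ≠ 0) :
    smootherBias K m X n h x ω =
      ∑ i ∈ Finset.range n, kernelWeight K X n h x i ω * (m (X i ω) - m x) := by
  simp only [mul_sub, Finset.sum_sub_distrib, ← Finset.sum_mul, sum_kernelWeight_eq_one h0,
    smootherBias, one_mul]

omit hK in
lemma smootherBias_eq_neg {n : ℕ} {h x : ℝ} {ω : Ω} (h0 : kernelSum K X n h x ω = 0) :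
    smootherBias K m X n h x ω = -m x := by
  simp [smootherBias, kernelWeight, h0]

variable [MeasurableSpace Ω] {μ : Measure Ω} [IsProbabilityMeasure μ]

lemma memLp_smootherBias (hXm : ∀ i, Measurable (X i)) 
    (hmX : ∀ i, MemLp (fun ω => m (X i ω)) 2 μ) (n : ℕ) (h x : ℝ) :
    MemLp (smootherBias K m X n h x) 2 μ := by
  have hS : Measurable (kernelSum K X n h x) :=
    Finset.measurable_fun_sum _ fun i _ => (hK.measurable_kernelAt h x).comp (hXm i)
  refine MemLp.sub (memLp_finsetSum _ fun i hi => ?_) (memLp_const (m x))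
  have : MemLp (kernelWeight K X n h x i) ⊤ μ :=
    memLp_top_of_bound (((hK.measurable_kernelAt h x).comp (hXm i)).div hS).aestronglyMeasurable 1
      (ae_of_all _ fun ω => by
        rw [Real.norm_eq_abs, abs_of_nonneg (hK.kernelWeight_nonneg X n h x i ω)]
        exact hK.kernelWeight_le_one X h x (Finset.mem_range.1 hi) ω)
  exact (hmX i).mul' this

/-- The bias and the weights depend on the predictors alone, so averaging over the independent
centered errors leaves the squared bias and the quadratic form of the weights. -/
lemma integral_squaredError (hXm : ∀ i, Measurable (X (i + 1))) (hm : Measurable m)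
    (hmX : ∀ i, MemLp (fun ω => m (X (i + 1) ω)) 2 μ)
    (hI : IndepFun (fun ω i => X (i + 1) ω) (fun ω i => ε (i + 1) ω) μ)
    (he : ∀ i, MemLp (ε (i + 1)) 2 μ) (he0 : ∀ i, ∫ ω, ε (i + 1) ω ∂μ = 0) {n : ℕ} {h : ℝ}
    (hN : (n * h : ℝ) ≠ 0) (x : ℝ) :
    Integrable (squaredError K m X ε n h x) μ ∧
    ∫ ω, squaredError K m X ε n h x ω ∂μ =
      ∫ ω, smootherBias K m (fun i => X (i + 1)) n h x ω ^ 2 ∂μ +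
        ∫ ω, quadForm μ (fun i => ε (i + 1)) n
          (fun i => kernelWeight K (fun i => X (i + 1)) n h x i ω) ∂μ := by
  have hmeasK := hK.measurable_kernelAt h x
  let S : (ℕ → ℝ) → ℝ := fun y => ∑ i ∈ Finset.range n, kernelAt K h x (y i)
  have hS : Measurable S := by fun_prop
  -- Cutting the weights off at `n` makes the bound by `1` valid for all indices; an observation
  -- beyond `n` does not contribute to the kernel sum.
  let w : ℕ → (ℕ → ℝ) → ℝ := fun i y => if i < n then kernelAt K h x (y i) / S y else 0
  have hw : ∀ i, Measurable (w i) := fun i => by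
    by_cases hi : i < n
    · simp only [w, hi, if_true]; fun_prop
    · simp only [w, hi, if_false]; fun_prop
  have hw1 : ∀ i y, |w i y| ≤ 1 := by
    intro i y
    by_cases hi : i < n
    · have h0 := hK.kernelWeight_nonneg (fun i (_ : Unit) => y i) n h x i ()
      have h1 := hK.kernelWeight_le_one (fun i (_ : Unit) => y i) h x hi ()
      have : w i y = kernelWeight K (fun i (_ : Unit) => y i) n h x i () := by simp [w, hi]; rfl
      rw [this, abs_of_nonneg h0]
      exact h1
    · simp [w, hi]
  have hwe : ∀ ω, ∀ i ∈ Finset.range n, w i (fun i => X (i + 1) ω) =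
      kernelWeight K (fun i => X (i + 1)) n h x i ω := by
    intro ω i hi
    simp only [w, Finset.mem_range.1 hi, if_true]
    rfl
  let b : (ℕ → ℝ) → ℝ := fun y => ∑ i ∈ Finset.range n, w i y * m (y i) - m x
  have hb : Measurable b := by
    refine Measurable.sub_const (Finset.measurable_fun_sum _ fun i _ => (hw i).mul ?_) _
    exact hm.comp (measurable_pi_apply i)
  have hbe : ∀ ω, (b fun i => X (i + 1) ω) = smootherBias K m (fun i => X (i + 1)) n h x ω := by
    intro ω
    simp only [b, smootherBias]
    congr 1
    exact Finset.sum_congr rfl fun i hi => by rw [hwe ω i hi]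
  have hb2 : MemLp (fun ω => b fun i => X (i + 1) ω) 2 μ := by
    simp_rw [hbe]
    exact memLp_smootherBias hK hXm hmX n h x
  obtain ⟨r1, r2⟩ := integral_add_sum_mul_sq (X := fun i => X (i + 1)) (ε := fun i => ε (i + 1))
    hXm hI he he0 hb hb2 hw hw1 n
  have e1 : ∀ ω, squaredError K m X ε n h x ω = ((b fun i => X (i + 1) ω) +
      ∑ i ∈ Finset.range n, w i (fun i => X (i + 1) ω) * ε (i + 1) ω) ^ 2 := by
    intro ω
    rw [squaredError_eq hN, hbe]
    congr 2
    exact Finset.sum_congr rfl fun i hi => by rw [hwe ω i hi]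
  have e2 : ∀ ω, quadForm μ (fun i => ε (i + 1)) n (fun i => w i fun i => X (i + 1) ω) =
      quadForm μ (fun i => ε (i + 1)) n
        (fun i => kernelWeight K (fun i => X (i + 1)) n h x i ω) := by
    intro ω
    simp only [quadForm]
    congr 1
    ext ω'
    congr 1
    exact Finset.sum_congr rfl fun i hi => by rw [hwe ω i hi]
  constructor
  · exact r1.congr (ae_of_all _ fun ω => (e1 ω).symm)
  · simp_rw [e1]
    rw [r2]
    simp_rw [hbe, e2]

omit [IsProbabilityMeasure μ] in
/-- The comparison of the conditional mean squared error with its linearization. -/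
lemma abs_smootherBias_sq_add_quadForm_sub_le (he : ∀ i, MemLp (ε i) 2 μ)
    (he1 : ∀ i, ∫ ω, ε i ω ^ 2 ∂μ = 1) {n : ℕ} {h : ℝ} (hN : 0 < (n * h : ℝ)) (x : ℝ) {g δ d : ℝ}
    (hg : 0 < g) (hδ0 : 0 ≤ δ) (hδ : δ ≤ 1 / 4) (ω : Ω) :
    |(smootherBias K m X n h x ω ^ 2 + quadForm μ ε n (fun i => kernelWeight K X n h x i ω)) -
      (quadForm μ ε n (fun i => kernelAt K h x (X i ω)) / (n * h) ^ 2 +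
        ((∑ i ∈ Finset.range n, kernelBiasAt K m h x (X i ω)) / (n * h)) ^ 2) / g ^ 2| ≤
    6 * δ * (quadForm μ ε n (fun i => kernelAt K h x (X i ω)) / (n * h) ^ 2 +
        ((∑ i ∈ Finset.range n, kernelBiasAt K m h x (X i ω)) / (n * h)) ^ 2) / g ^ 2 +
      2 * ((∑ i ∈ Finset.range n, kernelBiasAt K m h x (X i ω)) / (n * h) - d) ^ 2 / g ^ 2 +
      {ω | δ * (n * h * g) ≤ |kernelSum K X n h x ω - n * h * g|}.indicator (fun ω =>
        smootherBias K m X n h x ω ^ 2 + 1 + 2 * d ^ 2 / g ^ 2 +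
        (kernelSum K X n h x ω / (n * h)) ^ 2 / g ^ 2) ω := by
  set N : ℝ := n * h with hNdef
  set S := kernelSum K X n h x ω with hSdef
  set D := (∑ i ∈ Finset.range n, kernelBiasAt K m h x (X i ω)) / N with hDdef
  set q := quadForm μ ε n (fun i => kernelAt K h x (X i ω)) with hq
  set qw := quadForm μ ε n (fun i => kernelWeight K X n h x i ω) with hqw
  have hS0 : 0 ≤ S := hK.kernelSum_nonneg X n h x ω
  have hq0 : 0 ≤ q := quadForm_nonneg n _
  have hqw0 : 0 ≤ qw := quadForm_nonneg n _
  have hqS : q ≤ S ^ 2 := quadForm_le_sq_sum he he1 n fun i => hK.nonneg _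
  have hqw1 : qw ≤ 1 := by
    refine (quadForm_le_sq_sum he he1 n fun i => hK.kernelWeight_nonneg X n h x i ω).trans ?_
    exact pow_le_one₀ (Finset.sum_nonneg fun i _ => hK.kernelWeight_nonneg X n h x i ω)
      (sum_kernelWeight_le_one K X n h x ω)
  have hD2 : 0 ≤ 2 * (D - d) ^ 2 / g ^ 2 := by positivity
  have hQ0 : 0 ≤ q / N ^ 2 + D ^ 2 := by positivity
  by_cases hA : δ * (N * g) ≤ |S - N * g|
  -- On the exceptional event nothing is compared: each quantity is bounded separately, by `qw ≤ 1`,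
  -- `q ≤ S ^ 2` and `D ^ 2 ≤ 2 d ^ 2 + 2 (D - d) ^ 2`.
  · rw [Set.indicator_of_mem (by exact hA)]
    have h1 : (q / N ^ 2 + D ^ 2) / g ^ 2 ≤ (S / N) ^ 2 / g ^ 2 + (2 * d ^ 2 / g ^ 2 +
        2 * (D - d) ^ 2 / g ^ 2) := by
      rw [← add_div, ← add_div]
      refine div_le_div_of_nonneg_right ?_ (by positivity)
      have h2 : q / N ^ 2 ≤ (S / N) ^ 2 := by
        rw [div_pow]
        gcongr
      nlinarith [sq_nonneg (D - 2 * d)]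
    have h3 : 0 ≤ (q / N ^ 2 + D ^ 2) / g ^ 2 := by positivity
    have h4 : 0 ≤ 6 * δ * (q / N ^ 2 + D ^ 2) / g ^ 2 := by positivity
    have h5 : 0 ≤ smootherBias K m X n h x ω ^ 2 := sq_nonneg _
    have h6 : 0 ≤ (S / N) ^ 2 / g ^ 2 := by positivity
    have h7 : 0 ≤ 2 * d ^ 2 / g ^ 2 := by positivity
    rw [abs_le]
    constructor <;> linarith
  -- Off the exceptional event the conditional error equals the linearized one times `(N g / S) ^
  -- 2`, a factor within `6 * δ` of `1`.
  · rw [Set.indicator_of_notMem (by exact hA), add_zero]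
    rw [not_le] at hA
    have hA' := abs_lt.1 hA
    have hNg : 0 < N * g := by positivity
    have hlo : (1 - δ) * (N * g) ≤ S := by linarith [hA'.1]
    have hhi : S ≤ (1 + δ) * (N * g) := by linarith [hA'.2]
    have hSpos : 0 < S := lt_of_lt_of_le (by nlinarith) hlo
    have e1 : smootherBias K m X n h x ω = D * N / S := by
      rw [smootherBias_eq (K := K) (X := X) hSpos.ne', hDdef, div_mul_cancel₀ _ hN.ne',
        Finset.sum_div]
      refine Finset.sum_congr rfl fun i _ => ?_
      simp only [kernelWeight, kernelBiasAt, kernelAt]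
      ring
    have e2 : qw = q / S ^ 2 := by
      have : (fun i => kernelWeight K X n h x i ω) = fun i => S⁻¹ * kernelAt K h x (X i ω) := by
        ext i
        rw [kernelWeight, div_eq_inv_mul]
      rw [hqw, this, quadForm_const_mul, inv_pow, div_eq_inv_mul]
    set Q := q / N ^ 2 + D ^ 2 with hQ
    have e3 : smootherBias K m X n h x ω ^ 2 + qw = Q / g ^ 2 * (N * g / S) ^ 2 := by
      rw [e1, e2, hQ]
      field_simp
      ring
    set ρ := N * g / S with hρ
    have hρ0 : 0 < ρ := by positivity
    have hρ1 : (1 - δ) * ρ ≤ 1 := by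
      rw [hρ, ← mul_div_assoc, div_le_one hSpos]; exact hlo
    have hρ2 : 1 ≤ (1 + δ) * ρ := by
      rw [hρ, ← mul_div_assoc, one_le_div hSpos]; exact hhi
    have hρ3 : |ρ ^ 2 - 1| ≤ 6 * δ := by
      exact abs_sq_sub_one_le hδ0 hδ hρ1 hρ2
    rw [e3]
    have e4 : Q / g ^ 2 * ρ ^ 2 - Q / g ^ 2 = Q / g ^ 2 * (ρ ^ 2 - 1) := by ring
    have hQg : 0 ≤ Q / g ^ 2 := by positivity
    rw [e4, abs_mul, abs_of_nonneg hQg]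
    have := mul_le_mul_of_nonneg_left hρ3 hQg
    have e5 : 6 * δ * Q / g ^ 2 = Q / g ^ 2 * (6 * δ) := by ring
    linarith

end Decomposition

/-! ### The bias on the exceptional event. -/

lemma integrable_exp_sq_div_four :
    Integrable (fun y : ℝ => Real.exp (y ^ 2 / 4)) (gaussianReal 0 1) := by
  rw [gaussianReal_of_var_ne_zero _ one_ne_zero, integrable_withDensity_iff
    (measurable_gaussianPDF 0 1) (ae_of_all _ fun _ => ENNReal.ofReal_lt_top)]
  have h1 := (integrable_exp_neg_mul_sq (b := 1 / 4) (by norm_num)).const_mul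
    (Real.sqrt (2 * Real.pi))⁻¹
  refine h1.congr (ae_of_all _ fun y => ?_)
  simp only [toReal_gaussianPDF, gaussianPDFReal, sub_zero, NNReal.coe_one, mul_one]
  rw [mul_left_comm, ← Real.exp_add]
  congr 2
  ring

/-- Quadratic growth in `x`, which comes from the linear growth of `m`, is thereby absorbed into an
inverse power of the density. -/
lemma one_add_sq_le_div_gaussianPDFReal (x : ℝ) : 1 + x ^ 2 ≤ 2 / gaussianPDFReal 0 1 x := by
  have hφ := gaussianPDFReal_pos 0 1 x one_ne_zero
  rw [le_div_iff₀ hφ]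
  have h1 : gaussianPDFReal 0 1 x ≤ Real.exp (-(x ^ 2 / 2)) := by
    simp only [gaussianPDFReal, sub_zero, NNReal.coe_one, mul_one, neg_div]
    refine mul_le_of_le_one_left (Real.exp_pos _).le (inv_le_one_of_one_le₀ ?_)
    rw [Real.one_le_sqrt]
    nlinarith [Real.pi_gt_three]
  have h2 := Real.add_one_le_exp (x ^ 2 / 2)
  have h3 : Real.exp (x ^ 2 / 2) * Real.exp (-(x ^ 2 / 2)) = 1 := by
    rw [← Real.exp_add]; simp
  calc (1 + x ^ 2) * gaussianPDFReal 0 1 x ≤ (2 * Real.exp (x ^ 2 / 2)) * Real.exp (-(x ^ 2 / 2)) := by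
        gcongr
        nlinarith
    _ = 2 := by rw [mul_assoc, h3, mul_one]

section Bias

variable {Ω : Type*} {K m : ℝ → ℝ} (hK : IsKernel K)

-- A weighted average of differences `m (X i) - m x` is at most their bound `R`; if all weights
-- vanish, the default value of the estimator leaves the bias `-m x`.
include hK in
lemma smootherBias_sq_le {X : ℕ → Ω → ℝ} {n : ℕ} {h x R : ℝ} {ω : Ω}
    (hm : ∀ i < n, K ((x - X i ω) / h) ≠ 0 → |m (X i ω) - m x| ≤ R) :
    smootherBias K m X n h x ω ^ 2 ≤ R ^ 2 + m x ^ 2 := by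
  rcases eq_or_ne (kernelSum K X n h x ω) 0 with h0 | h0
  · rw [smootherBias_eq_neg h0, neg_sq]
    nlinarith
  · rw [smootherBias_eq h0]
    have h1 : |∑ i ∈ Finset.range n, kernelWeight K X n h x i ω * (m (X i ω) - m x)| ≤ R := by
      refine (Finset.abs_sum_le_sum_abs _ _).trans ?_
      calc _ ≤ ∑ i ∈ Finset.range n, kernelWeight K X n h x i ω * R := by
            refine Finset.sum_le_sum fun i hi => ?_
            rw [abs_mul, abs_of_nonneg (hK.kernelWeight_nonneg X n h x i ω)]
            by_cases hz : K ((x - X i ω) / h) = 0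
            · simp [kernelWeight, kernelAt, hz]
            · exact mul_le_mul_of_nonneg_left (hm i (Finset.mem_range.1 hi) hz)
                (hK.kernelWeight_nonneg X n h x i ω)
        _ = R := by rw [← Finset.sum_mul, sum_kernelWeight_eq_one h0, one_mul]
    have h2 := pow_le_pow_left₀ (abs_nonneg _) h1 2
    rw [sq_abs] at h2
    nlinarith [sq_nonneg (m x)]

variable [MeasurableSpace Ω] {μ : Measure Ω} [IsProbabilityMeasure μ] {X Z ζ : ℕ → Ω → ℝ} {v : ℝ≥0}

lemma sq_le_of_abs_deriv_le {B : ℝ} (hm : Differentiable ℝ m) (h1 : ∀ x, |deriv m x| ≤ B) (x : ℝ) :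
    m x ^ 2 ≤ 2 * m 0 ^ 2 + 2 * B ^ 2 * x ^ 2 := by
  have h2 := abs_sub_le_of_deriv hm h1 0 x
  rw [sub_zero] at h2
  have h3 : (m x - m 0) ^ 2 ≤ B ^ 2 * x ^ 2 := by
    rw [← sq_abs, ← sq_abs x, ← mul_pow]
    exact pow_le_pow_left₀ (abs_nonneg _) h2 2
  nlinarith [sq_nonneg (m x - 2 * m 0)]

omit [IsProbabilityMeasure μ] in
lemma GaussianDecomposition.memLp_comp_of_abs_deriv_le (hD : GaussianDecomposition μ X Z ζ v) {B : ℝ}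
    (hm : Differentiable ℝ m) (h1 : ∀ x, |deriv m x| ≤ B) (i : ℕ) :
    MemLp (fun ω => m (X i ω)) 2 μ := by
  refine hD.memLp_comp i ?_
  refine (((memLp_const |m 0|).add ((memLp_id_gaussianReal 2).norm.const_mul B))).of_le
    hm.continuous.aestronglyMeasurable (ae_of_all _ fun y => ?_)
  have h2 := abs_sub_le_of_deriv hm h1 0 y
  have hB : 0 ≤ B := (abs_nonneg _).trans (h1 0)
  rw [sub_zero] at h2
  simp only [Pi.add_apply, id, Real.norm_eq_abs]
  have h3 : |m 0| + B * |y| = |(|m 0| + B * |y|)| := (abs_of_nonneg (by positivity)).symm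
  rw [← h3]
  have := abs_add_le (m y - m 0) (m 0)
  rw [sub_add_cancel] at this
  linarith

include hK in
/-- The squared bias on small events. -/
lemma GaussianDecomposition.exists_setIntegral_smootherBias_sq_le
    (hD : GaussianDecomposition μ X Z ζ v) {B : ℝ} (hm : Differentiable ℝ m)
    (h1 : ∀ x, |deriv m x| ≤ B) {h : ℕ → ℝ} (hpos : ∀ᶠ n in atTop, 0 < h n ∧ h n ≤ 1 ∧ 1 ≤ n * h n)
    (hreg : HasCompactSupport K ∨ (∃ M : ℝ, ∀ x, |m x| ≤ M) ∨
      (fun n : ℕ => Real.log n) =O[atTop] fun n : ℕ => (n : ℝ) * h n) :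
    ∃ C : ℝ, 0 ≤ C ∧ ∀ᶠ n : ℕ in atTop, ∀ (x : ℝ) (A : Set Ω), MeasurableSet A →
      ∫ ω in A, smootherBias K m X n (h n) x ω ^ 2 ∂μ ≤
        C * (1 + x ^ 2) * (n * h n * μ.real A + 1 / n) := by
  have hB : 0 ≤ B := (abs_nonneg _).trans (h1 0)
  have hint : ∀ (n : ℕ) (x : ℝ), Integrable (fun ω => smootherBias K m X n (h n) x ω ^ 2) μ :=
    fun n x => (memLp_smootherBias hK hD.measurable
      (hD.memLp_comp_of_abs_deriv_le hm h1) n (h n) x).integrable_sq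
  -- A deterministic bound suffices, since `n * h n ≥ 1`. It is available when `K` has compact
  -- support or `m` is bounded.
  have easy : ∀ C : ℝ, 0 ≤ C → (∀ᶠ n : ℕ in atTop, ∀ x ω,
      smootherBias K m X n (h n) x ω ^ 2 ≤ C * (1 + x ^ 2)) →
      ∃ C : ℝ, 0 ≤ C ∧ ∀ᶠ n : ℕ in atTop, ∀ (x : ℝ) (A : Set Ω), MeasurableSet A →
      ∫ ω in A, smootherBias K m X n (h n) x ω ^ 2 ∂μ ≤
        C * (1 + x ^ 2) * (n * h n * μ.real A + 1 / n) := by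
    intro C hC hb
    refine ⟨C, hC, ?_⟩
    filter_upwards [hb, hpos] with n hn hp x A hA
    refine (setIntegral_mono (hint n x).integrableOn (integrable_const (C * (1 + x ^ 2))).integrableOn
      fun ω => hn x ω).trans ?_
    rw [setIntegral_const, smul_eq_mul, mul_comm]
    refine mul_le_mul_of_nonneg_left ?_ (by positivity)
    have : μ.real A ≤ n * h n * μ.real A := le_mul_of_one_le_left measureReal_nonneg hp.2.2
    have h0 : (0 : ℝ) ≤ 1 / n := by positivity
    linarith
  have hmx := sq_le_of_abs_deriv_le hm h1
  rcases hreg with hc | ⟨M, hM⟩ | hlog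
  -- Compact support: only observations within `|R| * h ≤ |R|` of `x` carry weight.
  · obtain ⟨R, hR⟩ := hc.isCompact.isBounded.exists_norm_le
    have hR' : ∀ u, K u ≠ 0 → |u| ≤ R := fun u hu => hR u (subset_tsupport K hu)
    refine easy (B ^ 2 * R ^ 2 + 2 * m 0 ^ 2 + 2 * B ^ 2) (by positivity) ?_
    filter_upwards [hpos] with n hn x ω
    have hb := smootherBias_sq_le (m := m) hK (X := X) (n := n) (h := h n) (x := x) (ω := ω)
      (R := B * |R|) fun i _ hi => by
        refine (abs_sub_le_of_deriv hm h1 x _).trans (mul_le_mul_of_nonneg_left ?_ hB)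
        have h2 := (hR' _ hi).trans (le_abs_self R)
        rw [abs_div, abs_of_pos hn.1, div_le_iff₀ hn.1] at h2
        rw [abs_sub_comm]
        exact h2.trans (mul_le_of_le_one_right (abs_nonneg _) hn.2.1)
    rw [mul_pow, sq_abs] at hb
    have := hmx x
    nlinarith [mul_nonneg (mul_nonneg (sq_nonneg B) (sq_nonneg R)) (sq_nonneg x),
      mul_nonneg (sq_nonneg (m 0)) (sq_nonneg x), sq_nonneg B]
  · have hM0 : 0 ≤ M := (abs_nonneg _).trans (hM 0)
    refine easy (5 * M ^ 2) (by positivity) (Eventually.of_forall fun n x ω => ?_)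
    have hb := smootherBias_sq_le (m := m) hK (X := X) (n := n) (h := h n) (x := x) (ω := ω)
      (R := 2 * M) fun i _ _ => by
        have := abs_sub (m (X i ω)) (m x)
        have := hM (X i ω)
        have := hM x
        linarith
    have h3 : m x ^ 2 ≤ M ^ 2 := by rw [← sq_abs]; exact pow_le_pow_left₀ (abs_nonneg _) (hM x) 2
    nlinarith [mul_nonneg (sq_nonneg M) (sq_nonneg x)]
  · obtain ⟨C', hC'⟩ := hlog.bound
    set E0 := ∫ y, Real.exp (y ^ 2 / 4) ∂gaussianReal 0 1 with hE0
    have hE00 : 0 ≤ E0 := integral_nonneg fun y => (Real.exp_pos _).le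
    set C1 := 4 * B ^ 2 + 2 * m 0 ^ 2 with hC1
    have hC10 : 0 ≤ C1 := by positivity
    refine ⟨C1 * (1 + 8 * |C'|) + 8 * B ^ 2 * E0, by positivity, ?_⟩
    filter_upwards [hC', hpos, eventually_ge_atTop 1] with n hn hp hn1 x A hA
    have hn0 : (0 : ℝ) < n := by exact_mod_cast hn1
    have hN0 : 0 < n * h n := mul_pos hn0 hp.1
    have hlog0 : 0 ≤ Real.log n := Real.log_natCast_nonneg n
    rw [Real.norm_eq_abs, Real.norm_eq_abs, abs_of_nonneg hlog0, abs_of_pos hN0] at hn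
    -- The squares of the predictors are truncated at this level. Since `exp (-(t / 4)) = n ^ (-2)`,
    -- the `n` expected excesses add up to `O(1 / n)`.
    set t := 8 * Real.log n with ht
    have ht0 : 0 ≤ t := by positivity
    let Y : Ω → ℝ := fun ω => ∑ i ∈ Finset.range n, max (X i ω ^ 2 - t) 0
    have hpt : ∀ y : ℝ, max (y ^ 2 - t) 0 ≤ 4 * (Real.exp (-(t / 4)) * Real.exp (y ^ 2 / 4)) := by
      intro y
      rw [← Real.exp_add]
      refine max_le ?_ (by positivity)
      have := Real.add_one_le_exp (-(t / 4) + y ^ 2 / 4)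
      linarith
    have hY0 : ∀ ω, 0 ≤ Y ω := fun ω => Finset.sum_nonneg fun i _ => le_max_right _ _
    have hYi : ∀ i, Integrable (fun ω => 4 * (Real.exp (-(t / 4)) * Real.exp (X i ω ^ 2 / 4))) μ :=
      fun i => ((hD.integrable_comp i integrable_exp_sq_div_four).const_mul _).const_mul _
    have hYi' : ∀ i, Integrable (fun ω => max (X i ω ^ 2 - t) 0) μ := fun i => by
      have := hD.measurable i
      exact (hYi i).mono' (by fun_prop : Measurable _).aestronglyMeasurable
        (ae_of_all _ fun ω => by
          rw [Real.norm_eq_abs, abs_of_nonneg (le_max_right _ _)]; exact hpt _)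
    have hYint : Integrable Y μ := integrable_finsetSum _ fun i _ => hYi' i
    have hYle : ∫ ω, Y ω ∂μ ≤ 4 * E0 / n := by
      rw [integral_finsetSum _ fun i _ => hYi' i]
      have hb : ∀ i ∈ Finset.range n, ∫ ω, max (X i ω ^ 2 - t) 0 ∂μ ≤ 4 * (Real.exp (-(t / 4)) * E0) := by
        intro i _
        refine (integral_mono (hYi' i) (hYi i) fun ω => hpt _).trans (le_of_eq ?_)
        rw [integral_const_mul, integral_const_mul,
          hD.integral_comp i (ψ := fun y => Real.exp (y ^ 2 / 4)) (by fun_prop)]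
      refine (Finset.sum_le_sum hb).trans (le_of_eq ?_)
      have e1 : Real.exp (-(t / 4)) = ((n : ℝ) ^ 2)⁻¹ := by
        rw [ht, show -(8 * Real.log n / 4) = -(((2 : ℕ) : ℝ) * Real.log n) by push_cast; ring,
          Real.exp_neg, Real.exp_nat_mul, Real.exp_log hn0]
      rw [Finset.sum_const, Finset.card_range, nsmul_eq_mul, e1]
      field_simp
    have hbias : ∀ ω, smootherBias K m X n (h n) x ω ^ 2 ≤
        C1 * (1 + x ^ 2) * (1 + t) + 2 * B ^ 2 * Y ω := by
      intro ω
      have hb := smootherBias_sq_le (m := m) hK (X := X) (n := n) (h := h n) (x := x) (ω := ω)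
        (R := B * (Real.sqrt (t + Y ω) + |x|)) fun i hi _ => by
          refine (abs_sub_le_of_deriv hm h1 x _).trans (mul_le_mul_of_nonneg_left ?_ hB)
          refine (abs_sub _ _).trans (add_le_add_left (Real.abs_le_sqrt ?_) _)
          have h3 : max (X i ω ^ 2 - t) 0 ≤ Y ω :=
            Finset.single_le_sum (f := fun i => max (X i ω ^ 2 - t) 0)
              (fun j _ => le_max_right _ _) (Finset.mem_range.2 hi)
          have := le_max_left (X i ω ^ 2 - t) 0
          linarith
      have h4 := Real.sq_sqrt (add_nonneg ht0 (hY0 ω))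
      have h5 : (B * (Real.sqrt (t + Y ω) + |x|)) ^ 2 ≤ B ^ 2 * (2 * (t + Y ω) + 2 * x ^ 2) := by
        rw [mul_pow]
        refine mul_le_mul_of_nonneg_left ?_ (sq_nonneg B)
        nlinarith [sq_nonneg (Real.sqrt (t + Y ω) - |x|), sq_abs x]
      have h6 := hmx x
      have h7 : 0 ≤ (2 * m 0 ^ 2) * (x ^ 2 + t + x ^ 2 * t) := by positivity
      have h8 : 0 ≤ B ^ 2 * (4 + 2 * t + 4 * x ^ 2 * t) := by positivity
      rw [hC1]
      nlinarith
    have hc : Integrable (fun _ : Ω => C1 * (1 + x ^ 2) * (1 + t)) μ := integrable_const _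
    refine (setIntegral_mono (hint n x).integrableOn
      (hc.add (hYint.const_mul (2 * B ^ 2))).integrableOn hbias).trans ?_
    simp only [Pi.add_apply]
    rw [integral_add hc.integrableOn (hYint.const_mul (2 * B ^ 2)).integrableOn, setIntegral_const,
      integral_const_mul, smul_eq_mul]
    have h9 : ∫ ω in A, Y ω ∂μ ≤ 4 * E0 / n :=
      (setIntegral_le_integral hYint (ae_of_all _ hY0)).trans hYle
    -- Here `log n = O(n h)` enters: the truncation level is at most a multiple of `n h`.
    have h10 : 1 + t ≤ (1 + 8 * |C'|) * (n * h n) := by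
      have : C' * (n * h n) ≤ |C'| * (n * h n) := by gcongr; exact le_abs_self _
      rw [ht]; nlinarith [hp.2.2]
    have h11 : 2 * B ^ 2 * ∫ ω in A, Y ω ∂μ ≤ 2 * B ^ 2 * (4 * E0 / n) := by gcongr
    have hx : 1 ≤ 1 + x ^ 2 := by nlinarith [sq_nonneg x]
    have h12 : μ.real A * (C1 * (1 + x ^ 2) * (1 + t)) ≤
        μ.real A * (C1 * (1 + x ^ 2) * ((1 + 8 * |C'|) * (n * h n))) := by gcongr
    have h13 : 2 * B ^ 2 * (4 * E0 / n) ≤ 8 * B ^ 2 * E0 * (1 + x ^ 2) * (1 / n) := by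
      have : 2 * B ^ 2 * (4 * E0 / n) = 8 * B ^ 2 * E0 * 1 * (1 / n) := by ring
      rw [this]
      gcongr
    have h14 : 0 ≤ C1 * (1 + 8 * |C'|) * (1 + x ^ 2) * (1 / n) := by positivity
    have h15 : 0 ≤ 8 * B ^ 2 * E0 * (1 + x ^ 2) * (n * h n * μ.real A) := by positivity
    calc _ ≤ μ.real A * (C1 * (1 + x ^ 2) * ((1 + 8 * |C'|) * (n * h n))) +
        8 * B ^ 2 * E0 * (1 + x ^ 2) * (1 / n) := by linarith
      _ ≤ _ := by linarith

end Bias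

/-! ### Moments of the linearized variance and bias. -/

namespace GaussianDecomposition

variable {Ω : Type*} [MeasurableSpace Ω] {μ : Measure Ω} [IsProbabilityMeasure μ]
  {X Z ζ : ℕ → Ω → ℝ} {v : ℝ≥0} {K : ℝ → ℝ} (hD : GaussianDecomposition μ X Z ζ v) (hK : IsKernel K)

include hD hK

/-- The second moment of kernel sums with independent weights. -/
lemma exists_abs_integral_quadForm_kernelAt_sub_le {Ω' : Type*} [MeasurableSpace Ω']
    {μ' : Measure Ω'} {e : ℕ → Ω' → ℝ} (he : ∀ i, MemLp (e i) 2 μ')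
    (he1 : ∀ i, ∫ ω, e i ω ^ 2 ∂μ' = 1) :
    ∃ C : ℝ, 0 < C ∧ ∀ (x h s : ℝ) (n : ℕ), 0 < h → 0 < n → 0 < s →
      |(∫ ω, quadForm μ' e n (fun i => kernelAt K h x (X i ω)) ∂μ) / (n * h) ^ 2 -
        ((∫ y, kernelAt K h x y ^ 2 ∂gaussianReal 0 1) / h / (n * h) +
          smoothedDensity K h x ^ 2 * (quadForm μ' e n (fun _ => 1) / n ^ 2))| ≤
      C * (1 / n + s / (n * h) + (1 + 1 / s) * ((∑ i ∈ Finset.range n, ∑ j ∈ Finset.range n,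
        |∫ ω, e i ω * e j ω ∂μ'| * |∫ ω, Z i ω * Z j ω ∂μ|) / n ^ 2)) := by
  obtain ⟨c, hc, hG⟩ := hK.exists_gaussianMean_kernelAt_bounds hD.var_ne_zero
  have hk1 := kappa1_nonneg K
  refine ⟨1 + c ^ 2 + kappa1 K + Real.pi ^ 2 / 8 * c ^ 2, by positivity, fun x h s n hh hn hs => ?_⟩
  obtain ⟨G', hd, hG'c, hGb, hG'b, -⟩ := hG x h hh
  have hn0 : (0 : ℝ) < n := by exact_mod_cast hn
  have hψ := hK.measurable_kernelAt h x
  have h2 : MemLp (kernelAt K h x) 2 (gaussianReal 0 1) := hK.memLp_kernelAt h x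
  have key := hD.abs_integral_quadForm_sub_le hψ h2 hd hG'c hGb hG'b he he1 n hs
  set E := ∫ y, kernelAt K h x y ∂gaussianReal 0 1 with hE
  have hEv : E = h * smoothedDensity K h x := integral_kernelAt K hh x
  have hu : ∀ i, MemLp (fun ω => kernelAt K h x (X i ω) - E) 2 μ := fun i =>
    (hD.memLp_comp i h2).sub (memLp_const E)
  have hu0 : ∀ i, ∫ ω, (kernelAt K h x (X i ω) - E) ∂μ = 0 := by
    intro i
    rw [integral_sub ((hD.memLp_comp i h2).integrable (by norm_num)) (integrable_const _),
      hD.integral_comp i hψ]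
    simp [hE]
  -- The mean `E = h * smoothedDensity K h x` of a kernel weight is split off; it is what multiplies
  -- the variance of the sum of the errors.
  have h3 := integral_quadForm_add_const he n hu hu0 E
  simp only [sub_add_cancel] at h3
  rw [h3]
  set q := ∫ ω, quadForm μ' e n (fun i => kernelAt K h x (X i ω) - E) ∂μ
  set S2 := ∫ y, kernelAt K h x y ^ 2 ∂gaussianReal 0 1 with hS2
  set T := ∑ i ∈ Finset.range n, ∑ j ∈ Finset.range n,
        |∫ ω, e i ω * e j ω ∂μ'| * |∫ ω, Z i ω * Z j ω ∂μ| with hT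
  have hT0 : 0 ≤ T := Finset.sum_nonneg fun i _ => Finset.sum_nonneg fun j _ => by positivity
  have hS2le : S2 ≤ kappa1 K * h := hK.integral_kernelAt_sq_le hh x
  have hS20 : 0 ≤ S2 := integral_nonneg fun y => sq_nonneg _
  have e1 : (q + E ^ 2 * quadForm μ' e n (fun _ => 1)) / (n * h) ^ 2 -
      (S2 / h / (n * h) + smoothedDensity K h x ^ 2 * (quadForm μ' e n (fun _ => 1) / n ^ 2)) =
      (q - n * S2) / (n * h) ^ 2 := by
    rw [hEv]
    field_simp
    ring
  rw [e1, abs_div, abs_of_pos (by positivity : (0 : ℝ) < (n * h) ^ 2), div_le_iff₀ (by positivity)]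
  refine key.trans ?_
  have k1 : s * (n * S2) ≤ kappa1 K * (s / (n * h)) * (n * h) ^ 2 := by
    calc s * (n * S2) ≤ s * (n * (kappa1 K * h)) := by gcongr
      _ = _ := by field_simp
  have k2 : (n : ℝ) * (c * h) ^ 2 = c ^ 2 * (1 / n) * (n * h) ^ 2 := by field_simp
  have k3 : (1 + 1 / s) * (Real.pi ^ 2 / 8 * (c * h) ^ 2 * T) =
      Real.pi ^ 2 / 8 * c ^ 2 * ((1 + 1 / s) * (T / n ^ 2)) * (n * h) ^ 2 := by field_simp
  rw [k2, k3]
  set a1 : ℝ := 1 / n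
  set a2 := s / (n * h)
  set a3 := (1 + 1 / s) * (T / n ^ 2)
  have ha1 : 0 ≤ a1 := by positivity
  have ha2 : 0 ≤ a2 := by positivity
  have ha3 : 0 ≤ a3 := by positivity
  refine (add_le_add_left (add_le_add_right k1 _) _).trans ?_
  rw [← add_mul, ← add_mul]
  refine mul_le_mul_of_nonneg_right ?_ (by positivity)
  have hp : 0 ≤ Real.pi ^ 2 / 8 * c ^ 2 := by positivity
  have c2 := sq_nonneg c
  nlinarith [mul_nonneg c2 ha2, mul_nonneg c2 ha3, mul_nonneg hk1 ha1, mul_nonneg hk1 ha3,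
    mul_nonneg hp ha1, mul_nonneg hp ha2]

/-- The variance of the linearized bias. -/
lemma exists_integral_sum_kernelBiasAt_sub_sq_le {a CZ : ℝ}
    (hcov : ∀ n : ℕ, ∑ i ∈ Finset.range n, ∑ j ∈ Finset.range n, |∫ ω, Z i ω * Z j ω ∂μ| ≤
      CZ * (n : ℝ) ^ (2 - a))
    {m : ℝ → ℝ} {B : ℝ} (hm : Differentiable ℝ m) (hm' : Differentiable ℝ (deriv m))
    (h1 : ∀ x, |deriv m x| ≤ B) (h2 : ∀ x, |deriv (deriv m) x| ≤ B) :
    ∃ C : ℝ, 0 < C ∧ ∀ (x h : ℝ) (n : ℕ), 0 < h → h ≤ 1 → 0 < n →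
      (Integrable (fun ω => ((∑ i ∈ Finset.range n, kernelBiasAt K m h x (X i ω)) / (n * h) -
        (∫ y, kernelBiasAt K m h x y ∂gaussianReal 0 1) / h) ^ 2) μ) ∧
      ∫ ω, ((∑ i ∈ Finset.range n, kernelBiasAt K m h x (X i ω)) / (n * h) -
        (∫ y, kernelBiasAt K m h x y ∂gaussianReal 0 1) / h) ^ 2 ∂μ ≤
      C * B ^ 2 * (h / n + h ^ 4 * (n : ℝ) ^ (-a)) := by
  obtain ⟨c, hc, hG⟩ := hK.exists_gaussianMean_kernelBiasAt_bounds hD.var_ne_zero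
  obtain ⟨M, hM0, hM⟩ := hK.exists_pos_bound
  have hk2 := hK.kappa2_nonneg
  have hCZ : 0 ≤ CZ := by
    have := (Finset.sum_nonneg fun i _ => Finset.sum_nonneg fun j _ => abs_nonneg _).trans (hcov 1)
    simpa using this
  refine ⟨1 + c ^ 2 + 2 * (M * kappa2 K) + Real.pi ^ 2 / 4 * c ^ 2 * CZ, by positivity,
    fun x h n hh hh1 hn => ?_⟩
  obtain ⟨G', hd, hG'c, hGb, hG'b⟩ := hG m B hm hm' h1 h2 x h hh
  have hn0 : (0 : ℝ) < n := by exact_mod_cast hn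
  have hψ := hK.measurable_kernelBiasAt hm.continuous.measurable h x
  obtain ⟨hi, hS2le⟩ := hK.integral_kernelBiasAt_sq_le hm h1 hM hh x
  have hL2 : MemLp (kernelBiasAt K m h x) 2 (gaussianReal 0 1) :=
    (memLp_two_iff_integrable_sq hψ.aestronglyMeasurable).2 hi
  set E := ∫ y, kernelBiasAt K m h x y ∂gaussianReal 0 1 with hE
  have hu : ∀ i, MemLp (fun ω => kernelBiasAt K m h x (X i ω) - E) 2 μ := fun i =>
    (hD.memLp_comp i hL2).sub (memLp_const E)
  -- Constant weights `1` on a one-point space turn the quadratic form into the plain square of the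
  -- sum, and the Young parameter may be `1` because only an order bound is needed.
  have key := hD.abs_integral_quadForm_sub_le hψ hL2 hd hG'c hGb hG'b
    (μ' := Measure.dirac ()) (e := fun _ _ => (1 : ℝ)) (fun _ => memLp_const _) (by simp) n one_pos
  simp only [quadForm, integral_dirac, mul_one, abs_one, one_mul] at key
  have e1 : ∀ ω, ((∑ i ∈ Finset.range n, kernelBiasAt K m h x (X i ω)) / (n * h) - E / h) ^ 2 =
      (∑ i ∈ Finset.range n, (kernelBiasAt K m h x (X i ω) - E)) ^ 2 * (1 / (n * h) ^ 2) := by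
    intro ω
    rw [Finset.sum_sub_distrib, Finset.sum_const, Finset.card_range, nsmul_eq_mul]
    field_simp
  simp_rw [e1]
  refine ⟨(memLp_finsetSum _ fun i _ => hu i).integrable_sq.mul_const _, ?_⟩
  rw [integral_mul_const, mul_one_div, div_le_iff₀ (by positivity)]
  set S2 := ∫ y, kernelBiasAt K m h x y ^ 2 ∂gaussianReal 0 1 with hS2
  have k0 := hcov n
  set T := ∑ i ∈ Finset.range n, ∑ j ∈ Finset.range n, |∫ ω, Z i ω * Z j ω ∂μ| with hT
  rw [rpow_two_sub_eq hn0] at k0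
  have k1 := (abs_le.1 key).2
  have k2 : n * S2 ≤ M * kappa2 K * B ^ 2 * (h / n) * (n * h) ^ 2 := by
    calc n * S2 ≤ n * (M * kappa2 K * B ^ 2 * h ^ 3) := by gcongr
      _ = _ := by field_simp
  have k3 : n * (c * B * h ^ 3) ^ 2 ≤ c ^ 2 * B ^ 2 * (h / n) * (n * h) ^ 2 := by
    have e2 : n * (c * B * h ^ 3) ^ 2 = c ^ 2 * B ^ 2 * (h / n) * (n * h) ^ 2 * h ^ 3 := by
      field_simp
    rw [e2]
    exact mul_le_of_le_one_right (by positivity) (pow_le_one₀ hh.le hh1)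
  have k4 : (1 + 1 / 1) * (Real.pi ^ 2 / 8 * (c * B * h ^ 3) ^ 2 * T) ≤
      Real.pi ^ 2 / 4 * c ^ 2 * CZ * B ^ 2 * (h ^ 4 * (n : ℝ) ^ (-a)) * (n * h) ^ 2 := by
    calc _ ≤ (1 + 1 / 1) * (Real.pi ^ 2 / 8 * (c * B * h ^ 3) ^ 2 *
          (CZ * ((n : ℝ) ^ 2 * (n : ℝ) ^ (-a)))) := by gcongr
      _ = _ := by ring
  set N2 : ℝ := (n * h) ^ 2
  set a1 : ℝ := B ^ 2 * (h / n) * N2 with ha1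
  set a2 : ℝ := B ^ 2 * (h ^ 4 * (n : ℝ) ^ (-a)) * N2 with ha2
  have ha10 : 0 ≤ a1 := by positivity
  have ha20 : 0 ≤ a2 := by positivity
  have hp : 0 ≤ Real.pi ^ 2 / 4 * c ^ 2 * CZ := by positivity
  have hMk : 0 ≤ M * kappa2 K := by positivity
  have e3 : (1 + c ^ 2 + 2 * (M * kappa2 K) + Real.pi ^ 2 / 4 * c ^ 2 * CZ) * B ^ 2 *
      (h / n + h ^ 4 * (n : ℝ) ^ (-a)) * N2 =
      (1 + c ^ 2 + 2 * (M * kappa2 K) + Real.pi ^ 2 / 4 * c ^ 2 * CZ) * (a1 + a2) := by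
    rw [ha1, ha2]; ring
  rw [e3]
  have k2' : n * S2 ≤ M * kappa2 K * a1 := k2.trans (le_of_eq (by rw [ha1]; ring))
  have k3' : n * (c * B * h ^ 3) ^ 2 ≤ c ^ 2 * a1 := k3.trans (le_of_eq (by rw [ha1]; ring))
  have k4' : (1 + 1 / 1) * (Real.pi ^ 2 / 8 * (c * B * h ^ 3) ^ 2 * T) ≤
      Real.pi ^ 2 / 4 * c ^ 2 * CZ * a2 := k4.trans (le_of_eq (by rw [ha2]; ring))
  nlinarith [mul_nonneg hp ha10, mul_nonneg hMk ha20, mul_nonneg (sq_nonneg c) ha20]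

end GaussianDecomposition

lemma measurable_quadForm {Ω Ω' : Type*} [MeasurableSpace Ω] [MeasurableSpace Ω'] {μ' : Measure Ω'}
    {e : ℕ → Ω' → ℝ} (he : ∀ i, MemLp (e i) 2 μ') (n : ℕ) {u : ℕ → Ω → ℝ}
    (hu : ∀ i, Measurable (u i)) : Measurable fun ω => quadForm μ' e n (fun i => u i ω) := by
  simp_rw [quadForm_eq_sum he]
  fun_prop

/-! ### The linearization error, uniformly up to powers of the inverse density. -/

section Uniform

variable {Ω : Type*} [MeasurableSpace Ω] {μ : Measure Ω} [IsProbabilityMeasure μ]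
  {X Z ζ ε : ℕ → Ω → ℝ} {v : ℝ≥0} {K m : ℝ → ℝ}

lemma IsKernel.exists_abs_integral_kernelBiasAt_div_le (hK : IsKernel K) :
    ∃ C : ℝ, 0 < C ∧ ∀ (m : ℝ → ℝ) (B : ℝ), Differentiable ℝ m → Differentiable ℝ (deriv m) →
      (∀ x, |deriv m x| ≤ B) → (∀ x, |deriv (deriv m) x| ≤ B) → ∀ x h : ℝ, 0 < h →
      |(∫ y, kernelBiasAt K m h x y ∂gaussianReal 0 1) / h| ≤ C * B * h ^ 2 := by
  obtain ⟨c, hc, hb1, hb2⟩ := exists_abs_deriv_gaussianPDFReal_le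
  have hk2 := hK.kappa2_nonneg
  refine ⟨2 * c * kappa2 K + 1, by positivity, fun m B hm hm' h1 h2 x h hh => ?_⟩
  have hB : 0 ≤ B := (abs_nonneg _).trans (h1 0)
  rw [integral_kernelBiasAt K m hh, mul_div_cancel_left₀ _ hh.ne']
  refine (hK.abs_integral_bias_le hm hm' h1 h2 (P := gaussianPDFReal 0 1)
    (fun y => (hasDerivAt_gaussianPDFReal y).differentiableAt) hb1 hb2 x h).trans ?_
  have : 0 ≤ B * h ^ 2 := by positivity
  nlinarith

/-- The error of the linearization, integrated. -/
lemma GaussianDecomposition.abs_integral_sub_le (hD : GaussianDecomposition μ X Z ζ v)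
    (hK : IsKernel K) (he : ∀ i, MemLp (ε i) 2 μ) (he1 : ∀ i, ∫ ω, ε i ω ^ 2 ∂μ = 1)
    (hmX : ∀ i, MemLp (fun ω => m (X i ω)) 2 μ) {n : ℕ} {h : ℝ} (hN : 0 < (n * h : ℝ)) (x : ℝ)
    {g δ d : ℝ} (hg : 0 < g) (hδ0 : 0 ≤ δ) (hδ : δ ≤ 1 / 4)
    (hd : ∫ ω, (∑ i ∈ Finset.range n, kernelBiasAt K m h x (X i ω)) / (n * h) ∂μ = d) :
    |(∫ ω, smootherBias K m X n h x ω ^ 2 ∂μ +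
        ∫ ω, quadForm μ ε n (fun i => kernelWeight K X n h x i ω) ∂μ) -
      ((∫ ω, quadForm μ ε n (fun i => kernelAt K h x (X i ω)) ∂μ) / (n * h) ^ 2 + d ^ 2) / g ^ 2| ≤
    (6 * δ * ((∫ ω, quadForm μ ε n (fun i => kernelAt K h x (X i ω)) ∂μ) / (n * h) ^ 2 + d ^ 2) +
      (6 * δ + 3) * ∫ ω, ((∑ i ∈ Finset.range n, kernelBiasAt K m h x (X i ω)) / (n * h) - d) ^ 2 ∂μ)
        / g ^ 2 +
    (∫ ω in {ω | δ * (n * h * g) ≤ |kernelSum K X n h x ω - n * h * g|},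
        smootherBias K m X n h x ω ^ 2 ∂μ) +
    (1 + 2 * d ^ 2 / g ^ 2) *
      μ.real {ω | δ * (n * h * g) ≤ |kernelSum K X n h x ω - n * h * g|} +
    (1 / (n * h) ^ 2 * ∫ ω, (kernelSum K X n h x ω / (n * h)) ^ 4 ∂μ + (n * h) ^ 2 *
      μ.real {ω | δ * (n * h * g) ≤ |kernelSum K X n h x ω - n * h * g|}) / g ^ 2 := by
  set N : ℝ := n * h with hNdef
  obtain ⟨M, hM0, hM⟩ := hK.exists_pos_bound
  set A := {ω | δ * (N * g) ≤ |kernelSum K X n h x ω - N * g|} with hAdef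
  have hSm := hD.measurable_kernelSum hK n h x
  have hA : MeasurableSet A := measurableSet_le measurable_const (by fun_prop)
  have hS0 := hK.kernelSum_nonneg X n h x
  have hb2 := memLp_smootherBias hK hD.measurable hmX n h x
  have hwm : ∀ i, Measurable (kernelWeight K X n h x i) := fun i =>
    ((hK.measurable_kernelAt h x).comp (hD.measurable i)).div hSm
  have iqw : Integrable (fun ω => quadForm μ ε n (fun i => kernelWeight K X n h x i ω)) μ := by
    refine Integrable.of_bound (measurable_quadForm he n hwm).aestronglyMeasurable 1
      (ae_of_all _ fun ω => ?_)
    rw [Real.norm_eq_abs, abs_of_nonneg (quadForm_nonneg n _)]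
    refine (quadForm_le_sq_sum he he1 n fun i => hK.kernelWeight_nonneg X n h x i ω).trans ?_
    exact pow_le_one₀ (Finset.sum_nonneg fun i _ => hK.kernelWeight_nonneg X n h x i ω)
      (sum_kernelWeight_le_one K X n h x ω)
  have hKL : ∀ i, MemLp (fun ω => kernelAt K h x (X i ω)) 2 μ := fun i =>
    hD.memLp_comp i (hK.memLp_kernelAt h x)
  have iqK := integrable_quadForm he n hKL
  let D : Ω → ℝ := fun ω => (∑ i ∈ Finset.range n, kernelBiasAt K m h x (X i ω)) / N
  have hKtop : ∀ i, MemLp (fun ω => kernelAt K h x (X i ω)) ⊤ μ := fun i =>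
    hD.memLp_comp i (hK.memLp_kernelAt h x)
  have hDL : MemLp D 2 μ := by
    have : MemLp (fun ω => ∑ i ∈ Finset.range n, kernelBiasAt K m h x (X i ω)) 2 μ :=
      memLp_finsetSum _ fun i _ => ((hmX i).sub (memLp_const (m x))).mul' (hKtop i)
    simpa only [D, div_eq_inv_mul] using this.const_mul N⁻¹
  have hDd : MemLp (fun ω => D ω - d) 2 μ := hDL.sub (memLp_const d)
  have iV := hDd.integrable_sq
  have hD2 : ∫ ω, D ω ^ 2 ∂μ = d ^ 2 + ∫ ω, (D ω - d) ^ 2 ∂μ := by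
    have e0 : ∀ ω, D ω ^ 2 = (D ω - d) ^ 2 + (2 * d * D ω - d ^ 2) := fun ω => by ring
    have iD : Integrable D μ := hDL.integrable (by norm_num)
    have i2 : Integrable (fun ω => 2 * d * D ω - d ^ 2) μ :=
      (iD.const_mul _).sub (integrable_const _)
    simp_rw [e0]
    rw [integral_add iV i2, integral_sub (iD.const_mul _) (integrable_const _), integral_const_mul]
    have : ∫ ω, D ω ∂μ = d := hd
    rw [this]
    simp
    ring
  let F : Ω → ℝ := fun ω => kernelSum K X n h x ω / N
  have hFm : Measurable F := hSm.div_const N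
  have hFb : ∀ ω, |F ω| ≤ n * M / N := fun ω => by
    rw [abs_of_nonneg (div_nonneg (hS0 ω) hN.le)]
    exact div_le_div_of_nonneg_right (kernelSum_le hM X n h x ω) hN.le
  have iF : ∀ k : ℕ, Integrable (fun ω => F ω ^ k) μ := fun k =>
    Integrable.of_bound (hFm.pow_const k).aestronglyMeasurable ((n * M / N) ^ k)
      (ae_of_all _ fun ω => by
        rw [Real.norm_eq_abs, abs_pow]
        exact pow_le_pow_left₀ (abs_nonneg _) (hFb ω) k)
  let q : Ω → ℝ := fun ω => quadForm μ ε n (fun i => kernelAt K h x (X i ω))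
  let Q : Ω → ℝ := fun ω => q ω / N ^ 2 + D ω ^ 2
  have iQ : Integrable Q μ := (iqK.div_const _).add hDL.integrable_sq
  have hQ : ∫ ω, Q ω ∂μ = (∫ ω, q ω ∂μ) / N ^ 2 + d ^ 2 + ∫ ω, (D ω - d) ^ 2 ∂μ := by
    rw [integral_add (iqK.div_const _) hDL.integrable_sq, hD2, integral_div, add_assoc]
  let T : Ω → ℝ := fun ω => smootherBias K m X n h x ω ^ 2 +
    quadForm μ ε n (fun i => kernelWeight K X n h x i ω)
  have iT : Integrable T μ := hb2.integrable_sq.add iqw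
  have hT : ∫ ω, T ω ∂μ = ∫ ω, smootherBias K m X n h x ω ^ 2 ∂μ +
        ∫ ω, quadForm μ ε n (fun i => kernelWeight K X n h x i ω) ∂μ :=
    integral_add hb2.integrable_sq iqw
  let R : Ω → ℝ := fun ω => smootherBias K m X n h x ω ^ 2 + (1 + 2 * d ^ 2 / g ^ 2) + F ω ^ 2 / g ^ 2
  have iR1 : Integrable (fun ω => smootherBias K m X n h x ω ^ 2 + (1 + 2 * d ^ 2 / g ^ 2)) μ :=
    hb2.integrable_sq.add (integrable_const _)
  have iR : Integrable R μ := iR1.add ((iF 2).div_const _)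
  have hpt : ∀ ω, |T ω - Q ω / g ^ 2| ≤
      (6 * δ * Q ω / g ^ 2 + 2 * (D ω - d) ^ 2 / g ^ 2) + A.indicator R ω := by
    intro ω
    have := abs_smootherBias_sq_add_quadForm_sub_le (m := m) (X := X) hK he he1 hN x (d := d) hg hδ0
      hδ ω
    have e5 : A.indicator R ω = A.indicator (fun ω => smootherBias K m X n h x ω ^ 2 + 1 +
        2 * d ^ 2 / g ^ 2 + (kernelSum K X n h x ω / N) ^ 2 / g ^ 2) ω := by
      congr 1
      ext ω
      simp only [R, F]
      ring
    rw [e5]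
    exact this
  have iL : Integrable (fun ω => 6 * δ * Q ω / g ^ 2 + 2 * (D ω - d) ^ 2 / g ^ 2) μ :=
    ((iQ.const_mul _).div_const _).add ((iV.const_mul _).div_const _)
  have main : |∫ ω, T ω ∂μ - (∫ ω, Q ω ∂μ) / g ^ 2| ≤
      6 * δ * (∫ ω, Q ω ∂μ) / g ^ 2 + 2 * (∫ ω, (D ω - d) ^ 2 ∂μ) / g ^ 2 + ∫ ω in A, R ω ∂μ := by
    rw [← integral_div, ← integral_sub iT (iQ.div_const _)]
    refine abs_integral_le_integral_abs.trans ((integral_mono (iT.sub (iQ.div_const _)).abs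
      (iL.add (iR.indicator hA)) hpt).trans (le_of_eq ?_))
    simp only [Pi.add_apply]
    rw [integral_add iL (iR.indicator hA), integral_indicator hA, integral_add
      ((iQ.const_mul _).div_const _) ((iV.const_mul _).div_const _), integral_div, integral_div,
      integral_const_mul, integral_const_mul]
  have hR : ∫ ω in A, R ω ∂μ ≤ (∫ ω in A, smootherBias K m X n h x ω ^ 2 ∂μ) +
      (1 + 2 * d ^ 2 / g ^ 2) * μ.real A +
      (1 / N ^ 2 * ∫ ω, F ω ^ 4 ∂μ + N ^ 2 * μ.real A) / g ^ 2 := by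
    have r1 : ∫ ω in A, R ω ∂μ = (∫ ω in A, smootherBias K m X n h x ω ^ 2 ∂μ) +
        (1 + 2 * d ^ 2 / g ^ 2) * μ.real A + (∫ ω in A, F ω ^ 2 ∂μ) / g ^ 2 := by
      rw [integral_add iR1.integrableOn ((iF 2).div_const _).integrableOn,
        integral_add hb2.integrable_sq.integrableOn (integrable_const _), setIntegral_const,
        integral_div, smul_eq_mul, mul_comm (μ.real A)]
    rw [r1]
    gcongr
    have i4 : Integrable (fun ω => 1 / N ^ 2 * F ω ^ 4 + N ^ 2) (μ.restrict A) :=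
      (((iF 4).const_mul _).add (integrable_const _)).integrableOn
    -- From `F² ≤ F⁴ / N² + N²`: the fourth moment is bounded, and the probability of the event will
    -- be of order `N ^ (-4)`, so both parts end up of order `N ^ (-2)`.
    calc ∫ ω in A, F ω ^ 2 ∂μ ≤ ∫ ω in A, (1 / N ^ 2 * F ω ^ 4 + N ^ 2) ∂μ := by
          refine integral_mono (iF 2).integrableOn i4 fun ω => ?_
          have e6 : 1 / N ^ 2 * F ω ^ 4 = (F ω ^ 2 / N) ^ 2 := by field_simp
          have e7 : F ω ^ 2 = (F ω ^ 2 / N) * N := by field_simp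
          simp only
          rw [e6]
          nlinarith [sq_nonneg (F ω ^ 2 / N - N), sq_nonneg (F ω ^ 2 / N), sq_nonneg N]
      _ = 1 / N ^ 2 * (∫ ω in A, F ω ^ 4 ∂μ) + N ^ 2 * μ.real A := by
          rw [integral_add ((iF 4).const_mul _).integrableOn (integrable_const _),
            setIntegral_const, integral_const_mul, smul_eq_mul, mul_comm (μ.real A)]
      _ ≤ _ := by
          exact add_le_add (mul_le_mul_of_nonneg_left (setIntegral_le_integral (iF 4)
            (ae_of_all _ fun ω => (by positivity : 0 ≤ F ω ^ 4))) (by positivity)) le_rfl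
  rw [hT, hQ] at main
  have hV0 : 0 ≤ ∫ ω, (D ω - d) ^ 2 ∂μ := integral_nonneg fun _ => sq_nonneg _
  change |_ - ((∫ ω, q ω ∂μ) / N ^ 2 + d ^ 2) / g ^ 2| ≤
    (6 * δ * ((∫ ω, q ω ∂μ) / N ^ 2 + d ^ 2) + (6 * δ + 3) * ∫ ω, (D ω - d) ^ 2 ∂μ) / g ^ 2 + _ + _ +
      (1 / N ^ 2 * ∫ ω, F ω ^ 4 ∂μ + N ^ 2 * μ.real A) / g ^ 2
  set V := ∫ ω, (D ω - d) ^ 2 ∂μ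
  set qb := (∫ ω, q ω ∂μ) / N ^ 2
  have hVg : 0 ≤ V / g ^ 2 := by positivity
  have e8 : (qb + d ^ 2 + V) / g ^ 2 = (qb + d ^ 2) / g ^ 2 + V / g ^ 2 := add_div _ _ _
  have e9 : 6 * δ * (qb + d ^ 2 + V) / g ^ 2 + 2 * V / g ^ 2 + V / g ^ 2 =
    (6 * δ * (qb + d ^ 2) + (6 * δ + 3) * V) / g ^ 2 := by ring
  rw [e8] at main
  rw [abs_le] at main ⊢
  constructor <;> linarith [main.1, main.2]

end Uniform

/-- The arithmetic of the error terms: `N` is the effective sample size, `P` the probability of the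
exceptional event, `u` the reciprocal of the density. -/
lemma abs_sub_le_of_error_bounds {E κ Cq Cv Cb Cp C4 Cd B N δ g d P bA V F4 qK S Γ T eQ eV u b bn
    y : ℝ} {p : ℕ} (hE0 : 0 < E) (hk1 : 0 ≤ κ) (hCq : 0 < Cq) (hCv : 0 < Cv) (hCb : 0 ≤ Cb)
    (hCp : 0 < Cp) (hC4 : 0 < C4) (hN1 : 1 ≤ N) (hδ0 : 0 ≤ δ) (hδn : δ ≤ 1 / 4) (hgp : 0 < g)
    (hu1 : 1 ≤ u) (hP0 : 0 ≤ P) (hV : V ≤ Cv * eV) (hΓ0 : 0 ≤ Γ) (heQ0 : 0 ≤ eQ) (heV0 : 0 ≤ eV)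
    (hb0 : 0 ≤ b) (hbn0 : 0 ≤ bn) (hbnQ : bn ≤ eQ) (hF0 : 0 ≤ F4) (h4 : F4 ≤ C4)
    (hgE : 1 / g ^ 2 ≤ E * u ^ 2) (hPu : P ≤ Cp * u ^ p / N ^ 4) (hd2 : d ^ 2 ≤ Cd ^ 2 * b)
    (hd2' : d ^ 2 ≤ (Cd * B) ^ 2) (hS : S ≤ κ / N + Γ) (hq : |qK - S| ≤ Cq * eQ)
    (hx' : y ≤ 2 * u) (hbA : bA ≤ Cb * y * (N * P + bn))
    (hmain : |T - (qK + d ^ 2) / g ^ 2| ≤ (6 * δ * (qK + d ^ 2) + (6 * δ + 3) * V) / g ^ 2 + bA +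
      (1 + 2 * d ^ 2 / g ^ 2) * P + (1 / N ^ 2 * F4 + N ^ 2 * P) / g ^ 2) :
    |T - (S + d ^ 2) / g ^ 2| ≤ (E * (6 * (κ + 1 + Cd ^ 2) + 6 * Cq + 9 * Cv) +
      2 * Cb * (Cp + 1) + (1 + 2 * (Cd * B) ^ 2 * E) * Cp + (C4 + Cp) * E + Cq * E) * u ^ (p + 2) *
      (δ * (1 / N + Γ + b) + 1 / N ^ 2 + eQ + eV) := by
  set L := 1 / N + Γ + b with hL
  set O := δ * L + 1 / N ^ 2 + eQ + eV with hO
  have hN0 : 0 < N := by linarith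
  have hu0 : 0 < u := by linarith
  have hL0 : 0 ≤ L := by positivity
  have hδL0 : 0 ≤ δ * L := by positivity
  have hN20 : 0 ≤ 1 / N ^ 2 := by positivity
  have hO0 : 0 ≤ O := by positivity
  have hg20 : 0 ≤ 1 / g ^ 2 := by positivity
  have hup : ∀ k, k ≤ p + 2 → u ^ k ≤ u ^ (p + 2) := fun k hk => pow_le_pow_right₀ hu1 hk
  have hqK : qK ≤ κ / N + Γ + Cq * eQ := by linarith [(abs_le.1 hq).2]
  -- The relative error of the linearization off the exceptional event, together with the variance
  -- of the linearized bias.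
  have t1 : (6 * δ * (qK + d ^ 2) + (6 * δ + 3) * V) / g ^ 2 ≤
      E * (6 * (κ + 1 + Cd ^ 2) + 6 * Cq + 9 * Cv) * u ^ (p + 2) * O := by
    have k1 : 6 * δ * (qK + d ^ 2) + (6 * δ + 3) * V ≤
        (6 * (κ + 1 + Cd ^ 2) + 6 * Cq + 9 * Cv) * O := by
      have j1 : qK + d ^ 2 ≤ (κ + 1 + Cd ^ 2) * L + Cq * eQ := by
        have j2 : κ / N + Γ + Cd ^ 2 * b ≤ (κ + 1 + Cd ^ 2) * L := by
          set l1 := 1 / N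
          have hl1 : 0 ≤ l1 := by positivity
          have e1 : κ / N = κ * l1 := by rw [← mul_one_div]
          rw [hL, e1]
          have p1 := mul_nonneg hk1 hΓ0
          have p2 := mul_nonneg hk1 hb0
          have p3 := mul_nonneg (sq_nonneg Cd) hl1
          have p4 := mul_nonneg (sq_nonneg Cd) hΓ0
          linarith
        linarith
      have j3 : 6 * δ * (qK + d ^ 2) ≤ 6 * (κ + 1 + Cd ^ 2) * (δ * L) + 6 * Cq * eQ := by
        have j4 := mul_le_mul_of_nonneg_left j1 (by positivity : 0 ≤ 6 * δ)
        have j5 : 6 * δ * (Cq * eQ) ≤ 6 * Cq * eQ := by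
          have := mul_le_mul_of_nonneg_right (hδn.trans (by norm_num : (1 / 4 : ℝ) ≤ 1))
            (by positivity : 0 ≤ Cq * eQ)
          linarith
        linarith
      have j6 : (6 * δ + 3) * V ≤ 9 * Cv * eV := by
        have j7 : (6 * δ + 3) * V ≤ (6 * δ + 3) * (Cv * eV) :=
          mul_le_mul_of_nonneg_left hV (by positivity)
        have := mul_le_mul_of_nonneg_right (hδn.trans (by norm_num : (1 / 4 : ℝ) ≤ 1))
          (by positivity : 0 ≤ Cv * eV)
        linarith
      have b1 : 6 * (κ + 1 + Cd ^ 2) * (δ * L) ≤ 6 * (κ + 1 + Cd ^ 2) * O := by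
        refine mul_le_mul_of_nonneg_left ?_ (by positivity)
        linarith
      have b2 : 6 * Cq * eQ ≤ 6 * Cq * O :=
        mul_le_mul_of_nonneg_left (by linarith) (by positivity)
      have b3 : 9 * Cv * eV ≤ 9 * Cv * O :=
        mul_le_mul_of_nonneg_left (by linarith) (by positivity)
      linarith
    have k2 : 0 ≤ (6 * (κ + 1 + Cd ^ 2) + 6 * Cq + 9 * Cv) * O := by positivity
    calc _ ≤ ((6 * (κ + 1 + Cd ^ 2) + 6 * Cq + 9 * Cv) * O) * (1 / g ^ 2) := by
          rw [← mul_one_div]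
          exact mul_le_mul_of_nonneg_right k1 hg20
      _ ≤ ((6 * (κ + 1 + Cd ^ 2) + 6 * Cq + 9 * Cv) * O) * (E * u ^ (p + 2)) := by
          refine mul_le_mul_of_nonneg_left (hgE.trans ?_) k2
          exact mul_le_mul_of_nonneg_left (hup 2 (by lia)) hE0.le
      _ = _ := by ring
  -- The probability bound `N ^ (-4)` absorbs the prefactors `N` and `N ^ 2` of the remaining terms
  -- and always leaves at most `N ^ (-2)`.
  have hN34 : 1 / N ^ 3 ≤ 1 / N ^ 2 := one_div_le_one_div_of_le (by positivity)
    (pow_le_pow_right₀ hN1 (by norm_num))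
  have hN44 : 1 / N ^ 4 ≤ 1 / N ^ 2 := one_div_le_one_div_of_le (by positivity)
    (pow_le_pow_right₀ hN1 (by norm_num))
  have hnO : 1 / N ^ 2 + bn ≤ O := by
    rw [hO]; linarith
  have hNO : 1 / N ^ 2 ≤ O := by rw [hO]; linarith
  have t2 : bA ≤ 2 * Cb * (Cp + 1) * u ^ (p + 2) * O := by
    have k1 : N * P + bn ≤ (Cp + 1) * u ^ (p + 1) * O := by
      have j1 : N * P ≤ Cp * u ^ p * (1 / N ^ 2) := by
        calc N * P ≤ N * (Cp * u ^ p / N ^ 4) := by gcongr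
          _ = Cp * u ^ p * (1 / N ^ 3) := by field_simp
          _ ≤ _ := by gcongr
      have hpu : 1 ≤ u ^ p := one_le_pow₀ hu1
      have hn1 : 0 ≤ bn := hbn0
      calc N * P + bn ≤ (Cp + 1) * u ^ p * (1 / N ^ 2 + bn) := by
            have : 0 ≤ Cp * u ^ p * bn := by positivity
            have p1 := mul_nonneg (by linarith : 0 ≤ u ^ p) hN20
            have p2 := mul_le_mul_of_nonneg_right hpu hn1
            linarith
        _ ≤ (Cp + 1) * u ^ (p + 1) * O := by
            gcongr
            lia
    calc bA ≤ Cb * y * (N * P + bn) := hbA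
      _ ≤ Cb * (2 * u) * ((Cp + 1) * u ^ (p + 1) * O) := by gcongr
      _ = _ := by ring
  have t3 : (1 + 2 * d ^ 2 / g ^ 2) * P ≤ (1 + 2 * (Cd * B) ^ 2 * E) * Cp * u ^ (p + 2) * O := by
    have k1 : 1 + 2 * d ^ 2 / g ^ 2 ≤ (1 + 2 * (Cd * B) ^ 2 * E) * u ^ 2 := by
      have j1 : 2 * d ^ 2 / g ^ 2 ≤ 2 * (Cd * B) ^ 2 * (E * u ^ 2) := by
        rw [← mul_one_div]
        gcongr
      have j2 : 1 ≤ u ^ 2 := one_le_pow₀ hu1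
      linarith
    have k2 : P ≤ Cp * u ^ p * O := by
      refine hPu.trans ?_
      rw [← mul_one_div]
      gcongr
      exact hN44.trans hNO
    calc _ ≤ ((1 + 2 * (Cd * B) ^ 2 * E) * u ^ 2) * (Cp * u ^ p * O) := by gcongr
      _ = _ := by ring
  have t4 : (1 / N ^ 2 * F4 + N ^ 2 * P) / g ^ 2 ≤ (C4 + Cp) * E * u ^ (p + 2) * O := by
    have k1 : 1 / N ^ 2 * F4 + N ^ 2 * P ≤ (C4 + Cp) * u ^ p * O := by
      have j1 : 1 / N ^ 2 * F4 ≤ C4 * u ^ p * O := by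
        have hpu : 1 ≤ u ^ p := one_le_pow₀ hu1
        calc 1 / N ^ 2 * F4 ≤ O * (C4 * u ^ p) := by
              exact mul_le_mul hNO (h4.trans (le_mul_of_one_le_right hC4.le hpu)) hF0 hO0
          _ = _ := by ring
      have j2 : N ^ 2 * P ≤ Cp * u ^ p * O := by
        calc N ^ 2 * P ≤ N ^ 2 * (Cp * u ^ p / N ^ 4) := by gcongr
          _ = Cp * u ^ p * (1 / N ^ 2) := by field_simp
          _ ≤ _ := by gcongr
      linarith
    calc _ ≤ ((C4 + Cp) * u ^ p * O) * (E * u ^ 2) := by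
          rw [← mul_one_div]
          gcongr
      _ = _ := by ring
  have t5 : |qK - S| / g ^ 2 ≤ Cq * E * u ^ (p + 2) * O := by
    calc _ ≤ (Cq * O) * (E * u ^ (p + 2)) := by
          rw [← mul_one_div]
          refine mul_le_mul (hq.trans ?_) (hgE.trans ?_) hg20 (by positivity)
          · exact mul_le_mul_of_nonneg_left (by linarith) hCq.le
          · exact mul_le_mul_of_nonneg_left (hup 2 (by lia)) hE0.le
      _ = _ := by ring
  have e1 : T - (S + d ^ 2) / g ^ 2 = (T - (qK + d ^ 2) / g ^ 2) +
      (qK - S) / g ^ 2 := by ring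
  rw [e1]
  refine (abs_add_le _ _).trans ?_
  rw [abs_div (qK - _), abs_of_pos (by positivity : 0 < g ^ 2)]
  have e2 : (E * (6 * (κ + 1 + Cd ^ 2) + 6 * Cq + 9 * Cv) + 2 * Cb * (Cp + 1) +
    (1 + 2 * (Cd * B) ^ 2 * E) * Cp + (C4 + Cp) * E + Cq * E) * u ^ (p + 2) * O =
    E * (6 * (κ + 1 + Cd ^ 2) + 6 * Cq + 9 * Cv) * u ^ (p + 2) * O +
    2 * Cb * (Cp + 1) * u ^ (p + 2) * O + (1 + 2 * (Cd * B) ^ 2 * E) * Cp * u ^ (p + 2) * O +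
    (C4 + Cp) * E * u ^ (p + 2) * O + Cq * E * u ^ (p + 2) * O := by ring
  rw [e2]
  linarith

section Uniform

variable {Ω : Type*} [MeasurableSpace Ω] {μ : Measure Ω} [IsProbabilityMeasure μ]
  {X Z ζ ε : ℕ → Ω → ℝ} {v : ℝ≥0} {K m : ℝ → ℝ}

omit [IsProbabilityMeasure μ] in
lemma GaussianDecomposition.integral_sum_kernelBiasAt_div (hD : GaussianDecomposition μ X Z ζ v)
    (hK : IsKernel K) {B : ℝ} (hm : Differentiable ℝ m) (h1 : ∀ x, |deriv m x| ≤ B) {n : ℕ} {h : ℝ}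
    (hn : 0 < n) (hh : 0 < h) (x : ℝ) :
    ∫ ω, (∑ i ∈ Finset.range n, kernelBiasAt K m h x (X i ω)) / (n * h) ∂μ =
      (∫ y, kernelBiasAt K m h x y ∂gaussianReal 0 1) / h := by
  obtain ⟨M, hM0, hM⟩ := hK.exists_pos_bound
  have hψ := hK.measurable_kernelBiasAt hm.continuous.measurable h x
  obtain ⟨hi, -⟩ := hK.integral_kernelBiasAt_sq_le hm h1 hM hh x
  have hL2 : MemLp (kernelBiasAt K m h x) 2 (gaussianReal 0 1) :=
    (memLp_two_iff_integrable_sq hψ.aestronglyMeasurable).2 hi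
  have hn0 : (0 : ℝ) < n := by exact_mod_cast hn
  rw [integral_div, integral_finsetSum _ fun i _ =>
    hD.integrable_comp i (hL2.integrable (by norm_num))]
  simp_rw [fun i => hD.integral_comp i hψ]
  rw [Finset.sum_const, Finset.card_range, nsmul_eq_mul]
  field_simp

/-- The uniform approximation of the conditional mean squared error. -/
lemma GaussianDecomposition.exists_abs_integral_sub_le (hD : GaussianDecomposition μ X Z ζ v)
    (hK : IsKernel K) {a CZ : ℝ} (ha : a ∈ Set.Ioo (0 : ℝ) 1)
    (hcov : ∀ n : ℕ, ∑ i ∈ Finset.range n, ∑ j ∈ Finset.range n, |∫ ω, Z i ω * Z j ω ∂μ| ≤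
      CZ * (n : ℝ) ^ (2 - a))
    (he : ∀ i, MemLp (ε i) 2 μ) (he1 : ∀ i, ∫ ω, ε i ω ^ 2 ∂μ = 1)
    {B : ℝ} (hm : Differentiable ℝ m) (hm' : Differentiable ℝ (deriv m))
    (h1 : ∀ x, |deriv m x| ≤ B) (h2 : ∀ x, |deriv (deriv m) x| ≤ B) {h : ℕ → ℝ}
    (hpos : ∀ᶠ n in atTop, 0 < h n ∧ h n ≤ 1 ∧ 1 ≤ n * h n)
    (hnh : Tendsto (fun n : ℕ => (n : ℝ) * h n) atTop atTop)
    (hreg : HasCompactSupport K ∨ (∃ M : ℝ, ∀ x, |m x| ≤ M) ∨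
      (fun n : ℕ => Real.log n) =O[atTop] fun n : ℕ => (n : ℝ) * h n) :
    ∃ (C : ℝ) (p : ℕ), 0 ≤ C ∧ ∀ᶠ n : ℕ in atTop, ∀ s : ℝ, 0 < s → ∀ x : ℝ,
      |(∫ ω, smootherBias K m X n (h n) x ω ^ 2 ∂μ +
        ∫ ω, quadForm μ ε n (fun i => kernelWeight K X n (h n) x i ω) ∂μ) -
      ((∫ y, kernelAt K (h n) x y ^ 2 ∂gaussianReal 0 1) / h n / (n * h n) +
        smoothedDensity K (h n) x ^ 2 * (quadForm μ ε n (fun _ => 1) / n ^ 2) +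
        ((∫ y, kernelBiasAt K m (h n) x y ∂gaussianReal 0 1) / h n) ^ 2) /
          smoothedDensity K (h n) x ^ 2| ≤
      C * (gaussianPDFReal 0 1 x)⁻¹ ^ p *
        ((n * h n) ^ (-(a / 4)) * (1 / (n * h n) + quadForm μ ε n (fun _ => 1) / n ^ 2 +
          B ^ 2 * h n ^ 4) + 1 / (n * h n) ^ 2 + (1 / n + s / (n * h n) + (1 + 1 / s) *
          ((∑ i ∈ Finset.range n, ∑ j ∈ Finset.range n,
          |∫ ω, ε i ω * ε j ω ∂μ| * |∫ ω, Z i ω * Z j ω ∂μ|) / n ^ 2)) +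
          B ^ 2 * (h n / n + h n ^ 4 * (n : ℝ) ^ (-a))) := by
  have hB : 0 ≤ B := (abs_nonneg _).trans (h1 0)
  obtain ⟨Cq, hCq, hq⟩ := hD.exists_abs_integral_quadForm_kernelAt_sub_le hK he he1
  obtain ⟨Cv, hCv, hv⟩ := hD.exists_integral_sum_kernelBiasAt_sub_sq_le hK hcov hm hm' h1 h2
  obtain ⟨Cd, hCd, hd⟩ := hK.exists_abs_integral_kernelBiasAt_div_le
  obtain ⟨Cb, hCb, hb⟩ := hD.exists_setIntegral_smootherBias_sq_le hK hm h1 hpos hreg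
  obtain ⟨Cp, p, hCp, hp⟩ := hD.exists_measureReal_kernelSum_le hK hcov ha
  obtain ⟨C4, hC4, h4⟩ := hD.exists_integral_kernelSum_pow_four_le hK hcov ha
  have hk1 := kappa1_nonneg K
  set E := (Real.exp (-kappa2 K / 2))⁻¹ ^ 2 with hE
  have hE0 : 0 < E := by positivity
  have hδ : ∀ᶠ n : ℕ in atTop, ((n : ℝ) * h n) ^ (-(a / 4)) ≤ 1 / 4 := by
    have := (tendsto_rpow_neg_atTop (y := a / 4) (by linarith [ha.1])).comp hnh
    exact this.eventually_le_const (by norm_num)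
  -- The exponent `p` comes from the exceptional probability and the extra `2` from dividing by the
  -- squared smoothed density.
  refine ⟨E * (6 * (kappa1 K + 1 + Cd ^ 2) + 6 * Cq + 9 * Cv) + 2 * Cb * (Cp + 1) +
    (1 + 2 * (Cd * B) ^ 2 * E) * Cp + (C4 + Cp) * E + Cq * E, p + 2, by positivity, ?_⟩
  filter_upwards [hb, hδ, hpos, eventually_gt_atTop 0] with n hbn hδn ⟨hh, hh1, hN1⟩ hn s hs x
  have hn0 : (0 : ℝ) < n := by exact_mod_cast hn
  have hmX := hD.memLp_comp_of_abs_deriv_le hm h1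
  have hφ := gaussianPDFReal_pos 0 1 x one_ne_zero
  have hφ1 := gaussianPDFReal_le_one x
  have hg := hK.smoothedDensity_ge (h := h n) (by rwa [abs_of_pos hh]) x
  have hg1 := hK.smoothedDensity_le_one (h n) x
  have hx := one_add_sq_le_div_gaussianPDFReal x
  replace hp := hp x (h n) n hh hh1 hN1
  have hS2 := hK.integral_kernelAt_sq_le hh x
  have hS20 : 0 ≤ ∫ y, kernelAt K (h n) x y ^ 2 ∂gaussianReal 0 1 := integral_nonneg fun y => sq_nonneg _
  have hgp : 0 < smoothedDensity K (h n) x := lt_of_lt_of_le (by positivity) hg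
  have hmain := hD.abs_integral_sub_le (m := m) hK he he1 hmX (n := n) (h := h n) (by linarith) x hgp
    (δ := ((n : ℝ) * h n) ^ (-(a / 4))) (by positivity) hδn
    (hD.integral_sum_kernelBiasAt_div hK hm h1 hn hh x)
  replace hq := hq x (h n) s n hh hn hs
  replace hv := (hv x (h n) n hh hh1 hn).2
  replace hd := hd m B hm hm' h1 h2 x (h n) hh
  replace h4 := h4 x (h n) n hh hh1 hN1
  have hSm := hD.measurable_kernelSum hK n (h n) x
  replace hbn := hbn x {ω | (n * h n : ℝ) ^ (-(a / 4)) * (n * h n * smoothedDensity K (h n) x) ≤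
        |kernelSum K X n (h n) x ω - n * h n * smoothedDensity K (h n) x|}
    (measurableSet_le measurable_const (by fun_prop))
  have hΓ0 : 0 ≤ quadForm μ ε n (fun _ => 1) / (n : ℝ) ^ 2 :=
    div_nonneg (quadForm_nonneg n _) (by positivity)
  have hθ0 : 0 ≤ (∑ i ∈ Finset.range n, ∑ j ∈ Finset.range n,
      |∫ ω, ε i ω * ε j ω ∂μ| * |∫ ω, Z i ω * Z j ω ∂μ|) / (n : ℝ) ^ 2 :=
    div_nonneg (Finset.sum_nonneg fun i _ => Finset.sum_nonneg fun j _ => by positivity)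
      (by positivity)
  set N : ℝ := n * h n with hN
  have hN0 : 0 < N := by linarith
  set δ := N ^ (-(a / 4))
  have hδ0 : 0 ≤ δ := by positivity
  set g := smoothedDensity K (h n) x
  set d := (∫ y, kernelBiasAt K m (h n) x y ∂gaussianReal 0 1) / h n
  set P := μ.real {ω | δ * (N * g) ≤ |kernelSum K X n (h n) x ω - N * g|}
  set bA := ∫ ω in {ω | δ * (N * g) ≤ |kernelSum K X n (h n) x ω - N * g|},
    smootherBias K m X n (h n) x ω ^ 2 ∂μ
  set V := ∫ ω, ((∑ i ∈ Finset.range n, kernelBiasAt K m (h n) x (X i ω)) / N - d) ^ 2 ∂μ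
  set F4 := ∫ ω, (kernelSum K X n (h n) x ω / N) ^ 4 ∂μ
  set qK := (∫ ω, quadForm μ ε n (fun i => kernelAt K (h n) x (X i ω)) ∂μ) / N ^ 2
  set S2 := ∫ y, kernelAt K (h n) x y ^ 2 ∂gaussianReal 0 1
  set Γ := quadForm μ ε n (fun _ => 1) / (n : ℝ) ^ 2
  set θ := (∑ i ∈ Finset.range n, ∑ j ∈ Finset.range n,
      |∫ ω, ε i ω * ε j ω ∂μ| * |∫ ω, Z i ω * Z j ω ∂μ|) / (n : ℝ) ^ 2
  set T := ∫ ω, smootherBias K m X n (h n) x ω ^ 2 ∂μ +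
        ∫ ω, quadForm μ ε n (fun i => kernelWeight K X n (h n) x i ω) ∂μ
  set eQ := 1 / (n : ℝ) + s / N + (1 + 1 / s) * θ with heQ
  set eV := B ^ 2 * (h n / n + h n ^ 4 * (n : ℝ) ^ (-a)) with heV
  set u := (gaussianPDFReal 0 1 x)⁻¹ with hu
  have hu1 : 1 ≤ u := (one_le_inv₀ hφ).2 hφ1
  have hu0 : 0 < u := by linarith
  have heQ0 : 0 ≤ eQ := by positivity
  have heV0 : 0 ≤ eV := by positivity
  have hgE : 1 / g ^ 2 ≤ E * u ^ 2 := by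
    rw [hE, hu, ← mul_pow, ← mul_inv, inv_pow, one_div]
    exact inv_anti₀ (by positivity) (pow_le_pow_left₀ (by positivity) hg 2)
  have hPu : P ≤ Cp * u ^ p / N ^ 4 := by
    rw [hu, inv_pow, ← div_eq_mul_inv]; exact hp
  have hd2 : d ^ 2 ≤ Cd ^ 2 * (B ^ 2 * h n ^ 4) := by
    rw [← sq_abs]
    refine (pow_le_pow_left₀ (abs_nonneg _) hd 2).trans (le_of_eq (by ring))
  have hd2' : d ^ 2 ≤ (Cd * B) ^ 2 := by
    refine hd2.trans ?_
    rw [mul_pow, ← mul_assoc]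
    exact mul_le_of_le_one_right (by positivity) (pow_le_one₀ hh.le hh1)
  have k2 : S2 / h n / N ≤ kappa1 K / N := by
    gcongr
    rwa [div_le_iff₀ hh]
  have k3 : g ^ 2 * Γ ≤ Γ := mul_le_of_le_one_left hΓ0 (pow_le_one₀ hgp.le hg1)
  have k4 : 0 ≤ s / N + (1 + 1 / s) * θ := by positivity
  have hx' : 1 + x ^ 2 ≤ 2 * u := by rw [hu, ← div_eq_mul_inv]; exact hx
  exact abs_sub_le_of_error_bounds hE0 hk1 hCq hCv hCb hCp hC4 hN1 hδ0 hδn hgp hu1 measureReal_nonneg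
    (hv.trans (le_of_eq (by rw [heV]; ring))) hΓ0 heQ0 heV0 (by positivity) (by positivity)
    (by rw [heQ]; linarith) (integral_nonneg fun ω => (by positivity)) h4 hgE hPu hd2 hd2'
    (add_le_add k2 k3) hq hx' hbn hmain

end Uniform

/-! ### Covariances of the predictions and of the errors. -/

section Covariance

variable {Ω : Type*} [MeasurableSpace Ω] {μ : Measure Ω} [IsProbabilityMeasure μ]

lemma IsLinearProcess.integral_mul_eq_dist {a : ℕ → ℝ} {ξ : ℤ → Ω → ℝ} {X : ℕ → Ω → ℝ}
    (hX : IsLinearProcess μ a ξ X) (h2 : MemLp (ξ 0) 2 μ) (ha : Summable fun k => a k ^ 2) (i j : ℕ) :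
    ∫ ω, X (i + 1) ω * X (j + 1) ω ∂μ =
      (∫ ω, ξ 0 ω ^ 2 ∂μ) * ∑' k, a k * a (k + Nat.dist i j) := by
  wlog hij : i ≤ j generalizing i j
  · simp_rw [mul_comm (X (i + 1) _), Nat.dist_comm i j]
    exact this j i (by lia)
  obtain ⟨l, rfl⟩ := Nat.exists_eq_add_of_le hij
  rw [Nat.dist_eq_sub_of_le hij, Nat.add_sub_cancel_left, show i + l + 1 = i + 1 + l by ring]
  exact hX.integral_mul h2 ha (by lia) l

/-- Coefficients of order `k ^ (-β)` with `β = (αX + 1) / 2` give covariances of order `l ^ (-(2 β -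
1))`, and `2 β - 1 = αX`. The vanishing zeroth coefficient of the prediction has no influence on the
order. -/
lemma LRDPredictors.exists_integral_mul_eq_dist {αX A₀ : ℝ} {ζ : ℤ → Ω → ℝ} {X : ℕ → Ω → ℝ}
    (hX : LRDPredictors μ αX A₀ ζ X) : ∃ (g : ℕ → ℝ) (G : ℝ),
      (∀ i j : ℕ, ∫ ω, (X (i + 1) ω - ζ (i + 1 : ℕ) ω) * (X (j + 1) ω - ζ (j + 1 : ℕ) ω) ∂μ =
        g (Nat.dist i j)) ∧
      Tendsto (fun l : ℕ => g l * (l : ℝ) ^ αX) atTop (𝓝 G) := by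
  obtain ⟨v, hv⟩ := hX.gaussian
  have h2 : MemLp (ζ 0) 2 μ := by
    have : MemLp (id : ℝ → ℝ) 2 (μ.map (ζ 0)) := by
      rw [hv 0]; exact memLp_id_gaussianReal 2
    exact this.comp_of_map (hX.linear.measurable_innov 0).aemeasurable
  have hα := hX.mem_Ioo
  have hb1 : 1 / 2 < (αX + 1) / 2 := by linarith [hα.1]
  have hb2 : (αX + 1) / 2 < 1 := by linarith [hα.2]
  have hc : Tendsto (fun k : ℕ => LRDPredictors.predictionCoeff A₀ αX k * (k : ℝ) ^ ((αX + 1) / 2)) atTop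
      (𝓝 A₀) := by
    refine tendsto_const_nhds.congr' ?_
    filter_upwards [eventually_gt_atTop 0] with k hk
    have hk0 : (0 : ℝ) < k := by exact_mod_cast hk
    rw [LRDPredictors.predictionCoeff, if_neg hk.ne', predictorCoeff, if_neg hk.ne', mul_assoc,
      ← Real.rpow_add hk0, neg_div, neg_add_cancel, Real.rpow_zero, mul_one]
  have hZ := hX.isLinearProcess_prediction
  have hlim := (tendsto_rpow_mul_tsum hb1 hb2 hc).const_mul (∫ ω, ζ 0 ω ^ 2 ∂μ)
  rw [show 2 * ((αX + 1) / 2) - 1 = αX by ring] at hlim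
  simp only [← mul_assoc] at hlim
  exact ⟨_, _, hZ.integral_mul_eq_dist h2 (summable_sq_of_tendsto hb1 hc), hlim⟩

lemma LRDErrors.memLp_two {α C₀ : ℝ} {c : ℕ → ℝ} {η : ℤ → Ω → ℝ} {ε X : ℕ → Ω → ℝ}
    (hE : LRDErrors μ α C₀ c η ε X) : MemLp (η 0) 2 μ :=
  hE.fourth_moment.mono_exponent (by norm_num)

/-- The same computation as for the predictors. Strict positivity of the limit, needed for `C₁ > 0`,
comes from `C₀ ≠ 0`, the positive limiting integral, and nondegenerate innovations. -/
lemma LRDErrors.exists_integral_mul_eq_dist {α C₀ : ℝ} {c : ℕ → ℝ} {η : ℤ → Ω → ℝ} {ε X : ℕ → Ω → ℝ}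
    (hE : LRDErrors μ α C₀ c η ε X) : ∃ (g : ℕ → ℝ) (G : ℝ), 0 < G ∧ g 0 = 1 ∧
      (∀ i j : ℕ, ∫ ω, ε (i + 1) ω * ε (j + 1) ω ∂μ = g (Nat.dist i j)) ∧
      Tendsto (fun l : ℕ => g l * (l : ℝ) ^ α) atTop (𝓝 G) := by
  have h2 := hE.memLp_two
  have hα := hE.mem_Ioo
  have hb1 : 1 / 2 < (α + 1) / 2 := by linarith [hα.1]
  have hb2 : (α + 1) / 2 < 1 := by linarith [hα.2]
  have hc : Tendsto (fun k : ℕ => c k * (k : ℝ) ^ ((α + 1) / 2)) atTop (𝓝 C₀) := by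
    have h3 : (fun k : ℕ => c k * (k : ℝ) ^ ((α + 1) / 2)) ~[atTop] fun _ => C₀ := by
      refine (hE.coeff_asymp.mul (IsEquivalent.refl (u := fun k : ℕ =>
        (k : ℝ) ^ ((α + 1) / 2)))).congr_right ?_
      filter_upwards [eventually_gt_atTop 0] with k hk
      have hk0 : (0 : ℝ) < k := by exact_mod_cast hk
      simp only [Pi.mul_apply]
      rw [mul_assoc, ← Real.rpow_add hk0, neg_div, neg_add_cancel, Real.rpow_zero, mul_one]
    exact (isEquivalent_const_iff_tendsto hE.const_ne_zero).1 h3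
  have hcov := hE.linear.integral_mul_eq_dist h2 (summable_sq_of_tendsto hb1 hc)
  have hg0 : (∫ ω, η 0 ω ^ 2 ∂μ) * ∑' k, c k * c (k + 0) = 1 := by
    have h3 := hcov 0 0
    rw [Nat.dist_self] at h3
    rw [← h3, ← hE.second_moment]
    simp_rw [pow_two]
  -- Degenerate innovations would contradict the unit second moment of the errors.
  have hσ : 0 < ∫ ω, η 0 ω ^ 2 ∂μ := by
    refine lt_of_le_of_ne (integral_nonneg fun _ => sq_nonneg _) fun h0 => ?_
    rw [← h0, zero_mul] at hg0
    exact zero_ne_one hg0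
  have hC : 0 < C₀ ^ 2 := by
    have := hE.const_ne_zero
    positivity
  refine ⟨fun l => (∫ ω, η 0 ω ^ 2 ∂μ) * ∑' k, c k * c (k + l), _,
    mul_pos hσ (mul_pos hC (covarianceKernel_integral_pos hb1 hb2)), hg0, hcov, ?_⟩
  have := (tendsto_rpow_mul_tsum hb1 hb2 hc).const_mul (∫ ω, η 0 ω ^ 2 ∂μ)
  rw [show 2 * ((α + 1) / 2) - 1 = α by ring] at this
  simpa only [mul_assoc] using this

end Covariance

lemma exists_le_rpow_of_tendsto_div {S : ℕ → ℝ} {b C : ℝ} (h0 : S 0 = 0)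
    (hS : Tendsto (fun n : ℕ => S n / (n : ℝ) ^ b) atTop (𝓝 C)) :
    ∃ M : ℝ, ∀ n : ℕ, S n ≤ M * (n : ℝ) ^ b := by
  obtain ⟨M, hM⟩ := hS.bddAbove_range
  refine ⟨max M 0, fun n => ?_⟩
  rcases Nat.eq_zero_or_pos n with rfl | hn
  · rw [h0]; positivity
  · have hn0 : (0 : ℝ) < n := by exact_mod_cast hn
    rw [← div_le_iff₀ (by positivity)]
    exact (hM ⟨n, rfl⟩).trans (le_max_left _ _)

/-! ### Growth of the covariance sums. -/

section Sums

variable {α αX : ℝ} {g gZ : ℕ → ℝ} {G GZ : ℝ}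

lemma exists_sum_abs_dist_le (h0 : 0 < αX) (h1 : αX < 1)
    (hgZ : Tendsto (fun l : ℕ => gZ l * (l : ℝ) ^ αX) atTop (𝓝 GZ)) :
    ∃ M : ℝ, ∀ n : ℕ, ∑ i ∈ Finset.range n, ∑ j ∈ Finset.range n, |gZ (Nat.dist i j)| ≤
      M * (n : ℝ) ^ (2 - αX) := by
  have h2 : Tendsto (fun l : ℕ => |gZ l| * (l : ℝ) ^ αX) atTop (𝓝 |GZ|) := by
    refine hgZ.abs.congr fun l => ?_
    rw [abs_mul, abs_of_nonneg (by positivity : 0 ≤ (l : ℝ) ^ αX)]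
  exact exists_le_rpow_of_tendsto_div (by simp)
    (tendsto_sum_sum_dist (g := fun l => |gZ l|) h0 h1 h2)

/-- The product of the two covariances is `O(l ^ (-α - αX))`, hence `o(l ^ (-α))` for every `αX >
0`. This is why the memory parameter of the predictors leaves no trace in the expansion. -/
lemma tendsto_sum_abs_mul_abs_dist (h0 : 0 < α) (h1 : α < 1) (h2 : 0 < αX)
    (hg : Tendsto (fun l : ℕ => g l * (l : ℝ) ^ α) atTop (𝓝 G))
    (hgZ : Tendsto (fun l : ℕ => gZ l * (l : ℝ) ^ αX) atTop (𝓝 GZ)) :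
    Tendsto (fun n : ℕ => (∑ i ∈ Finset.range n, ∑ j ∈ Finset.range n,
      |g (Nat.dist i j)| * |gZ (Nat.dist i j)|) / (n : ℝ) ^ (2 - α)) atTop (𝓝 0) := by
  have h3 : Tendsto (fun l : ℕ => (|g l| * |gZ l|) * (l : ℝ) ^ α) atTop (𝓝 0) := by
    have h4 : Tendsto (fun l : ℕ => (l : ℝ) ^ (-αX)) atTop (𝓝 0) :=
      (tendsto_rpow_neg_atTop h2).comp tendsto_natCast_atTop_atTop
    have h5 := (hg.abs.mul hgZ.abs).mul h4
    rw [mul_zero] at h5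
    refine h5.congr' ?_
    filter_upwards [eventually_gt_atTop 0] with l hl
    have hl0 : (0 : ℝ) < l := by exact_mod_cast hl
    rw [abs_mul, abs_mul, abs_of_nonneg (by positivity : 0 ≤ (l : ℝ) ^ α),
      abs_of_nonneg (by positivity : 0 ≤ (l : ℝ) ^ αX)]
    have : (l : ℝ) ^ αX * (l : ℝ) ^ (-αX) = 1 := by
      rw [← Real.rpow_add hl0, add_neg_cancel, Real.rpow_zero]
    calc |g l| * (l : ℝ) ^ α * (|gZ l| * (l : ℝ) ^ αX) * (l : ℝ) ^ (-αX) =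
        (|g l| * |gZ l|) * (l : ℝ) ^ α * ((l : ℝ) ^ αX * (l : ℝ) ^ (-αX)) := by ring
      _ = _ := by rw [this, mul_one]
  have := tendsto_sum_sum_dist (g := fun l => |g l| * |gZ l|) h0 h1 h3
  simpa using this

end Sums

/-- A density of a standard normal variable that is continuous is the normal density. -/
lemma eq_gaussianPDFReal_of_isDensityOf {Ω : Type*} [MeasurableSpace Ω] {μ : Measure Ω} {Y : Ω → ℝ}
    {f : ℝ → ℝ} (hf : IsDensityOf μ Y f) (hY : μ.map Y = gaussianReal 0 1) (hc : Continuous f)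
    (hpos : ∀ x, 0 < f x) : f = gaussianPDFReal 0 1 := by
  rw [IsDensityOf, hY, gaussianReal_of_var_ne_zero _ one_ne_zero] at hf
  have hfm : Measurable fun x => ENNReal.ofReal (f x) := by
    have := hc.measurable
    fun_prop
  have h1 : gaussianPDF 0 1 =ᵐ[volume] fun x => ENNReal.ofReal (f x) := by
    refine (withDensity_eq_iff (measurable_gaussianPDF 0 1).aemeasurable hfm.aemeasurable ?_).1 hf
    rw [lintegral_gaussianPDF_eq_one 0 one_ne_zero]
    exact ENNReal.one_ne_top
  refine (Continuous.ae_eq_iff_eq volume hc continuous_gaussianPDFReal).1 ?_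
  filter_upwards [h1] with x hx
  rw [gaussianPDF] at hx
  exact ((ENNReal.ofReal_eq_ofReal_iff (gaussianPDFReal_nonneg 0 1 x) (hpos x).le).1 hx).symm

/-! ### Limits of the weighted variance and squared bias. -/

section Weighted

variable {K m r : ℝ → ℝ} (hK : IsKernel K)

include hK

lemma IsKernel.measurable_integral_kernelAt_sq (h : ℝ) :
    Measurable fun x => ∫ y, kernelAt K h x y ^ 2 ∂gaussianReal 0 1 := by
  have := hK.measurable
  have h1 : Measurable fun p : ℝ × ℝ => kernelAt K h p.1 p.2 ^ 2 := by
    unfold kernelAt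
    fun_prop
  exact h1.stronglyMeasurable.integral_prod_right'.measurable

lemma IsKernel.measurable_smoothedDensity (h : ℝ) : Measurable (smoothedDensity K h) := by
  have := hK.measurable
  have h1 : Measurable fun p : ℝ × ℝ => K p.2 * gaussianPDFReal 0 1 (p.1 - h * p.2) := by
    have := measurable_gaussianPDFReal 0 1
    fun_prop
  exact h1.stronglyMeasurable.integral_prod_right'.measurable

lemma IsKernel.measurable_integral_kernelBiasAt (hm : Measurable m) (h : ℝ) :
    Measurable fun x => ∫ y, kernelBiasAt K m h x y ∂gaussianReal 0 1 := by
  have := hK.measurable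
  have h1 : Measurable fun p : ℝ × ℝ => kernelBiasAt K m h p.1 p.2 := by
    unfold kernelBiasAt
    fun_prop
  exact h1.stronglyMeasurable.integral_prod_right'.measurable

lemma IsKernel.one_div_smoothedDensity_sq_le {h : ℝ} (hh : |h| ≤ 1) (x : ℝ) :
    1 / smoothedDensity K h x ^ 2 ≤
      (Real.exp (-kappa2 K / 2))⁻¹ ^ 2 * (1 / gaussianPDFReal 0 1 x ^ 2) := by
  have hφ := gaussianPDFReal_pos 0 1 x one_ne_zero
  have hg := hK.smoothedDensity_ge hh x
  calc 1 / smoothedDensity K h x ^ 2 ≤ 1 / (Real.exp (-kappa2 K / 2) * gaussianPDFReal 0 1 x) ^ 2 :=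
        one_div_le_one_div_of_le (by positivity) (pow_le_pow_left₀ (by positivity) hg 2)
    _ = _ := by rw [mul_pow, inv_pow, ← one_div, one_div_mul_one_div]

/-- The variance factor of the approximate mean squared error. -/
noncomputable def varianceFactor (K : ℝ → ℝ) (h x : ℝ) : ℝ :=
  (∫ y, kernelAt K h x y ^ 2 ∂gaussianReal 0 1) / h / smoothedDensity K h x ^ 2

/-- The squared bias factor of the approximate mean squared error. -/
noncomputable def biasFactor (K m : ℝ → ℝ) (h x : ℝ) : ℝ :=
  ((∫ y, kernelBiasAt K m h x y ∂gaussianReal 0 1) / h ^ 3) ^ 2 / smoothedDensity K h x ^ 2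

lemma IsKernel.measurable_varianceFactor (h : ℝ) : Measurable (varianceFactor K h) :=
  ((hK.measurable_integral_kernelAt_sq h).div_const h).div ((hK.measurable_smoothedDensity h).pow_const 2)

lemma IsKernel.measurable_biasFactor (hm : Measurable m) (h : ℝ) : Measurable (biasFactor K m h) :=
  (((hK.measurable_integral_kernelBiasAt hm h).div_const (h ^ 3)).pow_const 2).div
    ((hK.measurable_smoothedDensity h).pow_const 2)

lemma IsKernel.abs_varianceFactor_le {h : ℝ} (hh : 0 < h) (hh1 : h ≤ 1) (x : ℝ) :
    |varianceFactor K h x| ≤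
      kappa1 K * (Real.exp (-kappa2 K / 2))⁻¹ ^ 2 * (1 / gaussianPDFReal 0 1 x ^ 2) := by
  have h1 := hK.one_div_smoothedDensity_sq_le (h := h) (by rwa [abs_of_pos hh]) x
  have h2 := hK.integral_kernelAt_sq_le hh x
  have h3 : 0 ≤ ∫ y, kernelAt K h x y ^ 2 ∂gaussianReal 0 1 := integral_nonneg fun y => sq_nonneg _
  rw [varianceFactor, abs_of_nonneg (by positivity), ← mul_one_div, mul_assoc]
  refine mul_le_mul ?_ h1 (by positivity) (kappa1_nonneg K)
  rwa [div_le_iff₀ hh]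

lemma IsKernel.exists_abs_biasFactor_le :
    ∃ C : ℝ, 0 < C ∧ ∀ (m : ℝ → ℝ) (B : ℝ), Differentiable ℝ m → Differentiable ℝ (deriv m) →
      (∀ x, |deriv m x| ≤ B) → (∀ x, |deriv (deriv m) x| ≤ B) → ∀ h : ℝ, 0 < h → h ≤ 1 → ∀ x,
      |biasFactor K m h x| ≤ C * B ^ 2 * (1 / gaussianPDFReal 0 1 x ^ 2) := by
  obtain ⟨C, hC, hb⟩ := hK.exists_abs_integral_kernelBiasAt_div_le
  refine ⟨C ^ 2 * (Real.exp (-kappa2 K / 2))⁻¹ ^ 2, by positivity,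
    fun m B hm hm' h1 h2 h hh hh1 x => ?_⟩
  have h3 := hK.one_div_smoothedDensity_sq_le (h := h) (by rwa [abs_of_pos hh]) x
  have h4 := hb m B hm hm' h1 h2 x h hh
  have h5 : |(∫ y, kernelBiasAt K m h x y ∂gaussianReal 0 1) / h ^ 3| ≤ C * B := by
    rw [pow_succ' h 2, ← div_div, abs_div, abs_of_pos (by positivity : 0 < h ^ 2),
      div_le_iff₀ (by positivity)]
    exact h4
  rw [biasFactor, abs_of_nonneg (by positivity), ← mul_one_div, ← sq_abs]
  calc _ ≤ (C * B) ^ 2 * ((Real.exp (-kappa2 K / 2))⁻¹ ^ 2 * (1 / gaussianPDFReal 0 1 x ^ 2)) :=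
        mul_le_mul (pow_le_pow_left₀ (abs_nonneg _) h5 2) h3 (by positivity) (by positivity)
    _ = _ := by ring

variable (hr : ∀ x, 0 ≤ r x)
  (hr_int : ∀ p : ℕ, Integrable fun x => r x / gaussianPDFReal 0 1 x ^ p)

omit hK in
include hr hr_int in
/-- Dominated convergence for functions that are dominated by an inverse power of the density. -/
lemma tendsto_integral_mul_of_abs_le {F : ℕ → ℝ → ℝ} {l : ℝ → ℝ} {C : ℝ} {p : ℕ}
    (hFm : ∀ n, Measurable (F n))
    (hF : ∀ᶠ n in atTop, ∀ x, |F n x| ≤ C * (1 / gaussianPDFReal 0 1 x ^ p))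
    (hl : ∀ x, Tendsto (fun n => F n x) atTop (𝓝 (l x))) :
    (∀ᶠ n in atTop, Integrable fun x => F n x * r x) ∧
      Tendsto (fun n => ∫ x, F n x * r x) atTop (𝓝 (∫ x, l x * r x)) := by
  have hrm : AEStronglyMeasurable r := by simpa using (hr_int 0).aestronglyMeasurable
  have hb : ∀ᶠ n in atTop, ∀ᵐ x, ‖F n x * r x‖ ≤ C * (r x / gaussianPDFReal 0 1 x ^ p) := by
    filter_upwards [hF] with n hn
    refine ae_of_all _ fun x => ?_
    rw [Real.norm_eq_abs, abs_mul, abs_of_nonneg (hr x)]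
    refine (mul_le_mul_of_nonneg_right (hn x) (hr x)).trans (le_of_eq ?_)
    ring
  have hm : ∀ n, AEStronglyMeasurable fun x => F n x * r x := fun n =>
    (hFm n).aestronglyMeasurable.mul hrm
  refine ⟨?_, tendsto_integral_filter_of_dominated_convergence _ (Eventually.of_forall hm) hb
    ((hr_int p).const_mul C) (ae_of_all _ fun x => (hl x).mul_const _)⟩
  filter_upwards [hb] with n hn
  exact ((hr_int p).const_mul C).mono' (hm n) hn

lemma IsKernel.tendsto_varianceFactor {h : ℕ → ℝ} (hh : Tendsto h atTop (𝓝 0))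
    (hpos : ∀ᶠ n in atTop, 0 < h n) (x : ℝ) :
    Tendsto (fun n => varianceFactor K (h n) x) atTop
      (𝓝 (kappa1 K * (1 / gaussianPDFReal 0 1 x))) := by
  have hφ := gaussianPDFReal_pos 0 1 x one_ne_zero
  have := (hK.tendsto_integral_kernelAt_sq hh hpos x).div ((hK.tendsto_smoothedDensity hh x).pow 2)
    (by positivity)
  refine this.trans (le_of_eq ?_)
  congr 1
  field_simp

lemma IsKernel.tendsto_biasFactor {B : ℝ} (hm : Differentiable ℝ m) (hm' : Differentiable ℝ (deriv m))
    (h1 : ∀ x, |deriv m x| ≤ B) (h2 : ∀ x, |deriv (deriv m) x| ≤ B) {h : ℕ → ℝ}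
    (hh : Tendsto h atTop (𝓝 0)) (hpos : ∀ᶠ n in atTop, 0 < h n) (x : ℝ) :
    Tendsto (fun n => biasFactor K m (h n) x) atTop
      (𝓝 (kappa2 K ^ 2 / 4 * ((deriv (deriv m) x * gaussianPDFReal 0 1 x +
        2 * deriv m x * deriv (gaussianPDFReal 0 1) x) / gaussianPDFReal 0 1 x) ^ 2)) := by
  have hφ := gaussianPDFReal_pos 0 1 x one_ne_zero
  have := ((hK.tendsto_integral_kernelBiasAt hm hm' h1 h2 hh hpos x).pow 2).div
    ((hK.tendsto_smoothedDensity hh x).pow 2) (by positivity)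
  refine this.trans (le_of_eq ?_)
  congr 1
  field_simp
  ring

end Weighted

/-! ### All remainders against the rate. -/

/-- The comparison of all remainder terms with the rate. -/
lemma isLittleO_of_error_bounds {N h Γ θ W a1 a2 : ℕ → ℝ} {a α B C κ J0 J1 J2 A c1 k2 : ℝ}
    (ha : 0 < a)
    (hNdef : ∀ n, N n = n * h n) (hh : Tendsto h atTop (𝓝 0)) (hN : Tendsto N atTop atTop)
    (hpos : ∀ᶠ n in atTop, 0 < h n)
    (hΓ : Tendsto (fun n : ℕ => Γ n * (n : ℝ) ^ α) atTop (𝓝 c1))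
    (hθ0 : ∀ n, 0 ≤ θ n) (hθ : Tendsto (fun n : ℕ => θ n * (n : ℝ) ^ α) atTop (𝓝 0))
    (ha1 : Tendsto a1 atTop (𝓝 (κ * J1))) (ha2 : Tendsto a2 atTop (𝓝 A))
    (hB : B = 0 → (∀ᶠ n in atTop, a2 n = 0) ∧ A = 0)
    (hW : ∀ᶠ n : ℕ in atTop, ∀ s : ℝ, 0 < s →
      |W n - (a1 n / N n + Γ n * J0 + h n ^ 4 * a2 n)| ≤ C *
        (N n ^ (-(a / 4)) * (1 / N n + Γ n + B ^ 2 * h n ^ 4) + 1 / N n ^ 2 +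
          (1 / n + s / N n + (1 + 1 / s) * θ n) +
          B ^ 2 * (h n / n + h n ^ 4 * (n : ℝ) ^ (-a)))) :
    (fun n : ℕ => W n - (κ / N n * J1 + h n ^ 4 * A + c1 * (n : ℝ) ^ (-α) * J0 +
      c1 * h n ^ 2 * k2 * (n : ℝ) ^ (-α) * J2)) =o[atTop]
      fun n : ℕ => 1 / N n + B ^ 2 * h n ^ 4 + (n : ℝ) ^ (-α) := by
  set τ : ℕ → ℝ := fun n => 1 / N n + B ^ 2 * h n ^ 4 + (n : ℝ) ^ (-α) with hτ
  have hNpos : ∀ᶠ n in atTop, 0 < N n := hN.eventually_gt_atTop 0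
  have o1 : (fun n => 1 / N n) =O[atTop] τ := by
    refine IsBigO.of_bound 1 ?_
    filter_upwards [hNpos] with n hn
    have h2 : 0 ≤ B ^ 2 * h n ^ 4 := by positivity
    have h3 : 0 ≤ (n : ℝ) ^ (-α) := by positivity
    have h4 : 0 ≤ 1 / N n := by positivity
    rw [Real.norm_eq_abs, Real.norm_eq_abs, abs_of_nonneg h4, abs_of_nonneg (by positivity)]
    linarith
  have o2 : (fun n => B ^ 2 * h n ^ 4) =O[atTop] τ := by
    refine IsBigO.of_bound 1 ?_
    filter_upwards [hNpos] with n hn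
    have h2 : 0 ≤ B ^ 2 * h n ^ 4 := by positivity
    have h3 : 0 ≤ (n : ℝ) ^ (-α) := by positivity
    have h4 : 0 ≤ 1 / N n := by positivity
    rw [Real.norm_eq_abs, Real.norm_eq_abs, abs_of_nonneg h2, abs_of_nonneg (by positivity)]
    linarith
  have o3 : (fun n : ℕ => (n : ℝ) ^ (-α)) =O[atTop] τ := by
    refine IsBigO.of_bound 1 ?_
    filter_upwards [hNpos] with n hn
    have h2 : 0 ≤ B ^ 2 * h n ^ 4 := by positivity
    have h3 : 0 ≤ (n : ℝ) ^ (-α) := by positivity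
    have h4 : 0 ≤ 1 / N n := by positivity
    rw [Real.norm_eq_abs, Real.norm_eq_abs, abs_of_nonneg h3, abs_of_nonneg (by positivity)]
    linarith
  have mulo : ∀ {e t : ℕ → ℝ}, Tendsto e atTop (𝓝 0) → t =O[atTop] τ →
      (fun n => e n * t n) =o[atTop] τ := by
    intro e t he ht
    have := ((isLittleO_one_iff ℝ).2 he).mul_isBigO ht
    simpa using this
  have hnα : ∀ᶠ n : ℕ in atTop, (n : ℝ) ^ α * (n : ℝ) ^ (-α) = 1 := by
    filter_upwards [eventually_gt_atTop 0] with n hn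
    have hn0 : (0 : ℝ) < n := by exact_mod_cast hn
    rw [← Real.rpow_add hn0, add_neg_cancel, Real.rpow_zero]
  have hinv : Tendsto (fun n => 1 / N n) atTop (𝓝 0) := by
    simp only [one_div]
    exact hN.inv_tendsto_atTop
  have hδ : Tendsto (fun n => N n ^ (-(a / 4))) atTop (𝓝 0) :=
    (tendsto_rpow_neg_atTop (y := a / 4) (by linarith)).comp hN
  have hna : Tendsto (fun n : ℕ => (n : ℝ) ^ (-a)) atTop (𝓝 0) :=
    (tendsto_rpow_neg_atTop ha).comp tendsto_natCast_atTop_atTop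
  have oΓ : Γ =O[atTop] τ := by
    have h1 : (fun n : ℕ => (Γ n * (n : ℝ) ^ α) * (n : ℝ) ^ (-α)) =O[atTop] τ := by
      have := (hΓ.isBigO_one ℝ).mul o3
      simpa using this
    refine h1.congr' ?_ EventuallyEq.rfl
    filter_upwards [hnα] with n hn
    rw [mul_assoc, hn, mul_one]
  -- The Young parameter is taken as `s = √w`: it tends to zero, and yet `θ / s` is at most `s * n ^
  -- (-α)`. The summand `1 / n` only keeps `s` positive.
  let w : ℕ → ℝ := fun n => θ n * (n : ℝ) ^ α + 1 / n
  let s : ℕ → ℝ := fun n => Real.sqrt (w n)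
  have hw : Tendsto w atTop (𝓝 0) := by
    have := hθ.add (tendsto_one_div_atTop_nhds_zero_nat (𝕜 := ℝ))
    rwa [add_zero] at this
  have hs : Tendsto s atTop (𝓝 0) := by
    have := (Real.continuous_sqrt.tendsto 0).comp hw
    rwa [Real.sqrt_zero] at this
  have hwpos : ∀ᶠ n in atTop, 0 < w n := by
    filter_upwards [eventually_gt_atTop 0] with n hn
    have hn0 : (0 : ℝ) < n := by exact_mod_cast hn
    have := hθ0 n
    positivity
  have oθ : (fun n => (1 + 1 / s n) * θ n) =o[atTop] τ := by
    have h1 : (fun n : ℕ => (w n + s n) * (n : ℝ) ^ (-α)) =o[atTop] τ :=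
      mulo (by simpa using hw.add hs) o3
    refine IsBigO.trans_isLittleO (IsBigO.of_bound 1 ?_) h1
    filter_upwards [hwpos, hnα] with n hn1 hn2
    have hs0 : 0 < s n := Real.sqrt_pos.2 hn1
    have h2 : θ n ≤ w n * (n : ℝ) ^ (-α) := by
      have h3 : (0 : ℝ) ≤ 1 / n * (n : ℝ) ^ (-α) := by positivity
      calc θ n = θ n * ((n : ℝ) ^ α * (n : ℝ) ^ (-α)) := by rw [hn2, mul_one]
        _ ≤ θ n * ((n : ℝ) ^ α * (n : ℝ) ^ (-α)) + 1 / n * (n : ℝ) ^ (-α) := by linarith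
        _ = _ := by ring
    have h4 : w n / s n = s n := Real.div_sqrt
    have := hθ0 n
    rw [Real.norm_eq_abs, Real.norm_eq_abs, abs_of_nonneg (by positivity),
      abs_of_nonneg (by positivity), one_mul]
    calc (1 + 1 / s n) * θ n ≤ (1 + 1 / s n) * (w n * (n : ℝ) ^ (-α)) := by gcongr
      _ = (w n + w n / s n) * (n : ℝ) ^ (-α) := by ring
      _ = _ := by rw [h4]
  have oO : (fun n : ℕ => N n ^ (-(a / 4)) * (1 / N n + Γ n + B ^ 2 * h n ^ 4) + 1 / N n ^ 2 +
          (1 / n + s n / N n + (1 + 1 / s n) * θ n) +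
          B ^ 2 * (h n / n + h n ^ 4 * (n : ℝ) ^ (-a))) =o[atTop] τ := by
    have p1 := mulo hδ ((o1.add oΓ).add o2)
    have p2 := mulo hinv o1
    have p3 := mulo hh o1
    have p4 := mulo hs o1
    have p5 : (fun n => (B ^ 2 * h n ^ 2) * (1 / N n)) =o[atTop] τ :=
      mulo (by simpa using (hh.pow 2).const_mul (B ^ 2)) o1
    have p6 := mulo hna o2
    refine ((((p1.add p2).add ((p3.add p4).add oθ))).add (p5.add p6)).congr' ?_ EventuallyEq.rfl
    filter_upwards [hNpos, hpos, eventually_gt_atTop 0] with n h1 h2 h3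
    have hn0 : (0 : ℝ) < n := by exact_mod_cast h3
    have e1 : h n * (1 / N n) = 1 / n := by rw [hNdef]; field_simp
    have e2 : (B ^ 2 * h n ^ 2) * (1 / N n) = B ^ 2 * (h n / n) := by rw [hNdef]; field_simp
    rw [e1, e2]
    ring
  have q0 : (fun n => W n - (a1 n / N n + Γ n * J0 + h n ^ 4 * a2 n)) =o[atTop] τ := by
    refine IsBigO.trans_isLittleO (IsBigO.of_bound (|C|) ?_) oO
    filter_upwards [hW, hwpos] with n h1 h2
    refine (h1 (s n) (Real.sqrt_pos.2 h2)).trans ?_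
    rw [Real.norm_eq_abs, ← abs_mul]
    exact le_abs_self _
  have q1 : (fun n => (a1 n - κ * J1) * (1 / N n)) =o[atTop] τ :=
    mulo (by simpa using ha1.sub_const (κ * J1)) o1
  have q2 : (fun n : ℕ => (Γ n - c1 * (n : ℝ) ^ (-α)) * J0) =o[atTop] τ := by
    have h1 : (fun n : ℕ => ((Γ n * (n : ℝ) ^ α - c1) * J0) * (n : ℝ) ^ (-α)) =o[atTop] τ :=
      mulo (by simpa using (hΓ.sub_const c1).mul_const J0) o3
    refine h1.congr' ?_ EventuallyEq.rfl
    filter_upwards [hnα] with n hn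
    have : Γ n * (n : ℝ) ^ α * (n : ℝ) ^ (-α) = Γ n := by rw [mul_assoc, hn, mul_one]
    linear_combination J0 * this
  -- For `B = 0` the rate contains no `h ^ 4`, so the bias term has to vanish identically; `hB`
  -- provides this.
  have q3 : (fun n => h n ^ 4 * (a2 n - A)) =o[atTop] τ := by
    rcases eq_or_ne B 0 with h0 | h0
    · obtain ⟨h1, h2⟩ := hB h0
      refine (isLittleO_zero τ atTop).congr' ?_ EventuallyEq.rfl
      filter_upwards [h1] with n hn
      rw [hn, h2, sub_zero, mul_zero]
    · have h1 : (fun n => ((a2 n - A) / B ^ 2) * (B ^ 2 * h n ^ 4)) =o[atTop] τ :=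
        mulo (by simpa using (ha2.sub_const A).div_const (B ^ 2)) o2
      refine h1.congr_left fun n => ?_
      field_simp
  -- The last term of the expansion is itself `o(n ^ (-α))`.
  have q4 : (fun n : ℕ => (c1 * h n ^ 2 * k2 * J2) * (n : ℝ) ^ (-α)) =o[atTop] τ :=
    mulo (by simpa using (((hh.pow 2).const_mul c1).mul_const k2).mul_const J2) o3
  refine ((((q0.add q1).add q2).add q3).sub q4).congr_left fun n => ?_
  ring

/-! ### The expansion of the mean integrated squared error. -/

section Main

variable {Ω : Type*} [MeasurableSpace Ω] {μ : Measure Ω} [IsProbabilityMeasure μ]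
  {αX A₀ : ℝ} {ζ : ℤ → Ω → ℝ} {X : ℕ → Ω → ℝ} {α C₀ : ℝ} {c : ℕ → ℝ} {η : ℤ → Ω → ℝ}
  {ε : ℕ → Ω → ℝ} {K m r : ℝ → ℝ} {h : ℕ → ℝ}

lemma measurable_integral_squaredError (hK : IsKernel K) (hm : Measurable m)
    (hX : ∀ i, Measurable (X i)) (hε : ∀ i, Measurable (ε i)) (n : ℕ) (h : ℝ) :
    Measurable fun x => ∫ ω, squaredError K m X ε n h x ω ∂μ := by
  have := hK.measurable
  have h1 : Measurable fun p : ℝ × Ω => squaredError K m X ε n h p.1 p.2 := by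
    unfold squaredError nadarayaWatson kernelDensityEstimator response
    fun_prop
  exact h1.stronglyMeasurable.integral_prod_right'.measurable

/-- Positivity of the bandwidth is forced by `n h ≥ 1`. -/
lemma eventually_bandwidth (hh : Tendsto h atTop (𝓝 0))
    (hnh : Tendsto (fun n : ℕ => (n : ℝ) * h n) atTop atTop) :
    ∀ᶠ n in atTop, 0 < h n ∧ h n ≤ 1 ∧ 1 ≤ n * h n := by
  filter_upwards [hh.eventually_le_const one_pos, hnh.eventually_ge_atTop 1] with n h1 h2
  exact ⟨pos_of_mul_pos_right (by linarith) (Nat.cast_nonneg n), h1, h2⟩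

/-- The expansion of the mean integrated squared error. -/
lemma isLittleO_MISE (hP : LRDPredictors μ αX A₀ ζ X) (hE : LRDErrors μ α C₀ c η ε X)
    (hK : IsKernel K) {B : ℝ} (hm : Differentiable ℝ m) (hm' : Differentiable ℝ (deriv m))
    (h1 : ∀ x, |deriv m x| ≤ B) (h2 : ∀ x, |deriv (deriv m) x| ≤ B)
    (hr : ∀ x, 0 ≤ r x) (hr_int : ∀ p : ℕ, Integrable fun x => r x / gaussianPDFReal 0 1 x ^ p)
    (hh : Tendsto h atTop (𝓝 0)) (hnh : Tendsto (fun n : ℕ => (n : ℝ) * h n) atTop atTop)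
    (hreg : HasCompactSupport K ∨ (∃ M : ℝ, ∀ x, |m x| ≤ M) ∨
      (fun n : ℕ => Real.log n) =O[atTop] fun n : ℕ => (n : ℝ) * h n) {C₁ : ℝ}
    (hC₁ : Tendsto (fun n : ℕ => quadForm μ (fun i => ε (i + 1)) n (fun _ => 1) / (n : ℝ) ^ (2 - α))
      atTop (𝓝 (C₁ ^ 2))) :
    (∀ᶠ n : ℕ in atTop, (∀ x, Integrable (fun ω => squaredError K m X ε n (h n) x ω) μ) ∧
        Integrable fun x => (∫ ω, squaredError K m X ε n (h n) x ω ∂μ) * r x) ∧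
      (fun n : ℕ => MISE μ K m r X ε n (h n) -
        asymptoticMISE K (gaussianPDFReal 0 1) m r C₁ α n (h n)) =o[atTop]
        fun n : ℕ => 1 / ((n : ℝ) * h n) + B ^ 2 * h n ^ 4 + (n : ℝ) ^ (-α) := by
  obtain ⟨v, hD⟩ := hP.gaussianDecomposition
  obtain ⟨gZ, GZ, hgZ, hGZ⟩ := hP.exists_integral_mul_eq_dist
  obtain ⟨gε, Gε, -, hg0, hgε, hGε⟩ := hE.exists_integral_mul_eq_dist
  obtain ⟨CZ, hCZ⟩ := exists_sum_abs_dist_le hP.mem_Ioo.1 hP.mem_Ioo.2 hGZ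
  have hcov : ∀ n : ℕ, ∑ i ∈ Finset.range n, ∑ j ∈ Finset.range n,
      |∫ ω, (X (i + 1) ω - ζ (i + 1 : ℕ) ω) * (X (j + 1) ω - ζ (j + 1 : ℕ) ω) ∂μ| ≤
      CZ * (n : ℝ) ^ (2 - αX) := by
    intro n
    simp_rw [hgZ]
    exact hCZ n
  have he : ∀ i : ℕ, MemLp (ε (i + 1)) 2 μ := fun i => hE.linear.memLp hE.memLp_two (by lia)
  have he0 : ∀ i : ℕ, ∫ ω, ε (i + 1) ω ∂μ = 0 := fun i =>
    hE.linear.integral_eq_zero hE.memLp_two (by lia)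
  have he1 : ∀ i : ℕ, ∫ ω, ε (i + 1) ω ^ 2 ∂μ = 1 := by
    intro i
    simp_rw [pow_two, hgε, Nat.dist_self, hg0]
  have hI := hE.linear.indepFun hE.indep_predictors
  have hpos := eventually_bandwidth hh hnh
  have hpos' : ∀ᶠ n in atTop, 0 < h n := hpos.mono fun n hn => hn.1
  obtain ⟨C, p, hC, happ⟩ := hD.exists_abs_integral_sub_le hK hP.mem_Ioo hcov he he1 hm hm' h1 h2
    hpos hnh hreg
  obtain ⟨Cb, hCb, hbF⟩ := hK.exists_abs_biasFactor_le
  obtain ⟨iV, tV⟩ := tendsto_integral_mul_of_abs_le hr hr_int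
    (fun n => hK.measurable_varianceFactor (h n))
    (hpos.mono fun n hn => hK.abs_varianceFactor_le hn.1 hn.2.1)
    (fun x => hK.tendsto_varianceFactor hh hpos' x)
  obtain ⟨iB, tB⟩ := tendsto_integral_mul_of_abs_le hr hr_int
    (fun n => hK.measurable_biasFactor hm.continuous.measurable (h n))
    (hpos.mono fun n hn => hbF m B hm hm' h1 h2 (h n) hn.1 hn.2.1)
    (fun x => hK.tendsto_biasFactor hm hm' h1 h2 hh hpos' x)
  have hr1 : Integrable r := by simpa using hr_int 0
  have hJ1 : ∫ x, kappa1 K * (1 / gaussianPDFReal 0 1 x) * r x =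
      kappa1 K * ∫ x, r x / gaussianPDFReal 0 1 x := by
    rw [← integral_const_mul]
    refine integral_congr_ae (ae_of_all _ fun x => ?_)
    simp only
    ring
  have hA : ∫ x, kappa2 K ^ 2 / 4 * ((deriv (deriv m) x * gaussianPDFReal 0 1 x +
        2 * deriv m x * deriv (gaussianPDFReal 0 1) x) / gaussianPDFReal 0 1 x) ^ 2 * r x =
      kappa2 K ^ 2 / 4 * biasIntegral (gaussianPDFReal 0 1) m r := by
    rw [biasIntegral, ← integral_const_mul]
    refine integral_congr_ae (ae_of_all _ fun x => ?_)
    simp only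
    ring
  rw [hJ1] at tV
  rw [hA] at tB
  have hXm : ∀ i, Measurable (X (i + 1)) := fun i => hP.linear.measurable_proc _
  have hmX := hD.memLp_comp_of_abs_deriv_le hm h1
  let MSE : ℕ → ℝ → ℝ := fun n x => ∫ ω, squaredError K m X ε n (h n) x ω ∂μ
  let Γ : ℕ → ℝ := fun n => quadForm μ (fun i => ε (i + 1)) n (fun _ => 1) / (n : ℝ) ^ 2
  let θ : ℕ → ℝ := fun n => (∑ i ∈ Finset.range n, ∑ j ∈ Finset.range n,
    |gε (Nat.dist i j)| * |gZ (Nat.dist i j)|) / (n : ℝ) ^ 2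
  let O : ℕ → ℝ → ℝ := fun n s => (n * h n) ^ (-(αX / 4)) * (1 / (n * h n) + Γ n + B ^ 2 * h n ^ 4) +
    1 / (n * h n) ^ 2 + (1 / n + s / (n * h n) + (1 + 1 / s) * θ n) +
    B ^ 2 * (h n / n + h n ^ 4 * (n : ℝ) ^ (-αX))
  -- `Γ n` stands without a factor because the squared mean of the kernel weights cancels against
  -- the squared smoothed density.
  let L : ℕ → ℝ → ℝ := fun n x => varianceFactor K (h n) x / (n * h n) + Γ n +
    h n ^ 4 * biasFactor K m (h n) x
  have hMSE : ∀ᶠ n in atTop, ∀ s : ℝ, 0 < s → ∀ x,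
      |MSE n x - L n x| ≤ C * (1 / gaussianPDFReal 0 1 x ^ p) * O n s := by
    filter_upwards [happ, hpos] with n hn ⟨hn1, hn2, hn3⟩ s hs x
    have hφ := gaussianPDFReal_pos 0 1 x one_ne_zero
    have hg := hK.smoothedDensity_ge (h := h n) (by rwa [abs_of_pos hn1]) x
    have hgp : 0 < smoothedDensity K (h n) x := lt_of_lt_of_le (by positivity) hg
    have key := hn s hs x
    rw [← (integral_squaredError hK hXm hm.continuous.measurable hmX hI he he0
      (n := n) (h := h n) (by linarith) x).2] at key
    simp only [hgε, hgZ] at key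
    have e1 : L n x = ((∫ y, kernelAt K (h n) x y ^ 2 ∂gaussianReal 0 1) / h n / (n * h n) +
        smoothedDensity K (h n) x ^ 2 * Γ n +
        ((∫ y, kernelBiasAt K m (h n) x y ∂gaussianReal 0 1) / h n) ^ 2) /
          smoothedDensity K (h n) x ^ 2 := by
      simp only [L, varianceFactor, biasFactor]
      field_simp
    rw [e1, one_div, ← inv_pow]
    exact key
  have hMm : ∀ n, Measurable (MSE n) := fun n =>
    measurable_integral_squaredError hK hm.continuous.measurable hP.linear.measurable_proc
      hE.linear.measurable_proc n (h n)
  have hLm : ∀ n, Measurable (L n) := fun n =>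
    (((hK.measurable_varianceFactor (h n)).div_const _).add_const _).add
      ((hK.measurable_biasFactor hm.continuous.measurable (h n)).const_mul _)
  have hbound : ∀ᶠ n in atTop, ∀ s : ℝ, 0 < s → ∀ x,
      ‖(MSE n x - L n x) * r x‖ ≤ C * O n s * (r x / gaussianPDFReal 0 1 x ^ p) := by
    filter_upwards [hMSE] with n hn s hs x
    rw [Real.norm_eq_abs, abs_mul, abs_of_nonneg (hr x)]
    refine (mul_le_mul_of_nonneg_right (hn s hs x) (hr x)).trans (le_of_eq ?_)
    ring
  have hdiff : ∀ᶠ n in atTop, Integrable fun x => (MSE n x - L n x) * r x := by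
    filter_upwards [hbound] with n hn
    exact ((hr_int p).const_mul (C * O n 1)).mono'
      (((hMm n).sub (hLm n)).aestronglyMeasurable.mul hr1.aestronglyMeasurable)
      (ae_of_all _ (hn 1 one_pos))
  have hL : ∀ᶠ n in atTop, (Integrable fun x => L n x * r x) ∧ ∫ x, L n x * r x =
      (∫ x, varianceFactor K (h n) x * r x) / (n * h n) + Γ n * (∫ x, r x) +
        h n ^ 4 * ∫ x, biasFactor K m (h n) x * r x := by
    filter_upwards [iV, iB] with n hn1 hn2
    have e1 : ∀ x, L n x * r x = (varianceFactor K (h n) x * r x / (n * h n) + Γ n * r x) +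
        h n ^ 4 * (biasFactor K m (h n) x * r x) := fun x => by simp only [L]; ring
    have j1 := hn1.div_const (n * h n)
    have j2 := hr1.const_mul (Γ n)
    have j3 := hn2.const_mul (h n ^ 4)
    have j12 : Integrable fun x =>
        varianceFactor K (h n) x * r x / (n * h n) + Γ n * r x := j1.add j2
    simp_rw [e1]
    refine ⟨j12.add j3, ?_⟩
    rw [integral_add j12 j3, integral_add j1 j2, integral_div, integral_const_mul,
      integral_const_mul]
  -- Finiteness comes from the approximation itself: both the approximant and the difference from it
  -- are dominated by inverse powers of the density.
  have hint : ∀ᶠ n in atTop, Integrable fun x => MSE n x * r x := by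
    filter_upwards [hdiff, hL] with n hn1 hn2
    exact (hn1.add hn2.1).congr (ae_of_all _ fun x => by simp only [Pi.add_apply]; ring)
  constructor
  · filter_upwards [hint, hpos] with n hn1 ⟨_, _, hn2⟩
    exact ⟨fun x => (integral_squaredError hK hXm hm.continuous.measurable hmX hI he he0
      (by linarith) x).1, hn1⟩
  have hW : ∀ᶠ n : ℕ in atTop, ∀ s : ℝ, 0 < s →
      |MISE μ K m r X ε n (h n) - ((∫ x, varianceFactor K (h n) x * r x) / (n * h n) +
        Γ n * (∫ x, r x) + h n ^ 4 * ∫ x, biasFactor K m (h n) x * r x)| ≤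
      (C * ∫ x, r x / gaussianPDFReal 0 1 x ^ p) * O n s := by
    filter_upwards [hbound, hL, hint, hdiff] with n hn1 hn2 hn3 hn4 s hs
    rw [← hn2.2, MISE, ← integral_sub hn3 hn2.1]
    simp_rw [← sub_mul]
    refine (norm_integral_le_of_norm_le ((hr_int p).const_mul (C * O n s))
      (ae_of_all _ (hn1 s hs))).trans (le_of_eq ?_)
    rw [integral_const_mul]
    ring
  have hΓ : Tendsto (fun n : ℕ => Γ n * (n : ℝ) ^ α) atTop (𝓝 (C₁ ^ 2)) := by
    refine hC₁.congr' ?_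
    filter_upwards [eventually_gt_atTop 0] with n hn
    have hn0 : (0 : ℝ) < n := by exact_mod_cast hn
    simp only [Γ]
    rw [rpow_two_sub_eq hn0, Real.rpow_neg hn0.le]
    field_simp
  have hθ : Tendsto (fun n : ℕ => θ n * (n : ℝ) ^ α) atTop (𝓝 0) := by
    refine (tendsto_sum_abs_mul_abs_dist hE.mem_Ioo.1 hE.mem_Ioo.2 hP.mem_Ioo.1 hGε hGZ).congr' ?_
    filter_upwards [eventually_gt_atTop 0] with n hn
    have hn0 : (0 : ℝ) < n := by exact_mod_cast hn
    simp only [θ]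
    rw [rpow_two_sub_eq hn0, Real.rpow_neg hn0.le]
    field_simp
  have hθ0 : ∀ n, 0 ≤ θ n := fun n => div_nonneg
    (Finset.sum_nonneg fun i _ => Finset.sum_nonneg fun j _ => by positivity) (by positivity)
  -- The limiting squared bias is zero as the limit of a sequence that is eventually zero.
  have hB0 : B = 0 → (∀ᶠ n in atTop, ∫ x, biasFactor K m (h n) x * r x = 0) ∧
      kappa2 K ^ 2 / 4 * biasIntegral (gaussianPDFReal 0 1) m r = 0 := by
    intro hB
    have hz : ∀ᶠ n in atTop, ∫ x, biasFactor K m (h n) x * r x = 0 := by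
      filter_upwards [hpos] with n hn
      refine integral_eq_zero_of_ae (ae_of_all _ fun x => ?_)
      have := hbF m B hm hm' h1 h2 (h n) hn.1 hn.2.1 x
      rw [hB] at this
      have h0 : biasFactor K m (h n) x = 0 := abs_nonpos_iff.1 (this.trans (by simp))
      simp [h0]
    exact ⟨hz, tendsto_nhds_unique tB (tendsto_const_nhds.congr' (hz.mono fun n hn => hn.symm))⟩
  have := isLittleO_of_error_bounds (N := fun n => n * h n) (k2 := kappa2 K)
    (J2 := ∫ x, deriv (deriv (gaussianPDFReal 0 1)) x / gaussianPDFReal 0 1 x * r x)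
    hP.mem_Ioo.1 (fun _ => rfl) hh hnh hpos' hΓ hθ0 hθ tV tB hB0 hW
  refine this.congr_left fun n => ?_
  rw [asymptoticMISE]
  ring

lemma asymptoticMISE_eq_zero (hr : r =ᵐ[volume] 0) (f : ℝ → ℝ) (C₁ α : ℝ) (n : ℕ) (h : ℝ) :
    asymptoticMISE K f m r C₁ α n h = 0 := by
  have e : ∀ g : ℝ → ℝ, ∫ x, g x * r x = 0 := fun g => integral_eq_zero_of_ae (by
    filter_upwards [hr] with x hx
    simp [hx])
  have e1 : ∫ x, r x = 0 := integral_eq_zero_of_ae hr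
  have e2 : ∫ x, r x / f x = 0 := integral_eq_zero_of_ae (by
    filter_upwards [hr] with x hx
    simp [hx])
  rw [asymptoticMISE, biasIntegral, e, e, e1, e2]
  ring

omit [IsProbabilityMeasure μ] in
lemma MISE_eq_zero (hr : r =ᵐ[volume] 0) (n : ℕ) (h : ℝ) : MISE μ K m r X ε n h = 0 :=
  integral_eq_zero_of_ae (by
    filter_upwards [hr] with x hx
    simp [hx])

/-- The asymptotic expression is of the exact order of the rate. -/
lemma isBigO_asymptoticMISE (hK : IsKernel K) (hr : ∀ x, 0 ≤ r x)
    (hr_int : ∀ p : ℕ, Integrable fun x => r x / gaussianPDFReal 0 1 x ^ p)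
    (hr0 : ∫ x, r x ≠ 0) (hh : Tendsto h atTop (𝓝 0))
    (hnh : Tendsto (fun n : ℕ => (n : ℝ) * h n) atTop atTop) {C₁ : ℝ} (hC₁ : 0 < C₁) {B : ℝ}
    (hB : B = 0 ∨ biasIntegral (gaussianPDFReal 0 1) m r ≠ 0) :
    (fun n : ℕ => 1 / ((n : ℝ) * h n) + B ^ 2 * h n ^ 4 + (n : ℝ) ^ (-α)) =O[atTop]
      fun n => asymptoticMISE K (gaussianPDFReal 0 1) m r C₁ α n (h n) := by
  have hr1 : Integrable r := by simpa using hr_int 0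
  have hJ0 : 0 < ∫ x, r x := lt_of_le_of_ne (integral_nonneg hr) hr0.symm
  have hJ1 : 0 < ∫ x, r x / gaussianPDFReal 0 1 x := by
    refine hJ0.trans_le (integral_mono hr1 (by simpa using hr_int 1) fun x => ?_)
    exact le_div_self (hr x) (gaussianPDFReal_pos 0 1 x one_ne_zero) (gaussianPDFReal_le_one x)
  have hBi : 0 ≤ biasIntegral (gaussianPDFReal 0 1) m r :=
    integral_nonneg fun x => mul_nonneg (sq_nonneg _) (hr x)
  set J0 := ∫ x, r x
  set J1 := ∫ x, r x / gaussianPDFReal 0 1 x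
  set b := biasIntegral (gaussianPDFReal 0 1) m r with hb
  have hk1 := hK.kappa1_pos
  have hk2 := hK.kappa2_pos
  -- The last term of the expression has no definite sign. The rate is therefore compared with the
  -- three nonnegative terms first, and the last one is then shown to be negligible.
  let M : ℕ → ℝ := fun n => kappa1 K / (n * h n) * J1 + h n ^ 4 * kappa2 K ^ 2 / 4 * b +
    C₁ ^ 2 * (n : ℝ) ^ (-α) * J0
  have hpos := eventually_bandwidth hh hnh
  have hτM : (fun n : ℕ => 1 / ((n : ℝ) * h n) + B ^ 2 * h n ^ 4 + (n : ℝ) ^ (-α)) =O[atTop] M := by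
    obtain ⟨D, hD0, hDB⟩ : ∃ D : ℝ, 0 ≤ D ∧ B ^ 2 ≤ D * (kappa2 K ^ 2 / 4 * b) := by
      rcases hB with hB | hB
      · exact ⟨0, le_rfl, by simp [hB]⟩
      · have hb0 : 0 < b := lt_of_le_of_ne hBi hB.symm
        exact ⟨B ^ 2 / (kappa2 K ^ 2 / 4 * b), by positivity,
          (div_mul_cancel₀ _ (by positivity)).ge⟩
    refine IsBigO.of_bound (1 / (kappa1 K * J1) + D + 1 / (C₁ ^ 2 * J0)) ?_
    filter_upwards [hpos] with n ⟨hn1, hn2, hn3⟩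
    have hN : 0 < (n : ℝ) * h n := by linarith
    set t1 : ℝ := kappa1 K / (n * h n) * J1 with ht1
    set t2 : ℝ := h n ^ 4 * kappa2 K ^ 2 / 4 * b with ht2
    set t3 : ℝ := C₁ ^ 2 * (n : ℝ) ^ (-α) * J0 with ht3
    have p1 : 0 ≤ t1 := by positivity
    have p2 : 0 ≤ t2 := by positivity
    have p3 : 0 ≤ t3 := by positivity
    have q1 : 1 / ((n : ℝ) * h n) = 1 / (kappa1 K * J1) * t1 := by rw [ht1]; field_simp
    have q2 : B ^ 2 * h n ^ 4 ≤ D * t2 := by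
      calc B ^ 2 * h n ^ 4 ≤ D * (kappa2 K ^ 2 / 4 * b) * h n ^ 4 := by gcongr
        _ = D * t2 := by rw [ht2]; ring
    have q3 : (n : ℝ) ^ (-α) = 1 / (C₁ ^ 2 * J0) * t3 := by rw [ht3]; field_simp
    have h0 : 0 ≤ B ^ 2 * h n ^ 4 := by positivity
    have h3 : 0 ≤ (n : ℝ) ^ (-α) := by positivity
    have hM : M n = t1 + t2 + t3 := rfl
    rw [hM, Real.norm_eq_abs, Real.norm_eq_abs, abs_of_nonneg (by positivity),
      abs_of_nonneg (by positivity)]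
    have c1 : 0 ≤ 1 / (kappa1 K * J1) := by positivity
    have c3 : 0 ≤ 1 / (C₁ ^ 2 * J0) := by positivity
    rw [q1, q3]
    nlinarith [mul_nonneg c1 p2, mul_nonneg c1 p3, mul_nonneg hD0 p1, mul_nonneg hD0 p3,
      mul_nonneg c3 p1, mul_nonneg c3 p2]
  have hα : (fun n : ℕ => (n : ℝ) ^ (-α)) =O[atTop] M := by
    refine IsBigO.trans (IsBigO.of_bound 1 ?_) hτM
    filter_upwards [hpos] with n ⟨hn1, hn2, hn3⟩
    have hN : 0 < (n : ℝ) * h n := by linarith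
    have h0 : 0 ≤ B ^ 2 * h n ^ 4 := by positivity
    have h3 : 0 ≤ (n : ℝ) ^ (-α) := by positivity
    have h4 : 0 ≤ 1 / ((n : ℝ) * h n) := by positivity
    rw [Real.norm_eq_abs, Real.norm_eq_abs, abs_of_nonneg h3, abs_of_nonneg (by positivity)]
    linarith
  have hRM : (fun n => asymptoticMISE K (gaussianPDFReal 0 1) m r C₁ α n (h n)) ~[atTop] M := by
    set J2 := ∫ x, deriv (deriv (gaussianPDFReal 0 1)) x / gaussianPDFReal 0 1 x * r x with hJ2
    have h5 : Tendsto (fun n => C₁ ^ 2 * h n ^ 2 * kappa2 K * J2) atTop (𝓝 0) := by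
      simpa using (((hh.pow 2).const_mul (C₁ ^ 2)).mul_const (kappa2 K)).mul_const J2
    have h6 := ((isLittleO_one_iff ℝ).2 h5).mul_isBigO hα
    simp only [one_mul] at h6
    refine h6.congr_left fun n => ?_
    simp only [asymptoticMISE, M, Pi.sub_apply]
    ring
  exact hτM.trans hRM.isBigO_symm

end Main

theorem mainTheorem3 {Ω : Type*} [MeasurableSpace Ω] (μ : Measure Ω) [IsProbabilityMeasure μ]
    (αX A₀ : ℝ) (ζ : ℤ → Ω → ℝ) (X : ℕ → Ω → ℝ) (hP2 : LRDPredictors μ αX A₀ ζ X)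
    (α C₀ : ℝ) (c : ℕ → ℝ) (η : ℤ → Ω → ℝ) (ε : ℕ → Ω → ℝ) (hE2 : LRDErrors μ α C₀ c η ε X)
    (K : ℝ → ℝ) (hK : IsKernel K)
    (f : ℝ → ℝ) (hfX : IsDensityOf μ (X 1) f) (hf : TwiceDiffBdd f) (hf_pos : ∀ x, 0 < f x)
    (m : ℝ → ℝ) (hm : TwiceDiffBdd m)
    (r : ℝ → ℝ) (hr : ∀ x, 0 ≤ r x) (hr_int : ∀ p : ℕ, Integrable fun x => r x / f x ^ p)
    (h : ℕ → ℝ) (hh : Tendsto h atTop (𝓝 0))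
    (hnh : Tendsto (fun n : ℕ => (n : ℝ) * h n) atTop atTop)
    (hreg : HasCompactSupport K ∨ (∃ M : ℝ, ∀ x, |m x| ≤ M) ∨
      (fun n : ℕ => Real.log n) =O[atTop] fun n : ℕ => (n : ℝ) * h n) :
    ∃ C₁ : ℝ, 0 < C₁ ∧
      Tendsto (fun n : ℕ => Var[fun ω => ∑ i ∈ Finset.Icc 1 n, ε i ω; μ] / (n : ℝ) ^ (2 - α))
        atTop (𝓝 (C₁ ^ 2)) ∧
      (∀ᶠ n : ℕ in atTop,
        (∀ x, Integrable (fun ω => squaredError K m X ε n (h n) x ω) μ) ∧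
        Integrable fun x => (∫ ω, squaredError K m X ε n (h n) x ω ∂μ) * r x) ∧
      ((fun n : ℕ => MISE μ K m r X ε n (h n) - asymptoticMISE K f m r C₁ α n (h n)) =o[atTop]
        fun n : ℕ => 1 / ((n : ℝ) * h n) + h n ^ 4 + (n : ℝ) ^ (-α)) ∧
      ((biasIntegral f m r ≠ 0 ∨ ∃ b : ℝ, ∀ x, m x = b) →
        (fun n : ℕ => MISE μ K m r X ε n (h n)) ~[atTop]
          fun n : ℕ => asymptoticMISE K f m r C₁ α n (h n)) := by
  obtain ⟨v, hD⟩ := hP2.gaussianDecomposition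
  -- The law of `X 1` is standard normal and `f` is continuous, so `f` is the normal density
  -- everywhere.
  obtain rfl := eq_gaussianPDFReal_of_isDensityOf hfX (hD.map_eq 0) hf.diff.continuous hf_pos
  obtain ⟨g, G, hG, -, hg, hgG⟩ := hE2.exists_integral_mul_eq_dist
  have hα := hE2.mem_Ioo
  have he : ∀ i : ℕ, MemLp (ε (i + 1)) 2 μ := fun i => hE2.linear.memLp hE2.memLp_two (by lia)
  have he0 : ∀ i : ℕ, ∫ ω, ε (i + 1) ω ∂μ = 0 := fun i =>
    hE2.linear.integral_eq_zero hE2.memLp_two (by lia)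
  set C₁ := Real.sqrt (2 * G / ((1 - α) * (2 - α))) with hC₁
  have hCpos : 0 < 2 * G / ((1 - α) * (2 - α)) := by
    have h1 : 0 < 1 - α := by linarith [hα.2]
    have h2 : 0 < 2 - α := by linarith [hα.2]
    positivity
  have hC₁pos : 0 < C₁ := Real.sqrt_pos.2 hCpos
  have hC₁sq : C₁ ^ 2 = 2 * G / ((1 - α) * (2 - α)) := Real.sq_sqrt hCpos.le
  have hlim : Tendsto (fun n : ℕ => quadForm μ (fun i => ε (i + 1)) n (fun _ => 1) /
      (n : ℝ) ^ (2 - α)) atTop (𝓝 (C₁ ^ 2)) := by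
    rw [hC₁sq]
    refine (tendsto_sum_sum_dist hα.1 hα.2 hgG).congr fun n => ?_
    rw [quadForm_eq_sum he]
    simp_rw [hg, mul_one]
  have hvar : ∀ n, Var[fun ω => ∑ i ∈ Finset.Icc 1 n, ε i ω; μ] =
      quadForm μ (fun i => ε (i + 1)) n (fun _ => 1) := by
    intro n
    have e1 : (fun ω => ∑ i ∈ Finset.Icc 1 n, ε i ω) =
        fun ω => ∑ i ∈ Finset.range n, ε (i + 1) ω := by
      ext ω
      exact sum_Icc_one_eq (fun i => ε i ω) n
    have e2 : ∫ ω, ∑ i ∈ Finset.range n, ε (i + 1) ω ∂μ = 0 := by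
      rw [integral_finsetSum _ fun i _ => (he i).integrable (by norm_num)]
      exact Finset.sum_eq_zero fun i _ => he0 i
    rw [e1, variance_eq_sub (memLp_finsetSum _ fun i _ => he i), e2]
    simp [quadForm]
  obtain ⟨B1, hB1⟩ := hm.bdd_deriv
  obtain ⟨B2, hB2⟩ := hm.bdd_deriv2
  -- The lower bound `1` makes the rate with `B ^ 2 * h ^ 4` a multiple of the rate without the
  -- factor.
  set B := max (max B1 B2) 1 with hB
  have hBpos : 0 < B := lt_of_lt_of_le one_pos (le_max_right _ _)
  have hb1 : ∀ x, |deriv m x| ≤ B := fun x =>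
    (hB1 x).trans ((le_max_left _ _).trans (le_max_left _ _))
  have hb2 : ∀ x, |deriv (deriv m) x| ≤ B := fun x =>
    (hB2 x).trans ((le_max_right _ _).trans (le_max_left _ _))
  obtain ⟨hint, ho⟩ := isLittleO_MISE hP2 hE2 hK hm.diff hm.diff_deriv hb1 hb2 hr hr_int hh hnh hreg
    hlim
  refine ⟨C₁, hC₁pos, by simpa only [hvar] using hlim, hint, ?_, fun hc => ?_⟩
  · refine ho.trans_isBigO (IsBigO.of_bound (B ^ 2) ?_)
    filter_upwards [eventually_bandwidth hh hnh] with n ⟨hn1, hn2, hn3⟩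
    have hN : 0 < (n : ℝ) * h n := by linarith
    have hB21 : 1 ≤ B ^ 2 := one_le_pow₀ (le_max_right _ _)
    have p1 : 0 ≤ 1 / ((n : ℝ) * h n) := by positivity
    have p2 : 0 ≤ h n ^ 4 := by positivity
    have p3 : 0 ≤ (n : ℝ) ^ (-α) := by positivity
    rw [Real.norm_eq_abs, Real.norm_eq_abs, abs_of_nonneg (by positivity),
      abs_of_nonneg (by positivity)]
    nlinarith [mul_le_mul_of_nonneg_right hB21 p1, mul_le_mul_of_nonneg_right hB21 p3]
  -- If `r` vanishes almost everywhere, both sides are identically zero and no order comparison is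
  -- possible or needed.
  by_cases hr0 : ∫ x, r x = 0
  · have hr1 : Integrable r := by simpa using hr_int 0
    have hz := (integral_eq_zero_iff_of_nonneg hr hr1).1 hr0
    simp_rw [asymptoticMISE_eq_zero hz, MISE_eq_zero hz]
    exact IsEquivalent.refl
  rcases hc with hc | ⟨b, hb⟩
  · exact ho.trans_isBigO (isBigO_asymptoticMISE hK hr hr_int hr0 hh hnh hC₁pos (Or.inr hc))
  · obtain rfl : m = fun _ => b := funext hb
    -- For constant `m` the expansion is rerun with `B = 0`: the remainder becomes `o(1 / (n h) + n
    -- ^ (-α))`, which the expression dominates although its bias term is zero.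
    obtain ⟨-, ho'⟩ := isLittleO_MISE hP2 hE2 hK hm.diff hm.diff_deriv (B := 0) (by simp) (by simp)
      hr hr_int hh hnh hreg hlim
    exact ho'.trans_isBigO (isBigO_asymptoticMISE hK hr hr_int hr0 hh hnh hC₁pos (Or.inl rfl))
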